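/- **Setting.** Let $\Sigma$ be a closed connected oriented smooth surface of genus $g>0$. A *link diagram* on $\Sigma$ is a finite ordered family of smoothly immersed oriented closed curves whose only multiple points are finitely many transverse double points, each with over/under information. Two link diagrams are *Reidemeister equivalent* if they are related by a finite sequence of ambient isotopies of $\Sigma$, orientation-preserving reparametrizations, and Reidemeister moves 1, 2, 3 performed inside discs of $\Sigma$. A *symplectic basis* $\Omega=\{x_1,y_1,\dots,x_g,y_g\}$ is a system of oriented simple closed curves on $\Sigma$ (smooth away from $\infty$) meeting only in a common base point $\infty$, with $x_i\cdot y_j=\delta_{ij}$, $x_i\cdot x_j=y_i\cdot y_j=0$, such that cutting $\Sigma$ along $\Omega$ gives a $4g$-gon whose boundary, read counterclockwise, is $[x_g,y_g]\cdots[x_1,y_1]$, where $[a,b]=a^{-1}b^{-1}ab$. A link diagram is *in general position* with respect to $\Omega$ if it avoids $\infty$ and meets the curves of $\Omega$ transversely, in finitely many points, and never at a crossing. **Prismatic links.** Virtual link diagrams are represented by their Gauss diagrams. An *$\Omega$-prismatic link diagram* is a virtual link diagram whose components are coloured by $\{\alpha\}\cup\Omega$, such that in every classical crossing involving the $\Omega$-part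 (the components coloured in $\Omega$) the over-strand is in the $\Omega$-part and the under-strand is in the $\alpha$-part. It is *complete* if every colour occurs and each colour of $\Omega$ occurs on exactly one component. Two $\Omega$-prismatic links (with the same coloured components) are *equivalent* if they are related by a finite sequence of the following moves and their inverses through $\Omega$-prismatic links: * extended Reidemeister moves, i.e. Reidemeister moves 1, 2, 3 of Gauss diagrams; * *$\Omega$-semi-welded moves*: two over-crossings that are adjacent on an $\Omega$-coloured component trade places; * *$\Omega$-commutator moves* (complete diagrams only): erase $4g$ consecutive under-crossings of an $\alpha$-strand whose over-strands have, in order along the strand, the colours $x_1,y_1,x_1,y_1,\dots,x_g,y_g,x_g,y_g$ and the crossing signs $-,-,+,+,\dots,-,-,+,+$, i.e. which spell $x_1^{-1}y_1^{-1}x_1y_1\cdots x_g^{-1}y_g^{-1}x_gy_g$, or which spell the inverse of this word; the positions of the over-crossings on their components are arbitrary. **Homotopy Zh-construction.** For $D$ in general position, $\mathrm{Zh}_\Omega(D)$ is the $\Omega$-prismatic link obtained as follows. Take a virtual link diagram with the same Gauss diagram as $D$, coloured $\alpha$. For every intersection of $D$ with $z\in\Omega$ add, in the order of the intersections along $D$,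 a small arc crossing over $D$ at that place: it has colour $x_i$ and the orientation of $z$ if $z=y_i$, and colour $y_i$ and the orientation opposite to $z$ if $z=x_i$. Connect all added arcs of the same colour, in an arbitrary order, into a single component, all new intersections being virtual, and add an unlinked unknot for every colour of $\Omega$ that does not occur. **Theorem.** Let $\Omega$ be a symplectic basis of $\Sigma$, and let $D_1,D_2$ be link diagrams on $\Sigma$ in general position with respect to $\Omega$. If $D_1$ and $D_2$ are Reidemeister equivalent, then $\mathrm{Zh}_\Omega(D_1)$ and $\mathrm{Zh}_\Omega(D_2)$ exist and are equivalent $\Omega$-prismatic links, whatever choices are made in their construction. -/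

import Mathlib

open Set
open scoped Manifold ContDiff

noncomputable section

namespace HomotopyZh

/-! ## Surfaces, velocities and signs -/

/-- The plane, on which surfaces are modelled. -/
abbrev Plane : Type := EuclideanSpace ℝ (Fin 2)

/-- All coordinate changes of the given atlas have positive Jacobian determinant.  An oriented
smooth surface is a smooth surface with such an atlas; its orientation is the one for which the
charts of the atlas preserve orientation. -/
def IsOrientedAtlas (S : Type*) [TopologicalSpace S] [ChartedSpace Plane S] : Prop :=
  ∀ e ∈ atlas Plane S, ∀ e' ∈ atlas Plane S, ∀ v ∈ (e.symm.trans e').source,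
    0 < (fderiv ℝ (e.symm.trans e') v).det

/-- The determinant of two plane vectors. -/
def wedge (v w : Plane) : ℝ := v 0 * w 1 - v 1 * w 0

section Surface

variable {S : Type*} [TopologicalSpace S] [ChartedSpace Plane S]

/-- Velocity vector of a parametrized curve at time `t`.  It lies in the tangent space at `c t`,
which is the plane seen through the preferred chart at `c t`; for an oriented atlas the sign of
`wedge` on that tangent space is the orientation of the surface. -/
def velocity (c : ℝ → S) (t : ℝ) : Plane := mfderiv 𝓘(ℝ, ℝ) (𝓡 2) c t (1 : ℝ)

/-- Jacobian determinant of a map from the plane to the surface. -/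
def jacobian (q : Plane → S) (v : Plane) : ℝ :=
  wedge (mfderiv (𝓡 2) (𝓡 2) q v (!₂[1, 0] : Plane)) (mfderiv (𝓡 2) (𝓡 2) q v (!₂[0, 1] : Plane))

end Surface

/-! ## Symplectic bases -/

/-- The two curves of each handle. -/
inductive Letter where
  | x
  | y

/-- The palette `x₁, y₁, …, x_g, y_g`; it indexes both the curves of a symplectic basis and the
colours of a prismatic link. -/
abbrev Palette (g : ℕ) : Type := Fin g × Letter

/-- The point at position `u` on the unit circle, whose circumference is divided into `4 * g`
arcs of length one, counterclockwise.  The integral positions are the corners of the `4g`-gon. -/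
def corner (g : ℕ) (u : ℝ) : Plane :=
  !₂[Real.cos (2 * Real.pi * u / (4 * g)), Real.sin (2 * Real.pi * u / (4 * g))]

/-- `q` exhibits the surface as a `4g`-gon (the closed unit disc with `4 * g` corners) glued along
its sides, the image of the boundary being the given curves: reading the sides counterclockwise
one finds, for `i = g, …, 1` in this order, the sides `x_i⁻¹, y_i⁻¹, x_i, y_i`.
The map preserves orientation and is an immersion away from the corners. -/
structure IsCutPolygon {S : Type*} [TopologicalSpace S] [ChartedSpace Plane S] {g : ℕ}
    (loop : Palette g → ℝ → S) (q : Plane → S) : Prop where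
  continuousOn : ContinuousOn q (Metric.closedBall 0 1)
  injOn : InjOn q (Metric.ball 0 1)
  image : q '' Metric.ball 0 1 = (⋃ z, loop z '' Icc 0 1)ᶜ
  smooth : ∀ v ∈ Metric.closedBall (0 : Plane) 1, (∀ n : ℕ, v ≠ corner g n) →
    ContMDiffAt (𝓡 2) (𝓡 2) ∞ q v ∧ 0 < jacobian q v
  side_x_inv : ∀ i : Fin g, ∀ s ∈ Icc (0 : ℝ) 1,
    q (corner g (4 * (i.rev : ℕ) + s)) = loop (i, .x) (1 - s)
  side_y_inv : ∀ i : Fin g, ∀ s ∈ Icc (0 : ℝ) 1,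
    q (corner g (4 * (i.rev : ℕ) + 1 + s)) = loop (i, .y) (1 - s)
  side_x : ∀ i : Fin g, ∀ s ∈ Icc (0 : ℝ) 1,
    q (corner g (4 * (i.rev : ℕ) + 2 + s)) = loop (i, .x) s
  side_y : ∀ i : Fin g, ∀ s ∈ Icc (0 : ℝ) 1,
    q (corner g (4 * (i.rev : ℕ) + 3 + s)) = loop (i, .y) s

/-- A symplectic basis of a surface: simple closed curves `x₁, y₁, …, x_g, y_g` that meet only in
the base point `∞`, such that cutting along them gives a `4g`-gon whose boundary, read
counterclockwise, is `[x_g, y_g] ⋯ [x₁, y₁]` with `[a, b] = a⁻¹ b⁻¹ a b`. In particular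
`x_i · y_j = δ_ij` and `x_i · x_j = y_i · y_j = 0`.  The curves may have corners at `∞`. -/
structure SymplecticBasis (S : Type*) [TopologicalSpace S] [ChartedSpace Plane S] (g : ℕ) where
  base : S
  loop : Palette g → ℝ → S
  loop_zero : ∀ z, loop z 0 = base
  loop_one : ∀ z, loop z 1 = base
  continuousOn : ∀ z, ContinuousOn (loop z) (Icc 0 1)
  smooth : ∀ z, ∀ s ∈ Ioo (0 : ℝ) 1, ContMDiffAt 𝓘(ℝ, ℝ) (𝓡 2) ∞ (loop z) s
  immersed : ∀ z, ∀ s ∈ Ioo (0 : ℝ) 1, velocity (loop z) s ≠ 0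
  simple : ∀ z, InjOn (loop z) (Ico 0 1)
  meet : ∀ z w, z ≠ w → ∀ s ∈ Ioo (0 : ℝ) 1, ∀ t ∈ Ioo (0 : ℝ) 1, loop z s ≠ loop w t
  cut : ∃ q : Plane → S, IsCutPolygon loop q

/-! ## Link diagrams on a surface -/

/-- A link diagram on the surface `S` with components indexed by `ι`: finitely many smooth
immersed oriented closed curves whose only multiple points are finitely many transverse double
points, each with a choice of over-strand.  A crossing is recorded as the pair
(parameter of the over-strand, parameter of the under-strand). -/
structure LinkDiagram (S : Type*) [TopologicalSpace S] [ChartedSpace Plane S] (ι : Type*) where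
  curve : ι → UnitAddCircle → S
  smooth : ∀ i, ContMDiff 𝓘(ℝ, ℝ) (𝓡 2) ∞ (fun t : ℝ => curve i (t : UnitAddCircle))
  immersed : ∀ i (p : UnitAddCircle),
    velocity (fun s : ℝ => curve i (p + (s : UnitAddCircle))) 0 ≠ 0
  crossings : Set ((ι × UnitAddCircle) × (ι × UnitAddCircle))
  finite : crossings.Finite
  double : ∀ p q : ι × UnitAddCircle, p ≠ q →
    (curve p.1 p.2 = curve q.1 q.2 ↔ (p, q) ∈ crossings ∨ (q, p) ∈ crossings)
  ne : ∀ c ∈ crossings, c.1 ≠ c.2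
  asymm : ∀ c ∈ crossings, (c.2, c.1) ∉ crossings
  no_triple : ∀ p q r : ι × UnitAddCircle, p ≠ q → q ≠ r → p ≠ r →
    ¬ (curve p.1 p.2 = curve q.1 q.2 ∧ curve q.1 q.2 = curve r.1 r.2)
  transverse : ∀ c ∈ crossings,
    wedge (velocity (fun s : ℝ => curve c.1.1 (c.1.2 + (s : UnitAddCircle))) 0)
      (velocity (fun s : ℝ => curve c.2.1 (c.2.2 + (s : UnitAddCircle))) 0) ≠ 0

namespace LinkDiagram

variable {S : Type*} [TopologicalSpace S] [ChartedSpace Plane S] {ι : Type*}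

/-- The point of the surface with parameter `p`. -/
def pt (D : LinkDiagram S ι) (p : ι × UnitAddCircle) : S := D.curve p.1 p.2

/-- The velocity vector at parameter `p`. -/
def vel (D : LinkDiagram S ι) (p : ι × UnitAddCircle) : Plane :=
  velocity (fun s : ℝ => D.curve p.1 (p.2 + (s : UnitAddCircle))) 0

/-- The parameters of the closed arc of component `i` from time `a` to time `b`. -/
def arc (i : ι) (a b : ℝ) : Set (ι × UnitAddCircle) :=
  {p | ∃ t ∈ Icc a b, p = (i, (t : UnitAddCircle))}

/-- Ambient isotopy of the surface carrying `D` to `D'`. -/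
def Isotopic (D D' : LinkDiagram S ι) : Prop :=
  ∃ H : ℝ → S → S,
    ContMDiff (𝓘(ℝ, ℝ).prod (𝓡 2)) (𝓡 2) ∞ (fun u : ℝ × S => H u.1 u.2) ∧
    (∀ t ∈ Icc (0 : ℝ) 1, ∃ Φ : S ≃ₘ^∞⟮𝓡 2, 𝓡 2⟯ S, ∀ u, Φ u = H t u) ∧
    (∀ u, H 0 u = u) ∧
    (∀ p, D'.pt p = H 1 (D.pt p)) ∧ D'.crossings = D.crossings

/-- `D'` is `D` with each component reparametrized, preserving its orientation. -/
def Reparametrized (D D' : LinkDiagram S ι) : Prop :=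
  ∃ f : ι → ℝ → ℝ,
    (∀ i, ContDiff ℝ ∞ (f i)) ∧ (∀ i t, 0 < deriv (f i) t) ∧
    (∀ i t, f i (t + 1) = f i t + 1) ∧
    (∀ i (t : ℝ), D'.curve i (t : UnitAddCircle) = D.curve i (f i t : UnitAddCircle)) ∧
    ∀ i j (s t : ℝ), ((i, (s : UnitAddCircle)), (j, (t : UnitAddCircle))) ∈ D'.crossings ↔
      ((i, (f i s : UnitAddCircle)), (j, (f j t : UnitAddCircle))) ∈ D.crossings

/-- The closed square `[-1, 1] × [-1, 1]`. -/
def square : Set Plane := {v | v 0 ∈ Icc (-1 : ℝ) 1 ∧ v 1 ∈ Icc (-1 : ℝ) 1}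

/-- `φ` is a smooth coordinate system (of either orientation) around the closed disc
`φ.symm '' square`. -/
def IsDiscChart (φ : OpenPartialHomeomorph S Plane) : Prop :=
  φ ∈ IsManifold.maximalAtlas (𝓡 2) ∞ S ∧ square ⊆ φ.target

/-- In the coordinates `φ`, the arc of component `i` of `D` from time `a` to time `b` runs exactly
once along the graph of `F` over `[-1, 1]`, in one direction or the other. -/
def IsGraphStrand (φ : OpenPartialHomeomorph S Plane) (D : LinkDiagram S ι) (i : ι) (a b : ℝ)
    (F : ℝ → ℝ) : Prop :=
  a < b ∧ b < a + 1 ∧ (∀ t ∈ Icc a b, D.curve i (t : UnitAddCircle) ∈ φ.source) ∧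
  BijOn (fun t : ℝ => φ (D.curve i (t : UnitAddCircle))) (Icc a b)
    {v | v 0 ∈ Icc (-1 : ℝ) 1 ∧ v 1 = F (v 0)}

/-- The first Reidemeister move: inside a disc, `D` is a single arc without crossings and `D'` is
a single arc with exactly one crossing. -/
def Reidemeister1 (D D' : LinkDiagram S ι) : Prop :=
  ∃ φ : OpenPartialHomeomorph S Plane, IsDiscChart φ ∧
  ∃ (i : ι) (a b : ℝ), a < b ∧ b < a + 1 ∧
    (∀ p, D.pt p ∈ φ.symm '' square ↔ p ∈ arc i a b) ∧
    (∀ p, D'.pt p ∈ φ.symm '' square ↔ p ∈ arc i a b) ∧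
    (∀ p, p ∉ arc i a b → D'.pt p = D.pt p) ∧
    (∀ c ∈ D.crossings, c.1 ∉ arc i a b ∧ c.2 ∉ arc i a b) ∧
    ∃ c, c.1 ∈ arc i a b ∧ c.2 ∈ arc i a b ∧ D'.crossings = insert c D.crossings

/-- The second Reidemeister move: inside a disc, both diagrams consist of two arcs.  The first arc
is the horizontal axis in both; the second lies above it in `D`, and in `D'` it cuts the
axis transversely in exactly two points.  At both new crossings the same arc is over. -/
def Reidemeister2 (D D' : LinkDiagram S ι) : Prop :=
  ∃ φ : OpenPartialHomeomorph S Plane, IsDiscChart φ ∧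
  ∃ (i : ι) (a b : ℝ) (j : ι) (c d : ℝ) (F F' : ℝ → ℝ),
    Disjoint (arc i a b) (arc j c d) ∧
    ContDiff ℝ ∞ F ∧ ContDiff ℝ ∞ F' ∧
    (∀ x ∈ Icc (-1 : ℝ) 1, 0 < F x) ∧
    {x | x ∈ Icc (-1 : ℝ) 1 ∧ F' x = 0}.ncard = 2 ∧
    (∀ x ∈ Icc (-1 : ℝ) 1, F' x = 0 → deriv F' x ≠ 0) ∧
    IsGraphStrand φ D i a b (fun _ => 0) ∧ IsGraphStrand φ D' i a b (fun _ => 0) ∧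
    IsGraphStrand φ D j c d F ∧ IsGraphStrand φ D' j c d F' ∧
    (∀ p, D.pt p ∈ φ.symm '' square ↔ p ∈ arc i a b ∪ arc j c d) ∧
    (∀ p, D'.pt p ∈ φ.symm '' square ↔ p ∈ arc i a b ∪ arc j c d) ∧
    (∀ p, p ∉ arc j c d → D'.pt p = D.pt p) ∧
    D.crossings ⊆ D'.crossings ∧
    ((∀ e ∈ D'.crossings \ D.crossings, e.1 ∈ arc i a b ∧ e.2 ∈ arc j c d) ∨
      (∀ e ∈ D'.crossings \ D.crossings, e.1 ∈ arc j c d ∧ e.2 ∈ arc i a b))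

/-- The third Reidemeister move: inside a disc, both diagrams consist of three arcs.  Two of them
are the lines of slope `1/2` and `-1/2` through the origin; the third, less steep, passes below
the origin in `D` and above it in `D'`.  The three arcs lie at three different heights, which are
the same in `D` and in `D'`. -/
def Reidemeister3 (D D' : LinkDiagram S ι) : Prop :=
  ∃ φ : OpenPartialHomeomorph S Plane, IsDiscChart φ ∧
  ∃ (i : Fin 3 → ι) (a b : Fin 3 → ℝ) (F F' : ℝ → ℝ) (height : Fin 3 → ℕ),
    (∀ u v, u ≠ v → Disjoint (arc (i u) (a u) (b u)) (arc (i v) (a v) (b v))) ∧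
    Function.Injective height ∧
    ContDiff ℝ ∞ F ∧ ContDiff ℝ ∞ F' ∧
    (∀ x ∈ Icc (-1 : ℝ) 1, |deriv F x| < 1 / 2 ∧ |deriv F' x| < 1 / 2) ∧
    F 0 < 0 ∧ 0 < F' 0 ∧
    IsGraphStrand φ D (i 0) (a 0) (b 0) (fun x => x / 2) ∧
    IsGraphStrand φ D' (i 0) (a 0) (b 0) (fun x => x / 2) ∧
    IsGraphStrand φ D (i 1) (a 1) (b 1) (fun x => -x / 2) ∧
    IsGraphStrand φ D' (i 1) (a 1) (b 1) (fun x => -x / 2) ∧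
    IsGraphStrand φ D (i 2) (a 2) (b 2) F ∧
    IsGraphStrand φ D' (i 2) (a 2) (b 2) F' ∧
    (∀ p, D.pt p ∈ φ.symm '' square ↔ ∃ u, p ∈ arc (i u) (a u) (b u)) ∧
    (∀ p, D'.pt p ∈ φ.symm '' square ↔ ∃ u, p ∈ arc (i u) (a u) (b u)) ∧
    (∀ p, p ∉ arc (i 2) (a 2) (b 2) → D'.pt p = D.pt p) ∧
    (∀ e, (∀ u, e.1 ∉ arc (i u) (a u) (b u)) → (∀ u, e.2 ∉ arc (i u) (a u) (b u)) →
      (e ∈ D'.crossings ↔ e ∈ D.crossings)) ∧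
    (∀ e ∈ D.crossings ∪ D'.crossings, ∀ u v,
      e.1 ∈ arc (i u) (a u) (b u) → e.2 ∈ arc (i v) (a v) (b v) → height v < height u)

/-- A single isotopy, reparametrization or Reidemeister move. -/
def Step (D D' : LinkDiagram S ι) : Prop :=
  Isotopic D D' ∨ Reparametrized D D' ∨ Reidemeister1 D D' ∨ Reidemeister2 D D' ∨
    Reidemeister3 D D'

/-- Reidemeister equivalence of link diagrams on the surface: the equivalence relation generated
by ambient isotopies, reparametrizations and the three Reidemeister moves. -/
def ReidemeisterEquivalent (D D' : LinkDiagram S ι) : Prop := Relation.EqvGen Step D D'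

variable {g : ℕ}

/-- The intersections of a diagram with the curves of a symplectic basis, outside the base point:
pairs (parameter on the diagram, curve of the basis). -/
def meets (D : LinkDiagram S ι) (Ω : SymplecticBasis S g) :
    Set ((ι × UnitAddCircle) × Palette g) :=
  {m | ∃ s ∈ Ioo (0 : ℝ) 1, D.pt m.1 = Ω.loop m.2 s}

/-- `D` avoids the base point, meets the curves of `Ω` transversely in finitely many points, and
never at a crossing of `D`. -/
structure InGeneralPosition (D : LinkDiagram S ι) (Ω : SymplecticBasis S g) : Prop where
  avoids_base : ∀ p, D.pt p ≠ Ω.base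
  finite : (D.meets Ω).Finite
  transverse : ∀ p z, ∀ s ∈ Ioo (0 : ℝ) 1, D.pt p = Ω.loop z s →
    wedge (D.vel p) (velocity (Ω.loop z) s) ≠ 0
  not_at_crossing : ∀ c ∈ D.crossings, ∀ z, (c.1, z) ∉ D.meets Ω

end LinkDiagram

/-! ## Prismatic links

Virtual link diagrams are represented by their Gauss diagrams: extended Reidemeister moves that
involve a virtual crossing do not change the Gauss diagram, and diagrams with the same Gauss
diagram are related by such moves. -/

/-- The two ends of a chord of a Gauss diagram: a classical crossing is met once on the
over-strand and once on the under-strand. -/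
inductive Role where
  | over
  | under

/-- An `Ω`-prismatic link diagram, given by its Gauss diagram.  The components are indexed by `K`;
`color k = none` means that component `k` belongs to the `α`-part, `color k = some z` that it has
colour `z`.  `Chord` is the set of classical crossings, each with its sign, and `word k` lists in
cyclic order the passages of component `k` through the classical crossings.  Every under-crossing
lies in the `α`-part, so a classical crossing that involves the `Ω`-part has its over-strand in
the `Ω`-part and its under-strand in the `α`-part. -/
structure PrismaticDiagram {K : Type*} {g : ℕ} (color : K → Option (Palette g)) where
  Chord : Type
  finite : Finite Chord
  sign : Chord → ℤˣ
  word : K → List (Chord × Role)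
  nodup : ∀ k, (word k).Nodup
  existsUnique_mem : ∀ e, ∃! k, e ∈ word k
  under_black : ∀ k c, (c, Role.under) ∈ word k → color k = none

namespace PrismaticDiagram

variable {K : Type*} {g : ℕ} {color : K → Option (Palette g)}

/-- `f` comes immediately after `e` on some component. -/
def Next (W : PrismaticDiagram color) (e f : W.Chord × Role) : Prop :=
  ∃ k u, W.word k ~r e :: f :: u

/-- `e` and `f` are neighbours; `f` comes after `e` if `o = 1` and before `e` if `o = -1`. -/
def Adjacent (W : PrismaticDiagram color) (o : ℤˣ) (e f : W.Chord × Role) : Prop :=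
  (o = 1 ∧ W.Next e f) ∨ (o = -1 ∧ W.Next f e)

open scoped Classical in
/-- `W'` is obtained from `W` by erasing the chords in `A` (up to renaming the chords). -/
def Erases (W : PrismaticDiagram color) (A : Set W.Chord) (W' : PrismaticDiagram color) : Prop :=
  ∃ f : W'.Chord → W.Chord, Function.Injective f ∧ range f = Aᶜ ∧
    (∀ c, W.sign (f c) = W'.sign c) ∧
    ∀ k, (W.word k).filter (fun e => decide (e.1 ∉ A)) ~r (W'.word k).map (Prod.map f id)

/-- `W'` is obtained from `W` by letting the chord ends trade places according to the
permutation `ρ` (up to renaming the chords). -/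
def Permutes (W : PrismaticDiagram color) (ρ : Equiv.Perm (W.Chord × Role))
    (W' : PrismaticDiagram color) : Prop :=
  ∃ f : W.Chord ≃ W'.Chord, (∀ c, W'.sign (f c) = W.sign c) ∧
    ∀ k, W'.word k ~r (W.word k).map (fun e => Prod.map f id (ρ e))

/-- The same diagram up to renaming the chords and moving the starting points of the words. -/
def Isomorphic (W W' : PrismaticDiagram color) : Prop := W.Permutes 1 W'

/-- Reidemeister move 1: erase a chord whose two ends are neighbours. -/
def Reidemeister1 (W W' : PrismaticDiagram color) : Prop :=
  ∃ (c : W.Chord) (o : ℤˣ), W.Adjacent o (c, .over) (c, .under) ∧ W.Erases {c} W'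

/-- Reidemeister move 2: erase two chords of opposite sign whose over-ends are neighbours and
whose under-ends are neighbours. -/
def Reidemeister2 (W W' : PrismaticDiagram color) : Prop :=
  ∃ (c d : W.Chord) (o o' : ℤˣ), c ≠ d ∧ W.sign d = -W.sign c ∧
    W.Adjacent o (c, .over) (d, .over) ∧ W.Adjacent o' (c, .under) (d, .under) ∧
    W.Erases {c, d} W'

open scoped Classical in
/-- Reidemeister move 3 on a top, a middle and a bottom strand, which cross in `a` (top over
middle), `b` (top over bottom) and `c` (middle over bottom).  On each strand the two crossings are
neighbours and trade places.  The condition on the signs and on the orders `ot`, `om`, `ob` of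
the crossings along the strands says that the strands bound a triangle. -/
def Reidemeister3 (W W' : PrismaticDiagram color) : Prop :=
  ∃ (a b c : W.Chord) (ot om ob : ℤˣ), a ≠ b ∧ a ≠ c ∧ b ≠ c ∧
    W.Adjacent ot (a, .over) (b, .over) ∧ W.Adjacent om (a, .under) (c, .over) ∧
    W.Adjacent ob (b, .under) (c, .under) ∧
    W.sign a * ob = W.sign b * om ∧ W.sign b * om = W.sign c * ot ∧
    W.Permutes (Equiv.swap (a, .over) (b, .over) * Equiv.swap (a, .under) (c, .over) *
      Equiv.swap (b, .under) (c, .under)) W'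

open scoped Classical in
/-- The `Ω`-semi-welded move: two neighbouring over-crossings of an `Ω`-coloured component trade
places (the two under-crossing strands are in the `α`-part). -/
def SemiWelded (W W' : PrismaticDiagram color) : Prop :=
  ∃ (k : K) (z : Palette g) (c d : W.Chord) (u : List (W.Chord × Role)),
    color k = some z ∧ W.word k ~r (c, .over) :: (d, .over) :: u ∧
    W.Permutes (Equiv.swap (c, .over) (d, .over)) W'

/-- Every colour appears, and each colour of `Ω` exactly once. -/
def Complete (color : K → Option (Palette g)) : Prop :=
  (∃ k, color k = none) ∧ ∀ z, ∃! k, color k = some z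

/-- The letter of position `j` in `x⁻¹ y⁻¹ x y`. -/
def blockLetter : Fin 4 → Letter := ![.x, .y, .x, .y]

/-- The exponent of position `j` in `x⁻¹ y⁻¹ x y`. -/
def blockSign : Fin 4 → ℤˣ := ![-1, -1, 1, 1]

/-- The `Ω`-commutator move: erase `4 * g` consecutive under-crossings of an `α`-component, whose
over-strands have, read along the under-strand, the colours and signs given by
`x₁⁻¹ y₁⁻¹ x₁ y₁ ⋯ x_g⁻¹ y_g⁻¹ x_g y_g`, or, if the under-strand is oriented the other way
(`o = -1`), by the inverse word.  The over-ends may be anywhere on their components. -/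
def Commutator (W W' : PrismaticDiagram color) : Prop :=
  Complete color ∧
  ∃ (chord : Fin g × Fin 4 → W.Chord) (o : ℤˣ) (k : K) (u : List (W.Chord × Role)),
    Function.Injective chord ∧
    (∀ i j, W.sign (chord (i, j)) = o * blockSign j) ∧
    (∀ i j, ∃ m, color m = some (i, blockLetter j) ∧ (chord (i, j), Role.over) ∈ W.word m) ∧
    (W.word k ~r
      (if o = 1 then
        (List.finRange g ×ˢ List.finRange 4).map (fun ij => (chord ij, Role.under))
      else
        ((List.finRange g ×ˢ List.finRange 4).map (fun ij => (chord ij, Role.under))).reverse)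
        ++ u) ∧
    W.Erases (range chord) W'

/-- A single move. -/
def Step (W W' : PrismaticDiagram color) : Prop :=
  Isomorphic W W' ∨ Reidemeister1 W W' ∨ Reidemeister2 W W' ∨ Reidemeister3 W W' ∨
    SemiWelded W W' ∨ Commutator W W'

/-- Equivalence of `Ω`-prismatic links. -/
def Equivalent (W W' : PrismaticDiagram color) : Prop := Relation.EqvGen Step W W'

end PrismaticDiagram

/-! ## The homotopy Zh-construction -/

/-- Components of the homotopy Zh-construction: those of the diagram, in the `α`-part, and one
component of each colour. -/
def zhColor (ι : Type*) (g : ℕ) : ι ⊕ Palette g → Option (Palette g) :=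
  Sum.elim (fun _ => none) some

/-- The colour of the over-crossing arc drawn at an intersection with a curve of the basis:
`x_i` for `y_i` and `y_i` for `x_i`. -/
def dualColor {g : ℕ} : Palette g → Palette g
  | (i, .x) => (i, .y)
  | (i, .y) => (i, .x)

/-- The over-crossing arc at an intersection with `z` is oriented like `z` if `z = y_i` and
opposite to `z` if `z = x_i`. -/
def arcOrientation {g : ℕ} : Palette g → ℝ
  | (_, .x) => -1
  | (_, .y) => 1

section Zh

variable {S : Type*} [TopologicalSpace S] [ChartedSpace Plane S] {ι : Type*} {g : ℕ}

/-- Where the passages through the classical crossings of the homotopy Zh-construction take place: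
at a parameter of the diagram, or on a component of the `Ω`-part. -/
def place (D : LinkDiagram S ι) (Ω : SymplecticBasis S g) :
    (D.crossings ⊕ D.meets Ω) × Role → (ι × UnitAddCircle) ⊕ Palette g
  | (.inl c, .over) => .inl c.1.1
  | (.inl c, .under) => .inl c.1.2
  | (.inr m, .over) => .inr (dualColor m.1.2)
  | (.inr m, .under) => .inl m.1.1

/-- `W` is a homotopy Zh-construction of `D` relative to `Ω`: its classical crossings are those of
`D` and one for each intersection of `D` with a curve of `Ω`, where an arc of the dual
colour crosses over `D`.  Along each component of `D` they occur in the order in which they are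
met on the surface; on each component of the `Ω`-part they occur in an arbitrary order.  The sign
of a crossing is `+1` if (direction of the over-strand, direction of the under-strand) is a
positively oriented frame, and `-1` otherwise. -/
structure IsHomotopyZhVia (D : LinkDiagram S ι) (Ω : SymplecticBasis S g)
    (W : PrismaticDiagram (zhColor ι g)) (χ : (D.crossings ⊕ D.meets Ω) ≃ W.Chord) : Prop where
  sign_crossing : ∀ c : D.crossings,
    0 < ((W.sign (χ (.inl c)) : ℤ) : ℝ) * wedge (D.vel c.1.1) (D.vel c.1.2)
  sign_meet : ∀ m : D.meets Ω, ∀ s ∈ Ioo (0 : ℝ) 1, D.pt m.1.1 = Ω.loop m.1.2 s →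
    0 < ((W.sign (χ (.inr m)) : ℤ) : ℝ) *
      wedge (arcOrientation m.1.2 • velocity (Ω.loop m.1.2) s) (D.vel m.1.1)
  word_black : ∀ i : ι, ∃ l : List ((D.crossings ⊕ D.meets Ω) × Role),
    W.word (.inl i) ~r l.map (Prod.map χ id) ∧
    (∀ e, e ∈ l ↔ ∃ t, place D Ω e = .inl (i, t)) ∧
    l.Pairwise (fun e f => ∃ s t : ℝ, 0 ≤ s ∧ s < t ∧ t < 1 ∧
      place D Ω e = .inl (i, (s : UnitAddCircle)) ∧ place D Ω f = .inl (i, (t : UnitAddCircle)))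
  word_color : ∀ (z : Palette g) e, Prod.map χ id e ∈ W.word (.inr z) ↔ place D Ω e = .inr z

/-- `W` is a homotopy Zh-construction of `D` relative to `Ω`. -/
def IsHomotopyZh (D : LinkDiagram S ι) (Ω : SymplecticBasis S g)
    (W : PrismaticDiagram (zhColor ι g)) : Prop :=
  ∃ χ, IsHomotopyZhVia D Ω W χ

end Zh

end HomotopyZh

end

/-! The coloured components of a Zh-diagram carry over-crossings only, and semi-welded moves permute
these at will. Up to equivalence the diagram is therefore determined by what is read along the black
components: cyclic words in the ends of black crossings and in signed colours, here called syllables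
(`RealizesVia.equivalent`). On such words the other moves become algebra. A second Reidemeister move
with two arcs of the same colour cancels z z⁻¹ (`leads_cancel`), a commutator move erases the
relator (`leads_relator`), so between two black ends only an element of the surface group matters
(`localLeads_of_val`). A third Reidemeister move slides an arc of the Ω-part over a black crossing
(`leads_slide`), which multiplies the states at both ends of that crossing by a common factor. What
survives is a `Holonomy`: the order of the black ends along the components, a group element at each
end and a monodromy for each component, up to changes of frame at the starting points and at the
crossings.

The same datum exists geometrically for every link diagram on the surface, in general position or
not. Gluing the sides of the 4g-gon by the elements `sideLetter` gives a flat bundle over the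
surface whose fibre is the surface group. Going once around ∞ one reads the relator, which is
trivial, so the flat structure extends over ∞ (`prefixVal_self`, `IsCutPolygon.eventually_frame`).
Frames can thus be carried along the components (`IsCutPolygon.exists_transport`); comparing them at
the crossings and after one turn gives a holonomy (`Presents`), unique up to the changes of frame
above (`Presents.equivalent`). When a component crosses a curve of Ω transversely, its frame is
multiplied by exactly the syllable that the Zh-construction writes there
(`IsTransportAt.eventually_letter`), so a Zh-diagram of `D` realizes words with the holonomy of `D`
(`IsHomotopyZh.exists_realizes`).

It remains to see that Reidemeister equivalent link diagrams have equivalent holonomies. Isotopies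
and reparametrizations carry the frames along. Over the disc of a Reidemeister move the bundle is
trivial, so all crossing ends on one arc are in the same state, before and after the move
(`LocalMove.exists_presents`). Consecutive ends in the same state have no syllable between them in
the canonical words, and the move of Gauss diagrams applies there.

Since the intermediate diagrams need not be in general position, strands passing over a curve of Ω
or over ∞ are never examined one by one; the moves that they would require are all contained in
`Holonomy.IsFlat.leads`. -/

noncomputable section
namespace HomotopyZh

/-! ### Operations on Gauss diagrams; reordering the over-crossings of a coloured component. -/

namespace PrismaticDiagram

variable {K : Type*} {g : ℕ} {color : K → Option (Palette g)}

lemma mem_unique (W : PrismaticDiagram color) {e : W.Chord × Role} {k k' : K}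
    (h : e ∈ W.word k) (h' : e ∈ W.word k') : k = k' :=
  (W.existsUnique_mem e).unique h h'

lemma Equivalent.refl (W : PrismaticDiagram color) : W.Equivalent W :=
  Relation.EqvGen.refl _

lemma Equivalent.symm {W W' : PrismaticDiagram color} (h : W.Equivalent W') : W'.Equivalent W :=
  Relation.EqvGen.symm _ _ h

lemma Equivalent.trans {W W' W'' : PrismaticDiagram color} (h : W.Equivalent W')
    (h' : W'.Equivalent W'') : W.Equivalent W'' := Relation.EqvGen.trans _ _ _ h h'

lemma Step.equivalent {W W' : PrismaticDiagram color} (h : W.Step W') : W.Equivalent W' :=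
  .rel _ _ h

/-! ### Erasing and permuting -/

open Classical in
/-- The diagram without the chords in `A`. -/
@[reducible] def erase (W : PrismaticDiagram color) (A : Set W.Chord) : PrismaticDiagram color where
  Chord := {c : W.Chord // c ∉ A}
  finite := have := W.finite; inferInstance
  sign c := W.sign c
  word k := (W.word k).filterMap fun e => if h : e.1 ∉ A then some (⟨e.1, h⟩, e.2) else none
  nodup k := by
    refine (W.nodup k).filterMap ?_
    intro a a' b hb hb'
    by_cases h : a.1 ∉ A <;> by_cases h' : a'.1 ∉ A <;> simp_all
    rw [← hb] at hb'
    simp only [Prod.mk.injEq, Subtype.mk.injEq] at hb'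
    exact Prod.ext hb'.1.symm hb'.2.symm
  existsUnique_mem e := by
    have key : ∀ k, (e ∈ (W.word k).filterMap fun e : W.Chord × Role =>
        if h : e.1 ∉ A then some ((⟨e.1, h⟩ : {c : W.Chord // c ∉ A}), e.2) else none) ↔
        ((e.1 : W.Chord), e.2) ∈ W.word k := by
      intro k
      simp only [List.mem_filterMap]
      constructor
      · rintro ⟨a, ha, hb⟩
        by_cases h : a.1 ∉ A
        · simp only [h, not_false_eq_true, dite_true, Option.some.injEq] at hb
          subst hb; exact ha
        · simp [h] at hb
      · intro h
        exact ⟨_, h, by simp [e.1.2]⟩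
    simpa only [key] using W.existsUnique_mem (e.1, e.2)
  under_black k c h := by
    simp only [List.mem_filterMap] at h
    obtain ⟨a, ha, hb⟩ := h
    by_cases h : a.1 ∉ A
    · simp only [h, not_false_eq_true, dite_true, Option.some.injEq, Prod.mk.injEq] at hb
      refine W.under_black k a.1 ?_
      rw [← hb.2]; exact ha
    · simp [h] at hb

lemma map_filterMap_erase (W : PrismaticDiagram color) (A : Set W.Chord) (k : K) :
    ((W.erase A).word k).map (Prod.map Subtype.val id) =
      (W.word k).filter (fun e => by classical exact decide (e.1 ∉ A)) := by
  classical
  simp only [List.map_filterMap]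
  rw [← List.filterMap_eq_filter]
  congr 1
  funext e
  by_cases h : e.1 ∉ A <;> simp [h, Option.guard]

lemma erases_erase (W : PrismaticDiagram color) (A : Set W.Chord) : W.Erases A (W.erase A) := by
  refine ⟨Subtype.val, Subtype.val_injective, Subtype.range_coe, fun _ => rfl, fun k => ?_⟩
  rw [map_filterMap_erase]

/-- The diagram in which the chord ends have traded places within the components. -/
@[reducible] def permute (W : PrismaticDiagram color) (ρ : Equiv.Perm (W.Chord × Role))
    (h : ∀ k e, ρ e ∈ W.word k ↔ e ∈ W.word k) : PrismaticDiagram color where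
  Chord := W.Chord
  finite := W.finite
  sign := W.sign
  word k := (W.word k).map ρ
  nodup k := (W.nodup k).map ρ.injective
  existsUnique_mem e := by
    have : ∀ k, e ∈ (W.word k).map ρ ↔ e ∈ W.word k := by
      intro k
      rw [List.mem_map]
      constructor
      · rintro ⟨a, ha, rfl⟩; exact (h k a).2 ha
      · intro he; exact ⟨ρ.symm e, (h k _).1 (by simpa using he), by simp⟩
    simpa only [this] using W.existsUnique_mem e
  under_black k c hc := by
    obtain ⟨a, ha, hb⟩ := List.mem_map.1 hc
    exact W.under_black k c (hb ▸ (h k a).2 ha)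

lemma permutes_permute (W : PrismaticDiagram color) (ρ : Equiv.Perm (W.Chord × Role))
    (h : ∀ k e, ρ e ∈ W.word k ↔ e ∈ W.word k) : W.Permutes ρ (W.permute ρ h) :=
  ⟨Equiv.refl _, fun _ => rfl, fun _ => List.IsRotated.refl _⟩

/-! ### Reordering the over-crossings of the coloured components -/

open Classical in
/-- The diagram in which the passages of one component are reordered. -/
@[reducible] def reorder (W : PrismaticDiagram color) (k : K) (l : List (W.Chord × Role))
    (h : l.Perm (W.word k)) : PrismaticDiagram color where
  Chord := W.Chord
  finite := W.finite
  sign := W.sign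
  word := Function.update W.word k l
  nodup k' := by
    rcases eq_or_ne k' k with rfl | hk
    · simpa using h.nodup_iff.2 (W.nodup k')
    · simpa [hk] using W.nodup k'
  existsUnique_mem e := by
    have : ∀ k', e ∈ Function.update W.word k l k' ↔ e ∈ W.word k' := by
      intro k'
      rcases eq_or_ne k' k with rfl | hk
      · simpa using h.mem_iff
      · simp [hk]
    simpa only [this] using W.existsUnique_mem e
  under_black k' c hc := by
    rcases eq_or_ne k' k with rfl | hk
    · exact W.under_black k' c (h.mem_iff.1 (by simpa using hc))
    · exact W.under_black k' c (by simpa [hk] using hc)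

lemma reorder_self (W : PrismaticDiagram color) (k : K) :
    W.reorder k (W.word k) (List.Perm.refl _) = W := by
  cases W; simp [reorder]

lemma reorder_word_of_ne (W : PrismaticDiagram color) {k k' : K} {l : List (W.Chord × Role)}
    (h : l.Perm (W.word k)) (hk : k' ≠ k) : (W.reorder k l h).word k' = W.word k' := by
  classical
  simp [reorder, hk]

lemma over_of_mem_color (W : PrismaticDiagram color) {k : K} {z : Palette g} (hk : color k = some z)
    {e : W.Chord × Role} (he : e ∈ W.word k) : e.2 = .over := by
  obtain ⟨c, r⟩ := e
  rcases r with _ | _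
  · rfl
  · simp [W.under_black k c he] at hk

/-- A permutation is a product of transpositions of neighbours, and each of these is one semi-welded
move, because a coloured component has over-ends only. The prefix `p` lets the induction reach pairs
inside the word; as words are cyclic, it can be rotated behind the pair that trades places. -/
lemma equivalent_reorder_aux (W : PrismaticDiagram color) {k : K} {z : Palette g}
    (hk : color k = some z) {l l' : List (W.Chord × Role)} (hl : l.Perm l') :
    ∀ (p : List (W.Chord × Role)) (h : (p ++ l).Perm (W.word k)) (h' : (p ++ l').Perm (W.word k)),
      (W.reorder k (p ++ l) h).Equivalent (W.reorder k (p ++ l') h') := by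
  classical
  induction hl with
  | nil => intro p h h'; exact Equivalent.refl _
  | @cons x l l' hl ih =>
    intro p h h'
    have := ih (p ++ [x]) (by simpa using h) (by simpa using h')
    simpa using this
  | @trans l l' l'' h₁ h₂ ih₁ ih₂ =>
    intro p h h'
    have hm : (p ++ l').Perm (W.word k) := (List.Perm.append_left p h₁.symm).trans h
    exact (ih₁ p h hm).trans (ih₂ p hm h')
  | swap x y l =>
    intro p h h'
    have hx : x.2 = .over := W.over_of_mem_color hk (h.mem_iff.1 (by simp))
    have hy : y.2 = .over := W.over_of_mem_color hk (h.mem_iff.1 (by simp))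
    have hx' : (x.1, Role.over) = x := Prod.ext rfl hx.symm
    have hy' : (y.1, Role.over) = y := Prod.ext rfl hy.symm
    have hnd : (p ++ y :: x :: l).Nodup := h.nodup_iff.2 (W.nodup k)
    have hfix : ∀ q : List (W.Chord × Role), x ∉ q → y ∉ q → q.map (Equiv.swap y x) = q := by
      intro q hxq hyq
      conv_rhs => rw [← List.map_id q]
      apply List.map_congr_left
      intro a ha
      exact Equiv.swap_apply_of_ne_of_ne (fun hh => hyq (hh ▸ ha)) (fun hh => hxq (hh ▸ ha))
    refine Step.equivalent (.inr <| .inr <| .inr <| .inr <| .inl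
      ⟨k, z, y.1, x.1, l ++ p, hk, ?_, Equiv.refl _, fun _ => rfl, fun k' => ?_⟩)
    · simp only [reorder, Function.update_self]
      rw [hx', hy']
      have := List.isRotated_append (l := p) (l' := y :: x :: l)
      simpa using this
    · have he : (fun e : W.Chord × Role => Prod.map (Equiv.refl W.Chord) id
          ((Equiv.swap (y.1, Role.over) (x.1, Role.over)) e)) = Equiv.swap y x := by
        funext e; rw [hx', hy']; simp
      change (Function.update W.word k (p ++ x :: y :: l) k').IsRotated
        ((Function.update W.word k (p ++ y :: x :: l) k').map (fun e : W.Chord × Role => Prod.map (Equiv.refl W.Chord) id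
          ((Equiv.swap (y.1, Role.over) (x.1, Role.over)) e)))
      rw [he]
      rcases eq_or_ne k' k with rfl | hk'
      · simp only [Function.update_self]
        rw [List.nodup_append, List.nodup_cons, List.nodup_cons] at hnd
        obtain ⟨-, ⟨hy1, hx1, -⟩, hp⟩ := hnd
        have hyp : y ∉ p := fun hh => hp y hh y (by simp) rfl
        have hxp : x ∉ p := fun hh => hp x hh x (by simp) rfl
        simp only [List.mem_cons, not_or] at hy1
        simp only [List.map_append, List.map_cons, Equiv.swap_apply_left, Equiv.swap_apply_right,
          hfix p hxp hyp, hfix l hx1 hy1.2]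
        exact List.IsRotated.refl _
      · simp only [Function.update_of_ne hk']
        have hxk : x ∈ W.word k := h.mem_iff.1 (by simp)
        have hyk : y ∈ W.word k := h.mem_iff.1 (by simp)
        rw [hfix _ (fun hh => hk' (W.mem_unique hh hxk)) (fun hh => hk' (W.mem_unique hh hyk))]

lemma equivalent_reorder (W : PrismaticDiagram color) {k : K} {z : Palette g}
    (hk : color k = some z) (l : List (W.Chord × Role)) (h : l.Perm (W.word k)) :
    W.Equivalent (W.reorder k l h) := by
  have := W.equivalent_reorder_aux hk h.symm [] (List.Perm.refl _) h
  simpa [reorder_self] using this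

end PrismaticDiagram
end HomotopyZh
end

/-! ### Diagrams are determined up to equivalence by the words of their black components. -/

noncomputable section
namespace HomotopyZh

instance : Fintype Letter := ⟨⟨[Letter.x, Letter.y], by simp⟩, by rintro (_ | _) <;> simp⟩


namespace PrismaticDiagram

variable {ι : Type*} {g : ℕ}

/-- The colours are treated one after the other. The bijection `χ` accompanies the induction because
the statement does not remember that reordering keeps the type of chords. -/
lemma equivalent_of_perm_aux (W : PrismaticDiagram (zhColor ι g))
    (t : Palette g → List (W.Chord × Role)) (ht : ∀ z, (t z).Perm (W.word (.inr z)))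
    (s : Finset (Palette g)) :
    ∃ (W₂ : PrismaticDiagram (zhColor ι g)) (χ : W.Chord ≃ W₂.Chord), W.Equivalent W₂ ∧
      (∀ c, W₂.sign (χ c) = W.sign c) ∧
      (∀ i, W₂.word (.inl i) = (W.word (.inl i)).map (Prod.map χ id)) ∧
      ∀ z, (z ∈ s → W₂.word (.inr z) = (t z).map (Prod.map χ id)) ∧
        (z ∉ s → W₂.word (.inr z) = (W.word (.inr z)).map (Prod.map χ id)) := by
  classical
  induction s using Finset.induction_on with
  | empty => exact ⟨W, Equiv.refl _, .refl _, by simp, by simp, by simp⟩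
  | @insert a s ha ih =>
    obtain ⟨W₂, χ, h, hs, hb, hc⟩ := ih
    have hp : ((t a).map (Prod.map χ id)).Perm (W₂.word (.inr a)) := by
      rw [(hc a).2 ha]; exact (ht a).map _
    refine ⟨W₂.reorder (.inr a) _ hp, χ, h.trans (W₂.equivalent_reorder (z := a) rfl _ hp), hs,
      fun i => ?_, fun z => ⟨fun hz => ?_, fun hz => ?_⟩⟩
    · simp [hb]
    · rcases eq_or_ne z a with rfl | hza
      · simp
      · have : z ∈ s := by simpa [hza] using hz
        simp [hza, (hc z).1 this]
    · simp only [Finset.mem_insert, not_or] at hz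
      simp [hz.1, (hc z).2 hz.2]

/-- Diagrams with the same signs and black words whose coloured components carry the same
over-crossings are equivalent. -/
lemma equivalent_of_perm {W W' : PrismaticDiagram (zhColor ι g)} (F : W.Chord ≃ W'.Chord)
    (hs : ∀ c, W'.sign (F c) = W.sign c)
    (hb : ∀ i, W'.word (.inl i) ~r (W.word (.inl i)).map (Prod.map F id))
    (hc : ∀ z c, (F c, Role.over) ∈ W'.word (.inr z) ↔ (c, Role.over) ∈ W.word (.inr z)) :
    W.Equivalent W' := by
  classical
  have hF : Function.Injective (Prod.map F.symm id : W'.Chord × Role → W.Chord × Role) :=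
    F.symm.injective.prodMap Function.injective_id
  have ht : ∀ z, ((W'.word (.inr z)).map (Prod.map F.symm id)).Perm (W.word (.inr z)) := by
    intro z
    rw [List.perm_ext_iff_of_nodup ((W'.nodup _).map hF) (W.nodup _)]
    rintro ⟨c, r⟩
    rcases r with _ | _
    · rw [← hc]
      simp only [List.mem_map]
      constructor
      · rintro ⟨⟨d, r⟩, hd, he⟩
        simp only [Prod.map_apply, id_eq, Prod.mk.injEq] at he
        obtain ⟨rfl, rfl⟩ := he
        simpa using hd
      · intro h; exact ⟨_, h, by simp⟩
    · constructor
      · intro h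
        obtain ⟨⟨d, r⟩, hd, he⟩ := List.mem_map.1 h
        simp only [Prod.map_apply, id_eq, Prod.mk.injEq] at he
        obtain ⟨rfl, rfl⟩ := he
        simpa using W'.over_of_mem_color (z := z) rfl hd
      · intro h
        simpa using W.over_of_mem_color (z := z) rfl h
  obtain ⟨W₂, χ, h, hs₂, hb₂, hc₂⟩ := equivalent_of_perm_aux W _ ht Finset.univ
  -- All coloured words now agree with those of `W'` up to the renaming, so that only an isomorphism
  -- is left.
  refine h.trans (Step.equivalent (.inl ⟨χ.symm.trans F, fun c => ?_, fun k => ?_⟩))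
  · rw [← χ.apply_symm_apply c, hs₂]; simp [hs]
  · rcases k with i | z
    · rw [hb₂, List.map_map]
      convert hb i using 2
      funext e
      obtain ⟨c, r⟩ := e
      simp
    · rw [(hc₂ z).1 (Finset.mem_univ _), List.map_map, List.map_map]
      convert List.IsRotated.refl _ using 1
      conv_rhs => rw [← List.map_id (W'.word _)]
      congr 1
      funext e
      obtain ⟨c, r⟩ := e
      simp

/-- A diagram with prescribed black words and prescribed colours of the other over-strands. -/
lemma exists_of_blackWords {C : Type*} [Finite C] (sgn : C → ℤˣ) (col : C → Option (Palette g))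
    (bw : ι → List (C × Role)) (nd : ∀ i, (bw i).Nodup)
    (hu : ∀ c, ∃! i, (c, Role.under) ∈ bw i)
    (ho : ∀ c, col c = none → ∃! i, (c, Role.over) ∈ bw i)
    (ho' : ∀ c z, col c = some z → ∀ i, (c, Role.over) ∉ bw i) :
    ∃ (W : PrismaticDiagram (zhColor ι g)) (χ : C ≃ W.Chord), (∀ c, W.sign (χ c) = sgn c) ∧
      (∀ i, W.word (.inl i) = (bw i).map (Prod.map χ id)) ∧
      ∀ z c, (χ c, Role.over) ∈ W.word (.inr z) ↔ col c = some z := by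
  classical
  -- The chords of a diagram live in `Type`, while `C` may live in any universe; `Fin n` takes its
  -- place.
  obtain ⟨n, ⟨e⟩⟩ := Finite.exists_equiv_fin C
  have inj : Function.Injective (Prod.map e id : C × Role → Fin n × Role) :=
    e.injective.prodMap Function.injective_id
  have hmem : ∀ c r i, (c, r) ∈ (bw i).map (Prod.map e id) ↔ (e.symm c, r) ∈ bw i := by
    intro c r i
    have : (c, r) = Prod.map e id (e.symm c, r) := by simp
    rw [this, List.mem_map_of_injective inj]
  -- Any order will do on a coloured component.
  let cw : Palette g → List (Fin n × Role) := fun z =>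
    ((Finset.univ.filter fun a : Fin n => col (e.symm a) = some z).toList).map (·, Role.over)
  have hcw : ∀ c r z, (c, r) ∈ cw z ↔ r = .over ∧ col (e.symm c) = some z := by
    intro c r z
    simp only [cw, List.mem_map, Finset.mem_toList, Finset.mem_filter, Finset.mem_univ, true_and,
      Prod.mk.injEq]
    constructor
    · rintro ⟨a, ha, rfl, rfl⟩; exact ⟨rfl, ha⟩
    · rintro ⟨rfl, h⟩; exact ⟨c, h, rfl, rfl⟩
  let W : PrismaticDiagram (zhColor ι g) :=
    { Chord := Fin n
      finite := inferInstance
      sign := fun c => sgn (e.symm c)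
      word := Sum.elim (fun i => (bw i).map (Prod.map e id)) cw
      nodup := by
        rintro (i | z)
        · exact (nd i).map inj
        · exact (Finset.nodup_toList _).map (fun a b h => by simpa using h)
      existsUnique_mem := by
        rintro ⟨c, r⟩
        rcases r with _ | _
        · cases hc : col (e.symm c) with
          | none =>
            obtain ⟨i, hi, hu⟩ := ho _ hc
            refine ⟨.inl i, (hmem _ _ _).2 hi, ?_⟩
            rintro (j | z) h
            · exact congrArg _ (hu j ((hmem _ _ _).1 h))
            · have := (hcw _ _ _).1 h
              simp [hc] at this
          | some z =>
            refine ⟨.inr z, (hcw _ _ _).2 ⟨rfl, hc⟩, ?_⟩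
            rintro (j | z') h
            · exact absurd ((hmem _ _ _).1 h) (ho' _ z hc j)
            · have := ((hcw _ _ _).1 h).2
              rw [hc] at this
              simpa using this.symm
        · obtain ⟨i, hi, hu⟩ := hu (e.symm c)
          refine ⟨.inl i, (hmem _ _ _).2 hi, ?_⟩
          rintro (j | z) h
          · exact congrArg _ (hu j ((hmem _ _ _).1 h))
          · have := (hcw _ _ _).1 h
            simp at this
      under_black := by
        rintro (i | z) c h
        · rfl
        · have := (hcw _ _ _).1 h
          simp at this }
  refine ⟨W, e, fun c => by simp [W], fun i => rfl, fun z c => ?_⟩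
  refine (hcw (e c) .over z).trans ?_
  simp

end PrismaticDiagram

/-! ## Codes -/

/-- A passage under an arc of the `Ω`-part: the colour of the arc and the sign of the crossing. -/
abbrev Syllable (g : ℕ) : Type := Palette g × ℤˣ

/-- What one meets along a component of the `α`-part: an end of a black crossing, or an arc of
the `Ω`-part. -/
abbrev Sym (X : Type*) (g : ℕ) := (X × Role) ⊕ Syllable g

/-- The symbol of a chord end when the chords are classified by `τ`. -/
def symbol {C X : Type*} {g : ℕ} (τ : C → X ⊕ Syllable g) (e : C × Role) : Sym X g :=
  Sum.map (fun x => (x, e.2)) id (τ e.1)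

variable {ι X : Type*} {g : ℕ}

/-- `W` has black crossings `X` of signs `sg`, and its black components read `w`. -/
structure RealizesVia (W : PrismaticDiagram (zhColor ι g)) (sg : X → ℤˣ) (w : ι → List (Sym X g))
    (τ : W.Chord → X ⊕ Syllable g) : Prop where
  existsUnique : ∀ x, ∃! c, τ c = .inl x
  sign_inl : ∀ c x, τ c = .inl x → W.sign c = sg x
  sign_inr : ∀ c l, τ c = .inr l → W.sign c = l.2
  over_inl : ∀ c x, τ c = .inl x → ∃ i, (c, Role.over) ∈ W.word (.inl i)
  over_inr : ∀ c l, τ c = .inr l → (c, Role.over) ∈ W.word (.inr l.1)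
  word : ∀ i, (W.word (.inl i)).map (symbol τ) ~r w i

def Realizes (W : PrismaticDiagram (zhColor ι g)) (sg : X → ℤˣ) (w : ι → List (Sym X g)) : Prop :=
  ∃ τ, RealizesVia W sg w τ

lemma exists_map_eq_of_isRotated {α β : Type*} {f : α → β} {l : List α} {m : List β}
    (h : l.map f ~r m) : ∃ l', l ~r l' ∧ l'.map f = m := by
  obtain ⟨n, rfl⟩ := h
  exact ⟨l.rotate n, ⟨n, rfl⟩, by rw [List.map_rotate]⟩

lemma symbol_inl {C : Type*} {τ : C → X ⊕ Syllable g} {e : C × Role} {x : X} {r : Role}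
    (h : symbol τ e = .inl (x, r)) : τ e.1 = .inl x ∧ e.2 = r := by
  unfold symbol at h
  cases ht : τ e.1 with
  | inl y => rw [ht] at h; simpa using h
  | inr l => rw [ht] at h; simp at h

lemma symbol_inr {C : Type*} {τ : C → X ⊕ Syllable g} {e : C × Role} {l : Syllable g}
    (h : symbol τ e = .inr l) : τ e.1 = .inr l := by
  unfold symbol at h
  cases ht : τ e.1 with
  | inl y => rw [ht] at h; simp at h
  | inr l => rw [ht] at h; simpa using h

namespace RealizesVia

variable {W W' : PrismaticDiagram (zhColor ι g)} {sg : X → ℤˣ} {w : ι → List (Sym X g)}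
  {τ : W.Chord → X ⊕ Syllable g} {τ' : W'.Chord → X ⊕ Syllable g}

lemma under_of_inr (h : RealizesVia W sg w τ) {e : W.Chord × Role} {l : Syllable g} {i : ι}
    (ht : τ e.1 = .inr l) (he : e ∈ W.word (.inl i)) : e.2 = .under := by
  obtain ⟨c, r⟩ := e
  rcases r with _ | _
  · exact absurd (W.mem_unique he (h.over_inr c l ht)) (by simp)
  · rfl

lemma exists_under (W : PrismaticDiagram (zhColor ι g)) (c : W.Chord) :
    ∃ i, (c, Role.under) ∈ W.word (.inl i) := by
  obtain ⟨k, hk, -⟩ := W.existsUnique_mem (c, .under)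
  rcases k with i | z
  · exact ⟨i, hk⟩
  · simpa [zhColor] using W.under_black _ _ hk

/-- A syllable does not record the role of its chord end, but the role can be recovered: the
over-end of such a chord is on a coloured component, so on a black one the end must be an under-end.
-/
lemma match_position (h : RealizesVia W sg w τ) (h' : RealizesVia W' sg w τ')
    {i : ι} {l : List (W.Chord × Role)} {l' : List (W'.Chord × Role)}
    (hl : W.word (.inl i) ~r l) (hl' : W'.word (.inl i) ~r l')
    (hm : l.map (symbol τ) = l'.map (symbol τ')) {n : ℕ} {c : W.Chord} {r : Role}
    (hn : l[n]? = some (c, r)) : ∃ c', l'[n]? = some (c', r) ∧ τ' c' = τ c := by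
  have := congrArg (fun m : List _ => m[n]?) hm
  simp only [List.getElem?_map, hn, Option.map_some] at this
  obtain ⟨⟨c', r'⟩, hc', he⟩ := Option.map_eq_some_iff.1 this.symm
  have hmem : (c, r) ∈ W.word (.inl i) := hl.perm.mem_iff.2 (List.mem_of_getElem? hn)
  have hmem' : (c', r') ∈ W'.word (.inl i) := hl'.perm.mem_iff.2 (List.mem_of_getElem? hc')
  cases ht : τ c with
  | inl x =>
    have : symbol τ (c, r) = .inl (x, r) := by simp [symbol, ht]
    rw [this] at he
    obtain ⟨h1, h2⟩ := symbol_inl he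
    exact ⟨c', by rw [hc', ← h2], h1⟩
  | inr y =>
    have : symbol τ (c, r) = .inr y := by simp [symbol, ht]
    rw [this] at he
    have h1 := symbol_inr he
    have h2 := h.under_of_inr (e := (c, r)) ht hmem
    have h3 := h'.under_of_inr (e := (c', r')) h1 hmem'
    simp only at h2 h3
    exact ⟨c', by rw [hc', h2, h3], h1⟩

/-- Two diagrams that realize the same words are equivalent. -/
lemma equivalent (h : RealizesVia W sg w τ) (h' : RealizesVia W' sg w τ') : W.Equivalent W' := by
  choose l hl hlm using fun i => exists_map_eq_of_isRotated (h.word i)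
  choose l' hl' hlm' using fun i => exists_map_eq_of_isRotated (h'.word i)
  have nd : ∀ i, (l i).Nodup := fun i => (hl i).perm.nodup_iff.1 (W.nodup _)
  have nd' : ∀ i, (l' i).Nodup := fun i => (hl' i).perm.nodup_iff.1 (W'.nodup _)
  have mem : ∀ i e, e ∈ l i ↔ e ∈ W.word (.inl i) := fun i e => (hl i).perm.mem_iff.symm
  have mem' : ∀ i e, e ∈ l' i ↔ e ∈ W'.word (.inl i) := fun i e => (hl' i).perm.mem_iff.symm
  -- Every chord has its under-end on a black component. Its partner in the other diagram is the
  -- chord whose under-end has the same position.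
  have pos : ∀ c : W.Chord, ∃ (i : ι) (n : ℕ), (l i)[n]? = some (c, Role.under) := by
    intro c
    obtain ⟨i, hi⟩ := exists_under W c
    exact ⟨i, List.mem_iff_getElem?.1 ((mem i _).2 hi)⟩
  have pos' : ∀ c : W'.Chord, ∃ (i : ι) (n : ℕ), (l' i)[n]? = some (c, Role.under) := by
    intro c
    obtain ⟨i, hi⟩ := exists_under W' c
    exact ⟨i, List.mem_iff_getElem?.1 ((mem' i _).2 hi)⟩
  have uniq : ∀ (e : W.Chord × Role) (i j : ι) (n m : ℕ), (l i)[n]? = some e → (l j)[m]? = some e → i = j ∧ n = m := by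
    intro e i j n m hi hj
    have hij : i = j := by
      have := W.mem_unique ((mem i _).1 (List.mem_of_getElem? hi))
        ((mem j _).1 (List.mem_of_getElem? hj))
      simpa using this
    subst hij
    refine ⟨rfl, ?_⟩
    have hn := (List.getElem?_eq_some_iff.1 hi).1
    exact (List.getElem?_inj hn (nd i)).1 (hi.trans hj.symm)
  have uniq' : ∀ (e : W'.Chord × Role) (i j : ι) (n m : ℕ), (l' i)[n]? = some e → (l' j)[m]? = some e → i = j ∧ n = m := by
    intro e i j n m hi hj
    have hij : i = j := by
      have := W'.mem_unique ((mem' i _).1 (List.mem_of_getElem? hi))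
        ((mem' j _).1 (List.mem_of_getElem? hj))
      simpa using this
    subst hij
    refine ⟨rfl, ?_⟩
    have hn := (List.getElem?_eq_some_iff.1 hi).1
    exact (List.getElem?_inj hn (nd' i)).1 (hi.trans hj.symm)
  choose a n hpos using pos
  choose a' n' hpos' using pos'
  have step := fun i {n : ℕ} {c : W.Chord} {r : Role} => h.match_position h' (hl i) (hl' i) ((hlm i).trans (hlm' i).symm) (n := n) (c := c) (r := r)
  have step' := fun i {n : ℕ} {c : W'.Chord} {r : Role} => h'.match_position h (hl' i) (hl i) ((hlm' i).trans (hlm i).symm) (n := n) (c := c) (r := r)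
  choose F hF hFτ using fun c => step (a c) (hpos c)
  choose F' hF' hFτ' using fun c => step' (a' c) (hpos' c)
  have left : ∀ c, F' (F c) = c := by
    intro c
    obtain ⟨h1, h2⟩ := uniq' _ _ _ _ _ (hF c) (hpos' (F c))
    have := hF' (F c)
    rw [← h1, ← h2, hpos c] at this
    simpa using this.symm
  have right : ∀ c, F (F' c) = c := by
    intro c
    obtain ⟨h1, h2⟩ := uniq _ _ _ _ _ (hF' c) (hpos (F' c))
    have := hF (F' c)
    rw [← h1, ← h2, hpos' c] at this
    simpa using this.symm
  refine PrismaticDiagram.equivalent_of_perm ⟨F, F', left, right⟩ (fun c => ?_) (fun i => ?_)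
    (fun z c => ?_)
  · change W'.sign (F c) = W.sign c
    cases ht : τ c with
    | inl x => rw [h.sign_inl c x ht, h'.sign_inl _ x ((hFτ c).trans ht)]
    | inr y => rw [h.sign_inr c y ht, h'.sign_inr _ y ((hFτ c).trans ht)]
  · have : l' i = (l i).map (Prod.map F id) := by
      apply List.ext_getElem?
      intro m
      rw [List.getElem?_map]
      cases hm : (l i)[m]? with
      | none =>
        have hlen : (l' i).length = (l i).length := by
          rw [← List.length_map (symbol τ'), hlm', ← hlm, List.length_map]
        rw [List.getElem?_eq_none_iff] at hm
        simpa [hlen] using hm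
      | some e =>
        obtain ⟨c, r⟩ := e
        obtain ⟨c', hc', ht'⟩ := step i hm
        rw [hc']
        suffices c' = F c by simp [this]
        -- A black crossing is met twice, and its partner is recognized by the label `x`; a syllable
        -- is met once, at its under-end, and its partner by the position.
        cases ht : τ c with
        | inl x =>
          exact (h'.existsUnique x).unique (ht'.trans ht) ((hFτ c).trans ht)
        | inr y =>
          have hr : r = .under := h.under_of_inr (e := (c, r)) ht ((mem i _).1 (List.mem_of_getElem? hm))
          subst hr
          obtain ⟨rfl, rfl⟩ := uniq _ _ _ _ _ hm (hpos c)
          have := hF c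
          rw [hc'] at this
          simpa using this
    change W'.word (.inl i) ~r (W.word (.inl i)).map (Prod.map F id)
    refine (hl' i).trans ?_
    rw [this]
    exact (hl i).symm.map _
  · change (F c, Role.over) ∈ W'.word (.inr z) ↔ _
    cases ht : τ c with
    | inl x =>
      obtain ⟨i, hi⟩ := h.over_inl c x ht
      obtain ⟨j, hj⟩ := h'.over_inl _ x ((hFτ c).trans ht)
      constructor
      · intro hh; exact absurd (W'.mem_unique hh hj) (by simp)
      · intro hh; exact absurd (W.mem_unique hh hi) (by simp)
    | inr y =>
      have h1 := h.over_inr c y ht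
      have h2 := h'.over_inr _ y ((hFτ c).trans ht)
      constructor
      · intro hh; rwa [W'.mem_unique hh h2]
      · intro hh; rwa [W.mem_unique hh h1]

end RealizesVia

end HomotopyZh
end

/-! ### Existence of diagrams with given words, and passing from one system of words to another. -/

noncomputable section
namespace HomotopyZh

variable {ι X : Type*} {g : ℕ}

/-- The black crossing ends among the symbols of a word. -/
def blackEnds (l : List (Sym X g)) : List (X × Role) := l.filterMap Sum.getLeft?

/-- Every end of a black crossing occurs exactly once. -/
structure WellFormed (w : ι → List (Sym X g)) : Prop where
  existsUnique : ∀ e, ∃! i, e ∈ blackEnds (w i)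
  nodup : ∀ i, (blackEnds (w i)).Nodup

lemma mem_blackEnds {l : List (Sym X g)} {e : X × Role} : e ∈ blackEnds l ↔ .inl e ∈ l := by
  simp only [blackEnds, List.mem_filterMap]
  constructor
  · rintro ⟨a, ha, hb⟩
    rcases a with a | a
    · simp only [Sum.getLeft?_inl, Option.some.injEq] at hb; rwa [← hb]
    · simp at hb
  · intro h; exact ⟨_, h, rfl⟩

@[simp] lemma blackEnds_append (l m : List (Sym X g)) :
    blackEnds (l ++ m) = blackEnds l ++ blackEnds m := List.filterMap_append

@[simp] lemma blackEnds_nil : blackEnds ([] : List (Sym X g)) = [] := rfl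

@[simp] lemma blackEnds_inl (e : X × Role) (l : List (Sym X g)) :
    blackEnds (.inl e :: l) = e :: blackEnds l := rfl

@[simp] lemma blackEnds_inr (a : Syllable g) (l : List (Sym X g)) :
    blackEnds (.inr a :: l) = blackEnds l := rfl

@[simp] lemma blackEnds_map_inr (m : List (Syllable g)) :
    blackEnds (m.map (.inr : Syllable g → Sym X g)) = [] := by
  induction m with
  | nil => rfl
  | cons a m ih => simpa using ih

lemma WellFormed.of_eq {w w' : ι → List (Sym X g)} (h : WellFormed w)
    (he : ∀ i, blackEnds (w' i) = blackEnds (w i)) : WellFormed w' :=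
  ⟨fun e => by simpa only [he] using h.existsUnique e, fun i => by rw [he]; exact h.nodup i⟩

/-! ### Existence of realizations -/

lemma getRight_eq_of_eq_inr {α β : Type*} {s : α ⊕ β} (hs : s.isRight) {b : β} (h : s = .inr b) :
    s.getRight hs = b := by
  subst h; rfl

/-- Take one chord for each black crossing and one for each position that carries a syllable. Moves
on words can be reversed only because every well-formed system of words has a realization. -/
lemma exists_realizes [Finite ι] [Finite X] (sg : X → ℤˣ) {w : ι → List (Sym X g)}
    (hw : WellFormed w) : ∃ W, Realizes W sg w := by
  classical
  let C := X ⊕ {p : Σ i, Fin (w i).length // ((w p.1).get p.2).isRight}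
  let entry : ∀ i, Fin (w i).length → C × Role := fun i n =>
    match h : (w i).get n with
    | .inl e => (.inl e.1, e.2)
    | .inr _ => (.inr ⟨⟨i, n⟩, by simp only [h]; rfl⟩, .under)
  let τ : C → X ⊕ Syllable g := Sum.map id fun p => ((w p.1.1).get p.1.2).getRight p.2
  have entry_inl : ∀ i n e, (w i).get n = .inl e → entry i n = (.inl e.1, e.2) := by
    intro i n e h
    simp only [entry]
    split
    · next e' h' => rw [h] at h'; cases h'; rfl
    · next h' => rw [h] at h'; simp at h'
  have entry_inr : ∀ i n (h : ((w i).get n).isRight), entry i n = (.inr ⟨⟨i, n⟩, h⟩, .under) := by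
    intro i n h
    simp only [entry]
    split
    · next e' h' => rw [h'] at h; simp at h
    · rfl
  have hsym : ∀ i n, symbol τ (entry i n) = (w i).get n := by
    intro i n
    rcases h : (w i).get n with e | l
    · rw [entry_inl i n e h]; simp [symbol, τ]
    · rw [entry_inr i n (by rw [h]; rfl)]
      simp only [symbol, τ, Sum.map_inr, id_eq]
      rw [getRight_eq_of_eq_inr _ h]
  have pw : ∀ i (n m : Fin (w i).length) e, (w i).get n = .inl e → (w i).get m = .inl e →
      n = m := by
    intro i n m e hn hm
    have h1 := hw.nodup i
    rw [blackEnds, List.Nodup, List.pairwise_filterMap, List.pairwise_iff_get] at h1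
    rcases lt_trichotomy n m with h | h | h
    · exact absurd rfl (h1 n m h e (by rw [hn]; rfl) e (by rw [hm]; rfl))
    · exact h
    · exact absurd rfl (h1 m n h e (by rw [hm]; rfl) e (by rw [hn]; rfl))
  have inj : ∀ i, Function.Injective (entry i) := by
    intro i n m h
    rcases hn : (w i).get n with e | l <;> rcases hm : (w i).get m with e' | l'
    · rw [entry_inl i n e hn, entry_inl i m e' hm] at h
      simp only [Prod.mk.injEq] at h
      have : e = e' := Prod.ext (Sum.inl.inj h.1) h.2
      subst this
      exact pw i n m e hn hm
    · rw [entry_inl i n e hn, entry_inr i m (by rw [hm]; rfl)] at h; simp at h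
    · rw [entry_inl i m e' hm, entry_inr i n (by rw [hn]; rfl)] at h; simp at h
    · rw [entry_inr i n (by rw [hn]; rfl), entry_inr i m (by rw [hm]; rfl)] at h
      simpa using Sum.inr.inj (Prod.mk.inj h).1
  let bw : ι → List (C × Role) := fun i => (List.finRange _).map (entry i)
  have mem_inl : ∀ x r i, (Sum.inl x, r) ∈ bw i ↔ (x, r) ∈ blackEnds (w i) := by
    intro x r i
    simp only [bw, List.mem_map, List.mem_finRange, true_and, mem_blackEnds]
    constructor
    · rintro ⟨n, hn⟩
      rcases h : (w i).get n with e | l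
      · rw [entry_inl i n e h] at hn
        simp only [Prod.mk.injEq] at hn
        rw [show (x, r) = e from Prod.ext (Sum.inl.inj hn.1).symm hn.2.symm, ← h]
        exact List.get_mem _ _
      · rw [entry_inr i n (by rw [h]; rfl)] at hn; simp at hn
    · intro h
      obtain ⟨n, hn⟩ := List.get_of_mem h
      exact ⟨n, entry_inl i n _ hn⟩
  have mem_inr : ∀ p r i, (Sum.inr p, r) ∈ bw i ↔ r = .under ∧ p.1.1 = i := by
    intro p r i
    simp only [bw, List.mem_map, List.mem_finRange, true_and]
    constructor
    · rintro ⟨n, hn⟩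
      rcases h : (w i).get n with e | l
      · rw [entry_inl i n e h] at hn; simp at hn
      · rw [entry_inr i n (by rw [h]; rfl)] at hn
        simp only [Prod.mk.injEq] at hn
        rw [← Sum.inr.inj hn.1]; exact ⟨hn.2.symm, rfl⟩
    · rintro ⟨rfl, rfl⟩; exact ⟨p.1.2, entry_inr _ _ p.2⟩
  obtain ⟨W, χ, hs, hb, hc⟩ := PrismaticDiagram.exists_of_blackWords (C := C) (g := g)
    (Sum.elim sg fun p => (((w p.1.1).get p.1.2).getRight p.2).2)
    (Sum.elim (fun _ => none) fun p => some (((w p.1.1).get p.1.2).getRight p.2).1) bw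
    (fun i => (List.nodup_finRange _).map (inj i))
    (by
      rintro (x | p)
      · simpa only [mem_inl] using hw.existsUnique (x, .under)
      · exact ⟨p.1.1, by simp [mem_inr], by simp [mem_inr]⟩)
    (by
      rintro (x | p) h
      · simpa only [mem_inl] using hw.existsUnique (x, .over)
      · simp at h)
    (by
      rintro (x | p) z h i
      · simp at h
      · simp [mem_inr])
  refine ⟨W, τ ∘ χ.symm, fun x => ⟨χ (.inl x), by simp [τ], ?_⟩, ?_, ?_, ?_, ?_, ?_⟩
  · intro c hc
    obtain ⟨c, rfl⟩ := χ.surjective c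
    rcases c with y | p <;> simp [τ] at hc
    rw [hc]
  · intro c x hc
    obtain ⟨c, rfl⟩ := χ.surjective c
    rcases c with y | p <;> simp [τ] at hc
    rw [hc, hs]; rfl
  · intro c l hc
    obtain ⟨c, rfl⟩ := χ.surjective c
    rcases c with y | p <;> simp [τ] at hc
    rw [hs, ← getRight_eq_of_eq_inr p.2 hc]; rfl
  · intro c x hc
    obtain ⟨c, rfl⟩ := χ.surjective c
    rcases c with y | p <;> simp [τ] at hc
    obtain ⟨i, hi, -⟩ := hw.existsUnique (y, .over)
    refine ⟨i, ?_⟩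
    rw [hb]
    exact List.mem_map.2 ⟨_, (mem_inl _ _ _).2 hi, rfl⟩
  · intro c l hc'
    obtain ⟨c, rfl⟩ := χ.surjective c
    rcases c with y | p <;> simp [τ] at hc'
    rw [hc, ← getRight_eq_of_eq_inr p.2 hc']; rfl
  · intro i
    rw [hb, List.map_map]
    have : (symbol (τ ∘ χ.symm) ∘ Prod.map χ id) = symbol τ := by
      funext e; simp [symbol]
    rw [this, List.map_map]
    have : symbol τ ∘ entry i = (w i).get := funext (hsym i)
    rw [this, ← List.ofFn_eq_map, List.ofFn_get]

/-! ### Leading from one word to another -/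

/-- Diagrams that realize `w` are equivalent to diagrams that realize `w'`. -/
def Leads {Y : Type*} (sg : X → ℤˣ) (w : ι → List (Sym X g)) (sg' : Y → ℤˣ)
    (w' : ι → List (Sym Y g)) : Prop :=
  ∀ W, Realizes W sg w → ∃ W', W.Equivalent W' ∧ Realizes W' sg' w'

lemma Realizes.equivalent {W W' : PrismaticDiagram (zhColor ι g)} {sg : X → ℤˣ}
    {w : ι → List (Sym X g)} (h : Realizes W sg w) (h' : Realizes W' sg w) : W.Equivalent W' := by
  obtain ⟨τ, h⟩ := h
  obtain ⟨τ', h'⟩ := h'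
  exact h.equivalent h'

lemma Leads.refl (sg : X → ℤˣ) (w : ι → List (Sym X g)) : Leads sg w sg w :=
  fun W h => ⟨W, .refl _, h⟩

section
variable {Y Z : Type*} {sg : X → ℤˣ} {w : ι → List (Sym X g)} {sg' : Y → ℤˣ}
    {w' : ι → List (Sym Y g)} {sg'' : Z → ℤˣ} {w'' : ι → List (Sym Z g)}

lemma Leads.trans (h : Leads sg w sg' w') (h' : Leads sg' w' sg'' w'') : Leads sg w sg'' w'' := by
  intro W hW
  obtain ⟨W', e, hW'⟩ := h W hW
  obtain ⟨W'', e', hW''⟩ := h' W' hW'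
  exact ⟨W'', e.trans e', hW''⟩

lemma Leads.equivalent (h : Leads sg w sg' w') {W W' : PrismaticDiagram (zhColor ι g)}
    (hW : Realizes W sg w) (hW' : Realizes W' sg' w') : W.Equivalent W' := by
  obtain ⟨W₁, e, h₁⟩ := h W hW
  exact e.trans (h₁.equivalent hW')

/-- A given realization of `w'` need not arise from one of `w`; but some realization of `w` exists,
it leads to one of `w'`, and any two realizations of `w'` are equivalent. -/
lemma Leads.symm [Finite ι] [Finite X] (hw : WellFormed w) (h : Leads sg w sg' w') :
    Leads sg' w' sg w := by
  intro W' hW'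
  obtain ⟨W, hW⟩ := exists_realizes sg hw
  exact ⟨W, (h.equivalent hW hW').symm, hW⟩
end

lemma Leads.of_isRotated {sg : X → ℤˣ} {w w' : ι → List (Sym X g)} (h : ∀ i, w i ~r w' i) :
    Leads sg w sg w' := by
  rintro W ⟨τ, hW⟩
  exact ⟨W, .refl _, τ, hW.existsUnique, hW.sign_inl, hW.sign_inr, hW.over_inl, hW.over_inr,
    fun i => (hW.word i).trans (h i)⟩

end HomotopyZh
end

/-! ### Erasing chords: cancellation of inverse syllables and of the relator. -/

noncomputable section
namespace HomotopyZh

variable {ι X : Type*} {g : ℕ}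

lemma exists_append_of_isRotated {α : Type*} {l l' : List α} (h : l ~r l') :
    ∃ a b, l = a ++ b ∧ l' = b ++ a := by
  obtain ⟨n, rfl⟩ := h
  exact ⟨l.take (n % l.length), l.drop (n % l.length), (List.take_append_drop _ _).symm,
    List.rotate_eq_drop_append_take_mod⟩

lemma isRotated_filter {α : Type*} {l l' : List α} (p : α → Bool) (h : l ~r l') :
    l.filter p ~r l'.filter p := by
  obtain ⟨a, b, rfl, rfl⟩ := exists_append_of_isRotated h
  simp only [List.filter_append]
  exact List.isRotated_append

lemma isRotated_flatMap {α β : Type*} {l l' : List α} (f : α → List β) (h : l ~r l') :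
    l.flatMap f ~r l'.flatMap f := by
  obtain ⟨a, b, rfl, rfl⟩ := exists_append_of_isRotated h
  simp only [List.flatMap_append]
  exact List.isRotated_append

lemma isRotated_of_map {α β : Type*} {f : α → β} (hf : Function.Injective f) {l l' : List α}
    (h : l.map f ~r l'.map f) : l ~r l' := by
  obtain ⟨m, hm, he⟩ := exists_map_eq_of_isRotated h
  rwa [← List.map_injective_iff.2 hf he]

namespace PrismaticDiagram

variable {K : Type*} {color : K → Option (Palette g)}

lemma mem_erase (W : PrismaticDiagram color) {A : Set W.Chord} {c : W.Chord} (hc : c ∉ A)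
    {r : Role} {k : K} :
    ((⟨c, hc⟩, r) : (W.erase A).Chord × Role) ∈ (W.erase A).word k ↔ (c, r) ∈ W.word k := by
  classical
  simp only [List.mem_filterMap]
  constructor
  · rintro ⟨a, ha, hb⟩
    by_cases h : a.1 ∉ A
    · simp only [h, not_false_eq_true, dite_true, Option.some.injEq, Prod.mk.injEq,
        Subtype.mk.injEq] at hb
      rw [← hb.1, ← hb.2]; exact ha
    · simp [h] at hb
  · intro h
    exact ⟨_, h, by simp [hc]⟩

lemma mem_permute (W : PrismaticDiagram color) (ρ : Equiv.Perm (W.Chord × Role))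
    (h : ∀ k e, ρ e ∈ W.word k ↔ e ∈ W.word k) {e : W.Chord × Role} {k : K} :
    e ∈ (W.permute ρ h).word k ↔ e ∈ W.word k := by
  change e ∈ (W.word k).map ρ ↔ _
  rw [List.mem_map]
  constructor
  · rintro ⟨a, ha, rfl⟩; exact (h k a).2 ha
  · intro he; exact ⟨ρ.symm e, (h k _).1 (by simpa using he), by simp⟩

end PrismaticDiagram

section

variable {W : PrismaticDiagram (zhColor ι g)} {sg : X → ℤˣ} {w : ι → List (Sym X g)}
  {τ : W.Chord → X ⊕ Syllable g}

/-- The common source of two kinds of erasure: of syllables, where `f` is the identity, and of black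
crossings, where the range of `f` consists of the labels that survive. -/
lemma RealizesVia.erase (h : RealizesVia W sg w τ) (A : Set W.Chord) {X₀ : Type*}
    {sg₀ : X₀ → ℤˣ} {w₀ : ι → List (Sym X₀ g)} (f : X₀ → X) (hf : Function.Injective f)
    (hA : ∀ c x, τ c = .inl x → (c ∉ A ↔ x ∈ range f)) (hs : ∀ x, sg₀ x = sg (f x))
    (hw : ∀ i, ((W.word (.inl i)).filter (fun e => by classical exact decide (e.1 ∉ A))).map
      (symbol τ) ~r (w₀ i).map (Sum.map (Prod.map f id) id)) :
    Realizes (W.erase A) sg₀ w₀ := by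
  classical
  have ex : ∀ c : {c : W.Chord // c ∉ A}, ∃ t : X₀ ⊕ Syllable g, Sum.map f id t = τ c.1 := by
    intro c
    rcases hc : τ c.1 with x | l
    · obtain ⟨y, rfl⟩ := (hA _ _ hc).1 c.2
      exact ⟨.inl y, rfl⟩
    · exact ⟨.inr l, rfl⟩
  choose τ₀ hτ using ex
  have t_inl : ∀ c x, τ₀ c = .inl x → τ c.1 = .inl (f x) := by
    intro c x hc; rw [← hτ, hc]; rfl
  have t_inr : ∀ c l, τ₀ c = .inr l → τ c.1 = .inr l := by
    intro c l hc; rw [← hτ, hc]; rfl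
  have hsym : ∀ e : {c : W.Chord // c ∉ A} × Role,
      Sum.map (Prod.map f id) id (symbol τ₀ e) = symbol τ (e.1.1, e.2) := by
    intro e
    simp only [symbol, ← hτ]
    rcases τ₀ e.1 with x | l <;> rfl
  refine ⟨τ₀, fun x => ?_, ?_, ?_, ?_, ?_, fun i => ?_⟩
  · obtain ⟨c, hc, hu⟩ := h.existsUnique (f x)
    have hcA : c ∉ A := (hA _ _ hc).2 ⟨x, rfl⟩
    refine ⟨⟨c, hcA⟩, ?_, ?_⟩
    · have := hτ ⟨c, hcA⟩
      simp only [hc] at this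
      rcases ht : τ₀ ⟨c, hcA⟩ with y | l
      · rw [ht] at this
        exact ht.trans (congrArg _ (hf (Sum.inl.inj this)))
      · rw [ht] at this; simp at this
    · intro d hd
      exact Subtype.ext (hu _ (t_inl _ _ hd))
  · intro c x hc; rw [hs]; exact h.sign_inl _ _ (t_inl _ _ hc)
  · intro c l hc; exact h.sign_inr _ _ (t_inr _ _ hc)
  · intro c x hc
    obtain ⟨i, hi⟩ := h.over_inl _ _ (t_inl _ _ hc)
    exact ⟨i, (W.mem_erase c.2).2 hi⟩
  · intro c l hc
    exact (W.mem_erase c.2).2 (h.over_inr _ _ (t_inr _ _ hc))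
  · have J : Function.Injective (Sum.map (Prod.map f id) id : Sym X₀ g → Sym X g) :=
      (hf.prodMap Function.injective_id).sumMap Function.injective_id
    refine isRotated_of_map J ?_
    convert hw i using 1
    rw [← W.map_filterMap_erase A (.inl i), List.map_map, List.map_map]
    exact List.map_congr_left fun e _ => hsym e

/-- The chords to be erased are singled out by their under-ends; their over-ends are on coloured
components and leave no trace in the black words. -/
lemma RealizesVia.delete_letters (h : RealizesVia W sg w τ) {i : ι} {w' : ι → List (Sym X g)}
    {p' m' s' : List (W.Chord × Role)} {m : List (Syllable g)}
    (hl : W.word (.inl i) ~r p' ++ m' ++ s') (hm : m'.map (symbol τ) = m.map .inr)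
    (hi : w' i = p'.map (symbol τ) ++ s'.map (symbol τ)) (hj : ∀ j, j ≠ i → w' j = w j) :
    Realizes (W.erase {c | (c, Role.under) ∈ m'}) sg w' := by
  classical
  have hlet : ∀ e ∈ m', ∃ l, τ e.1 = .inr l := by
    intro e he
    have : symbol τ e ∈ m.map (Sum.inr : Syllable g → Sym X g) := hm ▸ List.mem_map_of_mem he
    obtain ⟨l, -, hl⟩ := List.mem_map.1 this
    exact ⟨l, symbol_inr hl.symm⟩
  have hmem : ∀ e, e ∈ p' ++ m' ++ s' ↔ e ∈ W.word (.inl i) := fun e => hl.perm.mem_iff.symm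
  have hnd : (p' ++ m' ++ s').Nodup := hl.perm.nodup_iff.1 (W.nodup _)
  have key : ∀ j, ∀ e ∈ W.word (.inl j), (e.1, Role.under) ∈ m' → e ∈ m' ∧ j = i := by
    intro j e he hc
    obtain ⟨l, hl⟩ := hlet _ hc
    have hr := h.under_of_inr (e := e) hl he
    have : e = (e.1, Role.under) := Prod.ext rfl hr
    rw [← this] at hc
    refine ⟨hc, ?_⟩
    have := W.mem_unique he ((hmem e).1 (by simp [hc]))
    simpa using this
  refine h.erase _ id Function.injective_id ?_ (fun _ => rfl) fun j => ?_
  · intro c x hc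
    simp only [range_id, mem_univ, iff_true, mem_ofPred_eq]
    intro hcm
    obtain ⟨l, hl⟩ := hlet _ hcm
    simp only at hl
    rw [hc] at hl; simp at hl
  · have hid : (Sum.map (Prod.map id id) id : Sym X g → Sym X g) = id := by
      funext s; rcases s with s | s <;> rfl
    rw [hid, List.map_id]
    rcases eq_or_ne j i with rfl | hji
    · rw [hi, ← List.map_append]
      refine List.IsRotated.map ((isRotated_filter _ hl).trans ?_) _
      rw [List.nodup_append, List.nodup_append] at hnd
      have h1 : ∀ e ∈ p', (e.1, Role.under) ∉ m' := by
        intro e he hc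
        have := (key j e ((hmem e).1 (by simp [he])) hc).1
        exact hnd.1.2.2 e he e this rfl
      have h2 : ∀ e ∈ s', (e.1, Role.under) ∉ m' := by
        intro e he hc
        have := (key j e ((hmem e).1 (by simp [he])) hc).1
        exact hnd.2.2 e (by simp [this]) e he rfl
      have h3 : ∀ e ∈ m', (e.1, Role.under) ∈ m' := by
        intro e he
        obtain ⟨l, hl⟩ := hlet _ he
        have hr := h.under_of_inr hl ((hmem e).1 (by simp [he]))
        rwa [← hr]
      have e1 := List.filter_eq_self.2 (show ∀ e ∈ p', decide ((e.1, Role.under) ∉ m') = true by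
        simpa using h1)
      have e2 := List.filter_eq_self.2 (show ∀ e ∈ s', decide ((e.1, Role.under) ∉ m') = true by
        simpa using h2)
      have e3 := List.filter_eq_nil_iff.2 (show ∀ e ∈ m', ¬ decide ((e.1, Role.under) ∉ m') = true by
        simpa using h3)
      have e4 : List.filter (fun e : W.Chord × Role => decide ((e.1, Role.under) ∉ m'))
          (p' ++ m' ++ s') = p' ++ s' := by
        rw [List.filter_append, List.filter_append, e1, e2, e3, List.append_nil]
      refine ⟨0, (List.rotate_zero _).trans (Eq.trans ?_ e4)⟩
      exact List.filter_congr fun e _ => decide_eq_decide.2 Iff.rfl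
    · rw [hj j hji, List.filter_eq_self.2]
      · exact h.word j
      · intro e he
        have : (e.1, Role.under) ∉ m' := fun hc => hji (key j e he hc).2
        simpa using this

/-- Erasing black crossings. -/
lemma RealizesVia.delete_black (h : RealizesVia W sg w τ) {X₀ : Type*}
    {sg₀ : X₀ → ℤˣ} {w₀ : ι → List (Sym X₀ g)} (f : X₀ → X) (hf : Function.Injective f)
    (hs : ∀ x, sg₀ x = sg (f x))
    (hw : ∀ i, (w i).filter (fun s => by
      classical exact decide (∀ e, s = .inl e → e.1 ∈ range f)) =
        (w₀ i).map (Sum.map (Prod.map f id) id)) :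
    Realizes (W.erase {c | ∃ x ∉ range f, τ c = .inl x}) sg₀ w₀ := by
  classical
  refine h.erase _ f hf ?_ hs fun i => ?_
  · intro c x hc
    simp only [mem_ofPred_eq, hc, Sum.inl.injEq]
    push Not
    constructor
    · intro hh; by_contra hx; exact hh x hx rfl
    · rintro hx y hy rfl; exact hy hx
  · rw [← hw]
    refine List.IsRotated.trans ?_ (isRotated_filter _ (h.word i))
    rw [List.filter_map]
    convert List.IsRotated.refl _ using 3
    funext e
    simp only [Function.comp_apply, decide_eq_decide, mem_ofPred_eq]
    rcases ht : τ e.1 with x | l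
    · simp [symbol, ht]
    · simp [symbol, ht]

lemma RealizesVia.permute (h : RealizesVia W sg w τ) (ρ : Equiv.Perm (W.Chord × Role))
    (hρ : ∀ k e, ρ e ∈ W.word k ↔ e ∈ W.word k) {X' : Type*} {sg' : X' → ℤˣ}
    {w' : ι → List (Sym X' g)} (f : X ≃ X') (hs : ∀ x, sg' (f x) = sg x)
    (hw : ∀ i, ((W.word (.inl i)).map ρ).map (symbol (Sum.map f id ∘ τ)) ~r w' i) :
    Realizes (W.permute ρ hρ) sg' w' := by
  have t_inl : ∀ c x, (Sum.map f id ∘ τ) c = .inl x → τ c = .inl (f.symm x) := by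
    intro c x hc
    simp only [Function.comp_apply] at hc
    rcases ht : τ c with y | l
    · rw [ht] at hc
      rw [← Sum.inl.inj hc]; simp
    · rw [ht] at hc; simp at hc
  have t_inr : ∀ c l, (Sum.map f id ∘ τ) c = .inr l → τ c = .inr l := by
    intro c l hc
    simp only [Function.comp_apply] at hc
    rcases ht : τ c with y | l
    · rw [ht] at hc; simp at hc
    · rw [ht] at hc
      simpa using hc
  refine ⟨Sum.map f id ∘ τ, fun x => ?_, ?_, ?_, ?_, ?_, hw⟩
  · obtain ⟨c, hc, hu⟩ := h.existsUnique (f.symm x)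
    exact ⟨c, by simp [hc], fun d hd => hu d (t_inl _ _ hd)⟩
  · intro c x hc
    rw [← f.apply_symm_apply x, hs]
    exact h.sign_inl _ _ (t_inl _ _ hc)
  · intro c l hc; exact h.sign_inr _ _ (t_inr _ _ hc)
  · intro c x hc
    obtain ⟨i, hi⟩ := h.over_inl _ _ (t_inl _ _ hc)
    exact ⟨i, (W.mem_permute ρ hρ).2 hi⟩
  · intro c l hc
    exact (W.mem_permute ρ hρ).2 (h.over_inr _ _ (t_inr _ _ hc))

lemma RealizesVia.reorder (h : RealizesVia W sg w τ) (z : Palette g)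
    (l : List (W.Chord × Role)) (hl : l.Perm (W.word (.inr z))) :
    RealizesVia (W.reorder (.inr z) l hl) sg w τ where
  existsUnique := h.existsUnique
  sign_inl := h.sign_inl
  sign_inr := h.sign_inr
  over_inl := by simpa using h.over_inl
  over_inr c y hc := by
    have := h.over_inr c y hc
    by_cases hz : y.1 = z
    · subst hz
      simpa using hl.mem_iff.2 this
    · simpa [hz] using this
  word := by simpa using h.word

lemma exists_perm_cons_cons {α : Type*} {l : List α} {a b : α} (ha : a ∈ l) (hb : b ∈ l)
    (hab : a ≠ b) : ∃ u, (a :: b :: u).Perm l := by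
  classical
  have : b ∈ l.erase a := (List.mem_erase_of_ne hab.symm).2 hb
  exact ⟨(l.erase a).erase b, ((List.perm_cons_erase this).symm.cons a).trans
    (List.perm_cons_erase ha).symm⟩

end

/-- Neighbouring arcs of the same colour and of opposite signs cancel. -/
lemma leads_cancel {sg : X → ℤˣ} {w w' : ι → List (Sym X g)} {i : ι} {p s : List (Sym X g)}
    {z : Palette g} {ε : ℤˣ} (hi : w i = p ++ [.inr (z, ε), .inr (z, -ε)] ++ s)
    (hi' : w' i = p ++ s) (hj : ∀ j, j ≠ i → w' j = w j) : Leads sg w sg w' := by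
  rintro W ⟨τ, h⟩
  obtain ⟨l, hl, hlm⟩ := exists_map_eq_of_isRotated (h.word i)
  rw [hi] at hlm
  obtain ⟨q, s', rfl, hq, rfl⟩ := List.map_eq_append_iff.1 hlm
  obtain ⟨p', m', rfl, rfl, hm⟩ := List.map_eq_append_iff.1 hq
  obtain ⟨e, m', rfl, he, hm⟩ := List.map_eq_cons_iff.1 hm
  obtain ⟨f, m', rfl, hf, hm⟩ := List.map_eq_cons_iff.1 hm
  obtain rfl := List.map_eq_nil_iff.1 hm
  have hmem : ∀ a, a ∈ p' ++ [e, f] ++ s' ↔ a ∈ W.word (.inl i) := fun _ => hl.perm.mem_iff.symm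
  have hnd : (p' ++ [e, f] ++ s').Nodup := hl.perm.nodup_iff.1 (W.nodup _)
  have hτe := symbol_inr he
  have hτf := symbol_inr hf
  have hre := h.under_of_inr hτe ((hmem e).1 (by simp))
  have hrf := h.under_of_inr hτf ((hmem f).1 (by simp))
  have hef : e ≠ f := by
    rintro rfl
    simp [List.nodup_append] at hnd
  have he' : e = (e.1, Role.under) := Prod.ext rfl hre
  have hf' : f = (f.1, Role.under) := Prod.ext rfl hrf
  have hc : e.1 ≠ f.1 := fun hh => hef (Prod.ext hh (hre.trans hrf.symm))
  -- The under-ends are neighbours already. The over-ends are on the same coloured component, where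
  -- semi-welded moves bring them together; then a second Reidemeister move removes both chords.
  obtain ⟨u, hu⟩ := exists_perm_cons_cons (h.over_inr _ (z, ε) hτe) (h.over_inr _ (z, -ε) hτf)
    (by simpa using hc)
  have h₂ := h.reorder z _ hu
  refine ⟨_, (W.equivalent_reorder (k := .inr z) (z := z) rfl _ hu).trans
    (PrismaticDiagram.Step.equivalent (.inr <| .inr <| .inl
      ⟨e.1, f.1, 1, 1, hc, ?_, .inl ⟨rfl, .inr z, u, ?_⟩, .inl ⟨rfl, .inl i, s' ++ p', ?_⟩, ?_⟩)),
    h₂.delete_letters (i := i) (m' := [e, f]) (m := [(z, ε), (z, -ε)]) (p' := p') (s' := s')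
      (by simpa using hl) (by simp [he, hf]) hi' hj⟩
  · rw [show (W.reorder (.inr z) _ hu).sign f.1 = _ from h.sign_inr _ _ hτf,
      show (W.reorder (.inr z) _ hu).sign e.1 = _ from h.sign_inr _ _ hτe]
  · simp only [Function.update_self]; exact List.IsRotated.refl _
  · rw [← he', ← hf']
    simp only [ne_eq, reduceCtorEq, not_false_eq_true, Function.update_of_ne]
    refine hl.trans ?_
    have := List.isRotated_append (l := p') (l' := e :: f :: s')
    simpa using this
  · have : ({c | (c, Role.under) ∈ [e, f]} : Set W.Chord) = {e.1, f.1} := by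
      ext c
      rw [he', hf']
      simp
    change PrismaticDiagram.Erases (W.reorder (.inr z) _ hu) _ (PrismaticDiagram.erase (W.reorder (.inr z) _ hu) ({c | (c, Role.under) ∈ [e, f]} : Set W.Chord))
    rw [this]
    exact PrismaticDiagram.erases_erase _ _

/-- The word `x₁⁻¹ y₁⁻¹ x₁ y₁ ⋯ x_g⁻¹ y_g⁻¹ x_g y_g`. -/
def relator (g : ℕ) : List (Syllable g) :=
  (List.finRange g ×ˢ List.finRange 4).map fun ij =>
    ((ij.1, PrismaticDiagram.blockLetter ij.2), PrismaticDiagram.blockSign ij.2)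

/-- This serves to index the chords of a stretch of a word by the positions in the relator, as
`PrismaticDiagram.Commutator` demands. -/
lemma exists_map_eq_map {α β γ : Type*} [Nonempty β] {f : β → γ} {h : α → γ} {l : List α}
    (hl : l.Nodup) {m : List β} (hm : m.map f = l.map h) :
    ∃ k : α → β, m = l.map k ∧ ∀ a ∈ l, f (k a) = h a := by
  classical
  induction l generalizing m with
  | nil => exact ⟨fun _ => Classical.arbitrary β, by simpa using hm, by simp⟩
  | cons a l ih =>
    rw [List.map_cons] at hm
    obtain ⟨b, m, rfl, hb, hm⟩ := List.map_eq_cons_iff.1 hm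
    rw [List.nodup_cons] at hl
    obtain ⟨k, rfl, hk⟩ := ih hl.2 hm
    refine ⟨Function.update k a b, ?_, ?_⟩
    · simp only [List.map_cons, Function.update_self, List.cons.injEq, true_and]
      refine List.map_congr_left fun c hc => ?_
      rw [Function.update_of_ne (fun hh => hl.1 (by rwa [hh] at hc))]
    · intro c hc
      rcases eq_or_ne c a with rfl | hca
      · simpa using hb
      · rw [Function.update_of_ne hca]
        exact hk c (by simpa [hca] using hc)

lemma complete_zhColor (i : ι) : PrismaticDiagram.Complete (zhColor ι g) := by
  refine ⟨⟨.inl i, rfl⟩, fun z => ⟨.inr z, rfl, ?_⟩⟩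
  rintro (j | z') h
  · simp [zhColor] at h
  · simpa [zhColor] using h

/-- The relator may be erased. -/
lemma leads_relator {sg : X → ℤˣ} {w w' : ι → List (Sym X g)} {i : ι} {p s : List (Sym X g)}
    (hi : w i = p ++ (relator g).map .inr ++ s)
    (hi' : w' i = p ++ s) (hj : ∀ j, j ≠ i → w' j = w j) : Leads sg w sg w' := by
  rintro W ⟨τ, h⟩
  -- For `g = 0` the relator is the empty word. For `g > 0` it is not, and its first chord makes the
  -- type of chord ends nonempty.
  rcases Nat.eq_zero_or_pos g with rfl | hg
  · have : w' = w := by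
      funext j
      rcases eq_or_ne j i with rfl | hji
      · rw [hi, hi']; simp [relator]
      · exact hj j hji
    exact ⟨W, .refl _, τ, this ▸ h⟩
  obtain ⟨l, hl, hlm⟩ := exists_map_eq_of_isRotated (h.word i)
  rw [hi] at hlm
  obtain ⟨q, s', rfl, hq, rfl⟩ := List.map_eq_append_iff.1 hlm
  obtain ⟨p', m', rfl, rfl, hm⟩ := List.map_eq_append_iff.1 hq
  have hmem : ∀ e, e ∈ p' ++ m' ++ s' ↔ e ∈ W.word (.inl i) := fun e => hl.perm.mem_iff.symm
  have hnd : (p' ++ m' ++ s').Nodup := hl.perm.nodup_iff.1 (W.nodup _)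
  have hm' := hm
  rw [relator, List.map_map] at hm'
  have hL : (List.finRange g ×ˢ List.finRange 4).Nodup :=
    (List.nodup_finRange _).product (List.nodup_finRange _)
  have hmemL : ∀ ij, ij ∈ List.finRange g ×ˢ List.finRange 4 := by
    rintro ⟨a, b⟩
    exact List.mem_product.2 ⟨List.mem_finRange _, List.mem_finRange _⟩
  have : Nonempty (W.Chord × Role) := by
    rcases m' with _ | ⟨e, m'⟩
    · exfalso
      have := hmemL (⟨0, hg⟩, 0)
      rw [List.map_nil, eq_comm, List.map_eq_nil_iff] at hm'
      rw [hm'] at this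
      simp at this
    · exact ⟨e⟩
  obtain ⟨k, rfl, hk⟩ := exists_map_eq_map hL hm'
  have hτ : ∀ ij, τ (k ij).1 = .inr ((ij.1, PrismaticDiagram.blockLetter ij.2),
      PrismaticDiagram.blockSign ij.2) := fun ij => symbol_inr (hk ij (hmemL ij))
  have hr : ∀ ij, (k ij).2 = .under := fun ij => h.under_of_inr (hτ ij)
    ((hmem _).1 (by
      have : k ij ∈ (List.finRange g ×ˢ List.finRange 4).map k := List.mem_map_of_mem (hmemL ij)
      simp [this]))
  have hk' : ∀ ij, k ij = ((k ij).1, Role.under) := fun ij => Prod.ext rfl (hr ij)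
  have hinj : Function.Injective fun ij => (k ij).1 := by
    intro a b hab
    have h1 := (List.nodup_append.1 (List.nodup_append.1 hnd).1).2.1
    refine (List.inj_on_of_nodup_map h1 (hmemL a) (hmemL b) ?_)
    rw [hk' a, hk' b]
    exact congrArg (·, Role.under) hab
  refine ⟨_, PrismaticDiagram.Step.equivalent (.inr <| .inr <| .inr <| .inr <| .inr
      ⟨complete_zhColor i, fun ij => (k ij).1, 1, .inl i, s' ++ p', hinj, ?_, ?_, ?_, ?_⟩),
    h.delete_letters (i := i) (m := relator g) hl hm hi' hj⟩
  · intro a b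
    rw [h.sign_inr _ _ (hτ (a, b)), one_mul]
  · intro a b
    exact ⟨.inr (a, PrismaticDiagram.blockLetter b), rfl, h.over_inr _ _ (hτ (a, b))⟩
  · rw [if_pos rfl]
    have : (List.finRange g ×ˢ List.finRange 4).map (fun ij => ((k ij).1, Role.under)) =
        (List.finRange g ×ˢ List.finRange 4).map k :=
      List.map_congr_left fun ij _ => (hk' ij).symm
    rw [this]
    refine hl.trans ?_
    have := List.isRotated_append (l := p') (l' := (List.finRange g ×ˢ List.finRange 4).map k ++ s')
    simpa using this
  · have : ({c | (c, Role.under) ∈ (List.finRange g ×ˢ List.finRange 4).map k} : Set W.Chord) =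
        range fun ij => (k ij).1 := by
      ext c
      simp only [List.mem_map, mem_ofPred_eq, mem_range]
      constructor
      · rintro ⟨a, -, ha⟩; exact ⟨a, by rw [ha]⟩
      · rintro ⟨a, rfl⟩; exact ⟨a, hmemL a, hk' a⟩
    rw [this]
    exact PrismaticDiagram.erases_erase _ _

end HomotopyZh
end

/-! ### Third Reidemeister moves on words: black triangles, and arcs of the Ω-part sliding over a
crossing. -/

noncomputable section
namespace HomotopyZh

variable {ι X : Type*} {g : ℕ}

namespace PrismaticDiagram

variable {K : Type*} {color : K → Option (Palette g)}

lemma Next.same {W : PrismaticDiagram color} {e f : W.Chord × Role} (h : W.Next e f) :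
    ∃ k, e ∈ W.word k ∧ f ∈ W.word k := by
  obtain ⟨k, u, h⟩ := h
  exact ⟨k, h.mem_iff.2 (by simp), h.mem_iff.2 (by simp)⟩

lemma Adjacent.same {W : PrismaticDiagram color} {o : ℤˣ} {e f : W.Chord × Role}
    (h : W.Adjacent o e f) : ∃ k, e ∈ W.word k ∧ f ∈ W.word k := by
  rcases h with ⟨-, h⟩ | ⟨-, h⟩
  · exact h.same
  · obtain ⟨k, h1, h2⟩ := h.same
    exact ⟨k, h2, h1⟩

/-- `ρ` moves the chord ends within their components. -/
def Preserves (W : PrismaticDiagram color) (ρ : Equiv.Perm (W.Chord × Role)) : Prop :=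
  ∀ k e, ρ e ∈ W.word k ↔ e ∈ W.word k

lemma Preserves.mul {W : PrismaticDiagram color} {ρ σ : Equiv.Perm (W.Chord × Role)}
    (h : W.Preserves ρ) (h' : W.Preserves σ) : W.Preserves (ρ * σ) :=
  fun k e => (h k (σ e)).trans (h' k e)

open Classical in
lemma preserves_swap {W : PrismaticDiagram color} {e f : W.Chord × Role}
    (h : ∃ k, e ∈ W.word k ∧ f ∈ W.word k) : W.Preserves (Equiv.swap e f) := by
  obtain ⟨k, he, hf⟩ := h
  have hk : ∀ k', e ∈ W.word k' ↔ f ∈ W.word k' := by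
    intro k'
    constructor
    · intro h'; rwa [W.mem_unique h' he]
    · intro h'; rwa [W.mem_unique h' hf]
  intro k' a
  rcases eq_or_ne a e with rfl | hae
  · rw [Equiv.swap_apply_left, hk]
  rcases eq_or_ne a f with rfl | haf
  · rw [Equiv.swap_apply_right, hk]
  rw [Equiv.swap_apply_of_ne_of_ne hae haf]

end PrismaticDiagram

section

variable {W : PrismaticDiagram (zhColor ι g)} {sg : X → ℤˣ} {w : ι → List (Sym X g)}
  {τ : W.Chord → X ⊕ Syllable g}

lemma RealizesVia.next (h : RealizesVia W sg w τ) {i : ι} {p s : List (Sym X g)}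
    {a b : Sym X g} (hi : w i = p ++ a :: b :: s) :
    ∃ e f, symbol τ e = a ∧ symbol τ f = b ∧ W.Next e f := by
  obtain ⟨l, hl, hlm⟩ := exists_map_eq_of_isRotated (h.word i)
  rw [hi] at hlm
  obtain ⟨p', q, rfl, rfl, hq⟩ := List.map_eq_append_iff.1 hlm
  obtain ⟨e, q, rfl, he, hq⟩ := List.map_eq_cons_iff.1 hq
  obtain ⟨f, q, rfl, hf, hq⟩ := List.map_eq_cons_iff.1 hq
  refine ⟨e, f, he, hf, .inl i, q ++ p', hl.trans ?_⟩
  simpa using List.isRotated_append (l := p') (l' := e :: f :: q)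

lemma RealizesVia.eq_of_symbol (h : RealizesVia W sg w τ) {χ : X → W.Chord}
    (hχ : ∀ x, τ (χ x) = .inl x) {e : W.Chord × Role} {a : X × Role}
    (he : symbol τ e = .inl a) : e = Prod.map χ id a := by
  obtain ⟨h1, h2⟩ := symbol_inl (x := a.1) (r := a.2) he
  exact Prod.ext ((h.existsUnique a.1).unique h1 (hχ _)) h2

-- Each label belongs to exactly one chord, so a swap of two chord ends fixes all other symbols and
-- descends from the diagram to its words.
open Classical in
lemma RealizesVia.symbol_swap (h : RealizesVia W sg w τ) {χ : X → W.Chord}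
    (hχ : ∀ x, τ (χ x) = .inl x) (a b : X × Role) (e : W.Chord × Role) :
    symbol τ (Equiv.swap (Prod.map χ id a) (Prod.map χ id b) e) =
      Sum.map (Equiv.swap a b) id (symbol τ e) := by
  have hs : ∀ a : X × Role, symbol τ (Prod.map χ id a) = .inl a := by
    intro a; simp [symbol, hχ]
  by_cases hea : e = Prod.map χ id a
  · rw [hea, Equiv.swap_apply_left, hs, hs, Sum.map_inl, Equiv.swap_apply_left]
  by_cases heb : e = Prod.map χ id b
  · rw [heb, Equiv.swap_apply_right, hs, hs, Sum.map_inl, Equiv.swap_apply_right]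
  rw [Equiv.swap_apply_of_ne_of_ne hea heb]
  rcases hse : symbol τ e with u | l
  · rw [Sum.map_inl, Equiv.swap_apply_of_ne_of_ne]
    · rintro rfl; exact hea (h.eq_of_symbol hχ hse)
    · rintro rfl; exact heb (h.eq_of_symbol hχ hse)
  · rfl

/-- In the words `w`, the black end `f` is next to `e`, after it if `o = 1` and before it if
`o = -1`. -/
def AdjacentIn (w : ι → List (Sym X g)) (o : ℤˣ) (e f : X × Role) : Prop :=
  (o = 1 ∧ ∃ i p s, w i = p ++ .inl e :: .inl f :: s) ∨
    (o = -1 ∧ ∃ i p s, w i = p ++ .inl f :: .inl e :: s)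

lemma RealizesVia.adjacent (h : RealizesVia W sg w τ) {χ : X → W.Chord}
    (hχ : ∀ x, τ (χ x) = .inl x) {o : ℤˣ} {e f : X × Role} (ha : AdjacentIn w o e f) :
    W.Adjacent o (Prod.map χ id e) (Prod.map χ id f) := by
  rcases ha with ⟨ho, i, p, s, hi⟩ | ⟨ho, i, p, s, hi⟩
  · obtain ⟨e', f', he, hf, hn⟩ := h.next hi
    rw [h.eq_of_symbol hχ he, h.eq_of_symbol hχ hf] at hn
    exact .inl ⟨ho, hn⟩
  · obtain ⟨e', f', he, hf, hn⟩ := h.next hi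
    rw [h.eq_of_symbol hχ he, h.eq_of_symbol hχ hf] at hn
    exact .inr ⟨ho, hn⟩

lemma RealizesVia.exists_chord (h : RealizesVia W sg w τ) :
    ∃ χ : X → W.Chord, Function.Injective χ ∧ ∀ x, τ (χ x) = .inl x := by
  choose χ hχ _ using h.existsUnique
  exact ⟨χ, fun x y hxy => Sum.inl.inj ((hχ x).symm.trans ((congrArg τ hxy).trans (hχ y))), hχ⟩

end

open Classical in
/-- The permutation of the crossing ends in the third Reidemeister move. -/
def triangleSwap (a b c : X) : Equiv.Perm (X × Role) :=
  Equiv.swap (a, .over) (b, .over) * Equiv.swap (a, .under) (c, .over) *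
    Equiv.swap (b, .under) (c, .under)

/-- The third Reidemeister move on black crossings. -/
lemma leads_reidemeister3 {X' : Type*} {sg : X → ℤˣ} {w : ι → List (Sym X g)} {sg' : X' → ℤˣ}
    {w' : ι → List (Sym X' g)} (f : X ≃ X') (hs : ∀ x, sg' (f x) = sg x) {a b c : X}
    {ot om ob : ℤˣ} (hab : a ≠ b) (hac : a ≠ c) (hbc : b ≠ c)
    (ht : AdjacentIn w ot (a, .over) (b, .over)) (hm : AdjacentIn w om (a, .under) (c, .over))
    (hb : AdjacentIn w ob (b, .under) (c, .under))
    (h₁ : sg a * ob = sg b * om) (h₂ : sg b * om = sg c * ot)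
    (hw : ∀ i, w' i = (w i).map (Sum.map (Prod.map f id ∘ triangleSwap a b c) id)) :
    Leads sg w sg' w' := by
  classical
  rintro W ⟨τ, h⟩
  obtain ⟨χ, hχi, hχ⟩ := h.exists_chord
  have at' := h.adjacent hχ ht
  have am' := h.adjacent hχ hm
  have ab' := h.adjacent hχ hb
  have hρ := ((PrismaticDiagram.preserves_swap at'.same).mul
    (PrismaticDiagram.preserves_swap am'.same)).mul (PrismaticDiagram.preserves_swap ab'.same)
  refine ⟨_, PrismaticDiagram.Step.equivalent (.inr <| .inr <| .inr <| .inl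
    ⟨χ a, χ b, χ c, ot, om, ob, hχi.ne hab, hχi.ne hac, hχi.ne hbc, at', am', ab', ?_, ?_,
      W.permutes_permute _ hρ⟩), h.permute _ hρ f hs fun i => ?_⟩
  · rw [h.sign_inl _ _ (hχ a), h.sign_inl _ _ (hχ b), h₁]
  · rw [h.sign_inl _ _ (hχ b), h.sign_inl _ _ (hχ c), h₂]
  · rw [hw, List.map_map]
    refine List.IsRotated.trans ⟨0, ?_⟩ ((h.word i).map _)
    rw [List.rotate_zero, List.map_map]
    refine List.map_congr_left fun e _ => ?_
    have h1 : ∀ y : W.Chord × Role, symbol (Sum.map f id ∘ τ) y =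
        Sum.map (Prod.map f id) id (symbol τ y) := by
      intro y
      simp only [symbol, Function.comp_apply]
      rcases τ y.1 with x | l <;> rfl
    simp only [Function.comp_apply, triangleSwap, Equiv.Perm.coe_mul, h1]
    rw [h.symbol_swap hχ, h.symbol_swap hχ, h.symbol_swap hχ]
    rcases symbol τ e with u | l <;> rfl

/-- Put the letter `l` before each end of the crossing `x`. -/
def expandBefore (x : X) (l : Syllable g) (s : Sym X g) : List (Sym X g) :=
  open Classical in if ∃ r, s = .inl (x, r) then [.inr l, s] else [s]

/-- Put the letter `l` after each end of the crossing `x`. -/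
def expandAfter (x : X) (l : Syllable g) (s : Sym X g) : List (Sym X g) :=
  open Classical in if ∃ r, s = .inl (x, r) then [s, .inr l] else [s]

lemma blackEnds_flatMap (w : List (Sym X g)) (f : Sym X g → List (Sym X g))
    (hf : ∀ s, blackEnds (f s) = blackEnds [s]) : blackEnds (w.flatMap f) = blackEnds w := by
  induction w with
  | nil => rfl
  | cons a w ih =>
    rw [List.flatMap_cons, blackEnds_append, ih, hf, ← blackEnds_append]; rfl

lemma blackEnds_expandBefore (x : X) (l : Syllable g) (s : Sym X g) :
    blackEnds (expandBefore x l s) = blackEnds [s] := by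
  unfold expandBefore; split <;> rfl

lemma blackEnds_expandAfter (x : X) (l : Syllable g) (s : Sym X g) :
    blackEnds (expandAfter x l s) = blackEnds [s] := by
  unfold expandAfter; split
  · rcases s with s | s <;> rfl
  · rfl

/-- An arc of the `Ω`-part slides over a crossing. -/
lemma leads_slide [Finite ι] [Finite X] {sg : X → ℤˣ} {w : ι → List (Sym X g)} (hw : WellFormed w)
    (x : X) (l : Syllable g) :
    Leads sg (fun i => (w i).flatMap (expandBefore x l)) sg
      (fun i => (w i).flatMap (expandAfter x l)) := by
  classical
  intro V hV
  obtain ⟨W₀, τ₀, h₀⟩ := exists_realizes sg hw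
  obtain ⟨χ₀, hχ₀i, hχ₀⟩ := h₀.exists_chord
  set d := χ₀ x with hd
  have : Finite W₀.Chord := W₀.finite
  have : Finite Role := Finite.of_injective (fun r : Role => match r with | .over => true | .under => false)
    (by rintro (_ | _) (_ | _) h <;> simp_all)
  -- The chord `.inr r` is an arc of colour `l.1` over the strand with role `r` of the crossing `d`;
  -- it is passed immediately before `d`.
  let ex : W₀.Chord × Role → List ((W₀.Chord ⊕ Role) × Role) := fun e =>
    if e.1 = d then [(.inr e.2, .under), (.inl e.1, e.2)] else [(.inl e.1, e.2)]
  let bw : ι → List ((W₀.Chord ⊕ Role) × Role) := fun i => (W₀.word (.inl i)).flatMap ex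
  have mem_inl : ∀ c r i, (Sum.inl c, r) ∈ bw i ↔ (c, r) ∈ W₀.word (.inl i) := by
    intro c r i
    simp only [bw, List.mem_flatMap, ex]
    constructor
    · rintro ⟨e, he, hm⟩
      have : (c, r) = e := by
        split at hm <;> simp at hm <;> exact Prod.ext hm.1 hm.2
      rwa [this]
    · intro h
      exact ⟨_, h, by split <;> simp⟩
  have mem_inr : ∀ r r' i, (Sum.inr r, r') ∈ bw i ↔ r' = .under ∧ (d, r) ∈ W₀.word (.inl i) := by
    intro r r' i
    simp only [bw, List.mem_flatMap, ex]
    constructor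
    · rintro ⟨e, he, hm⟩
      split at hm
      · next hed =>
        simp at hm
        refine ⟨hm.2, ?_⟩
        rw [hm.1, ← hed]; exact he
      · simp at hm
    · rintro ⟨rfl, h⟩
      exact ⟨_, h, by simp⟩
  have nd : ∀ i, (bw i).Nodup := by
    intro i
    refine List.nodup_flatMap.2 ⟨fun e _ => ?_, ?_⟩
    · simp only [ex]; split <;> simp
    · refine (W₀.nodup (.inl i)).imp fun {e f} hef => ?_
      simp only [Function.onFun, List.disjoint_left, ex]
      intro a ha hb
      have : e = f := by
        split at ha <;> split at hb <;> simp at ha hb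
        · next h1 h2 =>
          rcases ha with rfl | rfl <;> rcases hb with hb | hb
          · exact Prod.ext (h1.trans h2.symm) (by simpa using hb)
          · simp at hb
          · simp at hb
          · simp at hb; exact Prod.ext hb.1 hb.2
        · rcases ha with rfl | rfl
          · simp at hb
          · simp at hb; exact Prod.ext hb.1 hb.2
        · subst ha
          simp at hb; exact Prod.ext hb.1 hb.2
        · subst ha
          simp at hb; exact Prod.ext hb.1 hb.2
      exact hef this
  have over_unique : ∀ c y, τ₀ c = .inl y → ∃! i, (c, Role.over) ∈ W₀.word (.inl i) := by
    intro c y hc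
    obtain ⟨i, hi⟩ := h₀.over_inl c y hc
    exact ⟨i, hi, fun j hj => by simpa using W₀.mem_unique hj hi⟩
  have under_unique : ∀ c, ∃! i, (c, Role.under) ∈ W₀.word (.inl i) := by
    intro c
    obtain ⟨i, hi⟩ := RealizesVia.exists_under W₀ c
    exact ⟨i, hi, fun j hj => by simpa using W₀.mem_unique hj hi⟩
  have both : ∀ r, ∃! i, (d, r) ∈ W₀.word (.inl i) := by
    rintro (_ | _)
    · exact over_unique d x (hχ₀ x)
    · exact under_unique d
  let τC : W₀.Chord ⊕ Role → X ⊕ Syllable g := Sum.elim τ₀ fun _ => .inr l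
  obtain ⟨W, χ, hsgn, hbw, hcol⟩ := PrismaticDiagram.exists_of_blackWords (C := W₀.Chord ⊕ Role) (g := g)
    (Sum.elim W₀.sign fun _ => l.2)
    (fun c => Sum.elim (fun _ => none) (fun m => some m.1) (τC c)) bw nd
    (by
      rintro (c | r)
      · simpa only [mem_inl] using under_unique c
      · simpa only [mem_inr, true_and] using both r)
    (by
      rintro (c | r) h
      · rcases hc : τ₀ c with y | m
        · simpa only [mem_inl] using over_unique c y hc
        · simp [τC, hc] at h
      · simp [τC] at h)
    (by
      rintro (c | r) z h i
      · rcases hc : τ₀ c with y | m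
        · simp [τC, hc] at h
        · rw [mem_inl]
          intro hh
          have := h₀.under_of_inr (e := (c, .over)) hc hh
          simp at this
      · rw [mem_inr]; simp)
  have hsymC : ∀ c r, symbol (τC ∘ χ.symm) (χ c, r) = symbol τC (c, r) := by
    intro c r; simp [symbol]
  have sym_inl : ∀ e : W₀.Chord × Role, symbol τC (Sum.inl e.1, e.2) = symbol τ₀ e := fun e => rfl
  have sym_inr : ∀ r r', symbol τC (Sum.inr r, r') = .inr l := fun _ _ => rfl
  have sym_d : ∀ e : W₀.Chord × Role, e.1 = d ↔ ∃ r, symbol τ₀ e = .inl (x, r) := by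
    intro e
    constructor
    · intro he
      exact ⟨e.2, by simp [symbol, he, hd, hχ₀]⟩
    · rintro ⟨r, hr⟩
      rw [h₀.eq_of_symbol hχ₀ hr]; rfl
  have h₁ : RealizesVia W sg (fun i => (w i).flatMap (expandBefore x l)) (τC ∘ χ.symm) := by
    refine ⟨fun y => ⟨χ (.inl (χ₀ y)), by simp [τC, hχ₀], ?_⟩, ?_, ?_, ?_, ?_, fun i => ?_⟩
    · intro c hc
      obtain ⟨c | r, rfl⟩ := χ.surjective c
      · simp [τC] at hc
        rw [(h₀.existsUnique y).unique hc (hχ₀ y)]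
      · simp [τC] at hc
    · intro c y hc
      obtain ⟨c | r, rfl⟩ := χ.surjective c
      · simp [τC] at hc
        rw [hsgn]; exact h₀.sign_inl _ _ hc
      · simp [τC] at hc
    · intro c m hc
      obtain ⟨c | r, rfl⟩ := χ.surjective c
      · simp [τC] at hc
        rw [hsgn]; exact h₀.sign_inr _ _ hc
      · simp [τC] at hc
        rw [hsgn, ← hc]; rfl
    · intro c y hc
      obtain ⟨c | r, rfl⟩ := χ.surjective c
      · simp [τC] at hc
        obtain ⟨i, hi⟩ := h₀.over_inl _ _ hc
        exact ⟨i, by rw [hbw]; exact List.mem_map.2 ⟨_, (mem_inl _ _ _).2 hi, rfl⟩⟩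
      · simp [τC] at hc
    · intro c m hc
      obtain ⟨c, rfl⟩ := χ.surjective c
      simp only [Function.comp_apply, Equiv.symm_apply_apply] at hc
      rw [hcol, hc]; rfl
    · refine List.IsRotated.trans ⟨0, ?_⟩ (isRotated_flatMap (expandBefore x l) (h₀.word i))
      rw [List.rotate_zero, hbw, List.map_map, List.flatMap_map, List.map_flatMap]
      refine List.flatMap_congr fun e _ => ?_
      simp only [ex, expandBefore]
      by_cases he : e.1 = d
      · rw [if_pos he, if_pos ((sym_d e).1 he)]
        simp [hsymC, sym_inl, sym_inr]
      · rw [if_neg he, if_neg (fun hh => he ((sym_d e).2 hh))]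
        simp [hsymC, sym_inl]
  -- Realizations of the same words are equivalent, so that `V` may be replaced by the explicit
  -- diagram `W`.
  refine (?_ : ∃ W', W.Equivalent W' ∧ Realizes W' sg _).elim fun W' hW' =>
    ⟨W', (hV.equivalent ⟨_, h₁⟩).trans hW'.1, hW'.2⟩
  have hne : (χ (.inr .over), Role.over) ≠ (χ (.inr .under), Role.over) := by simp
  have colr : ∀ r, (χ (.inr r), Role.over) ∈ W.word (.inr l.1) := by
    intro r; rw [hcol]; rfl
  -- On the two strands of `d` the arcs come first, that is `om = ob = 1`. The triangle condition of
  -- the third move then reads `l.2 = sg x * ot`, which dictates the order of the two over-ends on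
  -- their coloured component; a reordering provides this order.
  obtain ⟨u, ot, hot, hu, hadj⟩ : ∃ (u : List (W.Chord × Role)) (ot : ℤˣ) (_ : ot = l.2 * sg x)
      (hu : u.Perm (W.word (.inr l.1))), (W.reorder (.inr l.1) u hu).Adjacent ot
        (χ (.inr .over), Role.over) (χ (.inr .under), Role.over) := by
    rcases Int.units_eq_one_or (l.2 * sg x) with h | h
    · obtain ⟨u, hu⟩ := exists_perm_cons_cons (colr .over) (colr .under) hne
      refine ⟨_, 1, h.symm, hu, .inl ⟨rfl, .inr l.1, u, ?_⟩⟩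
      simp only [Function.update_self]; exact List.IsRotated.refl _
    · obtain ⟨u, hu⟩ := exists_perm_cons_cons (colr .under) (colr .over) hne.symm
      refine ⟨_, -1, h.symm, hu, .inr ⟨rfl, .inr l.1, u, ?_⟩⟩
      simp only [Function.update_self]; exact List.IsRotated.refl _
  have h₂ := h₁.reorder l.1 u hu
  have hnext : ∀ r, W.Next (χ (.inr r), Role.under) (χ (.inl d), r) := by
    intro r
    obtain ⟨i, hi, -⟩ := both r
    obtain ⟨p, s, hps⟩ := List.append_of_mem hi
    refine ⟨.inl i, (s.flatMap ex).map (Prod.map χ id) ++ (p.flatMap ex).map (Prod.map χ id), ?_⟩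
    rw [hbw]
    simp only [bw, hps, List.flatMap_append, List.flatMap_cons, List.map_append]
    have hexd : (ex (d, r)).map (Prod.map χ id) =
        [(χ (.inr r), Role.under), (χ (.inl d), r)] := by
      simp only [ex, if_pos]; rfl
    rw [hexd]
    have := List.isRotated_append (l := (p.flatMap ex).map (Prod.map χ id))
      (l' := (χ (.inr r), Role.under) :: (χ (.inl d), r) :: (s.flatMap ex).map (Prod.map χ id))
    simpa using this
  have hadj' : ∀ r, (W.reorder (.inr l.1) u hu).Adjacent 1
      (χ (.inr r), Role.under) (χ (.inl d), r) := by
    intro r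
    obtain ⟨k, v, hk⟩ := hnext r
    have : k ≠ .inr l.1 := by
      rintro rfl
      have := W.over_of_mem_color (z := l.1) rfl (hk.mem_iff.2 List.mem_cons_self)
      simp at this
    refine .inl ⟨rfl, k, v, ?_⟩
    have e : (W.reorder (.inr l.1) u hu).word k = W.word k :=
      PrismaticDiagram.reorder_word_of_ne W hu this
    exact e ▸ hk
  have hρ := ((PrismaticDiagram.preserves_swap hadj.same).mul
    (PrismaticDiagram.preserves_swap (hadj' .over).same)).mul
      (PrismaticDiagram.preserves_swap (hadj' .under).same)
  have sa : ∀ r, W.sign (χ (.inr r)) = l.2 := fun r => by rw [hsgn]; rfl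
  have sd : W.sign (χ (.inl d)) = sg x := by rw [hsgn]; exact h₀.sign_inl _ _ (hχ₀ x)
  refine ⟨_, (W.equivalent_reorder (k := .inr l.1) (z := l.1) rfl u hu).trans
    (PrismaticDiagram.Step.equivalent (.inr <| .inr <| .inr <| .inl
      ⟨χ (.inr .over), χ (.inr .under), χ (.inl d), ot, 1, 1, by simp, by simp, by simp, hadj,
        hadj' .over, hadj' .under, ?_, ?_, PrismaticDiagram.permutes_permute _ _ hρ⟩)),
    h₂.permute _ hρ (Equiv.refl X) (fun _ => rfl) fun i => ?_⟩
  · rw [show (W.reorder (.inr l.1) u hu).sign (χ (.inr .over)) = _ from sa .over,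
      show (W.reorder (.inr l.1) u hu).sign (χ (.inr .under)) = _ from sa .under]
  · rw [show (W.reorder (.inr l.1) u hu).sign (χ (.inl d)) = _ from sd,
      show (W.reorder (.inr l.1) u hu).sign (χ (.inr .under)) = _ from sa .under, hot, mul_one,
      mul_comm l.2, ← mul_assoc, Int.units_mul_self, one_mul]
  · simp only [ne_eq, reduceCtorEq, not_false_eq_true, Function.update_of_ne]
    refine List.IsRotated.trans ⟨0, ?_⟩ (isRotated_flatMap (expandAfter x l) (h₀.word i))
    rw [List.rotate_zero, hbw]
    simp only [bw]
    rw [List.map_flatMap, List.map_flatMap, List.map_flatMap, List.flatMap_map]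
    refine List.flatMap_congr fun e _ => ?_
    have hid : (Sum.map (Equiv.refl X) id ∘ τC ∘ χ.symm) = τC ∘ χ.symm := by
      funext c
      simp
    rw [hid]
    simp only [ex, expandAfter]
    by_cases he : e.1 = d
    · rw [if_pos he, if_pos ((sym_d e).1 he)]
      obtain ⟨c, r⟩ := e
      simp only at he
      subst he
      rcases r with _ | _
      · simp [Equiv.swap_apply_def, ← sym_inl, ← sym_inr .over .under, ← hsymC]
      · simp [Equiv.swap_apply_def, ← sym_inl, ← sym_inr .under .under, ← hsymC]
    · rw [if_neg he, if_neg (fun hh => he ((sym_d e).2 hh))]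
      simp [Equiv.swap_apply_def, ← sym_inl, ← hsymC, he]

end HomotopyZh
end

/-! ### Words modulo the relations of the surface group, and flat words with a given holonomy. -/

noncomputable section
namespace HomotopyZh

variable {ι X : Type*} {g : ℕ}

/-! ## The surface group -/

/-- The defining relations of the surface group, as a monoid. -/
inductive SurfaceRel (g : ℕ) : FreeMonoid (Syllable g) → FreeMonoid (Syllable g) → Prop
  | cancel (z : Palette g) (ε : ℤˣ) :
      SurfaceRel g (FreeMonoid.ofList [(z, ε), (z, -ε)]) (FreeMonoid.ofList [])
  | relator : SurfaceRel g (FreeMonoid.ofList (relator g)) (FreeMonoid.ofList [])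

/-- The group with generators the palette and the single relator
`x₁⁻¹ y₁⁻¹ x₁ y₁ ⋯ x_g⁻¹ y_g⁻¹ x_g y_g`. -/
def SurfaceGroup (g : ℕ) : Type := (conGen (SurfaceRel g)).Quotient

instance : Monoid (SurfaceGroup g) := inferInstanceAs (Monoid (conGen (SurfaceRel g)).Quotient)

/-- The element of the surface group spelled by a word. -/
def val (l : List (Syllable g)) : SurfaceGroup g :=
  ((FreeMonoid.ofList l : FreeMonoid (Syllable g)) : (conGen (SurfaceRel g)).Quotient)

@[simp] lemma val_nil : val ([] : List (Syllable g)) = 1 := rfl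

@[simp] lemma val_append (l m : List (Syllable g)) : val (l ++ m) = val l * val m := rfl

lemma val_cons (a : Syllable g) (m : List (Syllable g)) : val (a :: m) = val [a] * val m := rfl

lemma val_surjective : Function.Surjective (val : List (Syllable g) → SurfaceGroup g) := by
  rintro ⟨a⟩
  exact ⟨a.toList, rfl⟩

lemma val_eq_iff {l m : List (Syllable g)} : val l = val m ↔
    ConGen.Rel (SurfaceRel g) (FreeMonoid.ofList l) (FreeMonoid.ofList m) :=
  (conGen (SurfaceRel g)).eq

lemma val_cancel (z : Palette g) (ε : ℤˣ) : val [(z, ε)] * val [(z, -ε)] = 1 :=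
  val_eq_iff.2 (.of _ _ (.cancel z ε))

lemma val_relator : val (relator g) = 1 := val_eq_iff.2 (.of _ _ .relator)

lemma isUnit_val (l : List (Syllable g)) : IsUnit (val l) := by
  induction l with
  | nil => exact isUnit_one
  | cons a l ih =>
    rw [val_cons]
    refine IsUnit.mul ?_ ih
    obtain ⟨z, ε⟩ := a
    exact ⟨⟨_, val [(z, -ε)], val_cancel z ε, by simpa using val_cancel z (-ε)⟩, rfl⟩

instance : Group (SurfaceGroup g) :=
  groupOfIsUnit fun a => by obtain ⟨l, rfl⟩ := val_surjective a; exact isUnit_val l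

lemma val_neg (z : Palette g) (ε : ℤˣ) : val [(z, -ε)] = (val [(z, ε)])⁻¹ :=
  eq_inv_of_mul_eq_one_right (val_cancel z ε)

open Classical in
/-- A word that spells a given element. -/
def spell (a : SurfaceGroup g) : List (Syllable g) :=
  -- The trivial element must be spelled by the empty word: this is what makes black ends in equal
  -- states neighbours in a canonical word.
  if a = 1 then [] else (val_surjective a).choose

@[simp] lemma val_spell (a : SurfaceGroup g) : val (spell a) = a := by
  unfold spell
  split
  · next h => rw [h]; rfl
  · exact (val_surjective a).choose_spec

@[simp] lemma spell_one : spell (1 : SurfaceGroup g) = [] := if_pos rfl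

/-! ## Words that spell the same element -/

/-- Replacing the word `a` of one black component by `b` leads to an equivalent diagram. -/
def LocalLeads (ι : Type*) (sg : X → ℤˣ) (a b : List (Sym X g)) : Prop :=
  ∀ (i : ι) (w w' : ι → List (Sym X g)), WellFormed w → w i = a → w' i = b →
    (∀ j, j ≠ i → w' j = w j) → Leads sg w sg w'

lemma blackEnds_eq_of {w w' : ι → List (Sym X g)} {i : ι} (h : blackEnds (w' i) = blackEnds (w i))
    (hj : ∀ j, j ≠ i → w' j = w j) (j : ι) : blackEnds (w' j) = blackEnds (w j) := by
  rcases eq_or_ne j i with rfl | hji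
  · exact h
  · rw [hj j hji]

section
variable [Finite ι] [Finite X] {sg : X → ℤˣ}

lemma LocalLeads.refl (a : List (Sym X g)) : LocalLeads ι sg a a := by
  intro i w w' _ hi hi' hj
  have : w' = w := by
    funext j
    rcases eq_or_ne j i with rfl | hji
    · rw [hi, hi']
    · exact hj j hji
  rw [this]; exact Leads.refl _ _

lemma LocalLeads.trans {a b c : List (Sym X g)} (h : LocalLeads ι sg a b)
    (h' : LocalLeads ι sg b c) (hab : blackEnds b = blackEnds a) : LocalLeads ι sg a c := by
  classical
  intro i w w' hw hi hi' hj
  have hb : Function.update w i b i = b := Function.update_self ..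
  have hjb : ∀ j, j ≠ i → Function.update w i b j = w j := fun j hji => Function.update_of_ne hji ..
  refine (h i w (Function.update w i b) hw hi hb hjb).trans
    (h' i _ w' (hw.of_eq (blackEnds_eq_of (by rw [hb, hi, hab]) hjb)) hb hi' fun j hji => ?_)
  rw [hj j hji, hjb j hji]

lemma LocalLeads.symm {a b : List (Sym X g)} (h : LocalLeads ι sg a b)
    (hab : blackEnds b = blackEnds a) : LocalLeads ι sg b a := by
  intro i w w' hw hi hi' hj
  have hw' : WellFormed w' := hw.of_eq (blackEnds_eq_of (by rw [hi, hi', hab]) hj)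
  exact (h i w' w hw' hi' hi fun j hji => (hj j hji).symm).symm hw'

lemma LocalLeads.of_isRotated {a b : List (Sym X g)} (h : a ~r b) : LocalLeads ι sg a b := by
  intro i w w' _ hi hi' hj
  refine Leads.of_isRotated fun j => ?_
  rcases eq_or_ne j i with rfl | hji
  · rw [hi, hi']; exact h
  · rw [hj j hji]

/-- The generators of the congruence are exactly what a second Reidemeister move and a commutator
move erase, so the inductive construction of the congruence translates into a chain of moves. The
contexts `p` and `q` are needed for products, where one factor is replaced while the other is kept.
-/
lemma localLeads_of_rel {u v : FreeMonoid (Syllable g)} (h : ConGen.Rel (SurfaceRel g) u v) :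
    ∀ p q : List (Sym X g), LocalLeads ι sg (p ++ u.toList.map .inr ++ q)
      (p ++ v.toList.map .inr ++ q) := by
  induction h with
  | of u v h =>
    intro p q i w w' _ hi hi' hj
    rcases h with ⟨z, ε⟩ | _
    · exact leads_cancel (p := p) (s := q) (z := z) (ε := ε) (by simpa using hi)
        (by simpa using hi') hj
    · exact leads_relator (p := p) (s := q) (by simpa using hi) (by simpa using hi') hj
  | refl u => intro p q; exact .refl _
  | symm h ih => intro p q; exact (ih p q).symm (by simp)
  | trans h₁ h₂ ih₁ ih₂ => intro p q; exact (ih₁ p q).trans (ih₂ p q) (by simp)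
  | @mul a b c d h₁ h₂ ih₁ ih₂ =>
    intro p q
    have e₁ := ih₁ p (c.toList.map .inr ++ q)
    have e₂ := ih₂ (p ++ b.toList.map .inr) q
    simp only [FreeMonoid.toList_mul, List.map_append]
    simp only [List.append_assoc] at e₁ e₂ ⊢
    exact e₁.trans e₂ (by simp)

lemma localLeads_of_val {u v : List (Syllable g)} (h : val u = val v) (p q : List (Sym X g)) :
    LocalLeads ι sg (p ++ u.map .inr ++ q) (p ++ v.map .inr ++ q) :=
  localLeads_of_rel (val_eq_iff.1 h) p q

lemma leads_of_localLeads {w w' : ι → List (Sym X g)} (hw : WellFormed w)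
    (he : ∀ i, blackEnds (w' i) = blackEnds (w i)) (h : ∀ i, LocalLeads ι sg (w i) (w' i)) :
    Leads sg w sg w' := by
  classical
  have := Fintype.ofFinite ι
  have key : ∀ s : Finset ι, Leads sg w sg (fun i => if i ∈ s then w' i else w i) := by
    intro s
    induction s using Finset.induction_on with
    | empty => simpa using Leads.refl sg w
    | @insert a s ha ih =>
      refine ih.trans (h a a _ _ (hw.of_eq fun i => ?_) ?_ ?_ ?_)
      · split <;> simp [he]
      · simp [ha]
      · simp
      · intro j hj; simp [hj]
  simpa using key Finset.univ

end

/-! ## Holonomy -/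

/-- The holonomy of a diagram in the surface group: the order of the ends of the crossings along
the components, the holonomy from the starting points of the components to these ends (seen from
the crossings), and along the whole components. -/
structure Holonomy (ι X : Type*) (g : ℕ) where
  sign : X → ℤˣ
  ends : ι → List (X × Role)
  state : X × Role → SurfaceGroup g
  mono : ι → SurfaceGroup g
  existsUnique : ∀ e, ∃! i, e ∈ ends i
  nodup : ∀ i, (ends i).Nodup

/-- Reading the word from state `s` one arrives at state `t`, being in state `st e` at each black
end `e`. -/
def Reads (st : X × Role → SurfaceGroup g) :
    SurfaceGroup g → List (Sym X g) → SurfaceGroup g → Prop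
  | s, [], t => s = t
  | s, .inl e :: w, t => s = st e ∧ Reads st s w t
  | s, .inr l :: w, t => Reads st (s * val [l]) w t

lemma reads_append {st : X × Role → SurfaceGroup g} {s t : SurfaceGroup g} {u v : List (Sym X g)} :
    Reads st s (u ++ v) t ↔ ∃ m, Reads st s u m ∧ Reads st m v t := by
  induction u generalizing s with
  | nil => simp [Reads]
  | cons a u ih =>
    rcases a with e | l
    · simp only [List.cons_append, Reads, ih]
      constructor
      · rintro ⟨h, m, h1, h2⟩; exact ⟨m, ⟨h, h1⟩, h2⟩
      · rintro ⟨m, ⟨h, h1⟩, h2⟩; exact ⟨h, m, h1, h2⟩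
    · simp only [List.cons_append, Reads, ih]

lemma reads_letters {st : X × Role → SurfaceGroup g} {s t : SurfaceGroup g}
    {u : List (Syllable g)} : Reads st s (u.map .inr) t ↔ s * val u = t := by
  induction u generalizing s with
  | nil => simp [Reads]
  | cons a u ih => rw [List.map_cons, Reads, ih, val_cons a u, mul_assoc]

/-- Syllables act on states from the right, so multiplication from the left is a symmetry. It
expresses the freedom in the frame at the starting point of a component. -/
lemma Reads.smul {st st' : X × Role → SurfaceGroup g} {s t k : SurfaceGroup g}
    {u : List (Sym X g)} (h : Reads st s u t) (hk : ∀ e ∈ blackEnds u, st' e = k * st e) :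
    Reads st' (k * s) u (k * t) := by
  induction u generalizing s with
  | nil => exact congrArg _ h
  | cons a u ih =>
    rcases a with e | l
    · obtain ⟨rfl, h⟩ := h
      exact ⟨(hk e (by simp)).symm, ih h fun e' he' => hk e' (by simp [he'])⟩
    · have := ih h fun e' he' => hk e' (by simp [he'])
      rwa [← mul_assoc] at this

/-- The standard word with given black ends. -/
def canonicalWord (st : X × Role → SurfaceGroup g) :
    SurfaceGroup g → List (X × Role) → SurfaceGroup g → List (Sym X g)
  | s, [], t => (spell (s⁻¹ * t)).map .inr
  | s, e :: l, t => (spell (s⁻¹ * st e)).map .inr ++ .inl e :: canonicalWord st (st e) l t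

lemma reads_canonicalWord (st : X × Role → SurfaceGroup g) (s t : SurfaceGroup g)
    (l : List (X × Role)) : Reads st s (canonicalWord st s l t) t := by
  induction l generalizing s with
  | nil => rw [canonicalWord, reads_letters]; simp
  | cons e l ih =>
    rw [canonicalWord, reads_append]
    exact ⟨st e, by rw [reads_letters]; simp, rfl, ih _⟩

@[simp] lemma blackEnds_canonicalWord (st : X × Role → SurfaceGroup g) (s t : SurfaceGroup g)
    (l : List (X × Role)) : blackEnds (canonicalWord st s l t) = l := by
  induction l generalizing s with
  | nil => rw [canonicalWord, blackEnds_map_inr]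
  | cons e l ih => rw [canonicalWord, blackEnds_append, blackEnds_map_inr, blackEnds_inl, ih]; rfl

/-- Between ends in equal states the canonical word spells the trivial element, hence contains
nothing. In this way a condition on states becomes adjacency in the Gauss diagram. -/
lemma canonicalWord_append (st : X × Role → SurfaceGroup g) (s t : SurfaceGroup g)
    (p q : List (X × Role)) {e f : X × Role} (h : st e = st f) :
    ∃ P Q, canonicalWord st s (p ++ e :: f :: q) t = P ++ .inl e :: .inl f :: Q := by
  induction p generalizing s with
  | nil =>
    refine ⟨(spell (s⁻¹ * st e)).map .inr, canonicalWord st (st f) q t, ?_⟩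
    simp only [List.nil_append, canonicalWord, h, inv_mul_cancel, spell_one, List.map_nil]
  | cons a p ih =>
    obtain ⟨P, Q, hPQ⟩ := ih (st a)
    exact ⟨(spell (s⁻¹ * st a)).map .inr ++ .inl a :: P, Q, by
      simp only [List.cons_append, canonicalWord, hPQ, List.append_assoc]⟩

/-- The word is normalized from its end towards its beginning: a black end already has the right
state, and a syllable is absorbed into the stretch that leads to the next black end, or to the end
of the word, since only the value of this stretch matters. -/
lemma localLeads_canonicalWord [Finite ι] [Finite X] {sg : X → ℤˣ}
    (st : X × Role → SurfaceGroup g) {t : SurfaceGroup g} {u : List (Sym X g)} :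
    ∀ {s : SurfaceGroup g} (p : List (Sym X g)), Reads st s u t →
      LocalLeads ι sg (p ++ u) (p ++ canonicalWord st s (blackEnds u) t) := by
  induction u with
  | nil =>
    rintro s p rfl
    simp only [blackEnds_nil, canonicalWord, inv_mul_cancel, spell_one, List.map_nil]
    exact .refl _
  | cons a u ih =>
    rintro s p h
    rcases a with e | l
    · obtain ⟨rfl, h⟩ := h
      have := ih (p ++ [.inl e]) h
      simp only [blackEnds_inl, canonicalWord, inv_mul_cancel, spell_one, List.map_nil]
      simpa using this
    · have h1 := ih (p ++ [.inr l]) h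
      rw [blackEnds_inr]
      simp only [List.append_assoc, List.cons_append, List.nil_append] at h1
      refine h1.trans ?_ (by simp)
      cases hb : blackEnds u with
      | nil =>
        have := localLeads_of_val (ι := ι) (sg := sg)
          (u := l :: spell ((s * val [l])⁻¹ * t)) (v := spell (s⁻¹ * t))
          (by rw [val_cons, val_spell, val_spell]; group) p []
        simpa [canonicalWord] using this
      | cons e es =>
        have := localLeads_of_val (ι := ι) (sg := sg)
          (u := l :: spell ((s * val [l])⁻¹ * st e)) (v := spell (s⁻¹ * st e))
          (by rw [val_cons, val_spell, val_spell]; group) p (.inl e :: canonicalWord st (st e) es t)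
        simpa [canonicalWord] using this

namespace Holonomy

/-- The words `w` have holonomy `Θ`. -/
structure IsFlat (Θ : Holonomy ι X g) (w : ι → List (Sym X g)) : Prop where
  ends : ∀ i, blackEnds (w i) = Θ.ends i
  reads : ∀ i, ∃ s, Reads Θ.state s (w i) (Θ.mono i * s)

lemma IsFlat.wellFormed {Θ : Holonomy ι X g} {w : ι → List (Sym X g)} (h : Θ.IsFlat w) :
    WellFormed w :=
  ⟨fun e => by simpa only [h.ends] using Θ.existsUnique e, fun i => by rw [h.ends]; exact Θ.nodup i⟩

/-- The standard words with holonomy `Θ`. -/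
def canonical (Θ : Holonomy ι X g) (i : ι) : List (Sym X g) :=
  canonicalWord Θ.state 1 (Θ.ends i) (Θ.mono i)

lemma isFlat_canonical (Θ : Holonomy ι X g) : Θ.IsFlat Θ.canonical :=
  ⟨fun i => blackEnds_canonicalWord .., fun i => ⟨1, by
    rw [mul_one]; exact reads_canonicalWord ..⟩⟩

/-- To begin in state `1` instead of `s`, insert a word for `s⁻¹ * s` at the end of the cyclic word
and rotate its second half to the front. -/
lemma localLeads_conj [Finite ι] [Finite X] {sg : X → ℤˣ} (st : X × Role → SurfaceGroup g)
    {m s : SurfaceGroup g} {u : List (Sym X g)} (h : Reads st s u (m * s)) :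
    LocalLeads ι sg u (canonicalWord st 1 (blackEnds u) m) := by
  have h1 := localLeads_of_val (ι := ι) (sg := sg) (u := []) (v := spell s⁻¹ ++ spell s)
    (by simp) u []
  have h2 : LocalLeads ι sg (u ++ (spell s⁻¹ ++ spell s).map .inr ++ [])
      ((spell s).map .inr ++ (u ++ (spell s⁻¹).map .inr)) := by
    refine LocalLeads.of_isRotated ?_
    have := List.isRotated_append (l := u ++ (spell s⁻¹).map .inr)
      (l' := ((spell s).map .inr : List (Sym X g)))
    simpa using this
  have h3 : Reads st 1 ((spell s).map .inr ++ (u ++ (spell s⁻¹).map .inr)) m := by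
    rw [reads_append]
    refine ⟨s, by rw [reads_letters]; simp, ?_⟩
    rw [reads_append]
    exact ⟨m * s, h, by rw [reads_letters]; simp⟩
  have h4 := localLeads_canonicalWord (ι := ι) (sg := sg) st [] h3
  have e : blackEnds ((spell s).map .inr ++ (u ++ (spell s⁻¹).map .inr)) = blackEnds u := by simp
  rw [e] at h4
  simp only [List.nil_append] at h4
  have h1' : LocalLeads ι sg u (u ++ (spell s⁻¹ ++ spell s).map .inr ++ []) := by
    simpa using h1
  exact (h1'.trans h2 (by simp)).trans h4 (by simp)

lemma IsFlat.leads_canonical [Finite ι] [Finite X] {Θ : Holonomy ι X g} {w : ι → List (Sym X g)}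
    (h : Θ.IsFlat w) : Leads Θ.sign w Θ.sign Θ.canonical := by
  refine leads_of_localLeads h.wellFormed (fun i => ?_) fun i => ?_
  · rw [h.ends]; exact blackEnds_canonicalWord ..
  · obtain ⟨s, hs⟩ := h.reads i
    have := localLeads_conj (ι := ι) (sg := Θ.sign) Θ.state hs
    rwa [h.ends] at this

/-- Two systems of words with the same holonomy lead to each other. -/
lemma IsFlat.leads [Finite ι] [Finite X] {Θ : Holonomy ι X g} {w w' : ι → List (Sym X g)}
    (h : Θ.IsFlat w) (h' : Θ.IsFlat w') : Leads Θ.sign w Θ.sign w' :=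
  h.leads_canonical.trans (h'.leads_canonical.symm h'.wellFormed)

/-- The diagrams with holonomy `Θ` and `Θ'` are equivalent. -/
def Equivalent {X' : Type*} (Θ : Holonomy ι X g) (Θ' : Holonomy ι X' g) : Prop :=
  ∀ w w', Θ.IsFlat w → Θ'.IsFlat w' → Leads Θ.sign w Θ'.sign w'

section
variable [Finite ι] {Y Z : Type*} [Finite X] [Finite Y] [Finite Z] {Θ : Holonomy ι X g}
  {Θ' : Holonomy ι Y g} {Θ'' : Holonomy ι Z g}

/-- By `IsFlat.leads` all flat words of one holonomy are interchangeable, so a single pair of flat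
words decides; these may be chosen to suit a move. -/
lemma equivalent_of_leads {w : ι → List (Sym X g)} {w' : ι → List (Sym Y g)} (h : Θ.IsFlat w)
    (h' : Θ'.IsFlat w') (hl : Leads Θ.sign w Θ'.sign w') : Θ.Equivalent Θ' :=
  fun _ _ hv hv' => ((hv.leads h).trans hl).trans (h'.leads hv')

lemma Equivalent.refl (Θ : Holonomy ι X g) : Θ.Equivalent Θ := fun _ _ h h' => h.leads h'

lemma Equivalent.symm (h : Θ.Equivalent Θ') : Θ'.Equivalent Θ :=
  fun w w' hw hw' => (h w' w hw' hw).symm hw'.wellFormed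

lemma Equivalent.trans (h : Θ.Equivalent Θ') (h' : Θ'.Equivalent Θ'') : Θ.Equivalent Θ'' :=
  fun w w'' hw hw'' => (h w _ hw Θ'.isFlat_canonical).trans (h' _ w'' Θ'.isFlat_canonical hw'')

end

end Holonomy

end HomotopyZh
end

/-! ### Changes of a holonomy that keep the diagram: base points, frames and Reidemeister moves. -/

noncomputable section
namespace HomotopyZh

variable {ι X : Type*} {g : ℕ}

namespace Holonomy

variable [Finite ι] [Finite X]

/-! ### Changes of base points and of frames -/

/-- Moving the starting points of the components. -/
lemma equivalent_rotate {Θ Θ' : Holonomy ι X g} (hs : Θ'.sign = Θ.sign)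
    (h : ∀ i, ∃ p q, Θ.ends i = p ++ q ∧ Θ'.ends i = q ++ p ∧
      (∀ e ∈ p, Θ'.state e = Θ.mono i * Θ.state e) ∧ (∀ e ∈ q, Θ'.state e = Θ.state e))
    (hm : Θ'.mono = Θ.mono) : Θ.Equivalent Θ' := by
  have key : ∀ i, ∃ w, Θ.canonical i ~r w ∧ blackEnds w = Θ'.ends i ∧
      ∃ s, Reads Θ'.state s w (Θ'.mono i * s) := by
    intro i
    obtain ⟨p, q, h1, h2, hp, hq⟩ := h i
    have he := Θ.isFlat_canonical.ends i
    rw [h1] at he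
    obtain ⟨u, v, huv, hu, hv⟩ := List.filterMap_eq_append_iff.1 he
    obtain ⟨s, hr⟩ := Θ.isFlat_canonical.reads i
    rw [huv, reads_append] at hr
    obtain ⟨m, hr1, hr2⟩ := hr
    -- The new starting state `m` is the state between the two stretches. The first stretch is now
    -- read after the second one, one turn later, and its states are multiplied by the monodromy.
    refine ⟨v ++ u, huv ▸ List.isRotated_append, ?_, m, ?_⟩
    · rw [blackEnds_append, h2]; exact congrArg₂ _ hv hu
    · rw [reads_append, hm]
      refine ⟨Θ.mono i * s, ?_, ?_⟩
      · have := Reads.smul (st' := Θ'.state) (k := 1) hr2 fun e he' => by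
          rw [one_mul]; exact hq e (by rw [← hv]; exact he')
        simpa using this
      · exact Reads.smul hr1 fun e he' => hp e (by rw [← hu]; exact he')
  choose w hw he hr using key
  exact equivalent_of_leads Θ.isFlat_canonical ⟨he, hr⟩ (by rw [hs]; exact Leads.of_isRotated hw)

/-- Changing the frames at the starting points of the components. -/
lemma equivalent_smul {Θ Θ' : Holonomy ι X g} (κ : ι → SurfaceGroup g) (hs : Θ'.sign = Θ.sign)
    (he : Θ'.ends = Θ.ends) (h : ∀ i, ∀ e ∈ Θ.ends i, Θ'.state e = κ i * Θ.state e)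
    (hm : ∀ i, Θ'.mono i = κ i * Θ.mono i * (κ i)⁻¹) : Θ.Equivalent Θ' := by
  have hf := Θ.isFlat_canonical
  refine equivalent_of_leads hf ⟨fun i => by rw [he, hf.ends], fun i => ?_⟩
    (by rw [hs]; exact Leads.refl _ _)
  obtain ⟨s, hr⟩ := hf.reads i
  refine ⟨κ i * s, ?_⟩
  have := hr.smul (st' := Θ'.state) (k := κ i) fun e he' => h i e (by rwa [hf.ends] at he')
  rw [hm]
  simpa [mul_assoc] using this

/-- Changing the frames at the crossings. -/
def gauge (Θ : Holonomy ι X g) (k : X → SurfaceGroup g) : Holonomy ι X g :=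
  { Θ with state := fun e => Θ.state e * k e.1 }

lemma reads_expandBefore {st : X × Role → SurfaceGroup g} (x : X) (z : Palette g) (ε : ℤˣ)
    {s t : SurfaceGroup g} {u : List (Sym X g)} (h : Reads st s u t) :
    Reads st s ((u.flatMap (expandBefore x (z, -ε))).flatMap (expandBefore x (z, ε))) t := by
  induction u generalizing s with
  | nil => exact h
  | cons a u ih =>
    rw [List.flatMap_cons, List.flatMap_append]
    rcases a with e | l
    · obtain ⟨rfl, h⟩ := h
      by_cases hx : e.1 = x
      · have : ∃ r, (Sum.inl e : Sym X g) = .inl (x, r) := ⟨e.2, by rw [← hx]⟩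
        simp only [expandBefore, if_pos this, List.flatMap_cons, List.flatMap_nil,
          reduceCtorEq, exists_false, if_false]
        change Reads st (st e * val [(z, -ε)] * val [(z, ε)]) (Sum.inl e :: _) t
        rw [val_neg, inv_mul_cancel_right]
        exact ⟨rfl, ih h⟩
      · have : ¬ ∃ r, (Sum.inl e : Sym X g) = .inl (x, r) := by
          rintro ⟨r, hr⟩; exact hx (by rw [Sum.inl.inj hr])
        simp only [expandBefore, if_neg this, List.flatMap_cons, List.flatMap_nil]
        exact ⟨rfl, ih h⟩
    · simp only [expandBefore, reduceCtorEq, exists_false, if_false, List.flatMap_cons,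
        List.flatMap_nil]
      exact ih h

/-- Each end of `x` is enclosed by two inverse syllables. The reading outside does not notice them,
but the end itself is met in a state shifted by the first one. -/
lemma reads_expandAfter {st st' : X × Role → SurfaceGroup g} (x : X) (z : Palette g) (ε : ℤˣ)
    (hx : ∀ r, st' (x, r) = st (x, r) * (val [(z, ε)])⁻¹)
    (hst : ∀ e : X × Role, e.1 ≠ x → st' e = st e)
    {s t : SurfaceGroup g} {u : List (Sym X g)} (h : Reads st s u t) :
    Reads st' s ((u.flatMap (expandBefore x (z, -ε))).flatMap (expandAfter x (z, ε))) t := by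
  induction u generalizing s with
  | nil => exact h
  | cons a u ih =>
    rw [List.flatMap_cons, List.flatMap_append]
    rcases a with e | l
    · obtain ⟨rfl, h⟩ := h
      by_cases hex : e.1 = x
      · obtain ⟨y, r⟩ := e
        simp only at hex
        subst hex
        have : ∃ r', (Sum.inl (y, r) : Sym X g) = .inl (y, r') := ⟨r, rfl⟩
        simp only [expandBefore, if_pos this, List.flatMap_cons, List.flatMap_nil, expandAfter,
          reduceCtorEq, exists_false, if_false]
        refine ⟨?_, ?_⟩
        · rw [val_neg, hx]
        · change Reads st' (st (y, r) * val [(z, -ε)] * val [(z, ε)]) _ t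
          rw [val_neg, inv_mul_cancel_right]
          exact ih h
      · have : ¬ ∃ r, (Sum.inl e : Sym X g) = .inl (x, r) := by
          rintro ⟨r, hr⟩; exact hex (by rw [Sum.inl.inj hr])
        simp only [expandBefore, expandAfter, if_neg this, List.flatMap_cons, List.flatMap_nil]
        exact ⟨(hst e hex).symm, ih h⟩
    · simp only [expandBefore, expandAfter, reduceCtorEq, exists_false, if_false,
        List.flatMap_cons, List.flatMap_nil]
      exact ih h

-- Before each end of `x` insert two syllables with trivial product. Sliding the arc of the second
-- one over the crossing leaves the first one before each end and puts the second one behind it, so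
-- that both ends of `x` are now met in states multiplied by the same element.
open Classical in
lemma equivalent_gauge_letter (Θ : Holonomy ι X g) (x : X) (z : Palette g) (ε : ℤˣ) :
    Θ.Equivalent (Θ.gauge (Pi.mulSingle x (val [(z, ε)])⁻¹)) := by
  have hf := Θ.isFlat_canonical
  have hw : WellFormed fun i => (Θ.canonical i).flatMap (expandBefore x (z, -ε)) :=
    hf.wellFormed.of_eq fun i => blackEnds_flatMap _ _ (blackEnds_expandBefore _ _)
  have hends : ∀ (i : ι) (f : Sym X g → List (Sym X g)), (∀ s, blackEnds (f s) = blackEnds [s]) →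
      blackEnds (((Θ.canonical i).flatMap (expandBefore x (z, -ε))).flatMap f) = Θ.ends i := by
    intro i f hb
    rw [blackEnds_flatMap _ _ hb, blackEnds_flatMap _ _ (blackEnds_expandBefore _ _), hf.ends]
  have h₁ : Θ.IsFlat fun i => ((Θ.canonical i).flatMap (expandBefore x (z, -ε))).flatMap
      (expandBefore x (z, ε)) := by
    refine ⟨fun i => hends i _ (blackEnds_expandBefore _ _), fun i => ?_⟩
    obtain ⟨s, hs⟩ := hf.reads i
    exact ⟨s, reads_expandBefore x z ε hs⟩
  have h₂ : (Θ.gauge (Pi.mulSingle x (val [(z, ε)])⁻¹)).IsFlat fun i =>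
      ((Θ.canonical i).flatMap (expandBefore x (z, -ε))).flatMap (expandAfter x (z, ε)) := by
    refine ⟨fun i => hends i _ (blackEnds_expandAfter _ _), fun i => ?_⟩
    obtain ⟨s, hs⟩ := hf.reads i
    refine ⟨s, reads_expandAfter x z ε (fun r => ?_) (fun e he => ?_) hs⟩
    · simp [gauge]
    · simp [gauge, he]
  exact equivalent_of_leads h₁ h₂ (leads_slide hw x (z, ε))

lemma gauge_gauge (Θ : Holonomy ι X g) (k k' : X → SurfaceGroup g) :
    (Θ.gauge k).gauge k' = Θ.gauge (k * k') := by
  simp [gauge, mul_assoc]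

lemma gauge_one (Θ : Holonomy ι X g) : Θ.gauge 1 = Θ := by
  simp [gauge]

/-- Changes of frames compose, and every one is a product of changes at a single crossing by a
single letter. -/
lemma equivalent_gauge (Θ : Holonomy ι X g) (k : X → SurfaceGroup g) :
    Θ.Equivalent (Θ.gauge k) := by
  classical
  have := Fintype.ofFinite X
  have mul : ∀ k k' : X → SurfaceGroup g, (∀ Θ : Holonomy ι X g, Θ.Equivalent (Θ.gauge k)) →
      (∀ Θ : Holonomy ι X g, Θ.Equivalent (Θ.gauge k')) →
      ∀ Θ : Holonomy ι X g, Θ.Equivalent (Θ.gauge (k * k')) := by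
    intro k k' h h' Θ
    rw [← gauge_gauge]
    exact (h Θ).trans (h' _)
  have one : ∀ Θ : Holonomy ι X g, Θ.Equivalent (Θ.gauge 1) := by
    intro Θ; rw [gauge_one]; exact .refl _
  have single : ∀ (x : X) (l : List (Syllable g)), ∀ Θ : Holonomy ι X g,
      Θ.Equivalent (Θ.gauge (Pi.mulSingle x (val l))) := by
    intro x l
    induction l with
    | nil => simpa using one
    | cons a l ih =>
      rw [val_cons, Pi.mulSingle_mul]
      refine mul _ _ (fun Θ => ?_) ih
      have := Θ.equivalent_gauge_letter x a.1 (-a.2)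
      rwa [val_neg, inv_inv] at this
  have key : ∀ s : Finset X, ∀ Θ : Holonomy ι X g,
      Θ.Equivalent (Θ.gauge fun x => if x ∈ s then k x else 1) := by
    intro s
    induction s using Finset.induction_on with
    | empty => exact one
    | @insert a s ha ih =>
      have : (fun x => if x ∈ insert a s then k x else 1) =
          (fun x => if x ∈ s then k x else 1) * Pi.mulSingle a (k a) := by
        funext x
        rcases eq_or_ne x a with rfl | hxa
        · simp [ha]
        · simp [hxa]
      rw [this]
      refine mul _ _ ih ?_
      obtain ⟨l, hl⟩ := val_surjective (k a)
      rw [← hl]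
      exact single a l
  simpa using key Finset.univ Θ

/-! ### Reidemeister moves -/

/-- The black end `f` follows `e` if `o = 1`, precedes it if `o = -1`, and it is in the same
state. -/
def Adjacent (Θ : Holonomy ι X g) (o : ℤˣ) (e f : X × Role) : Prop :=
  Θ.state e = Θ.state f ∧ ((o = 1 ∧ ∃ i p q, Θ.ends i = p ++ e :: f :: q) ∨
    (o = -1 ∧ ∃ i p q, Θ.ends i = p ++ f :: e :: q))

lemma Adjacent.adjacentIn {Θ : Holonomy ι X g} {o : ℤˣ} {e f : X × Role} (h : Θ.Adjacent o e f) :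
    AdjacentIn Θ.canonical o e f := by
  obtain ⟨hs, ⟨ho, i, p, q, h⟩ | ⟨ho, i, p, q, h⟩⟩ := h
  · obtain ⟨P, Q, hPQ⟩ := canonicalWord_append Θ.state 1 (Θ.mono i) p q hs
    exact .inl ⟨ho, i, P, Q, by rw [canonical, h, hPQ]⟩
  · obtain ⟨P, Q, hPQ⟩ := canonicalWord_append Θ.state 1 (Θ.mono i) p q hs.symm
    exact .inr ⟨ho, i, P, Q, by rw [canonical, h, hPQ]⟩

/-- `Θ'` is obtained from `Θ` by forgetting the crossings outside the range of `f`. -/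
structure Restricts {Y : Type*} (Θ : Holonomy ι X g) (f : Y → X) (Θ' : Holonomy ι Y g) : Prop where
  injective : Function.Injective f
  sign : ∀ y, Θ'.sign y = Θ.sign (f y)
  ends : ∀ i, (Θ'.ends i).map (Prod.map f id) =
    (Θ.ends i).filter (fun e => by classical exact decide (e.1 ∈ range f))
  state : ∀ e, Θ'.state e = Θ.state (Prod.map f id e)
  mono : Θ'.mono = Θ.mono

/-- A black end does not change the state during a reading, so dropping some of the ends leaves a
flat word. Words for both sides of the first two Reidemeister moves are found in this way. -/
lemma Restricts.exists_isFlat {Y : Type*} {Θ : Holonomy ι X g} {f : Y → X} {Θ' : Holonomy ι Y g}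
    (h : Θ.Restricts f Θ') {w : ι → List (Sym X g)} (hw : Θ.IsFlat w) :
    ∃ w', Θ'.IsFlat w' ∧ ∀ i, (w i).filter (fun s => by
      classical exact decide (∀ e, s = .inl e → e.1 ∈ range f)) =
        (w' i).map (Sum.map (Prod.map f id) id) := by
  classical
  have key : ∀ u : List (Sym X g), ∃ v : List (Sym Y g),
      u.filter (fun s => decide (∀ e, s = .inl e → e.1 ∈ range f)) =
        v.map (Sum.map (Prod.map f id) id) ∧
      (blackEnds v).map (Prod.map f id) =
        (blackEnds u).filter (fun e => decide (e.1 ∈ range f)) ∧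
      ∀ s t, Reads Θ.state s u t → Reads Θ'.state s v t := by
    intro u
    induction u with
    | nil => exact ⟨[], rfl, rfl, fun s t h => h⟩
    | cons a u ih =>
      obtain ⟨v, h1, h2, h3⟩ := ih
      rcases a with e | l
      · by_cases he : e.1 ∈ range f
        · obtain ⟨y, hy⟩ := he
          have hye : Prod.map f id (y, e.2) = e := Prod.ext hy rfl
          refine ⟨.inl (y, e.2) :: v, ?_, ?_, ?_⟩
          · rw [List.filter_cons_of_pos, h1, List.map_cons, Sum.map_inl, hye]
            simp only [Sum.inl.injEq, decide_eq_true_eq]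
            rintro e' rfl; exact ⟨y, hy⟩
          · rw [blackEnds_inl, blackEnds_inl, List.filter_cons_of_pos, List.map_cons, h2, hye]
            simpa using ⟨y, hy⟩
          · rintro s t ⟨rfl, hr⟩
            refine ⟨?_, h3 _ _ hr⟩
            rw [h.state, hye]
        · refine ⟨v, ?_, ?_, ?_⟩
          · rw [List.filter_cons_of_neg, h1]
            simpa using he
          · rw [blackEnds_inl, List.filter_cons_of_neg, h2]
            simpa using he
          · rintro s t ⟨rfl, hr⟩
            exact h3 _ _ hr
      · refine ⟨.inr l :: v, ?_, h2, fun s t hr => h3 _ _ hr⟩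
        rw [List.filter_cons_of_pos, h1]
        · rfl
        · simp
  choose v h1 h2 h3 using key
  have inj : Function.Injective (Prod.map f id : Y × Role → X × Role) :=
    h.injective.prodMap Function.injective_id
  refine ⟨fun i => v (w i), ⟨fun i => ?_, fun i => ?_⟩, fun i => h1 (w i)⟩
  · apply List.map_injective_iff.2 inj
    rw [h2, h.ends, hw.ends]
  · obtain ⟨s, hs⟩ := hw.reads i
    exact ⟨s, by rw [h.mono]; exact h3 _ _ _ hs⟩

section
variable {Y : Type*} {Θ : Holonomy ι X g} {Θ' : Holonomy ι Y g}

lemma Restricts.reidemeister1 [Finite Y] {f : Y → X} (h : Θ.Restricts f Θ') {x : X} (hx : range f = {x}ᶜ)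
    {o : ℤˣ} (ha : Θ.Adjacent o (x, .over) (x, .under)) : Θ.Equivalent Θ' := by
  obtain ⟨w', hw', hf⟩ := h.exists_isFlat Θ.isFlat_canonical
  refine equivalent_of_leads Θ.isFlat_canonical hw' ?_
  rintro W ⟨τ, hW⟩
  obtain ⟨χ, hχi, hχ⟩ := hW.exists_chord
  have hdel := hW.delete_black f h.injective h.sign hf
  have hset : {c | ∃ y ∉ range f, τ c = .inl y} = {χ x} := by
    ext c
    simp only [hx, mem_compl_iff, mem_singleton_iff, not_not, mem_ofPred_eq, exists_eq_left]
    constructor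
    · intro hc; exact (hW.existsUnique x).unique hc (hχ x)
    · rintro rfl; exact hχ x
  refine ⟨_, PrismaticDiagram.Step.equivalent (.inr <| .inl ⟨χ x, o, ?_, ?_⟩), hdel⟩
  · exact hW.adjacent hχ ha.adjacentIn
  · rw [hset]; exact W.erases_erase _

lemma Restricts.reidemeister2 [Finite Y] {f : Y → X} (h : Θ.Restricts f Θ') {x y : X} (hxy : x ≠ y)
    (hr : range f = {x, y}ᶜ) {o o' : ℤˣ} (hs : Θ.sign y = -Θ.sign x)
    (ho : Θ.Adjacent o (x, .over) (y, .over)) (hu : Θ.Adjacent o' (x, .under) (y, .under)) :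
    Θ.Equivalent Θ' := by
  obtain ⟨w', hw', hf⟩ := h.exists_isFlat Θ.isFlat_canonical
  refine equivalent_of_leads Θ.isFlat_canonical hw' ?_
  rintro W ⟨τ, hW⟩
  obtain ⟨χ, hχi, hχ⟩ := hW.exists_chord
  have hdel := hW.delete_black f h.injective h.sign hf
  have hset : {c | ∃ y ∉ range f, τ c = .inl y} = {χ x, χ y} := by
    ext c
    simp only [hr, mem_compl_iff, not_not, mem_ofPred_eq, mem_insert_iff, mem_singleton_iff,
      exists_eq_or_imp, exists_eq_left]
    refine or_congr ⟨fun hc => (hW.existsUnique x).unique hc (hχ x), ?_⟩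
      ⟨fun hc => (hW.existsUnique y).unique hc (hχ y), ?_⟩
    · rintro rfl; exact hχ x
    · rintro rfl; exact hχ y
  refine ⟨_, PrismaticDiagram.Step.equivalent (.inr <| .inr <| .inl
    ⟨χ x, χ y, o, o', hχi.ne hxy, ?_, hW.adjacent hχ ho.adjacentIn,
      hW.adjacent hχ hu.adjacentIn, ?_⟩), hdel⟩
  · rw [hW.sign_inl _ _ (hχ x), hW.sign_inl _ _ (hχ y), hs]
  · rw [hset]; exact W.erases_erase _

lemma isFlat_map {σ : X × Role → Y × Role} (he : ∀ i, Θ'.ends i = (Θ.ends i).map σ)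
    (hst : ∀ e, Θ'.state (σ e) = Θ.state e) (hm : Θ'.mono = Θ.mono) {w : ι → List (Sym X g)}
    (hw : Θ.IsFlat w) : Θ'.IsFlat fun i => (w i).map (Sum.map σ id) := by
  have key : ∀ u : List (Sym X g), blackEnds (u.map (Sum.map σ id)) = (blackEnds u).map σ ∧
      ∀ s t, Reads Θ.state s u t → Reads Θ'.state s (u.map (Sum.map σ id)) t := by
    intro u
    induction u with
    | nil => exact ⟨rfl, fun s t h => h⟩
    | cons a u ih =>
      rcases a with e | l
      · refine ⟨by simp [ih.1], ?_⟩
        rintro s t ⟨rfl, hr⟩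
        exact ⟨(hst e).symm, ih.2 _ _ hr⟩
      · exact ⟨by simpa using ih.1, fun s t hr => ih.2 _ _ hr⟩
  refine ⟨fun i => by rw [(key _).1, hw.ends, he], fun i => ?_⟩
  obtain ⟨s, hs⟩ := hw.reads i
  exact ⟨s, by rw [hm]; exact (key _).2 _ _ hs⟩

lemma equivalent_reidemeister3 [Finite Y] (f : X ≃ Y) {a b c : X} (hab : a ≠ b) (hac : a ≠ c)
    (hbc : b ≠ c) {ot om ob : ℤˣ} (hs : ∀ x, Θ'.sign (f x) = Θ.sign x)
    (he : ∀ i, Θ'.ends i = (Θ.ends i).map (Prod.map f id ∘ triangleSwap a b c))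
    (hst : ∀ e, Θ'.state (Prod.map f id (triangleSwap a b c e)) = Θ.state e)
    (hm : Θ'.mono = Θ.mono) (ht : Θ.Adjacent ot (a, .over) (b, .over))
    (hmi : Θ.Adjacent om (a, .under) (c, .over)) (hb : Θ.Adjacent ob (b, .under) (c, .under))
    (h₁ : Θ.sign a * ob = Θ.sign b * om) (h₂ : Θ.sign b * om = Θ.sign c * ot) :
    Θ.Equivalent Θ' :=
  equivalent_of_leads Θ.isFlat_canonical (isFlat_map he hst hm Θ.isFlat_canonical)
    (leads_reidemeister3 f hs hab hac hbc ht.adjacentIn hmi.adjacentIn hb.adjacentIn h₁ h₂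
      fun _ => rfl)

/-- Renaming the crossings. -/
lemma equivalent_rename [Finite Y] (f : X ≃ Y) (hs : ∀ x, Θ'.sign (f x) = Θ.sign x)
    (he : ∀ i, Θ'.ends i = (Θ.ends i).map (Prod.map f id))
    (hst : ∀ e, Θ'.state (Prod.map f id e) = Θ.state e) (hm : Θ'.mono = Θ.mono) :
    Θ.Equivalent Θ' := by
  refine equivalent_of_leads Θ.isFlat_canonical (isFlat_map he hst hm Θ.isFlat_canonical) ?_
  rintro W ⟨τ, hW⟩
  refine ⟨W, .refl _, ?_⟩
  -- The diagram itself does not change, only the labels of its black crossings; this is the case of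
  -- the identity permutation in `RealizesVia.permute`.
  have h1 : (W.Preserves 1) := fun _ _ => Iff.rfl
  have := hW.permute (sg' := Θ'.sign) (w' := fun i => (Θ.canonical i).map (Sum.map (Prod.map f id) id))
    1 h1 f hs fun i => ?_
  · have e : W.permute 1 h1 = W := by cases W; simp [PrismaticDiagram.permute]
    rwa [e] at this
  · refine List.IsRotated.trans ⟨0, ?_⟩ ((hW.word i).map _)
    rw [List.rotate_zero, List.map_map, List.map_map]
    refine List.map_congr_left fun e _ => ?_
    simp only [symbol, Function.comp_apply, Equiv.Perm.coe_one, id_eq]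
    rcases τ e.1 with x | l <;> rfl

end

end Holonomy

end HomotopyZh
end

/-! ### The sides of the 4g-gon and a frame on it that is compatible with the gluing. -/

noncomputable section
namespace HomotopyZh

variable {g : ℕ}

/-! ## The polygon -/

/-- The position on the circle of the point with parameter `s` of the side labelled `z`. -/
def sidePos : Palette g → ℝ → ℝ
  | (i, .x), s => 4 * (i.rev : ℕ) + 2 + s
  | (i, .y), s => 4 * (i.rev : ℕ) + 3 + s

/-- The position on the circle of the point with parameter `s` of the side labelled `z⁻¹`. -/
def sideNeg : Palette g → ℝ → ℝ
  | (i, .x), s => 4 * (i.rev : ℕ) + (1 - s)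
  | (i, .y), s => 4 * (i.rev : ℕ) + 1 + (1 - s)

section
variable {S : Type*} [TopologicalSpace S] [ChartedSpace Plane S] {loop : Palette g → ℝ → S}
  {q : Plane → S}

lemma IsCutPolygon.sidePos (hq : IsCutPolygon loop q) (z : Palette g) {s : ℝ}
    (hs : s ∈ Icc (0 : ℝ) 1) : q (corner g (sidePos z s)) = loop z s := by
  obtain ⟨i, _ | _⟩ := z
  · exact hq.side_x i s hs
  · exact hq.side_y i s hs

lemma IsCutPolygon.sideNeg (hq : IsCutPolygon loop q) (z : Palette g) {s : ℝ}
    (hs : s ∈ Icc (0 : ℝ) 1) : q (corner g (sideNeg z s)) = loop z s := by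
  have h : 1 - s ∈ Icc (0 : ℝ) 1 := ⟨by linarith [hs.2], by linarith [hs.1]⟩
  obtain ⟨i, _ | _⟩ := z
  · exact (hq.side_x_inv i (1 - s) h).trans (by rw [sub_sub_cancel])
  · exact (hq.side_y_inv i (1 - s) h).trans (by rw [sub_sub_cancel])

end

lemma norm_plane_sq (v : Plane) : ‖v‖ ^ 2 = v 0 ^ 2 + v 1 ^ 2 := by
  rw [EuclideanSpace.norm_sq_eq, Fin.sum_univ_two]
  simp

lemma norm_corner (u : ℝ) : ‖corner g u‖ = 1 := by
  have : ‖corner g u‖ ^ 2 = 1 := by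
    rw [norm_plane_sq]; simp [corner, Real.cos_sq_add_sin_sq]
  exact (pow_eq_one_iff_of_nonneg (norm_nonneg _) two_ne_zero).1 this

lemma corner_eq_corner_iff (hg : 0 < g) {u v : ℝ} :
    corner g u = corner g v ↔ ∃ k : ℤ, u = v + 4 * g * k := by
  have hg' : (0 : ℝ) < 4 * g := by positivity
  have e : corner g u = corner g v ↔
      ((2 * Real.pi * u / (4 * g) : ℝ) : Real.Angle) = ((2 * Real.pi * v / (4 * g) : ℝ) : Real.Angle) := by
    constructor
    · intro h
      have h0 := congrArg (fun w : Plane => w 0) h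
      have h1 := congrArg (fun w : Plane => w 1) h
      exact Real.Angle.cos_sin_inj (by simpa [corner] using h0) (by simpa [corner] using h1)
    · intro h
      have h0 := congrArg Real.Angle.cos h
      have h1 := congrArg Real.Angle.sin h
      simp only [Real.Angle.cos_coe, Real.Angle.sin_coe] at h0 h1
      simp [corner, h0, h1]
  rw [e, Real.Angle.angle_eq_iff_two_pi_dvd_sub]
  refine exists_congr fun k => ?_
  have hpi := Real.pi_pos
  constructor
  · intro h
    field_simp at h
    linear_combination h
  · rintro rfl
    field_simp
    ring

lemma exists_corner (hg : 0 < g) {v : Plane} (hv : ‖v‖ = 1) :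
    ∃ u ∈ Ico (0 : ℝ) (4 * g), corner g u = v := by
  have hg' : (0 : ℝ) < 4 * g := by positivity
  have hpi := Real.pi_pos
  have h1 : v 0 ^ 2 + v 1 ^ 2 = 1 := by rw [← norm_plane_sq, hv, one_pow]
  let θ := Complex.arg ⟨v 0, v 1⟩
  have hn : ‖(⟨v 0, v 1⟩ : ℂ)‖ = 1 := by
    rw [Complex.norm_eq_sqrt_sq_add_sq]; simp [h1]
  have hne : (⟨v 0, v 1⟩ : ℂ) ≠ 0 := by
    intro h; rw [h] at hn; simp at hn
  have hc : Real.cos θ = v 0 := by rw [Complex.cos_arg hne, hn]; simp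
  have hs : Real.sin θ = v 1 := by rw [Complex.sin_arg, hn]; simp
  have e : corner g (4 * g * θ / (2 * Real.pi)) = v := by
    have : 2 * Real.pi * (4 * g * θ / (2 * Real.pi)) / (4 * g) = θ := by field_simp
    ext i
    fin_cases i <;> simp [corner, this, hc, hs]
  refine ⟨toIcoMod hg' 0 (4 * g * θ / (2 * Real.pi)), by simpa using toIcoMod_mem_Ico hg' 0 _, ?_⟩
  rw [← e, corner_eq_corner_iff hg]
  refine ⟨-toIcoDiv hg' 0 (4 * g * θ / (2 * Real.pi)), ?_⟩
  rw [toIcoMod]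
  push_cast
  simp only [zsmul_eq_mul]
  ring

/-- Every point of the circle lies on some side. -/
lemma exists_side (hg : 0 < g) {v : Plane} (hv : ‖v‖ = 1) :
    ∃ z : Palette g, ∃ s ∈ Icc (0 : ℝ) 1, v = corner g (sidePos z s) ∨ v = corner g (sideNeg z s) := by
  obtain ⟨u, ⟨hu0, hu⟩, rfl⟩ := exists_corner hg hv
  have hn := Nat.floor_le hu0
  have hn' := Nat.lt_floor_add_one u
  have hlt : ⌊u⌋₊ < 4 * g := by
    rw [Nat.floor_lt hu0]; exact_mod_cast hu
  set n := ⌊u⌋₊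
  have hr : n / 4 < g := by omega
  have hrev : ((Fin.rev (Fin.rev (⟨n / 4, hr⟩ : Fin g)) : Fin g) : ℕ) = n / 4 := by
    rw [Fin.rev_rev]
  have hd : (n : ℝ) = 4 * ((n / 4 : ℕ) : ℝ) + ((n % 4 : ℕ) : ℝ) := by
    exact_mod_cast (Nat.div_add_mod n 4).symm
  have h4 : n % 4 < 4 := Nat.mod_lt _ (by norm_num)
  -- In a block of four sides the labels are `x⁻¹, y⁻¹, x, y`. The first two are traversed
  -- backwards, which explains the parameter `1 - (u - n)`.
  interval_cases hk : n % 4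
  · refine ⟨(Fin.rev ⟨n / 4, hr⟩, .x), 1 - (u - n), ⟨by linarith, by linarith⟩, .inr ?_⟩
    rw [HomotopyZh.sideNeg, hrev]
    congr 1
    push_cast at hd; linarith
  · refine ⟨(Fin.rev ⟨n / 4, hr⟩, .y), 1 - (u - n), ⟨by linarith, by linarith⟩, .inr ?_⟩
    rw [HomotopyZh.sideNeg, hrev]
    congr 1
    push_cast at hd; linarith
  · refine ⟨(Fin.rev ⟨n / 4, hr⟩, .x), u - n, ⟨by linarith, by linarith⟩, .inl ?_⟩
    rw [HomotopyZh.sidePos, hrev]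
    congr 1
    push_cast at hd; linarith
  · refine ⟨(Fin.rev ⟨n / 4, hr⟩, .y), u - n, ⟨by linarith, by linarith⟩, .inl ?_⟩
    rw [HomotopyZh.sidePos, hrev]
    congr 1
    push_cast at hd; linarith

/-- The ends of the sides are corners. -/
lemma sidePos_zero_one (z : Palette g) {s : ℝ} (hs : s = 0 ∨ s = 1) :
    ∃ n ≤ 4 * g, sidePos z s = (n : ℕ) := by
  obtain ⟨i, _ | _⟩ := z <;> have := i.rev.isLt <;> rcases hs with rfl | rfl
  exacts [⟨4 * i.rev + 2, by omega, by simp [sidePos]⟩,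
    ⟨4 * i.rev + 3, by omega, by simp [sidePos]; ring⟩,
    ⟨4 * i.rev + 3, by omega, by simp [sidePos]⟩,
    ⟨4 * i.rev + 4, by omega, by simp [sidePos]; ring⟩]

lemma sideNeg_zero_one (z : Palette g) {s : ℝ} (hs : s = 0 ∨ s = 1) :
    ∃ n ≤ 4 * g, sideNeg z s = (n : ℕ) := by
  obtain ⟨i, _ | _⟩ := z <;> have := i.rev.isLt <;> rcases hs with rfl | rfl
  exacts [⟨4 * i.rev + 1, by omega, by simp [sideNeg]⟩,
    ⟨4 * i.rev, by omega, by simp [sideNeg]⟩,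
    ⟨4 * i.rev + 2, by omega, by simp [sideNeg]; ring⟩,
    ⟨4 * i.rev + 1, by omega, by simp [sideNeg]⟩]

/-! ## Frames on the polygon -/

/-- The holonomy along a path that leaves the polygon through the side labelled `z` and enters
it through the side labelled `z⁻¹`, inverted. -/
def sideLetter : Palette g → SurfaceGroup g
  | (i, .x) => val [((i, .y), 1)]
  | (i, .y) => val [((i, .x), -1)]

/-- The value of the first `k` blocks of the relator. -/
def prefixVal (g k : ℕ) : SurfaceGroup g :=
  val (((List.finRange g).take k).flatMap fun i =>
    [((i, .x), -1), ((i, .y), -1), ((i, .x), 1), ((i, .y), 1)])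

lemma prefixVal_zero : prefixVal g 0 = 1 := rfl

/-- This is the only use of the relator in the geometry: it makes the frame single-valued around
`∞`. -/
lemma prefixVal_self : prefixVal g g = 1 := by
  rw [← val_relator (g := g), prefixVal, List.take_of_length_le (by simp)]
  congr 1
  have e : List.finRange 4 = [0, 1, 2, 3] := rfl
  simp only [relator, SProd.sprod, List.product, List.map_flatMap, e]
  rfl

lemma prefixVal_succ (i : Fin g) : prefixVal g (i + 1) = prefixVal g i *
    (val [((i, .x), 1)])⁻¹ * (val [((i, .y), 1)])⁻¹ * val [((i, .x), 1)] * val [((i, .y), 1)] := by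
  rw [prefixVal, List.take_add_one]
  have e : (List.finRange g)[(i : ℕ)]? = some i := by simp
  rw [e, List.flatMap_append, val_append, ← prefixVal]
  simp only [Option.toList_some, List.flatMap_cons, List.flatMap_nil, List.append_nil]
  rw [val_cons, val_cons _ [_, _], val_cons _ [_], val_neg, val_neg]
  simp only [mul_assoc]

/-- The frame at the corner with index `n`. -/
def cornerFrame (g n : ℕ) : SurfaceGroup g :=
  -- Going around `∞`, one meets the corners with indices `4 * i.rev` plus `4, 1, 2, 3, 0` in this
  -- order, crossing one pair of sides between any two of them; at each step the next letter of
  -- `x_i⁻¹ y_i⁻¹ x_i y_i` is appended. The last corner of this block is the first one of the block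
  -- of `i + 1`.
  if n % 4 = 0 then prefixVal g (g - n / 4) else
    if h : g - 1 - n / 4 < g then
      if n % 4 = 1 then prefixVal g (g - 1 - n / 4) * (val [((⟨_, h⟩, .x), 1)])⁻¹
      else if n % 4 = 2 then prefixVal g (g - 1 - n / 4) * (val [((⟨_, h⟩, .x), 1)])⁻¹ *
        (val [((⟨_, h⟩, .y), 1)])⁻¹
      else prefixVal g (g - 1 - n / 4) * (val [((⟨_, h⟩, .x), 1)])⁻¹ *
        (val [((⟨_, h⟩, .y), 1)])⁻¹ * val [((⟨_, h⟩, .x), 1)]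
    else 1

/-- The frame in the interior of the side that starts at the corner with index `n`. -/
def sideFrame (g n : ℕ) : SurfaceGroup g :=
  if h : g - 1 - n / 4 < g then
    if n % 4 = 0 then val [((⟨_, h⟩, .y), 1)]
    else if n % 4 = 1 then (val [((⟨_, h⟩, .x), 1)])⁻¹ else 1
  else 1

open Classical in
/-- The frame at a position on the circle. -/
def circleFrame (g : ℕ) (u : ℝ) : SurfaceGroup g :=
  if (⌊u⌋₊ : ℝ) = u then cornerFrame g ⌊u⌋₊ else sideFrame g ⌊u⌋₊

lemma circleFrame_natCast (n : ℕ) : circleFrame g n = cornerFrame g n := by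
  simp [circleFrame]

lemma circleFrame_add (n : ℕ) {s : ℝ} (hs : s ∈ Ioo (0 : ℝ) 1) :
    circleFrame g (n + s) = sideFrame g n := by
  have : ⌊(n : ℝ) + s⌋₊ = n := by
    rw [Nat.floor_eq_iff (by linarith [hs.1, Nat.cast_nonneg (α := ℝ) n])]
    exact ⟨by linarith [hs.1], by linarith [hs.2]⟩
  rw [circleFrame, this, if_neg]
  linarith [hs.1]

section
variable (i : Fin g)

lemma sub_rev_div {k : ℕ} (hk : k < 4) : g - 1 - (4 * (i.rev : ℕ) + k) / 4 = i := by
  rw [Fin.val_rev]; omega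

lemma fin_sub_rev_div {k : ℕ} (hk : k < 4) (h : g - 1 - (4 * (i.rev : ℕ) + k) / 4 < g) :
    (⟨g - 1 - (4 * (i.rev : ℕ) + k) / 4, h⟩ : Fin g) = i := Fin.ext (sub_rev_div i hk)

lemma cornerFrame_zero : cornerFrame g (4 * i.rev) = prefixVal g (i + 1) := by
  rw [cornerFrame, if_pos (by omega)]
  congr 1
  rw [Fin.val_rev]; omega

lemma cornerFrame_one : cornerFrame g (4 * i.rev + 1) = prefixVal g i * (val [((i, .x), 1)])⁻¹ := by
  have h := sub_rev_div i (k := 1) (by norm_num)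
  rw [cornerFrame, if_neg (by omega), dif_pos (h ▸ i.isLt), if_pos (by omega),
    fin_sub_rev_div i (by norm_num), h]

lemma cornerFrame_two : cornerFrame g (4 * i.rev + 2) =
    prefixVal g i * (val [((i, .x), 1)])⁻¹ * (val [((i, .y), 1)])⁻¹ := by
  have h := sub_rev_div i (k := 2) (by norm_num)
  rw [cornerFrame, if_neg (by omega), dif_pos (h ▸ i.isLt), if_neg (by omega), if_pos (by omega),
    fin_sub_rev_div i (by norm_num), h]

lemma cornerFrame_three : cornerFrame g (4 * i.rev + 3) =
    prefixVal g i * (val [((i, .x), 1)])⁻¹ * (val [((i, .y), 1)])⁻¹ * val [((i, .x), 1)] := by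
  have h := sub_rev_div i (k := 3) (by norm_num)
  rw [cornerFrame, if_neg (by omega), dif_pos (h ▸ i.isLt), if_neg (by omega), if_neg (by omega),
    fin_sub_rev_div i (by norm_num), h]

lemma cornerFrame_four : cornerFrame g (4 * i.rev + 4) = prefixVal g i := by
  rw [cornerFrame, if_pos (by omega)]
  congr 1
  rw [Fin.val_rev]; omega

lemma sideFrame_zero : sideFrame g (4 * i.rev) = val [((i, .y), 1)] := by
  have h := sub_rev_div i (k := 0) (by norm_num)
  have := fin_sub_rev_div i (k := 0) (by norm_num)
  simp only [add_zero] at h this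
  rw [sideFrame, dif_pos (by rw [h]; exact i.isLt), if_pos (by omega),
    this (by rw [h]; exact i.isLt)]

lemma sideFrame_one : sideFrame g (4 * i.rev + 1) = (val [((i, .x), 1)])⁻¹ := by
  have h := sub_rev_div i (k := 1) (by norm_num)
  rw [sideFrame, dif_pos (h ▸ i.isLt), if_neg (by omega), if_pos (by omega),
    fin_sub_rev_div i (by norm_num)]

lemma sideFrame_two : sideFrame g (4 * i.rev + 2) = 1 := by
  rw [sideFrame]
  split
  · rw [if_neg (by omega), if_neg (by omega)]
  · rfl

lemma sideFrame_three : sideFrame g (4 * i.rev + 3) = 1 := by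
  rw [sideFrame]
  split
  · rw [if_neg (by omega), if_neg (by omega)]
  · rfl

end

lemma circleFrame_of_eq {u : ℝ} {n : ℕ} (h : u = n) : circleFrame g u = cornerFrame g n := by
  rw [h, circleFrame_natCast]

lemma circleFrame_of_eq_add {u s : ℝ} {n : ℕ} (hs : s ∈ Ioo (0 : ℝ) 1) (h : u = n + s) :
    circleFrame g u = sideFrame g n := by
  rw [h, circleFrame_add n hs]

lemma circleFrame_sidePos (z : Palette g) {s : ℝ} (hs : s ∈ Ioo (0 : ℝ) 1) :
    circleFrame g (sidePos z s) = 1 := by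
  obtain ⟨i, _ | _⟩ := z
  · rw [circleFrame_of_eq_add (n := 4 * i.rev + 2) hs (by simp [sidePos]), sideFrame_two]
  · rw [circleFrame_of_eq_add (n := 4 * i.rev + 3) hs (by simp [sidePos]), sideFrame_three]

/-- In the interior of a pair of sides the frames `1` and `sideLetter z` were chosen for this
purpose. At the ends `s = 0, 1` it is the recursion of `cornerFrame` around `∞`, read off pair by
pair. -/
lemma circleFrame_sideNeg (z : Palette g) {s : ℝ} (hs : s ∈ Icc (0 : ℝ) 1) :
    circleFrame g (sideNeg z s) = circleFrame g (sidePos z s) * sideLetter z := by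
  rcases eq_or_ne s 0 with rfl | h0
  · obtain ⟨i, _ | _⟩ := z
    · rw [circleFrame_of_eq (n := 4 * i.rev + 1) (by simp [sideNeg]), cornerFrame_one,
        circleFrame_of_eq (n := 4 * i.rev + 2) (by simp [sidePos]), cornerFrame_two, sideLetter]
      group
    · rw [circleFrame_of_eq (n := 4 * i.rev + 2) (by simp [sideNeg]; ring), cornerFrame_two,
        circleFrame_of_eq (n := 4 * i.rev + 3) (by simp [sidePos]), cornerFrame_three, sideLetter,
        val_neg]
      group
  rcases eq_or_ne s 1 with rfl | h1
  · obtain ⟨i, _ | _⟩ := z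
    · rw [circleFrame_of_eq (n := 4 * i.rev) (by simp [sideNeg]), cornerFrame_zero,
        circleFrame_of_eq (n := 4 * i.rev + 3) (by simp [sidePos]; ring), cornerFrame_three,
        sideLetter, prefixVal_succ]
    · rw [circleFrame_of_eq (n := 4 * i.rev + 1) (by simp [sideNeg]), cornerFrame_one,
        circleFrame_of_eq (n := 4 * i.rev + 4) (by simp [sidePos]; ring), cornerFrame_four,
        sideLetter, val_neg]
  have hs' : s ∈ Ioo (0 : ℝ) 1 := ⟨lt_of_le_of_ne hs.1 h0.symm, lt_of_le_of_ne hs.2 h1⟩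
  have hs'' : 1 - s ∈ Ioo (0 : ℝ) 1 := ⟨by linarith [hs'.2], by linarith [hs'.1]⟩
  rw [circleFrame_sidePos z hs', one_mul]
  obtain ⟨i, _ | _⟩ := z
  · rw [circleFrame_of_eq_add (n := 4 * i.rev) hs'' (by simp [sideNeg]), sideFrame_zero, sideLetter]
  · rw [circleFrame_of_eq_add (n := 4 * i.rev + 1) hs'' (by simp [sideNeg]), sideFrame_one,
      sideLetter, val_neg]

open Classical in
/-- A frame at each point of the closed polygon, constant inside, and compatible with the pairing
of the sides. -/
def frame (g : ℕ) (v : Plane) : SurfaceGroup g :=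
  if h : ∃ u ∈ Ico (0 : ℝ) (4 * g), corner g u = v then circleFrame g h.choose else 1

lemma frame_of_norm_lt {v : Plane} (hv : ‖v‖ < 1) : frame g v = 1 := by
  rw [frame, dif_neg]
  rintro ⟨u, -, rfl⟩
  rw [norm_corner] at hv
  exact lt_irrefl _ hv

lemma frame_corner (hg : 0 < g) {u : ℝ} (hu : u ∈ Icc (0 : ℝ) (4 * g)) :
    frame g (corner g u) = circleFrame g u := by
  have key : ∀ u ∈ Ico (0 : ℝ) (4 * g), frame g (corner g u) = circleFrame g u := by
    intro u hu
    have h : ∃ u' ∈ Ico (0 : ℝ) (4 * g), corner g u' = corner g u := ⟨u, hu, rfl⟩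
    rw [frame, dif_pos h]
    obtain ⟨h1, h2⟩ := h.choose_spec
    obtain ⟨k, hk⟩ := (corner_eq_corner_iff hg).1 h2
    set w := h.choose
    have hg' : (0 : ℝ) < g := by exact_mod_cast hg
    have : k = 0 := by
      have hlt : (k : ℝ) < 1 := by
        by_contra hk1
        rw [not_lt] at hk1
        nlinarith [h1.2, hu.1]
      have hgt : (-1 : ℝ) < k := by
        by_contra hk1
        rw [not_lt] at hk1
        nlinarith [h1.1, hu.2]
      have h3 : k < 1 := by exact_mod_cast hlt
      have h4 : -1 < k := by exact_mod_cast hgt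
      omega
    rw [hk, this]; simp
  rcases eq_or_lt_of_le hu.2 with rfl | hlt
  -- The positions `0` and `4 * g` are the same point of the circle. Their frames are the value of
  -- the whole relator and of the empty word, which agree.
  · have e : corner g (4 * g : ℝ) = corner g (0 : ℝ) := (corner_eq_corner_iff hg).2 ⟨1, by simp⟩
    rw [e, key 0 ⟨le_rfl, by positivity⟩, circleFrame_of_eq (u := 0) (n := 0) (by simp),
      circleFrame_of_eq (n := 4 * g) (by simp)]
    simp [cornerFrame, prefixVal_self, prefixVal_zero]
  · exact key u ⟨hu.1, hlt⟩

lemma sidePos_mem (z : Palette g) {s : ℝ} (hs : s ∈ Icc (0 : ℝ) 1) :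
    sidePos z s ∈ Icc (0 : ℝ) (4 * g) := by
  obtain ⟨i, _ | _⟩ := z <;> have h : (((i.rev : ℕ) + 1 : ℕ) : ℝ) ≤ g := by
    exact_mod_cast i.rev.isLt
  all_goals
    push_cast at h
    have := Nat.cast_nonneg (α := ℝ) (i.rev : ℕ)
    constructor <;> simp only [sidePos] <;> linarith [hs.1, hs.2]

lemma sideNeg_mem (z : Palette g) {s : ℝ} (hs : s ∈ Icc (0 : ℝ) 1) :
    sideNeg z s ∈ Icc (0 : ℝ) (4 * g) := by
  obtain ⟨i, _ | _⟩ := z <;> have h : (((i.rev : ℕ) + 1 : ℕ) : ℝ) ≤ g := by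
    exact_mod_cast i.rev.isLt
  all_goals
    push_cast at h
    have := Nat.cast_nonneg (α := ℝ) (i.rev : ℕ)
    constructor <;> simp only [sideNeg] <;> linarith [hs.1, hs.2]

lemma frame_sideNeg (hg : 0 < g) (z : Palette g) {s : ℝ} (hs : s ∈ Icc (0 : ℝ) 1) :
    frame g (corner g (sideNeg z s)) = frame g (corner g (sidePos z s)) * sideLetter z := by
  rw [frame_corner hg (sideNeg_mem z hs), frame_corner hg (sidePos_mem z hs),
    circleFrame_sideNeg z hs]

lemma frame_sidePos (hg : 0 < g) (z : Palette g) {s : ℝ} (hs : s ∈ Ioo (0 : ℝ) 1) :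
    frame g (corner g (sidePos z s)) = 1 := by
  rw [frame_corner hg (sidePos_mem z ⟨hs.1.le, hs.2.le⟩), circleFrame_sidePos z hs]

end HomotopyZh
end

/-! ### Parallel transport in the flat bundle obtained by gluing the polygon. -/

noncomputable section
namespace HomotopyZh
open Filter Topology

variable {S : Type*} [TopologicalSpace S] [ChartedSpace Plane S] {g : ℕ} {Ω : SymplecticBasis S g}
  {q : Plane → S}

/-! ## Transport -/

lemma IsCutPolygon.exists_preimage (hq : IsCutPolygon Ω.loop q) (p : S) :
    ∃ v ∈ Metric.closedBall (0 : Plane) 1, q v = p := by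
  by_cases hp : p ∈ ⋃ z, Ω.loop z '' Icc 0 1
  · obtain ⟨z, s, hs, rfl⟩ := mem_iUnion.1 hp
    exact ⟨corner g (HomotopyZh.sidePos z s), by simp [norm_corner], hq.sidePos z hs⟩
  · have : p ∈ q '' Metric.ball 0 1 := by rw [hq.image]; exact hp
    obtain ⟨v, hv, rfl⟩ := this
    exact ⟨v, Metric.ball_subset_closedBall hv, rfl⟩

/-- Pairs of points of the two sides labelled `z` that are glued to each other. -/
def sidePair (z : Palette g) (s : ℝ) : Plane × Plane :=
  (corner g (sidePos z s), corner g (sideNeg z s))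

lemma continuous_corner : Continuous (corner g) := by
  unfold corner
  refine (PiLp.continuous_toLp 2 _).comp ?_
  refine continuous_pi fun i => ?_
  fin_cases i <;> simp <;> fun_prop

lemma continuous_sidePos (z : Palette g) : Continuous (sidePos z) := by
  obtain ⟨i, _ | _⟩ := z
  · exact continuous_const.add continuous_id
  · exact continuous_const.add continuous_id

lemma continuous_sideNeg (z : Palette g) : Continuous (sideNeg z) := by
  obtain ⟨i, _ | _⟩ := z
  · exact continuous_const.add (continuous_const.sub continuous_id)
  · exact continuous_const.add (continuous_const.sub continuous_id)

lemma continuous_sidePair (z : Palette g) : Continuous (sidePair z) :=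
  (continuous_corner.comp (continuous_sidePos z)).prodMk
    (continuous_corner.comp (continuous_sideNeg z))

variable (Ω) in
lemma loop_eq_base_iff (z : Palette g) {s : ℝ} (hs : s ∈ Icc (0 : ℝ) 1) :
    Ω.loop z s = Ω.base ↔ s = 0 ∨ s = 1 := by
  constructor
  · intro h
    rcases eq_or_lt_of_le hs.2 with h1 | h1
    · exact .inr h1
    · refine .inl (Ω.simple z ⟨hs.1, h1⟩ ⟨le_rfl, one_pos⟩ (h.trans (Ω.loop_zero z).symm))
  · rintro (rfl | rfl)
    exacts [Ω.loop_zero z, Ω.loop_one z]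

/-- Points of the polygon with the same image. -/
lemma IsCutPolygon.eq_cases (hq : IsCutPolygon Ω.loop q) (hg : 0 < g) {v w : Plane}
    (hv : v ∈ Metric.closedBall (0 : Plane) 1) (hw : w ∈ Metric.closedBall (0 : Plane) 1)
    (h : q v = q w) : v = w ∨ (∃ z : Palette g, ∃ s ∈ Icc (0 : ℝ) 1, (v, w) = sidePair z s) ∨
      (∃ z : Palette g, ∃ s ∈ Icc (0 : ℝ) 1, (w, v) = sidePair z s) ∨
      ∃ m ≤ 4 * g, ∃ n ≤ 4 * g, v = corner g (m : ℕ) ∧ w = corner g (n : ℕ) := by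
  have side : ∀ v ∈ Metric.closedBall (0 : Plane) 1, ‖v‖ < 1 ∨ ‖v‖ = 1 := fun v hv =>
    lt_or_eq_of_le (by simpa using hv)
  have loops : ∀ v, ‖v‖ = 1 → ∃ z, ∃ s ∈ Icc (0 : ℝ) 1, q v = Ω.loop z s ∧
      (v = corner g (HomotopyZh.sidePos z s) ∨ v = corner g (HomotopyZh.sideNeg z s)) := by
    intro v hv
    obtain ⟨z, s, hs, rfl | rfl⟩ := exists_side hg hv
    exacts [⟨z, s, hs, hq.sidePos z hs, .inl rfl⟩, ⟨z, s, hs, hq.sideNeg z hs, .inr rfl⟩]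
  have notmem : ∀ v, ‖v‖ < 1 → ∀ z, ∀ s ∈ Icc (0 : ℝ) 1, q v ≠ Ω.loop z s := by
    intro v hv z s hs e
    have : q v ∈ q '' Metric.ball 0 1 := ⟨v, by simpa using hv, rfl⟩
    rw [hq.image] at this
    exact this (mem_iUnion.2 ⟨z, s, hs, e.symm⟩)
  rcases side v hv with hv1 | hv1 <;> rcases side w hw with hw1 | hw1
  · exact .inl (hq.injOn (by simpa using hv1) (by simpa using hw1) h)
  · obtain ⟨z, s, hs, e, -⟩ := loops w hw1
    exact absurd (h.trans e) (notmem v hv1 z s hs)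
  · obtain ⟨z, s, hs, e, -⟩ := loops v hv1
    exact absurd (h.symm.trans e) (notmem w hw1 z s hs)
  obtain ⟨z, s, hs, e, hvs⟩ := loops v hv1
  obtain ⟨z', s', hs', e', hws⟩ := loops w hw1
  have hl : Ω.loop z s = Ω.loop z' s' := by rw [← e, ← e', h]
  by_cases hb : Ω.loop z s = Ω.base
  · have h0 := (loop_eq_base_iff Ω z hs).1 hb
    have h0' := (loop_eq_base_iff Ω z' hs').1 (hl.symm.trans hb)
    have c : ∃ m ≤ 4 * g, v = corner g (m : ℕ) := by
      rcases hvs with rfl | rfl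
      · obtain ⟨m, hm, e⟩ := sidePos_zero_one z h0; exact ⟨m, hm, by rw [e]⟩
      · obtain ⟨m, hm, e⟩ := sideNeg_zero_one z h0; exact ⟨m, hm, by rw [e]⟩
    have c' : ∃ m ≤ 4 * g, w = corner g (m : ℕ) := by
      rcases hws with rfl | rfl
      · obtain ⟨m, hm, e⟩ := sidePos_zero_one z' h0'; exact ⟨m, hm, by rw [e]⟩
      · obtain ⟨m, hm, e⟩ := sideNeg_zero_one z' h0'; exact ⟨m, hm, by rw [e]⟩
    obtain ⟨m, hm, e1⟩ := c
    obtain ⟨n, hn, e2⟩ := c'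
    exact .inr (.inr (.inr ⟨m, hm, n, hn, e1, e2⟩))
  · have hi : s ∈ Ioo (0 : ℝ) 1 := by
      rw [loop_eq_base_iff Ω z hs, not_or] at hb
      exact ⟨lt_of_le_of_ne hs.1 (Ne.symm hb.1), lt_of_le_of_ne hs.2 hb.2⟩
    have hi' : s' ∈ Ioo (0 : ℝ) 1 := by
      rw [hl, loop_eq_base_iff Ω z' hs', not_or] at hb
      exact ⟨lt_of_le_of_ne hs'.1 (Ne.symm hb.1), lt_of_le_of_ne hs'.2 hb.2⟩
    obtain rfl : z = z' := by
      by_contra hz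
      exact Ω.meet z z' hz s hi s' hi' hl
    obtain rfl : s = s' := Ω.simple z ⟨hi.1.le, hi.2⟩ ⟨hi'.1.le, hi'.2⟩ hl
    rcases hvs with rfl | rfl <;> rcases hws with rfl | rfl
    exacts [.inl rfl, .inr (.inl ⟨z, s, hs, rfl⟩), .inr (.inr (.inl ⟨z, s, hs, rfl⟩)), .inl rfl]

/-- The frames change in the same way near points of the polygon with the same image. -/
lemma IsCutPolygon.eventually_frame (hq : IsCutPolygon Ω.loop q) (hg : 0 < g) {v w : Plane} :
    ∀ᶠ y in 𝓝 (v, w), y.1 ∈ Metric.closedBall (0 : Plane) 1 → y.2 ∈ Metric.closedBall (0 : Plane) 1 →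
      q y.1 = q y.2 → frame g v * (frame g y.1)⁻¹ = frame g w * (frame g y.2)⁻¹ := by
  -- The pairs of polygon points with the same image form a finite union of closed sets: the
  -- diagonal, the pairings of sides in both orders, and pairs of corners. Near `(v, w)` only those
  -- containing `(v, w)` occur, and on a pairing of sides the two frames differ by one constant
  -- letter.
  have closed : ∀ C : Set (Plane × Plane), IsClosed C → ∀ᶠ y in 𝓝 (v, w), y ∈ C → (v, w) ∈ C := by
    intro C hC
    by_cases h : (v, w) ∈ C
    · exact .of_forall fun _ _ => h
    · filter_upwards [hC.isOpen_compl.mem_nhds h] with y hy hy'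
      exact absurd hy' hy
  have pair : ∀ z : Palette g, ∀ᶠ y in 𝓝 (v, w), y ∈ sidePair z '' Icc (0 : ℝ) 1 →
      (v, w) ∈ sidePair z '' Icc (0 : ℝ) 1 := fun z =>
    closed _ (isCompact_Icc.image (continuous_sidePair z)).isClosed
  have pair' : ∀ z : Palette g, ∀ᶠ y in 𝓝 (v, w), y ∈ Prod.swap ∘ sidePair z '' Icc (0 : ℝ) 1 →
      (v, w) ∈ Prod.swap ∘ sidePair z '' Icc (0 : ℝ) 1 := fun z =>
    closed _ (isCompact_Icc.image (continuous_swap.comp (continuous_sidePair z))).isClosed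
  have diag : ∀ᶠ y in 𝓝 (v, w), y ∈ diagonal Plane → (v, w) ∈ diagonal Plane :=
    closed _ isClosed_diagonal
  have corners : ∀ m ∈ Finset.range (4 * g + 1), ∀ n ∈ Finset.range (4 * g + 1),
      ∀ᶠ y in 𝓝 (v, w), y ∈ ({(corner g (m : ℕ), corner g (n : ℕ))} : Set (Plane × Plane)) →
        (v, w) ∈ ({(corner g (m : ℕ), corner g (n : ℕ))} : Set (Plane × Plane)) :=
    fun m _ n _ => closed _ isClosed_singleton
  have corners' := (Finset.range (4 * g + 1)).eventually_all.2 fun m hm =>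
    (Finset.range (4 * g + 1)).eventually_all.2 (corners m hm)
  filter_upwards [diag, corners', eventually_all.2 pair, eventually_all.2 pair'] with
    y hd hc hp hp' hy1 hy2 he
  have rel : ∀ {z : Palette g} {s : ℝ} {a b : Plane}, s ∈ Icc (0 : ℝ) 1 → sidePair z s = (a, b) →
      frame g b = frame g a * sideLetter z := by
    rintro z s a b hs h
    obtain ⟨rfl, rfl⟩ := Prod.mk.inj h
    exact frame_sideNeg hg z hs
  rcases hq.eq_cases hg hy1 hy2 he with h | ⟨z, s, hs, h⟩ | ⟨z, s, hs, h⟩ | ⟨m, hm, n, hn, h, h'⟩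
  · obtain rfl : v = w := hd h
    rw [h]
  · obtain ⟨s', hs', h'⟩ := hp z ⟨s, hs, h.symm⟩
    rw [rel hs' h', rel hs h.symm]
    group
  · obtain ⟨s', hs', h'⟩ := hp' z ⟨s, hs, by simp [← h]⟩
    have h'' : sidePair z s' = (w, v) := by rw [← Prod.swap_swap (sidePair z s')]; exact congrArg _ h'
    rw [rel hs' h'', rel hs h.symm]
    group
  · have := hc m (by simp; omega) n (by simp; omega) (Prod.ext h h')
    obtain ⟨h1, h2⟩ := Prod.mk.inj (mem_singleton_iff.1 this)
    rw [h, h', h1, h2]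
    simp

section
variable {A : Type*} [TopologicalSpace A]

variable (g q) in
/-- Near `a`, the frames `κ` at the points of `A` are carried along in the surface: they change as
prescribed by the frames of the polygon. -/
def IsTransportAt (f : A → S) (κ : A → SurfaceGroup g) (a : A) : Prop :=
  ∀ v ∈ Metric.closedBall (0 : Plane) 1, q v = f a → ∀ᶠ y in 𝓝 (a, v),
    y.2 ∈ Metric.closedBall (0 : Plane) 1 → q y.2 = f y.1 →
      κ y.1 * frame g y.2 = κ a * frame g v

variable (g q) in
/-- The frames `κ` at the points of `A` are carried along in the surface. -/
def IsTransport (f : A → S) (κ : A → SurfaceGroup g) : Prop := ∀ a, IsTransportAt g q f κ a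

/-- A tube lemma. The closed polygon is compact, and a point of it that does not lie over `f a` has,
the surface being Hausdorff, a neighbourhood without points over `f a'` for `a'` near `a`. So it
suffices to look near the points over `f a`. -/
lemma IsCutPolygon.eventually_of_fiber [T2Space S] (hq : IsCutPolygon Ω.loop q) {f : A → S} {a : A}
    (hf : ContinuousAt f a) {p : A → Plane → Prop}
    (h : ∀ v ∈ Metric.closedBall (0 : Plane) 1, q v = f a → ∀ᶠ y in 𝓝 (a, v),
      y.2 ∈ Metric.closedBall (0 : Plane) 1 → q y.2 = f y.1 → p y.1 y.2) :
    ∀ᶠ a' in 𝓝 a, ∀ v ∈ Metric.closedBall (0 : Plane) 1, q v = f a' → p a' v := by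
  have := (isCompact_closedBall (0 : Plane) 1).eventually_forall_of_forall_eventually (x₀ := a)
    (P := fun a' v => v ∈ Metric.closedBall (0 : Plane) 1 → q v = f a' → p a' v) ?_
  · exact this.mono fun a' h v hv => h v hv hv
  intro v hv
  by_cases hva : q v = f a
  · exact h v hv hva
  · have h1 : Tendsto (fun y : A × Plane => q y.2) (𝓝 (a, v) ⊓ 𝓟 {y | y.2 ∈ Metric.closedBall 0 1})
        (𝓝 (q v)) := by
      refine (hq.continuousOn v hv).tendsto.comp (tendsto_nhdsWithin_iff.2 ⟨?_, ?_⟩)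
      · exact (continuous_snd.tendsto (a, v)).mono_left inf_le_left
      · exact mem_inf_of_right (mem_principal_self _)
    have h2 : Tendsto (fun y : A × Plane => f y.1) (𝓝 (a, v) ⊓ 𝓟 {y | y.2 ∈ Metric.closedBall 0 1})
        (𝓝 (f a)) :=
      (hf.tendsto.comp (continuous_fst.tendsto (a, v))).mono_left inf_le_left
    have h3 := (h1.prodMk_nhds h2).eventually (isClosed_diagonal.isOpen_compl.mem_nhds hva)
    rw [eventually_inf_principal] at h3
    filter_upwards [h3] with y hy hy1 hy2
    exact absurd hy2 (hy hy1)

lemma IsTransportAt.const_mul {f : A → S} {κ : A → SurfaceGroup g} {a : A}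
    (h : IsTransportAt g q f κ a) (c : SurfaceGroup g) :
    IsTransportAt g q f (fun a => c * κ a) a := by
  intro v hv hva
  filter_upwards [h v hv hva] with y hy hy1 hy2
  rw [mul_assoc, mul_assoc, hy hy1 hy2]

lemma IsTransportAt.congr {f f' : A → S} {κ κ' : A → SurfaceGroup g} {a : A}
    (h : IsTransportAt g q f κ a) (hf : f' =ᶠ[𝓝 a] f) (hκ : κ' =ᶠ[𝓝 a] κ) :
    IsTransportAt g q f' κ' a := by
  intro v hv hva
  have e : ∀ᶠ y in 𝓝 (a, v), f' y.1 = f y.1 ∧ κ' y.1 = κ y.1 :=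
    (continuous_fst.tendsto (a, v)).eventually (hf.and hκ)
  filter_upwards [h v hv (hva.trans hf.self_of_nhds), e] with y hy he hy1 hy2
  rw [he.2, hκ.self_of_nhds, hy hy1 (hy2.trans he.1)]

lemma IsTransportAt.comp {B : Type*} [TopologicalSpace B] {f : A → S} {κ : A → SurfaceGroup g}
    {k : B → A} {b : B} (h : IsTransportAt g q f κ (k b)) (hk : ContinuousAt k b) :
    IsTransportAt g q (f ∘ k) (κ ∘ k) b := by
  intro v hv hva
  have : Tendsto (fun y : B × Plane => (k y.1, y.2)) (𝓝 (b, v)) (𝓝 (k b, v)) :=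
    (hk.tendsto.comp (continuous_fst.tendsto (b, v))).prodMk_nhds (continuous_snd.tendsto (b, v))
  exact this.eventually (h v hv hva)

lemma IsTransport.comp {B : Type*} [TopologicalSpace B] {f : A → S} {κ : A → SurfaceGroup g}
    (h : IsTransport g q f κ) {k : B → A} (hk : Continuous k) :
    IsTransport g q (f ∘ k) (κ ∘ k) := fun b => (h (k b)).comp hk.continuousAt

lemma IsTransportAt.eventually_mul_inv [T2Space S] (hq : IsCutPolygon Ω.loop q) {f : A → S}
    {κ κ' : A → SurfaceGroup g} {a : A} (h : IsTransportAt g q f κ a)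
    (h' : IsTransportAt g q f κ' a) (hf : ContinuousAt f a) :
    ∀ᶠ a' in 𝓝 a, κ' a' * (κ a')⁻¹ = κ' a * (κ a)⁻¹ := by
  have := hq.eventually_of_fiber hf (p := fun a' _ => κ' a' * (κ a')⁻¹ = κ' a * (κ a)⁻¹) ?_
  · filter_upwards [this] with a' ha'
    obtain ⟨v, hv, hva⟩ := hq.exists_preimage (f a')
    exact ha' v hv hva
  intro v hv hva
  filter_upwards [h v hv hva, h' v hv hva] with y hy hy' hy1 hy2
  calc κ' y.1 * (κ y.1)⁻¹ = κ' y.1 * frame g y.2 * (κ y.1 * frame g y.2)⁻¹ := by group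
    _ = κ' a * (κ a)⁻¹ := by rw [hy hy1 hy2, hy' hy1 hy2]; group

/-- Transport is unique up to the choice of a frame at one point. -/
lemma IsTransport.mul_inv_eq [T2Space S] [PreconnectedSpace A] (hq : IsCutPolygon Ω.loop q)
    {f : A → S} (hf : Continuous f) {κ κ' : A → SurfaceGroup g} (h : IsTransport g q f κ)
    (h' : IsTransport g q f κ') (a b : A) : κ' a * (κ a)⁻¹ = κ' b * (κ b)⁻¹ :=
  (IsLocallyConstant.iff_eventually_eq _ |>.2 fun a =>
    (h a).eventually_mul_inv hq (h' a) hf.continuousAt).apply_eq_of_preconnectedSpace a b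

end

/-- The fibres of the polygon are finite. -/
lemma IsCutPolygon.finite_fiber (hq : IsCutPolygon Ω.loop q) (hg : 0 < g) (p : S) :
    {v | v ∈ Metric.closedBall (0 : Plane) 1 ∧ q v = p}.Finite := by
  by_cases hne : ∃ w ∈ Metric.closedBall (0 : Plane) 1, q w = p
  swap
  · convert Set.finite_empty (α := Plane)
    ext v
    simp only [mem_ofPred_eq, mem_empty_iff_false, iff_false]
    exact fun h => hne ⟨v, h⟩
  obtain ⟨w, hw, rfl⟩ := hne
  have fin : ∀ z : Palette g, {s | s ∈ Icc (0 : ℝ) 1 ∧ Ω.loop z s = q w}.Finite := by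
    intro z
    have h1 : {s | s ∈ Ico (0 : ℝ) 1 ∧ Ω.loop z s = q w}.Subsingleton :=
      fun s hs t ht => Ω.simple z hs.1 ht.1 (hs.2.trans ht.2.symm)
    refine (h1.finite.union (finite_singleton (1 : ℝ))).subset fun s hs => ?_
    rcases eq_or_lt_of_le hs.1.2 with h | h
    · exact .inr h
    · exact .inl ⟨⟨hs.1.1, h⟩, hs.2⟩
  have h2 := finite_iUnion fun z : Palette g =>
    ((fin z).image fun s => corner g (HomotopyZh.sidePos z s)).union
      ((fin z).image fun s => corner g (HomotopyZh.sideNeg z s))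
  have h3 := (finite_Iic (4 * g)).image fun n : ℕ => corner g (n : ℝ)
  refine ((finite_singleton w).union (h2.union h3)).subset ?_
  rintro v ⟨hv, hvw⟩
  rcases hq.eq_cases hg hv hw hvw with h | ⟨z, s, hs, h⟩ | ⟨z, s, hs, h⟩ | ⟨m, hm, n, hn, h, h'⟩
  · exact .inl h
  · obtain ⟨rfl, rfl⟩ := Prod.mk.inj h
    exact .inr (.inl (mem_iUnion.2 ⟨z, .inl ⟨s, ⟨hs, (hq.sideNeg z hs).symm⟩, rfl⟩⟩))
  · obtain ⟨rfl, rfl⟩ := Prod.mk.inj h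
    exact .inr (.inl (mem_iUnion.2 ⟨z, .inr ⟨s, ⟨hs, (hq.sidePos z hs).symm⟩, rfl⟩⟩))
  · exact .inr (.inr ⟨m, hm, h.symm⟩)

/-- Transport exists locally. -/
lemma IsCutPolygon.exists_transport_nhds [T2Space S] (hq : IsCutPolygon Ω.loop q) (hg : 0 < g)
    (p : S) : ∃ (U : Set S) (κ : S → SurfaceGroup g), IsOpen U ∧ p ∈ U ∧
      ∀ x ∈ U, IsTransportAt g q id κ x := by
  classical
  set F := {v | v ∈ Metric.closedBall (0 : Plane) 1 ∧ q v = p}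
  have hF : F.Finite := hq.finite_fiber hg p
  have key : ∀ v w : Plane, ∃ O O' : Set Plane, IsOpen O ∧ IsOpen O' ∧ v ∈ O ∧ w ∈ O' ∧
      ∀ v' ∈ O, ∀ w' ∈ O', v' ∈ Metric.closedBall (0 : Plane) 1 →
        w' ∈ Metric.closedBall (0 : Plane) 1 → q v' = q w' →
          frame g v * (frame g v')⁻¹ = frame g w * (frame g w')⁻¹ := by
    intro v w
    obtain ⟨O, O', h1, h2, h3, h4, h5⟩ :=
      mem_nhds_prod_iff'.1 (hq.eventually_frame hg (v := v) (w := w))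
    refine ⟨O, O', h1, h3, h2, h4, fun v' hv' w' hw' => ?_⟩
    have h6 : (v', w') ∈ O ×ˢ O' := mk_mem_prod hv' hw'
    simpa only [mem_ofPred_eq] using h5 h6
  choose O O' hO hO' hvO hwO' hOO using key
  let N : Plane → Set Plane := fun v => ⋂ w ∈ F, O v w ∩ O' w v
  have hNo : ∀ v, IsOpen (N v) := fun v => hF.isOpen_biInter fun w _ => (hO v w).inter (hO' w v)
  have hN : ∀ v, v ∈ N v := fun v => mem_iInter₂.2 fun w _ => ⟨hvO v w, hwO' w v⟩
  have hNN : ∀ v ∈ F, ∀ w ∈ F, ∀ v' ∈ N v, ∀ w' ∈ N w, v' ∈ Metric.closedBall (0 : Plane) 1 →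
      w' ∈ Metric.closedBall (0 : Plane) 1 → q v' = q w' →
        frame g v * (frame g v')⁻¹ = frame g w * (frame g w')⁻¹ := by
    intro v hv w hw v' hv' w' hw'
    exact hOO v w v' (mem_iInter₂.1 hv' w hw).1 w' (mem_iInter₂.1 hw' v hv).2
  -- The points whose preimages are all close to the fibre of `p`. The set is open because `q` maps
  -- the rest of the polygon onto a compact set.
  let U : Set S := (q '' (Metric.closedBall 0 1 \ ⋃ v ∈ F, N v))ᶜ
  have hU : IsOpen U := by
    refine IsClosed.isOpen_compl (self := IsCompact.isClosed (IsCompact.image_of_continuousOn ?_ ?_))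
    · exact (isCompact_closedBall (0 : Plane) 1).diff (isOpen_biUnion fun v _ => hNo v)
    · exact hq.continuousOn.mono sdiff_subset
  have hUF : ∀ v' ∈ Metric.closedBall (0 : Plane) 1, q v' ∈ U → ∃ v ∈ F, v' ∈ N v := by
    intro v' hv' hU
    by_contra hc
    refine hU ⟨v', ⟨hv', fun h => hc ?_⟩, rfl⟩
    simpa using h
  -- A point near `p` is reached from `p` within the polygon, from `v` in the fibre to the nearby
  -- `v'`, and the two frames are compared. By `hNN` the choice of `v` and `v'` is irrelevant.
  let κ : S → SurfaceGroup g := fun x =>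
    if h : ∃ vv : Plane × Plane, vv.1 ∈ F ∧ vv.2 ∈ N vv.1 ∧ vv.2 ∈ Metric.closedBall (0 : Plane) 1 ∧
      q vv.2 = x then frame g h.choose.1 * (frame g h.choose.2)⁻¹ else 1
  have hκ : ∀ v ∈ F, ∀ v' ∈ N v, v' ∈ Metric.closedBall (0 : Plane) 1 →
      κ (q v') = frame g v * (frame g v')⁻¹ := by
    intro v hv v' hv' hv'1
    have h : ∃ vv : Plane × Plane, vv.1 ∈ F ∧ vv.2 ∈ N vv.1 ∧
      vv.2 ∈ Metric.closedBall (0 : Plane) 1 ∧ q vv.2 = q v' := ⟨(v, v'), hv, hv', hv'1, rfl⟩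
    simp only [κ]
    rw [dif_pos h]
    obtain ⟨h1, h2, h3, h4⟩ := h.choose_spec
    exact hNN _ h1 v hv _ h2 v' hv' h3 hv'1 h4
  refine ⟨U, κ, hU, ?_, ?_⟩
  · rintro ⟨v, ⟨hv, hv'⟩, hvp⟩
    exact hv' (mem_iUnion₂.2 ⟨v, ⟨hv, hvp⟩, hN v⟩)
  · intro x hx v' hv' hvx
    simp only [id] at hvx
    subst hvx
    obtain ⟨v, hv, hvN⟩ := hUF v' hv' hx
    have : ∀ᶠ y : S × Plane in 𝓝 (q v', v'), y.2 ∈ N v :=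
      (continuous_snd.tendsto (q v', v')).eventually ((hNo v).mem_nhds hvN)
    filter_upwards [this] with y hy hy1 hy2
    simp only [id] at hy2
    rw [← hy2, hκ v hv y.2 hy hy1, hκ v hv v' hvN hv']
    group

attribute [local instance] Classical.propDecidable in
/-- Transport along a simply connected space exists. -/
lemma IsCutPolygon.exists_transport [T2Space S] (hq : IsCutPolygon Ω.loop q) (hg : 0 < g)
    {A : Type*} [TopologicalSpace A] [SimplyConnectedSpace A] [LocallyPathConnectedSpace A]
    {f : A → S} (hf : Continuous f) : ∃ κ : A → SurfaceGroup g, IsTransport g q f κ := by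
  choose U κ hU hpU hκ using hq.exists_transport_nhds hg
  let : TopologicalSpace (SurfaceGroup g) := ⊥
  have : DiscreteTopology (SurfaceGroup g) := ⟨rfl⟩
  -- Two local transports differ by a locally constant factor from the left. These factors are the
  -- transition functions of a bundle with discrete fibre, that is of a covering of the surface.
  let Z : FiberBundleCore S S (SurfaceGroup g) :=
    { baseSet := U
      isOpen_baseSet := hU
      indexAt := id
      mem_baseSet_at := hpU
      coordChange := fun i j x γ => γ * (κ i x * (κ j x)⁻¹)
      coordChange_self := by intro i x _ v; simp
      continuousOn_coordChange := by
        rintro i j ⟨x, γ⟩ hx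
        refine ContinuousAt.continuousWithinAt ?_
        have h1 : ContinuousAt (fun y => κ i y * (κ j y)⁻¹) x :=
          (tendsto_const_nhds (x := κ i x * (κ j x)⁻¹)).congr' ((IsTransportAt.eventually_mul_inv hq
            (hκ j x hx.1.2) (hκ i x hx.1.1) continuousAt_id).mono fun y hy => hy.symm)
        exact (continuous_of_discreteTopology (f := fun ab : SurfaceGroup g × SurfaceGroup g =>
          ab.1 * ab.2)).continuousAt.comp
            ((continuous_snd.tendsto (x, γ)).prodMk_nhds (h1.tendsto.comp (continuous_fst.tendsto (x, γ))))
      coordChange_comp := by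
        intro i j k x _ v
        group }
  have cov : IsCoveringMap (Bundle.TotalSpace.proj : Z.TotalSpace → S) :=
    FiberBundle.isCoveringMap (F := SurfaceGroup g) (E := Z.Fiber)
  obtain ⟨a₀⟩ : Nonempty A := inferInstance
  -- A lift of `f` chooses consistent coefficients `h a`, and the coefficient times the local
  -- transport at `f a` is a transport along `f`.
  obtain ⟨F, ⟨-, hF⟩, -⟩ := cov.existsUnique_continuousMap_lifts ⟨f, hf⟩ a₀ ⟨f a₀, (1 : SurfaceGroup g)⟩ rfl
  have hFf : ∀ a, (F a).1 = f a := fun a => congrFun hF a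
  let h : A → SurfaceGroup g := fun a => (F a).2
  refine ⟨fun a => h a * κ (f a) (f a), fun a => ?_⟩
  have hcont : ContinuousAt (fun a' => (Z.localTriv (f a) (F a')).2) a := by
    refine continuous_snd.continuousAt.comp (ContinuousAt.comp (f := fun a' => F a') ?_
      F.continuous.continuousAt)
    refine (Z.localTriv (f a)).toOpenPartialHomeomorph.continuousAt ?_
    change (F a).1 ∈ U (f a)
    rw [hFf]; exact hpU _
  have hval : ∀ a', (Z.localTriv (f a) (F a')).2 = h a' * (κ (f a') (f a') * (κ (f a) (f a'))⁻¹) := by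
    intro a'
    change h a' * (κ (F a').1 (F a').1 * (κ (f a) (F a').1)⁻¹) = _
    rw [hFf]
  have hev : ∀ᶠ a' in 𝓝 a, h a' * κ (f a') (f a') = h a * κ (f a) (f a') := by
    have h1 : {γ : SurfaceGroup g | γ = h a} ∈ 𝓝 ((Z.localTriv (f a) (F a)).2) :=
      (isOpen_discrete _).mem_nhds (by rw [mem_ofPred_eq, hval]; simp)
    filter_upwards [hcont.tendsto.eventually h1] with a' ha'
    rw [hval, ← mul_assoc] at ha'
    rw [← ha']; group
  exact (((hκ (f a) (f a) (hpU _)).comp (k := f) hf.continuousAt).const_mul (h a)).congr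
    (.of_forall fun _ => rfl) hev

end HomotopyZh
end

/-! ### Jacobians and velocities in preferred charts; signs of charts and of isotopies. -/

noncomputable section
namespace HomotopyZh
open Filter Topology

/-! ## Orientation -/

lemma wedge_map (L : Plane →L[ℝ] Plane) (a b : Plane) :
    wedge (L a) (L b) = wedge (L !₂[1, 0]) (L !₂[0, 1]) * wedge a b := by
  have h : ∀ a : Plane, L a = a 0 • L !₂[1, 0] + a 1 • L !₂[0, 1] := by
    intro a
    rw [← map_smul, ← map_smul, ← map_add]
    congr 1
    ext i; fin_cases i <;> simp
  rw [h a, h b]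
  simp only [wedge, PiLp.add_apply, PiLp.smul_apply, smul_eq_mul]
  ring

lemma det_eq_wedge (L : Plane →L[ℝ] Plane) : L.det = wedge (L !₂[1, 0]) (L !₂[0, 1]) := by
  have h := LinearMap.det_toMatrix (EuclideanSpace.basisFun (Fin 2) ℝ).toBasis (L : Plane →ₗ[ℝ] Plane)
  rw [ContinuousLinearMap.det, ← h, Matrix.det_fin_two]
  have e0 : EuclideanSpace.single (0 : Fin 2) (1 : ℝ) = !₂[1, 0] := by
    ext i; fin_cases i <;> simp
  have e1 : EuclideanSpace.single (1 : Fin 2) (1 : ℝ) = !₂[0, 1] := by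
    ext i; fin_cases i <;> simp
  simp [LinearMap.toMatrix_apply, wedge, e0, e1]
  ring

lemma wedge_swap (v w : Plane) : wedge w v = -wedge v w := by
  simp only [wedge]; ring

lemma wedge_smul_left (r : ℝ) (v w : Plane) : wedge (r • v) w = r * wedge v w := by
  simp only [wedge, PiLp.smul_apply, smul_eq_mul]; ring

lemma wedge_smul_right (r : ℝ) (v w : Plane) : wedge v (r • w) = r * wedge v w := by
  simp only [wedge, PiLp.smul_apply, smul_eq_mul]; ring

section
variable {M N N' : Type*} [TopologicalSpace M] [ChartedSpace Plane M] [TopologicalSpace N]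
  [ChartedSpace Plane N] [TopologicalSpace N'] [ChartedSpace Plane N']

/-- Jacobian determinant of a map between surfaces. -/
def jac (f : M → N) (x : M) : ℝ :=
  wedge (mfderiv (𝓡 2) (𝓡 2) f x (!₂[1, 0] : Plane)) (mfderiv (𝓡 2) (𝓡 2) f x (!₂[0, 1] : Plane))

lemma wedge_mfderiv (f : M → N) (x : M) (a b : Plane) :
    wedge (mfderiv (𝓡 2) (𝓡 2) f x a) (mfderiv (𝓡 2) (𝓡 2) f x b) = jac f x * wedge a b :=
  wedge_map (mfderiv (𝓡 2) (𝓡 2) f x : Plane →L[ℝ] Plane) a b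

lemma jac_comp {f : M → N} {f' : N → N'} {x : M}
    (hf' : MDifferentiableAt (𝓡 2) (𝓡 2) f' (f x)) (hf : MDifferentiableAt (𝓡 2) (𝓡 2) f x) :
    jac (f' ∘ f) x = jac f' (f x) * jac f x := by
  rw [jac, mfderiv_comp x hf' hf]
  exact wedge_mfderiv f' (f x) _ _

lemma jac_congr {f f' : M → N} {x : M} (h : f =ᶠ[𝓝 x] f') : jac f x = jac f' x := by
  have := h.mfderiv_eq (I := 𝓡 2) (I' := 𝓡 2)
  simp only [jac]
  have e : (mfderiv (𝓡 2) (𝓡 2) f x : Plane →L[ℝ] Plane) = mfderiv (𝓡 2) (𝓡 2) f' x := this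
  exact congrArg (fun L : Plane →L[ℝ] Plane => wedge (L !₂[1, 0]) (L !₂[0, 1])) e

lemma jac_id (x : M) : jac (id : M → M) x = 1 := by
  rw [jac, mfderiv_id]
  change wedge (!₂[1, 0] : Plane) (!₂[0, 1] : Plane) = 1
  simp [wedge]

lemma jac_plane (f : Plane → Plane) (x : Plane) : jac f x = (fderiv ℝ f x).det := by
  rw [det_eq_wedge, jac, mfderiv_eq_fderiv]
  rfl

lemma velocity_comp {f : M → N} {c : ℝ → M} {t : ℝ}
    (hf : MDifferentiableAt (𝓡 2) (𝓡 2) f (c t)) (hc : MDifferentiableAt 𝓘(ℝ, ℝ) (𝓡 2) c t) :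
    velocity (f ∘ c) t = mfderiv (𝓡 2) (𝓡 2) f (c t) (velocity c t) := by
  rw [velocity, mfderiv_comp t hf hc]
  rfl

lemma velocity_plane (c : ℝ → Plane) (t : ℝ) : velocity c t = deriv c t := by
  rw [velocity, mfderiv_eq_fderiv]
  rfl

lemma velocity_congr {c c' : ℝ → M} {t : ℝ} (h : c =ᶠ[𝓝 t] c') : velocity c t = velocity c' t := by
  have e : (mfderiv 𝓘(ℝ, ℝ) (𝓡 2) c t : ℝ →L[ℝ] Plane) = mfderiv 𝓘(ℝ, ℝ) (𝓡 2) c' t :=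
    h.mfderiv_eq (I := 𝓘(ℝ, ℝ)) (I' := 𝓡 2)
  exact congrArg (fun L : ℝ →L[ℝ] Plane => L 1) e

lemma velocity_comp_real {c : ℝ → M} {f : ℝ → ℝ} {t : ℝ}
    (hc : MDifferentiableAt 𝓘(ℝ, ℝ) (𝓡 2) c (f t)) (hf : DifferentiableAt ℝ f t) :
    velocity (c ∘ f) t = deriv f t • velocity c (f t) := by
  rw [velocity, mfderiv_comp t hc hf.mdifferentiableAt]
  have e : mfderiv 𝓘(ℝ, ℝ) 𝓘(ℝ, ℝ) f t (1 : ℝ) = deriv f t • (1 : ℝ) := by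
    rw [mfderiv_eq_fderiv, smul_eq_mul, mul_one]; rfl
  change (mfderiv 𝓘(ℝ, ℝ) (𝓡 2) c (f t) : ℝ →L[ℝ] Plane) (mfderiv 𝓘(ℝ, ℝ) 𝓘(ℝ, ℝ) f t (1 : ℝ)) = _
  rw [e]
  exact (mfderiv 𝓘(ℝ, ℝ) (𝓡 2) c (f t) : ℝ →L[ℝ] Plane).map_smul (deriv f t) 1

lemma wedge_velocity_comp {f : M → N} {c c' : ℝ → M} {t t' : ℝ}
    (hf : MDifferentiableAt (𝓡 2) (𝓡 2) f (c t)) (hc : MDifferentiableAt 𝓘(ℝ, ℝ) (𝓡 2) c t)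
    (hc' : MDifferentiableAt 𝓘(ℝ, ℝ) (𝓡 2) c' t') (h : c t = c' t') :
    wedge (velocity (f ∘ c) t) (velocity (f ∘ c') t') =
      jac f (c t) * wedge (velocity c t) (velocity c' t') := by
  rw [velocity_comp hf hc, velocity_comp (h ▸ hf) hc', ← wedge_mfderiv]
  have e : (mfderiv (𝓡 2) (𝓡 2) f (c' t') : Plane →L[ℝ] Plane) = mfderiv (𝓡 2) (𝓡 2) f (c t) := by
    rw [h]
  exact congrArg (fun L : Plane →L[ℝ] Plane =>
    wedge (mfderiv (𝓡 2) (𝓡 2) f (c t) (velocity c t)) (L (velocity c' t'))) e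

end

variable {S : Type*} [TopologicalSpace S] [ChartedSpace Plane S]

lemma mfderiv_chart [IsManifold (𝓡 2) ∞ S] {e : S → Plane} {x : S}
    (he : MDifferentiableAt (𝓡 2) (𝓡 2) e x) :
    (mfderiv (𝓡 2) (𝓡 2) e x : Plane →L[ℝ] Plane) =
      fderiv ℝ (e ∘ (chartAt Plane x).symm) (chartAt Plane x x) := by
  have h : (mfderiv (𝓡 2) (𝓡 2) e x : Plane →L[ℝ] Plane) =
    fderivWithin ℝ (writtenInExtChartAt (𝓡 2) (𝓡 2) x e) (range (𝓡 2)) (extChartAt (𝓡 2) x x) :=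
    he.mfderiv
  rw [h]
  simp [writtenInExtChartAt, mfld_simps, fderivWithin_univ]
  rfl

lemma jac_chart [IsManifold (𝓡 2) ∞ S] {e : S → Plane} {x : S}
    (he : MDifferentiableAt (𝓡 2) (𝓡 2) e x) :
    jac e x = (fderiv ℝ (e ∘ (chartAt Plane x).symm) (chartAt Plane x x)).det := by
  rw [det_eq_wedge, ← mfderiv_chart he]
  rfl

lemma mdifferentiableAt_of_mem_maximalAtlas [IsManifold (𝓡 2) ∞ S] {φ : OpenPartialHomeomorph S Plane}
    (hφ : φ ∈ IsManifold.maximalAtlas (𝓡 2) ∞ S) {x : S} (hx : x ∈ φ.source) :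
    MDifferentiableAt (𝓡 2) (𝓡 2) φ x :=
  ((contMDiffOn_of_mem_maximalAtlas hφ).contMDiffAt (φ.open_source.mem_nhds hx)).mdifferentiableAt
    (by simp)

lemma mdifferentiableAt_symm_of_mem_maximalAtlas [IsManifold (𝓡 2) ∞ S]
    {φ : OpenPartialHomeomorph S Plane}
    (hφ : φ ∈ IsManifold.maximalAtlas (𝓡 2) ∞ S) {v : Plane} (hv : v ∈ φ.target) :
    MDifferentiableAt (𝓡 2) (𝓡 2) φ.symm v :=
  ((contMDiffOn_symm_of_mem_maximalAtlas hφ).contMDiffAt (φ.open_target.mem_nhds hv)).mdifferentiableAt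
    (by simp)

lemma jac_pos_of_mem_atlas [IsManifold (𝓡 2) ∞ S] (hS : IsOrientedAtlas S)
    {e : OpenPartialHomeomorph S Plane} (he : e ∈ atlas Plane S) {x : S} (hx : x ∈ e.source) :
    0 < jac e x := by
  rw [jac_chart (mdifferentiableAt_of_mem_maximalAtlas
    (IsManifold.subset_maximalAtlas he) hx)]
  exact hS _ (chart_mem_atlas Plane x) e he _ (by simp [hx])

lemma jac_ne_zero_of_mem_maximalAtlas [IsManifold (𝓡 2) ∞ S] {φ : OpenPartialHomeomorph S Plane}
    (hφ : φ ∈ IsManifold.maximalAtlas (𝓡 2) ∞ S) {x : S} (hx : x ∈ φ.source) : jac φ x ≠ 0 := by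
  intro h
  have h1 := jac_comp (f' := φ.symm) (f := φ) (x := x)
    (mdifferentiableAt_symm_of_mem_maximalAtlas hφ (φ.map_source hx))
    (mdifferentiableAt_of_mem_maximalAtlas hφ hx)
  have h2 : jac (φ.symm ∘ φ) x = jac (id : S → S) x := by
    refine jac_congr ?_
    filter_upwards [φ.open_source.mem_nhds hx] with y hy
    exact φ.left_inv hy
  rw [h2, jac_id, h, mul_zero] at h1
  exact one_ne_zero h1

lemma eventually_sign_eq {A : Type*} [TopologicalSpace A] {f : A → ℝ} {a : A} (hf : ContinuousAt f a)
    (h : f a ≠ 0) : ∀ᶠ b in 𝓝 a, SignType.sign (f b) = SignType.sign (f a) := by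
  rcases lt_or_gt_of_ne h with h | h
  · filter_upwards [hf.eventually_lt_const h] with b hb
    rw [sign_neg hb, sign_neg h]
  · filter_upwards [hf.eventually_const_lt h] with b hb
    rw [sign_pos hb, sign_pos h]

lemma continuous_det : Continuous fun L : Plane →L[ℝ] Plane => L.det := by
  simp only [det_eq_wedge, wedge]
  fun_prop

/-- The number `jac φ y` is computed in the preferred chart at `y` and may jump with `y`; only its
sign is meaningful. Passing through one fixed chart `e` gives a continuous factor, and the other
factor `jac e y` is positive because the atlas is oriented. -/
lemma eventually_sign_jac_chart [IsManifold (𝓡 2) ∞ S] (hS : IsOrientedAtlas S)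
    {φ : OpenPartialHomeomorph S Plane}
    (hφ : φ ∈ IsManifold.maximalAtlas (𝓡 2) ∞ S) {x : S} (hx : x ∈ φ.source) :
    ∀ᶠ y in 𝓝 x, SignType.sign (jac φ y) = SignType.sign (jac φ x) := by
  set e := chartAt Plane x
  have hex : x ∈ e.source := mem_chart_source Plane x
  have hea : e ∈ atlas Plane S := chart_mem_atlas Plane x
  have hem : e ∈ IsManifold.maximalAtlas (𝓡 2) ∞ S := IsManifold.subset_maximalAtlas hea
  have fac : ∀ y ∈ e.source, y ∈ φ.source →
      jac φ y = jac (φ ∘ e.symm) (e y) * jac e y := by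
    intro y hy hyφ
    have h1 : MDifferentiableAt (𝓡 2) (𝓡 2) (φ ∘ e.symm) (e y) := by
      refine MDifferentiableAt.comp (I' := 𝓡 2) _ ?_
        (mdifferentiableAt_symm_of_mem_maximalAtlas hem (e.map_source hy))
      rw [e.left_inv hy]
      exact mdifferentiableAt_of_mem_maximalAtlas hφ hyφ
    rw [← jac_comp h1 (mdifferentiableAt_of_mem_maximalAtlas hem hy)]
    refine jac_congr ?_
    filter_upwards [e.open_source.mem_nhds hy] with y' hy'
    simp [e.left_inv hy']
  have hcd : ContDiffAt ℝ ∞ (φ ∘ e.symm) (e x) := by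
    refine contMDiffAt_iff_contDiffAt.1 (ContMDiffAt.comp (I' := 𝓡 2) _ ?_
      ((contMDiffOn_symm_of_mem_maximalAtlas hem).contMDiffAt
        (e.open_target.mem_nhds (e.map_source hex))))
    rw [e.left_inv hex]
    exact (contMDiffOn_of_mem_maximalAtlas hφ).contMDiffAt (φ.open_source.mem_nhds hx)
  have hcont : ContinuousAt (fun y => jac (φ ∘ e.symm) (e y)) x := by
    simp only [jac_plane]
    exact continuous_det.continuousAt.comp ((hcd.continuousAt_fderiv (by simp)).comp
      (e.continuousAt hex))
  have hne : jac (φ ∘ e.symm) (e x) ≠ 0 := by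
    intro h
    refine jac_ne_zero_of_mem_maximalAtlas hφ hx ?_
    rw [fac x hex hx, h, zero_mul]
  have hpos : ∀ y ∈ e.source, SignType.sign (jac e y) = 1 := fun y hy =>
    sign_pos (jac_pos_of_mem_atlas hS hea hy)
  filter_upwards [eventually_sign_eq hcont hne, e.open_source.mem_nhds hex,
    φ.open_source.mem_nhds hx] with y hy hye hyφ
  rw [fac y hye hyφ, fac x hex hx, sign_mul, sign_mul, hpos y hye, hpos x hex, hy]

/-- A chart preserves or reverses orientation on a connected set. -/
lemma exists_sign_jac_chart [IsManifold (𝓡 2) ∞ S] (hS : IsOrientedAtlas S)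
    {φ : OpenPartialHomeomorph S Plane} (hφ : φ ∈ IsManifold.maximalAtlas (𝓡 2) ∞ S) {C : Set S}
    (hC : IsPreconnected C) (hCφ : C ⊆ φ.source) :
    ∃ η : ℤˣ, ∀ x ∈ C, 0 < ((η : ℤ) : ℝ) * jac φ x := by
  rcases C.eq_empty_or_nonempty with rfl | ⟨x₀, hx₀⟩
  · exact ⟨1, by simp⟩
  have : PreconnectedSpace C := Subtype.preconnectedSpace hC
  have hl : IsLocallyConstant fun x : C => SignType.sign (jac φ x) :=
    (IsLocallyConstant.iff_eventually_eq _).2 fun x =>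
      (continuous_subtype_val.tendsto x).eventually (eventually_sign_jac_chart hS hφ (hCφ x.2))
  have hs : ∀ x ∈ C, SignType.sign (jac φ x) = SignType.sign (jac φ x₀) := fun x hx =>
    hl.apply_eq_of_preconnectedSpace ⟨x, hx⟩ ⟨x₀, hx₀⟩
  rcases lt_or_gt_of_ne (jac_ne_zero_of_mem_maximalAtlas hφ (hCφ hx₀)) with h | h
  · refine ⟨-1, fun x hx => ?_⟩
    have := hs x hx
    rw [sign_neg h, sign_eq_neg_one_iff] at this
    simpa using this
  · refine ⟨1, fun x hx => ?_⟩
    have := hs x hx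
    rw [sign_pos h, sign_eq_one_iff] at this
    simpa using this

/-- An ambient isotopy preserves orientation. -/
lemma jac_pos_of_isotopy [IsManifold (𝓡 2) ∞ S] (hS : IsOrientedAtlas S) {H : ℝ → S → S}
    (hH : ContMDiff (𝓘(ℝ, ℝ).prod (𝓡 2)) (𝓡 2) ∞ (fun u : ℝ × S => H u.1 u.2))
    (hΦ : ∀ t ∈ Icc (0 : ℝ) 1, ∃ Φ : S ≃ₘ^∞⟮𝓡 2, 𝓡 2⟯ S, ∀ u, Φ u = H t u)
    (h0 : ∀ u, H 0 u = u) (x : S) {t : ℝ} (ht : t ∈ Icc (0 : ℝ) 1) : 0 < jac (H t) x := by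
  have hHt : ∀ t, ContMDiff (𝓡 2) (𝓡 2) ∞ (H t) := fun t =>
    hH.comp (contMDiff_const.prodMk contMDiff_id)
  have hmd : ∀ t y, MDifferentiableAt (𝓡 2) (𝓡 2) (H t) y := fun t y =>
    (hHt t y).mdifferentiableAt (by simp)
  have hne : ∀ t ∈ Icc (0 : ℝ) 1, jac (H t) x ≠ 0 := by
    intro t ht h
    obtain ⟨Φ, hΦ⟩ := hΦ t ht
    have e : H t = Φ := funext fun u => (hΦ u).symm
    have h1 := jac_comp (f' := Φ.symm) (f := H t) (x := x)
      ((Φ.symm.contMDiff _).mdifferentiableAt (by simp)) (hmd t x)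
    have h2 : Φ.symm ∘ H t = id := by
      rw [e]; funext u; simp
    rw [h2, jac_id, h, mul_zero] at h1
    exact one_ne_zero h1
  -- The preferred chart at `H s x` may jump with `s`, so `H s` is followed by one fixed chart `e`,
  -- whose Jacobian is positive. The Jacobian of the composite is continuous in `s` because `H` is
  -- smooth in both variables.
  have hloc : ∀ t ∈ Icc (0 : ℝ) 1,
      ∀ᶠ s in 𝓝 t, SignType.sign (jac (H s) x) = SignType.sign (jac (H t) x) := by
    intro t ht
    set e := chartAt Plane (H t x)
    have hex : H t x ∈ e.source := mem_chart_source Plane _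
    have hea : e ∈ atlas Plane S := chart_mem_atlas Plane _
    have hem : e ∈ IsManifold.maximalAtlas (𝓡 2) ∞ S := IsManifold.subset_maximalAtlas hea
    set k := chartAt Plane x
    have hkx : x ∈ k.source := mem_chart_source Plane _
    have hkm : k ∈ IsManifold.maximalAtlas (𝓡 2) ∞ S :=
      IsManifold.subset_maximalAtlas (chart_mem_atlas Plane _)
    let G : ℝ × Plane → Plane := fun u => e (H u.1 (k.symm u.2))
    have hG : ContDiffAt ℝ ∞ G (t, k x) := by
      have e₀ : ContMDiffAt (𝓘(ℝ, ℝ).prod (𝓡 2)) (𝓡 2) ∞ G (t, k x) → ContDiffAt ℝ ∞ G (t, k x) := by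
        rw [← contMDiffAt_iff_contDiffAt, modelWithCornersSelf_prod, ← chartedSpaceSelf_prod]
        exact id
      apply e₀
      have h1 : ContMDiffAt (𝓘(ℝ, ℝ).prod (𝓡 2)) (𝓘(ℝ, ℝ).prod (𝓡 2)) ∞
          (fun u : ℝ × Plane => (u.1, k.symm u.2)) (t, k x) :=
        contMDiffAt_fst.prodMk (ContMDiffAt.comp (I' := 𝓡 2) (t, k x)
          ((contMDiffOn_symm_of_mem_maximalAtlas hkm).contMDiffAt
            (k.open_target.mem_nhds (k.map_source hkx))) contMDiffAt_snd)
      have h2 : ContMDiffAt (𝓘(ℝ, ℝ).prod (𝓡 2)) (𝓡 2) ∞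
          (fun u : ℝ × Plane => H u.1 (k.symm u.2)) (t, k x) :=
        ContMDiffAt.comp (t, k x) (hH _) h1
      refine ContMDiffAt.comp (I' := 𝓡 2) (t, k x) ?_ h2
      simp only [k.left_inv hkx]
      exact (contMDiffOn_of_mem_maximalAtlas hem).contMDiffAt (e.open_source.mem_nhds hex)
    have hcontH : ContinuousAt (fun s => H s x) t :=
      (hH.continuous.comp (Continuous.prodMk_left x)).continuousAt
    have hsrc : ∀ᶠ s in 𝓝 t, H s x ∈ e.source :=
      hcontH.eventually (e.open_source.mem_nhds hex)
    have hpair : Tendsto (fun s : ℝ => (s, k x)) (𝓝 t) (𝓝 (t, k x)) :=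
      (Continuous.prodMk_left (k x)).tendsto t
    have hdiff : ∀ᶠ s in 𝓝 t, DifferentiableAt ℝ G (s, k x) := by
      have := (hG.of_le (m := 1) (by simp)).eventually (by simp)
      filter_upwards [hpair.eventually this] with s hs
      exact hs.differentiableAt one_ne_zero
    have hjac : ∀ᶠ s in 𝓝 t, jac (e ∘ H s) x =
        ((fderiv ℝ G (s, k x)).comp (ContinuousLinearMap.inr ℝ ℝ Plane)).det := by
      filter_upwards [hsrc, hdiff] with s hs hd
      rw [jac_chart ((mdifferentiableAt_of_mem_maximalAtlas hem hs).comp x (hmd s x))]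
      congr 1
      have h3 : HasFDerivAt (fun v : Plane => (s, v)) (ContinuousLinearMap.inr ℝ ℝ Plane) (k x) :=
        hasFDerivAt_prodMk_right s (k x)
      exact (hd.hasFDerivAt.comp (k x) h3).fderiv
    have hfac : ∀ᶠ s in 𝓝 t, jac (e ∘ H s) x = jac e (H s x) * jac (H s) x := by
      filter_upwards [hsrc] with s hs
      exact jac_comp (mdifferentiableAt_of_mem_maximalAtlas hem hs) (hmd s x)
    have hcont : ContinuousAt (fun s => jac (e ∘ H s) x) t := by
      have h4 : ContinuousAt (fun s =>
          ((fderiv ℝ G (s, k x)).comp (ContinuousLinearMap.inr ℝ ℝ Plane)).det) t := by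
        refine continuous_det.continuousAt.comp ?_
        refine ContinuousAt.clm_comp ?_ continuousAt_const
        exact (hG.continuousAt_fderiv (by simp)).comp_of_eq hpair rfl
      exact h4.congr (hjac.mono fun s hs => hs.symm)
    have hpos : ∀ y ∈ e.source, SignType.sign (jac e y) = 1 := fun y hy =>
      sign_pos (jac_pos_of_mem_atlas hS hea hy)
    have hne' : jac (e ∘ H t) x ≠ 0 := by
      rw [hfac.self_of_nhds]
      exact mul_ne_zero (jac_pos_of_mem_atlas hS hea hex).ne' (hne t ht)
    filter_upwards [eventually_sign_eq hcont hne', hsrc, hfac] with s hs hsr hf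
    rw [hf, hfac.self_of_nhds, sign_mul, sign_mul, hpos _ hsr, hpos _ hex, one_mul, one_mul] at hs
    exact hs
  have : PreconnectedSpace (Icc (0 : ℝ) 1) := Subtype.preconnectedSpace isPreconnected_Icc
  have hl : IsLocallyConstant fun s : Icc (0 : ℝ) 1 => SignType.sign (jac (H s) x) :=
    (IsLocallyConstant.iff_eventually_eq _).2 fun s =>
      (continuous_subtype_val.tendsto s).eventually (hloc s s.2)
  have h := hl.apply_eq_of_preconnectedSpace ⟨t, ht⟩ ⟨0, ⟨le_rfl, zero_le_one⟩⟩
  have h0' : H 0 = id := funext h0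
  simp only [h0', jac_id, sign_one, sign_eq_one_iff] at h
  exact h

end HomotopyZh
end

/-! ### How a transported frame changes at a side of the polygon. -/

noncomputable section
namespace HomotopyZh
open Filter Topology

variable {S : Type*} [TopologicalSpace S] [ChartedSpace Plane S] {g : ℕ} {Ω : SymplecticBasis S g}
  {q : Plane → S}

/-! ## Crossing the curves of the basis -/

lemma hasDerivAt_corner (u : ℝ) : HasDerivAt (corner g)
    ((2 * Real.pi / (4 * g)) • !₂[-(corner g u) 1, (corner g u) 0]) u := by
  have h : HasDerivAt (fun u : ℝ => 2 * Real.pi * u / (4 * g)) (2 * Real.pi / (4 * g)) u := by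
    simpa using ((hasDerivAt_id u).const_mul (2 * Real.pi)).div_const (4 * (g : ℝ))
  have h1 := (h.cos.smul_const (!₂[1, 0] : Plane)).add (h.sin.smul_const (!₂[0, 1] : Plane))
  have e : corner g = (fun u : ℝ => Real.cos (2 * Real.pi * u / (4 * g)) • (!₂[1, 0] : Plane)) +
      fun u : ℝ => Real.sin (2 * Real.pi * u / (4 * g)) • (!₂[0, 1] : Plane) := by
    funext u
    ext i; fin_cases i <;> simp [corner]
  rw [e]
  refine h1.congr_deriv ?_
  ext i; fin_cases i <;> simp <;> ring

lemma corner_ne_corner (hg : 0 < g) {u s : ℝ} {m : ℤ} (hs : s ∈ Ioo (0 : ℝ) 1) (hu : u = m + s) (n : ℕ) :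
    corner g u ≠ corner g n := by
  intro h
  obtain ⟨k, hk⟩ := (corner_eq_corner_iff hg).1 h
  have e : s = ((n + 4 * g * k - m : ℤ) : ℝ) := by push_cast; linarith
  have h0 : (0 : ℝ) < ((n + 4 * g * k - m : ℤ) : ℝ) := e ▸ hs.1
  have h1 : ((n + 4 * g * k - m : ℤ) : ℝ) < 1 := e ▸ hs.2
  have h0' : 0 < (n + 4 * g * k - m : ℤ) := by exact_mod_cast h0
  have h1' : (n + 4 * g * k - m : ℤ) < 1 := by exact_mod_cast h1
  omega

lemma sidePos_ne_corner (hg : 0 < g) (z : Palette g) {s : ℝ} (hs : s ∈ Ioo (0 : ℝ) 1) (n : ℕ) :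
    corner g (sidePos z s) ≠ corner g n := by
  obtain ⟨i, _ | _⟩ := z
  · exact corner_ne_corner hg (m := 4 * (i.rev : ℕ) + 2) hs (by simp [sidePos]) n
  · exact corner_ne_corner hg (m := 4 * (i.rev : ℕ) + 3) hs (by simp [sidePos]) n

lemma sideNeg_ne_corner (hg : 0 < g) (z : Palette g) {s : ℝ} (hs : s ∈ Ioo (0 : ℝ) 1) (n : ℕ) :
    corner g (sideNeg z s) ≠ corner g n := by
  have hs' : 1 - s ∈ Ioo (0 : ℝ) 1 := ⟨by linarith [hs.2], by linarith [hs.1]⟩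
  obtain ⟨i, _ | _⟩ := z
  · exact corner_ne_corner hg (m := 4 * (i.rev : ℕ)) hs' (by simp [sideNeg]) n
  · exact corner_ne_corner hg (m := 4 * (i.rev : ℕ) + 1) hs' (by simp [sideNeg]) n

/-- Curves lift through a local diffeomorphism. -/
lemma exists_lift [IsManifold (𝓡 2) ∞ S] {v : Plane} (hq : ContMDiffAt (𝓡 2) (𝓡 2) ∞ q v)
    (hj : jac q v ≠ 0) {c : ℝ → S} {t : ℝ} (hc : MDifferentiableAt 𝓘(ℝ, ℝ) (𝓡 2) c t)
    (hct : c t = q v) :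
    ∃ γ : ℝ → Plane, γ t = v ∧ DifferentiableAt ℝ γ t ∧ ∀ᶠ s in 𝓝 t, q (γ s) = c s := by
  set e := chartAt Plane (q v)
  have hev : q v ∈ e.source := mem_chart_source Plane _
  have hem : e ∈ IsManifold.maximalAtlas (𝓡 2) ∞ S :=
    IsManifold.subset_maximalAtlas (chart_mem_atlas Plane _)
  have hQ : ContDiffAt ℝ ∞ (e ∘ q) v := contMDiffAt_iff_contDiffAt.1
    (ContMDiffAt.comp v ((contMDiffOn_of_mem_maximalAtlas hem).contMDiffAt
      (e.open_source.mem_nhds hev)) hq)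
  have hdet : (fderiv ℝ (e ∘ q) v).det ≠ 0 := by
    rw [← jac_plane, jac_comp (mdifferentiableAt_of_mem_maximalAtlas hem hev)
      (hq.mdifferentiableAt (by simp))]
    exact mul_ne_zero (jac_ne_zero_of_mem_maximalAtlas hem hev) hj
  have hQs : HasStrictFDerivAt (e ∘ q)
      (((fderiv ℝ (e ∘ q) v).toContinuousLinearEquivOfDetNeZero hdet : Plane ≃L[ℝ] Plane) :
        Plane →L[ℝ] Plane) v := by
    rw [ContinuousLinearMap.coe_toContinuousLinearEquivOfDetNeZero]
    exact hQ.hasStrictFDerivAt (by simp)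
  have hcs : ContinuousAt c t := hc.continuousAt
  have hec : DifferentiableAt ℝ (e ∘ c) t := mdifferentiableAt_iff_differentiableAt.1
    (MDifferentiableAt.comp t (by rw [hct]; exact mdifferentiableAt_of_mem_maximalAtlas hem hev) hc)
  have ht : (e ∘ c) t = (e ∘ q) v := by simp [hct]
  refine ⟨HasStrictFDerivAt.localInverse (e ∘ q) _ v hQs ∘ e ∘ c, ?_, ?_, ?_⟩
  · change HasStrictFDerivAt.localInverse (e ∘ q) _ v hQs ((e ∘ c) t) = v
    rw [ht, hQs.localInverse_apply_image]
  · refine DifferentiableAt.comp t ?_ hec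
    rw [ht]
    exact hQs.to_localInverse.hasFDerivAt.differentiableAt
  · have h1 : Tendsto (e ∘ c) (𝓝 t) (𝓝 ((e ∘ q) v)) := ht ▸ hec.continuousAt.tendsto
    have h2 : Tendsto (fun s => q (HasStrictFDerivAt.localInverse (e ∘ q) _ v hQs (e (c s)))) (𝓝 t) (𝓝 (q v)) :=
      hq.continuousAt.tendsto.comp (hQs.localInverse_tendsto.comp h1)
    filter_upwards [h1.eventually hQs.eventually_right_inverse,
      h2.eventually (e.open_source.mem_nhds hev),
      hcs.eventually (e.open_source.mem_nhds (hct ▸ hev))] with s hs1 hs2 hs3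
    exact e.injOn hs2 hs3 hs1

lemma hasDerivAt_coord {γ : ℝ → Plane} {γ' : Plane} {t : ℝ} (h : HasDerivAt γ γ' t) (i : Fin 2) :
    HasDerivAt (fun s => γ s i) (γ' i) t :=
  ((EuclideanSpace.proj i : Plane →L[ℝ] ℝ).hasFDerivAt.comp_hasDerivAt t h)

/-- Near a boundary point `v` that is no corner, `q` is an orientation preserving local
diffeomorphism of the plane, so the curve lifts to some `γ` through `v`. The derivative of `‖γ‖² -
1` is twice the product of `v` and `γ'`, and this is up to a nonnegative factor `r` times the wedge
of the two velocities. Its sign decides when the lift is inside the polygon, where the frame is `1`.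
-/
lemma IsTransportAt.eventually_side [IsManifold (𝓡 2) ∞ S] (hq : IsCutPolygon Ω.loop q)
    {c : ℝ → S} {κ : ℝ → SurfaceGroup g} {t : ℝ} (hκ : IsTransportAt g q c κ t)
    (hc : MDifferentiableAt 𝓘(ℝ, ℝ) (𝓡 2) c t) {v : Plane} (hv : ‖v‖ = 1)
    (hvc : ∀ n : ℕ, v ≠ corner g n) (hct : c t = q v) {T : ℝ → Plane} {ℓ : ℝ → S} {s r : ℝ}
    (hTs : T s = v) (hT : HasDerivAt T (r • !₂[-(v 1), v 0]) s) (hℓ : ℓ =ᶠ[𝓝 s] q ∘ T) :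
    (r * wedge (velocity c t) (velocity ℓ s) < 0 →
      ∀ᶠ t' in 𝓝[>] t, κ t' = κ t * frame g v) ∧
    (0 < r * wedge (velocity c t) (velocity ℓ s) →
      ∀ᶠ t' in 𝓝[<] t, κ t' = κ t * frame g v) := by
  have hvP : v ∈ Metric.closedBall (0 : Plane) 1 := by simp [hv]
  obtain ⟨hqv, hj⟩ := hq.smooth v hvP hvc
  obtain ⟨γ, hγt, hγ, hqγ⟩ := exists_lift hqv hj.ne' hc hct
  have hqm : MDifferentiableAt (𝓡 2) (𝓡 2) q v := hqv.mdifferentiableAt (by simp)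
  have hw : wedge (velocity c t) (velocity ℓ s) =
      jac q v * wedge (deriv γ t) (r • !₂[-(v 1), v 0]) := by
    rw [velocity_congr (c := c) (c' := q ∘ γ) (hqγ.mono fun s h => h.symm), velocity_congr hℓ,
      wedge_velocity_comp (by rwa [hγt]) hγ.mdifferentiableAt
        hT.differentiableAt.mdifferentiableAt (by rw [hγt, hTs]), hγt, velocity_plane,
      velocity_plane, hT.deriv]
  have hN : HasDerivAt (fun t' => γ t' 0 ^ 2 + γ t' 1 ^ 2 - 1)
      (2 * (v 0 * deriv γ t 0 + v 1 * deriv γ t 1)) t := by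
    have h0 := (hasDerivAt_coord hγ.hasDerivAt 0).pow 2
    have h1 := (hasDerivAt_coord hγ.hasDerivAt 1).pow 2
    refine ((h0.add h1).sub_const 1).congr_deriv ?_
    rw [hγt]
    push_cast; ring
  have hN0 : γ t 0 ^ 2 + γ t 1 ^ 2 - 1 = 0 := by
    rw [hγt, ← norm_plane_sq, hv]; norm_num
  have hrw : r * wedge (velocity c t) (velocity ℓ s) =
      (r ^ 2 * jac q v / 2) * (2 * (v 0 * deriv γ t 0 + v 1 * deriv γ t 1)) := by
    rw [hw, wedge_smul_right, wedge]
    simp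
    ring
  have hnn : 0 ≤ r ^ 2 * jac q v / 2 := by
    have : 0 < jac q v := hj
    positivity
  have hκv := hκ v hvP hct.symm
  have htend : Tendsto (fun t' => (t', γ t')) (𝓝 t) (𝓝 (t, v)) := by
    have := tendsto_id.prodMk_nhds hγ.continuousAt.tendsto
    rwa [hγt] at this
  have key : ∀ᶠ t' in 𝓝 t, γ t' 0 ^ 2 + γ t' 1 ^ 2 - 1 < 0 → κ t' = κ t * frame g v := by
    filter_upwards [htend.eventually hκv, hqγ] with t' h1 h2 h3
    have hlt : ‖γ t'‖ < 1 := by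
      rw [← norm_plane_sq] at h3
      nlinarith [norm_nonneg (γ t')]
    have := h1 (by simpa using hlt.le) h2
    rwa [frame_of_norm_lt hlt, mul_one] at this
  constructor
  · intro h
    rw [hrw] at h
    have hneg : deriv (fun t' => γ t' 0 ^ 2 + γ t' 1 ^ 2 - 1) t < 0 := by
      rw [hN.deriv]; by_contra h'; rw [not_lt] at h'; nlinarith [mul_nonneg hnn h']
    have := eventually_nhdsWithin_sign_eq_of_deriv_neg hneg hN0
    filter_upwards [this.filter_mono nhdsWithin_le_nhds, key.filter_mono nhdsWithin_le_nhds,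
      self_mem_nhdsWithin] with t' h1 h2 h3
    refine h2 ?_
    rw [mem_Ioi] at h3
    exact sign_eq_neg_one_iff.1 (h1.trans (sign_neg (by linarith)))
  · intro h
    rw [hrw] at h
    have hpos : 0 < deriv (fun t' => γ t' 0 ^ 2 + γ t' 1 ^ 2 - 1) t := by
      rw [hN.deriv]; by_contra h'; rw [not_lt] at h'
      nlinarith [mul_nonneg hnn (neg_nonneg.2 h')]
    have := eventually_nhdsWithin_sign_eq_of_deriv_pos hpos hN0
    filter_upwards [this.filter_mono nhdsWithin_le_nhds, key.filter_mono nhdsWithin_le_nhds,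
      self_mem_nhdsWithin] with t' h1 h2 h3
    refine h2 ?_
    rw [mem_Iio] at h3
    exact sign_eq_neg_one_iff.1 (h1.trans (sign_neg (by linarith)))

/-- The frames before and after a transverse intersection with a curve of the basis. -/
lemma IsTransportAt.eventually_crossing [IsManifold (𝓡 2) ∞ S] (hq : IsCutPolygon Ω.loop q)
    (hg : 0 < g) {c : ℝ → S} {κ : ℝ → SurfaceGroup g} {t : ℝ} (hκ : IsTransportAt g q c κ t)
    (hc : MDifferentiableAt 𝓘(ℝ, ℝ) (𝓡 2) c t) {z : Palette g} {s : ℝ} (hs : s ∈ Ioo (0 : ℝ) 1)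
    (hct : c t = Ω.loop z s) :
    (wedge (velocity c t) (velocity (Ω.loop z) s) < 0 →
      (∀ᶠ t' in 𝓝[<] t, κ t' = κ t * sideLetter z) ∧ ∀ᶠ t' in 𝓝[>] t, κ t' = κ t) ∧
    (0 < wedge (velocity c t) (velocity (Ω.loop z) s) →
      (∀ᶠ t' in 𝓝[<] t, κ t' = κ t) ∧ ∀ᶠ t' in 𝓝[>] t, κ t' = κ t * sideLetter z) := by
  have hs' : s ∈ Icc (0 : ℝ) 1 := ⟨hs.1.le, hs.2.le⟩
  have hr : (0 : ℝ) < 2 * Real.pi / (4 * g) := by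
    have : (0 : ℝ) < g := by exact_mod_cast hg
    have := Real.pi_pos
    positivity
  have hnear : ∀ᶠ s' in 𝓝 s, s' ∈ Icc (0 : ℝ) 1 := Icc_mem_nhds hs.1 hs.2
  have dpos : HasDerivAt (fun s => corner g (sidePos z s)) ((2 * Real.pi / (4 * g)) •
      !₂[-(corner g (sidePos z s)) 1, (corner g (sidePos z s)) 0]) s := by
    have h : HasDerivAt (sidePos z) 1 s := by
      obtain ⟨i, _ | _⟩ := z
      · exact (hasDerivAt_id s).const_add _
      · exact (hasDerivAt_id s).const_add _
    have := (hasDerivAt_corner (g := g) (sidePos z s)).scomp s h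
    rwa [one_smul] at this
  -- With growing parameter the side labelled `z⁻¹` is run through clockwise. The curve therefore
  -- leaves the polygon at one side of the pair when it enters at the other.
  have dneg : HasDerivAt (fun s => corner g (sideNeg z s)) ((-(2 * Real.pi / (4 * g))) •
      !₂[-(corner g (sideNeg z s)) 1, (corner g (sideNeg z s)) 0]) s := by
    have h : HasDerivAt (sideNeg z) (-1) s := by
      obtain ⟨i, _ | _⟩ := z
      · exact ((hasDerivAt_id s).const_sub 1).const_add _
      · exact ((hasDerivAt_id s).const_sub 1).const_add _
    have := (hasDerivAt_corner (g := g) (sideNeg z s)).scomp s h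
    rwa [smul_smul, neg_one_mul] at this
  have h1 := hκ.eventually_side (T := fun s => corner g (sidePos z s)) (s := s) hq hc (norm_corner (sidePos z s)) (sidePos_ne_corner hg z hs)
    (hct.trans (hq.sidePos z hs').symm) rfl dpos
    (hnear.mono fun s' h => (hq.sidePos z h).symm : Ω.loop z =ᶠ[𝓝 s] _)
  have h2 := hκ.eventually_side (T := fun s => corner g (sideNeg z s)) (s := s) hq hc (norm_corner (sideNeg z s)) (sideNeg_ne_corner hg z hs)
    (hct.trans (hq.sideNeg z hs').symm) rfl dneg
    (hnear.mono fun s' h => (hq.sideNeg z h).symm : Ω.loop z =ᶠ[𝓝 s] _)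
  rw [frame_sidePos hg z hs, mul_one] at h1
  rw [frame_sideNeg hg z hs', frame_sidePos hg z hs, one_mul] at h2
  refine ⟨fun h => ⟨h2.2 ?_, h1.1 (mul_neg_of_pos_of_neg hr h)⟩,
    fun h => ⟨h1.2 (mul_pos hr h), h2.1 ?_⟩⟩
  · exact mul_pos_of_neg_of_neg (neg_lt_zero.2 hr) h
  · exact mul_neg_of_neg_of_pos (neg_lt_zero.2 hr) h

/-- Away from the curves of the basis the frames do not change. -/
lemma IsTransportAt.eventually_eq [T2Space S] (hq : IsCutPolygon Ω.loop q) (hg : 0 < g) {A : Type*}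
    [TopologicalSpace A] {c : A → S} {κ : A → SurfaceGroup g} {a : A}
    (hκ : IsTransportAt g q c κ a) (hc : ContinuousAt c a)
    (h : ∀ z, ∀ s ∈ Icc (0 : ℝ) 1, c a ≠ Ω.loop z s) : ∀ᶠ b in 𝓝 a, κ b = κ a := by
  have hmem : c a ∈ q '' Metric.ball 0 1 := by
    rw [hq.image]
    intro hm
    obtain ⟨z, s, hs, e⟩ := mem_iUnion.1 hm
    exact h z s hs e.symm
  obtain ⟨v, hv, hvc⟩ := hmem
  have hball : ∀ w ∈ Metric.closedBall (0 : Plane) 1, q w = c a → w ∈ Metric.ball (0 : Plane) 1 := by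
    intro w hw hwc
    rcases lt_or_eq_of_le (mem_closedBall_zero_iff.1 hw) with h1 | h1
    · simpa using h1
    · exfalso
      obtain ⟨z, s, hs, rfl | rfl⟩ := exists_side hg h1
      · exact h z s hs (hwc.symm.trans (hq.sidePos z hs))
      · exact h z s hs (hwc.symm.trans (hq.sideNeg z hs))
  have := hq.eventually_of_fiber hc (p := fun b _ => κ b = κ a) ?_
  · filter_upwards [this] with b hb
    obtain ⟨w, hw, hwb⟩ := hq.exists_preimage (c b)
    exact hb w hw hwb
  intro w hw hwc
  have hwb := hball w hw hwc
  have h1 : ∀ᶠ y : A × Plane in 𝓝 (a, w), y.2 ∈ Metric.ball (0 : Plane) 1 :=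
    (continuous_snd.tendsto (a, w)).eventually (Metric.isOpen_ball.mem_nhds hwb)
  filter_upwards [hκ w hw hwc, h1] with y hy hy1 hy2 hy3
  have := hy hy2 hy3
  rwa [frame_of_norm_lt (by simpa using hy1), frame_of_norm_lt (by simpa using hwb), mul_one,
    mul_one] at this

/-- Frames along an interval that avoids the curves of the basis. -/
lemma IsTransport.eq_of_avoids [T2Space S] (hq : IsCutPolygon Ω.loop q) (hg : 0 < g)
    {c : ℝ → S} {κ : ℝ → SurfaceGroup g} (hκ : IsTransport g q c κ) (hc : Continuous c) {I : Set ℝ}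
    (hI : IsPreconnected I) (h : ∀ t ∈ I, ∀ z, ∀ s ∈ Icc (0 : ℝ) 1, c t ≠ Ω.loop z s) {t t' : ℝ}
    (ht : t ∈ I) (ht' : t' ∈ I) : κ t = κ t' := by
  have : PreconnectedSpace I := Subtype.preconnectedSpace hI
  have hl : IsLocallyConstant fun t : I => κ t :=
    (IsLocallyConstant.iff_eventually_eq _).2 fun t =>
      (continuous_subtype_val.tendsto t).eventually
        ((hκ t).eventually_eq hq hg hc.continuousAt (h t t.2))
  exact hl.apply_eq_of_preconnectedSpace ⟨t, ht⟩ ⟨t', ht'⟩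

end HomotopyZh
end

/-! ### Times on the circle, ends sorted by time, and presentations of link diagrams by holonomies.
-/

noncomputable section
namespace HomotopyZh
open Filter Topology

/-! ## Sorted lists -/

lemma exists_sorted {α : Type*} (s : Finset α) (f : α → ℝ) (hf : InjOn f s) :
    ∃ l : List α, (∀ a, a ∈ l ↔ a ∈ s) ∧ l.Pairwise fun a b => f a < f b := by
  classical
  induction s using Finset.induction_on_max_value f with
  | empty => exact ⟨[], by simp, .nil⟩
  | insert a s ha hmax ih =>
    obtain ⟨l, hl, hp⟩ := ih (hf.mono (by simp))
    refine ⟨l ++ [a], fun b => by simp [hl, or_comm], ?_⟩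
    rw [List.pairwise_append]
    refine ⟨hp, List.pairwise_singleton _ _, fun b hb c hc => ?_⟩
    rw [List.mem_singleton] at hc
    subst hc
    have hbs := (hl b).1 hb
    refine lt_of_le_of_ne (hmax b hbs) fun h => ha ?_
    rw [← hf (by simp [hbs]) (by simp) h]
    exact hbs

lemma sorted_nodup {α : Type*} {f : α → ℝ} {l : List α} (h : l.Pairwise fun a b => f a < f b) :
    l.Nodup := h.imp fun hab hne => absurd (congrArg f hne) hab.ne

/-- All comparisons of the order of ends along components go through this: a list sorted by time is
determined by its members. -/
lemma sorted_ext {α : Type*} {f : α → ℝ} {l l' : List α} (h : l.Pairwise fun a b => f a < f b)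
    (h' : l'.Pairwise fun a b => f a < f b) (hm : ∀ a, a ∈ l ↔ a ∈ l') : l = l' :=
  List.Perm.eq_of_pairwise (fun _ _ _ _ h1 h2 => absurd h1 h2.asymm) h h'
    ((List.perm_ext_iff_of_nodup (sorted_nodup h) (sorted_nodup h')).2 hm)

lemma sorted_consecutive {α : Type*} {f : α → ℝ} {l : List α}
    (h : l.Pairwise fun a b => f a < f b) {a b : α} (ha : a ∈ l) (hb : b ∈ l) (hab : f a < f b)
    (hc : ∀ c ∈ l, f a < f c → f c < f b → False) : ∃ p q, l = p ++ a :: b :: q := by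
  obtain ⟨p, r, rfl⟩ := List.append_of_mem ha
  rw [List.pairwise_append, List.pairwise_cons] at h
  obtain ⟨-, ⟨h1, h2⟩, h3⟩ := h
  have hbr : b ∈ r := by
    rcases List.mem_append.1 hb with hb | hb
    · exact absurd (h3 b hb a (by simp)) hab.asymm
    · rcases List.mem_cons.1 hb with rfl | hb
      · exact absurd hab (lt_irrefl _)
      · exact hb
  rcases r with _ | ⟨c, r⟩
  · simp at hbr
  · rcases List.mem_cons.1 hbr with rfl | hbr
    · exact ⟨p, r, rfl⟩
    · exact (hc c (by simp) (h1 c (by simp)) ((List.pairwise_cons.1 h2).1 b hbr)).elim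

/-! ## Times -/

/-- The parameter of a point of the circle in `[T, T + 1)`. -/
def time (T : ℝ) (p : UnitAddCircle) : ℝ := AddCircle.equivIco 1 T p

lemma time_mem (T : ℝ) (p : UnitAddCircle) : time T p ∈ Ico T (T + 1) :=
  (AddCircle.equivIco 1 T p).2

@[simp] lemma coe_time (T : ℝ) (p : UnitAddCircle) : ((time T p : ℝ) : UnitAddCircle) = p :=
  (AddCircle.equivIco 1 T).symm_apply_apply p

lemma coe_eq_coe_iff {s t : ℝ} : (s : UnitAddCircle) = t ↔ ∃ n : ℤ, s = t + n := by
  rw [← sub_eq_zero, ← AddCircle.coe_sub, AddCircle.coe_eq_zero_iff]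
  refine exists_congr fun n => ?_
  rw [zsmul_eq_mul, mul_one]
  constructor <;> intro h <;> linarith

lemma coe_add_intCast (t : ℝ) (n : ℤ) : ((t + n : ℝ) : UnitAddCircle) = t :=
  coe_eq_coe_iff.2 ⟨n, rfl⟩

lemma time_coe {T t : ℝ} (ht : t ∈ Ico T (T + 1)) : time T t = t := by
  have h := AddCircle.equivIco_coe_eq (p := (1 : ℝ)) (a := T) ht
  rw [time, h]

lemma time_eq {T t : ℝ} {p : UnitAddCircle} (ht : t ∈ Ico T (T + 1)) (hp : (t : UnitAddCircle) = p) :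
    time T p = t := by
  rw [← hp, time_coe ht]

lemma time_injective (T : ℝ) : Function.Injective (time T) :=
  Function.LeftInverse.injective (coe_time T)

lemma time_add_intCast (T : ℝ) (n : ℤ) (p : UnitAddCircle) : time (T + n) p = time T p + n := by
  have h := time_mem T p
  refine time_eq ⟨by linarith [h.1], by linarith [h.2]⟩ ?_
  rw [coe_add_intCast, coe_time]

namespace LinkDiagram

variable {S : Type*} [TopologicalSpace S] [ChartedSpace Plane S] {ι : Type*} (D : LinkDiagram S ι)

/-- The components of a link diagram as periodic curves. -/
def line (i : ι) (t : ℝ) : S := D.curve i (t : UnitAddCircle)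

lemma contMDiff_line (i : ι) : ContMDiff 𝓘(ℝ, ℝ) (𝓡 2) ∞ (D.line i) := D.smooth i

lemma mdifferentiableAt_line (i : ι) (t : ℝ) : MDifferentiableAt 𝓘(ℝ, ℝ) (𝓡 2) (D.line i) t :=
  (D.contMDiff_line i t).mdifferentiableAt (by simp)

lemma continuous_line (i : ι) : Continuous (D.line i) := (D.contMDiff_line i).continuous

lemma line_add_intCast (i : ι) (t : ℝ) (n : ℤ) : D.line i (t + n) = D.line i t := by
  rw [line, coe_add_intCast, line]

lemma pt_coe (i : ι) (t : ℝ) : D.pt (i, (t : UnitAddCircle)) = D.line i t := rfl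

lemma vel_coe (i : ι) (t : ℝ) : D.vel (i, (t : UnitAddCircle)) = velocity (D.line i) t := by
  have h := velocity_comp_real (c := D.line i) (f := fun s => t + s) (t := 0)
    (D.mdifferentiableAt_line i _) (by fun_prop)
  have e : deriv (fun s : ℝ => t + s) 0 = 1 := by simp
  rw [e, one_smul] at h
  simp only [add_zero] at h
  rw [← h]
  rfl

lemma velocity_line_ne_zero (i : ι) (t : ℝ) : velocity (D.line i) t ≠ 0 := by
  rw [← D.vel_coe]; exact D.immersed i t

/-- The parameter at which an end of a crossing is met. -/
def endPt : D.crossings × Role → ι × UnitAddCircle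
  | (c, .over) => c.1.1
  | (c, .under) => c.1.2

lemma pt_fst_eq_snd {c : (ι × UnitAddCircle) × (ι × UnitAddCircle)} (hc : c ∈ D.crossings) :
    D.pt c.1 = D.pt c.2 :=
  (D.double c.1 c.2 (D.ne c hc)).2 (.inl hc)

lemma eq_of_mem_mem {p r r' : ι × UnitAddCircle} (h : (p, r) ∈ D.crossings ∨ (r, p) ∈ D.crossings)
    (h' : (p, r') ∈ D.crossings ∨ (r', p) ∈ D.crossings) : r = r' := by
  have key : ∀ {r}, ((p, r) ∈ D.crossings ∨ (r, p) ∈ D.crossings) → p ≠ r ∧ D.pt p = D.pt r := by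
    rintro r (h | h)
    · exact ⟨D.ne _ h, D.pt_fst_eq_snd h⟩
    · exact ⟨(D.ne _ h).symm, (D.pt_fst_eq_snd h).symm⟩
  by_contra hne
  obtain ⟨h1, h2⟩ := key h
  obtain ⟨h3, h4⟩ := key h'
  exact D.no_triple p r r' h1 hne h3 ⟨h2, h2.symm.trans h4⟩

lemma endPt_injective : Function.Injective D.endPt := by
  rintro ⟨⟨⟨p, r⟩, hc⟩, e⟩ ⟨⟨⟨p', r'⟩, hc'⟩, e'⟩ h
  rcases e with _ | _ <;> rcases e' with _ | _ <;> simp only [endPt] at h <;> subst h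
  · obtain rfl := D.eq_of_mem_mem (.inl hc) (.inl hc'); rfl
  · obtain rfl := D.eq_of_mem_mem (.inl hc) (.inr hc'); exact absurd hc' (D.asymm _ hc)
  · obtain rfl := D.eq_of_mem_mem (.inr hc) (.inl hc'); exact absurd hc' (D.asymm _ hc)
  · obtain rfl := D.eq_of_mem_mem (.inr hc) (.inr hc'); rfl

/-- The time at which an end of a crossing is met, when component `i` starts at time `T i`. -/
def endTime (T : ι → ℝ) (e : D.crossings × Role) : ℝ := time (T (D.endPt e).1) (D.endPt e).2

lemma endTime_injOn (T : ι → ℝ) (i : ι) : InjOn (D.endTime T) {e | (D.endPt e).1 = i} := by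
  intro e he f hf h
  have he' : (D.endPt e).1 = i := he
  have hf' : (D.endPt f).1 = i := hf
  simp only [endTime, he', hf'] at h
  exact D.endPt_injective (Prod.ext (he'.trans hf'.symm) (time_injective _ h))

end LinkDiagram

/-! ## Presentations -/

instance : Fintype Role :=
  ⟨⟨[Role.over, Role.under], by simp⟩, by rintro (_ | _) <;> simp⟩

lemma sign_eq_sign {ε ε' : ℤˣ} {a b : ℝ} (h : 0 < ((ε : ℤ) : ℝ) * a) (h' : 0 < ((ε' : ℤ) : ℝ) * b)
    (hab : 0 < a * b) : ε = ε' := by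
  rcases Int.units_eq_one_or ε with rfl | rfl <;> rcases Int.units_eq_one_or ε' with rfl | rfl
  · rfl
  · push_cast at h h'; nlinarith
  · push_cast at h h'; nlinarith
  · rfl

lemma exists_sign {a : ℝ} (h : a ≠ 0) : ∃ ε : ℤˣ, 0 < ((ε : ℤ) : ℝ) * a := by
  rcases lt_or_gt_of_ne h with h | h
  · exact ⟨-1, by push_cast; linarith⟩
  · exact ⟨1, by push_cast; linarith⟩

section
variable {S : Type*} [TopologicalSpace S] [ChartedSpace Plane S] {ι : Type*} {g : ℕ}

/-- `Θ` is the holonomy of the diagram `D` when component `i` starts at time `T i`, the frames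
`κ i` are carried along component `i`, and the frames `b` are used at the crossings. -/
structure Presents (q : Plane → S) (D : LinkDiagram S ι) (T : ι → ℝ) (κ : ι → ℝ → SurfaceGroup g)
    (b : D.crossings → SurfaceGroup g) (Θ : Holonomy ι D.crossings g) : Prop where
  transport : ∀ i, IsTransport g q (D.line i) (κ i)
  sign : ∀ c, 0 < ((Θ.sign c : ℤ) : ℝ) * wedge (D.vel c.1.1) (D.vel c.1.2)
  mem_ends : ∀ i e, e ∈ Θ.ends i ↔ (D.endPt e).1 = i
  sorted : ∀ i, (Θ.ends i).Pairwise fun e f => D.endTime T e < D.endTime T f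
  state : ∀ e, Θ.state e = κ (D.endPt e).1 (D.endTime T e) * (b e.1)⁻¹
  mono : ∀ i, Θ.mono i = κ i (T i + 1) * (κ i (T i))⁻¹

lemma exists_presents (q : Plane → S) (D : LinkDiagram S ι) (T : ι → ℝ)
    {κ : ι → ℝ → SurfaceGroup g} (hκ : ∀ i, IsTransport g q (D.line i) (κ i))
    (b : D.crossings → SurfaceGroup g) : ∃ Θ : Holonomy ι D.crossings g, Presents q D T κ b Θ := by
  classical
  have := D.finite.to_subtype
  have := Fintype.ofFinite D.crossings
  choose sg hsg using fun c : D.crossings => exists_sign (D.transverse c.1 c.2)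
  choose l hl hp using fun i => exists_sorted (Finset.univ.filter fun e => (D.endPt e).1 = i)
    (D.endTime T) ((D.endTime_injOn T i).mono fun e he => by simpa using he)
  have hm : ∀ i e, e ∈ l i ↔ (D.endPt e).1 = i := fun i e => by simp [hl]
  exact ⟨⟨sg, l, fun e => κ (D.endPt e).1 (D.endTime T e) * (b e.1)⁻¹,
    fun i => κ i (T i + 1) * (κ i (T i))⁻¹,
    fun e => ⟨_, (hm _ e).2 rfl, fun i hi => ((hm i e).1 hi).symm⟩, fun i => sorted_nodup (hp i)⟩,
    hκ, hsg, hm, hp, fun _ => rfl, fun _ => rfl⟩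

namespace Presents

variable {Ω : SymplecticBasis S g} {q : Plane → S} {D D' : LinkDiagram S ι} {T T' : ι → ℝ}
  {κ κ' : ι → ℝ → SurfaceGroup g} {b : D.crossings → SurfaceGroup g}
  {b' : D'.crossings → SurfaceGroup g} {Θ : Holonomy ι D.crossings g}
  {Θ' : Holonomy ι D'.crossings g}

/-- By periodicity `κ i` shifted by one turn is again a transport along component `i`, hence differs
from `κ i` by a constant factor from the left. -/
lemma monodromy [T2Space S] (hq : IsCutPolygon Ω.loop q) (h : Presents q D T κ b Θ) (i : ι) (t : ℝ) :
    κ i (t + 1) = Θ.mono i * κ i t := by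
  have hk : Continuous fun t : ℝ => t + 1 := by fun_prop
  have e : D.line i ∘ (fun t : ℝ => t + 1) = D.line i := by
    funext t; simpa using D.line_add_intCast i t 1
  have h1 := (h.transport i).comp hk
  rw [e] at h1
  have := (h.transport i).mul_inv_eq hq (D.continuous_line i) h1 t (T i)
  simp only [Function.comp_apply] at this
  rw [h.mono, ← this]
  group

/-- Corresponding presentations of diagrams with corresponding crossings. -/
lemma equivalent_of_equiv [Finite ι] (h : Presents q D T κ b Θ) (h' : Presents q D' T' κ' b' Θ')
    (f : D.crossings ≃ D'.crossings)
    (hw : ∀ c, 0 < wedge (D.vel c.1.1) (D.vel c.1.2) *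
      wedge (D'.vel (f c).1.1) (D'.vel (f c).1.2))
    (hi : ∀ e, (D'.endPt (Prod.map f id e)).1 = (D.endPt e).1)
    (ht : ∀ e e', (D.endPt e).1 = (D.endPt e').1 → D.endTime T e < D.endTime T e' →
      D'.endTime T' (Prod.map f id e) < D'.endTime T' (Prod.map f id e'))
    (hst : ∀ e, Θ'.state (Prod.map f id e) = Θ.state e) (hm : Θ'.mono = Θ.mono) :
    Θ.Equivalent Θ' := by
  have := D.finite.to_subtype
  have := D'.finite.to_subtype
  refine Holonomy.equivalent_rename f (fun c => ?_) (fun i => ?_) hst hm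
  · exact (sign_eq_sign (h.sign c) (h'.sign (f c)) (hw c)).symm
  · refine sorted_ext (h'.sorted i) ?_ fun e => ?_
    · rw [List.pairwise_map]
      refine (List.pairwise_iff_forall_sublist.2 fun {e e'} hs => ?_)
      have he := (h.mem_ends i e).1 (hs.subset (by simp))
      have he' := (h.mem_ends i e').1 (hs.subset (by simp))
      have := (h.sorted i).forall_sublist hs
      exact ht e e' (he.trans he'.symm) this
    · rw [h'.mem_ends, List.mem_map]
      constructor
      · intro he
        have e₁ : Prod.map f id (Prod.map f.symm id e) = e := Prod.ext (f.apply_symm_apply _) rfl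
        refine ⟨Prod.map f.symm id e, ?_, e₁⟩
        rw [h.mem_ends, ← hi, e₁, he]
      · rintro ⟨e', he', rfl⟩
        rw [hi]
        exact (h.mem_ends i e').1 he'

/-- Different frames. -/
lemma equivalent_frames [T2Space S] [Finite ι] (hq : IsCutPolygon Ω.loop q)
    {b' : D.crossings → SurfaceGroup g} {Θ' : Holonomy ι D.crossings g}
    (h : Presents q D T κ b Θ) (h' : Presents q D T κ' b' Θ') : Θ.Equivalent Θ' := by
  have := D.finite.to_subtype
  have hc : ∀ i t, κ' i t = κ' i 0 * (κ i 0)⁻¹ * κ i t := by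
    intro i t
    have := (h.transport i).mul_inv_eq hq (D.continuous_line i) (h'.transport i) t 0
    rw [← this]; group
  -- The frames at the crossings are changed by a gauge transformation. The two transports along a
  -- component differ by a constant, which is a change of frame at its starting point.
  refine (Θ.equivalent_gauge fun c => b c * (b' c)⁻¹).trans (Holonomy.equivalent_smul
    (fun i => κ' i 0 * (κ i 0)⁻¹) ?_ ?_ ?_ ?_)
  · funext c
    refine (sign_eq_sign (h.sign c) (h'.sign c) ?_).symm
    exact mul_self_pos.2 (D.transverse c.1 c.2)
  · funext i
    exact sorted_ext (h'.sorted i) (h.sorted i) fun e => (h'.mem_ends i e).trans (h.mem_ends i e).symm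
  · intro i e he
    have hei : (D.endPt e).1 = i := (h.mem_ends i e).1 he
    rw [h'.state, hei, hc]
    simp only [Holonomy.gauge, h.state, hei]
    group
  · intro i
    simp only [Holonomy.gauge]
    rw [h'.mono, h.mono, hc i (T i + 1), hc i (T i)]
    group

/-- Different starting points. -/
lemma equivalent_start [T2Space S] [Finite ι] (hq : IsCutPolygon Ω.loop q)
    {Θ' : Holonomy ι D.crossings g}
    (h : Presents q D T κ b Θ) (h' : Presents q D T' κ b Θ')
    (hT : ∀ i, T' i ∈ Ico (T i) (T i + 1)) : Θ.Equivalent Θ' := by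
  classical
  have := D.finite.to_subtype
  have hlt : ∀ e, D.endTime T e < T' (D.endPt e).1 → D.endTime T' e = D.endTime T e + 1 := by
    intro e he
    have h1 := time_mem (T (D.endPt e).1) (D.endPt e).2
    have h2 := hT (D.endPt e).1
    refine time_eq ⟨?_, ?_⟩ ?_
    · have := h1.1; simp only [LinkDiagram.endTime]; linarith [h2.2]
    · linarith
    · simpa [LinkDiagram.endTime] using coe_add_intCast (D.endTime T e) 1
  have hge : ∀ e, ¬ D.endTime T e < T' (D.endPt e).1 → D.endTime T' e = D.endTime T e := by
    intro e he
    have h1 := time_mem (T (D.endPt e).1) (D.endPt e).2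
    have h2 := hT (D.endPt e).1
    refine time_eq ⟨not_lt.1 he, ?_⟩ (coe_time _ _)
    have := h1.2; simp only [LinkDiagram.endTime]; linarith [h2.1]
  have hmono : Θ'.mono = Θ.mono := by
    funext i
    rw [h'.mono, h.monodromy hq]; group
  refine Holonomy.equivalent_rotate ?_ (fun i => ?_) hmono
  · funext c
    refine (sign_eq_sign (h.sign c) (h'.sign c) ?_).symm
    exact mul_self_pos.2 (D.transverse c.1 c.2)
  have mem : ∀ e ∈ Θ.ends i, (D.endPt e).1 = i := fun e => (h.mem_ends i e).1
  have hlen : ∀ e ∈ Θ.ends i, ∀ f ∈ Θ.ends i, D.endTime T e < D.endTime T f + 1 := by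
    intro e he f hf
    have h1 := (time_mem (T (D.endPt e).1) (D.endPt e).2).2
    have h2 := (time_mem (T (D.endPt f).1) (D.endPt f).2).1
    rw [mem e he] at h1
    rw [mem f hf] at h2
    simp only [LinkDiagram.endTime, mem e he, mem f hf]
    linarith
  -- The ends met between the old and the new starting time are now met at the end of the turn, in a
  -- state multiplied by the monodromy.
  refine ⟨(Θ.ends i).filter fun e => D.endTime T e < T' i,
    (Θ.ends i).filter fun e => ¬ D.endTime T e < T' i, ?_, ?_, ?_, ?_⟩
  · refine sorted_ext (h.sorted i) ?_ fun e => ?_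
    · rw [List.pairwise_append]
      refine ⟨(h.sorted i).filter _, (h.sorted i).filter _, fun e he f hf => ?_⟩
      simp only [List.mem_filter, decide_eq_true_eq] at he hf
      linarith [he.2, not_lt.1 hf.2]
    · simp only [List.mem_append, List.mem_filter, decide_eq_true_eq]
      tauto
  · refine sorted_ext (h'.sorted i) ?_ fun e => ?_
    · rw [List.pairwise_append]
      refine ⟨?_, ?_, fun e he f hf => ?_⟩
      · refine ((h.sorted i).filter _).imp_of_mem fun {e f} he hf hef => ?_
        simp only [List.mem_filter, decide_eq_true_eq] at he hf
        rwa [hge e (by rw [mem e he.1]; exact he.2), hge f (by rw [mem f hf.1]; exact hf.2)]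
      · refine ((h.sorted i).filter _).imp_of_mem fun {e f} he hf hef => ?_
        simp only [List.mem_filter, decide_eq_true_eq] at he hf
        rw [hlt e (by rw [mem e he.1]; exact he.2), hlt f (by rw [mem f hf.1]; exact hf.2)]
        linarith
      · simp only [List.mem_filter, decide_eq_true_eq] at he hf
        rw [hge e (by rw [mem e he.1]; exact he.2), hlt f (by rw [mem f hf.1]; exact hf.2)]
        exact hlen e he.1 f hf.1
    · simp only [List.mem_append, List.mem_filter, decide_eq_true_eq, h'.mem_ends, h.mem_ends]
      tauto
  · intro e he
    simp only [List.mem_filter, decide_eq_true_eq] at he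
    rw [h'.state, h.state, hlt e (by rw [mem e he.1]; exact he.2), h.monodromy hq, mem e he.1]
    group
  · intro e he
    simp only [List.mem_filter, decide_eq_true_eq] at he
    rw [h'.state, h.state, hge e (by rw [mem e he.1]; exact he.2)]

/-- Shifting the times. -/
lemma shift (h : Presents q D T κ b Θ) (n : ι → ℤ) :
    Presents q D (fun i => T i + n i) (fun i t => κ i (t - n i)) b Θ := by
  have ht : ∀ e, D.endTime (fun i => T i + n i) e = D.endTime T e + n (D.endPt e).1 := fun e =>
    time_add_intCast _ _ _
  refine ⟨fun i => ?_, h.sign, h.mem_ends, fun i => ?_, fun e => ?_, fun i => ?_⟩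
  · have hk : Continuous fun t : ℝ => t - n i := by fun_prop
    have e : D.line i ∘ (fun t : ℝ => t - n i) = D.line i := by
      funext t
      have := D.line_add_intCast i t (-n i)
      simpa [sub_eq_add_neg] using this
    have h1 := (h.transport i).comp hk
    rwa [e] at h1
  · refine (h.sorted i).imp_of_mem fun {e f} he hf hef => ?_
    rw [ht, ht, (h.mem_ends i e).1 he, (h.mem_ends i f).1 hf]
    linarith
  · rw [h.state, ht, add_sub_cancel_right]
  · rw [h.mono, add_sub_cancel_right]
    congr 2
    ring

/-- Any two presentations of a diagram are equivalent. -/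
lemma equivalent [T2Space S] [Finite ι] (hq : IsCutPolygon Ω.loop q)
    {b' : D.crossings → SurfaceGroup g} {Θ' : Holonomy ι D.crossings g}
    (h : Presents q D T κ b Θ) (h' : Presents q D T' κ' b' Θ') : Θ.Equivalent Θ' := by
  have := D.finite.to_subtype
  -- A shift by whole turns brings the old starting time within one turn before the new one, as
  -- `equivalent_start` requires.
  have h1 := h.shift fun i => ⌊T' i - T i⌋
  obtain ⟨Θ₁, hΘ₁⟩ := exists_presents q D T' h1.transport b
  refine (h1.equivalent_start hq hΘ₁ fun i => ?_).trans (hΘ₁.equivalent_frames hq h')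
  have h2 := Int.floor_le (T' i - T i)
  have h3 := Int.lt_floor_add_one (T' i - T i)
  constructor <;> linarith

end Presents

end

end HomotopyZh
end

/-! ### Invariance of the holonomy under isotopy and reparametrization. -/

noncomputable section
namespace HomotopyZh
open Filter Topology

variable {S : Type*} [TopologicalSpace S] [ChartedSpace Plane S] {ι : Type*} {g : ℕ}
  {Ω : SymplecticBasis S g} {q : Plane → S} {D D' D'' : LinkDiagram S ι}

variable (g q) in
/-- All presentations of `D` and `D'` are equivalent. -/
def HolonomyEquivalent (D D' : LinkDiagram S ι) : Prop :=
  ∀ T κ b (Θ : Holonomy ι D.crossings g) T' κ' b' (Θ' : Holonomy ι D'.crossings g),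
    Presents q D T κ b Θ → Presents q D' T' κ' b' Θ' → Θ.Equivalent Θ'

lemma IsCutPolygon.exists_transport_line [T2Space S] (hq : IsCutPolygon Ω.loop q) (hg : 0 < g)
    (D : LinkDiagram S ι) :
    ∃ κ : ι → ℝ → SurfaceGroup g, ∀ i, IsTransport g q (D.line i) (κ i) :=
  ⟨_, fun i => (hq.exists_transport hg (D.continuous_line i)).choose_spec⟩

namespace HolonomyEquivalent

variable [Finite ι]

lemma of_presents [T2Space S] (hq : IsCutPolygon Ω.loop q) {T κ b T' κ' b'}
    {Θ : Holonomy ι D.crossings g} {Θ' : Holonomy ι D'.crossings g} (h : Presents q D T κ b Θ)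
    (h' : Presents q D' T' κ' b' Θ') (he : Θ.Equivalent Θ') : HolonomyEquivalent g q D D' := by
  intro T₁ κ₁ b₁ Θ₁ T₂ κ₂ b₂ Θ₂ h₁ h₂
  have := D.finite.to_subtype
  have := D'.finite.to_subtype
  exact ((h₁.equivalent hq h).trans he).trans (h'.equivalent hq h₂)

lemma refl [T2Space S] (hq : IsCutPolygon Ω.loop q) (D : LinkDiagram S ι) :
    HolonomyEquivalent g q D D :=
  fun _ _ _ _ _ _ _ _ h h' => h.equivalent hq h'

lemma symm (h : HolonomyEquivalent g q D D') : HolonomyEquivalent g q D' D := by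
  intro T κ b Θ T' κ' b' Θ' h₁ h₂
  have := D.finite.to_subtype
  have := D'.finite.to_subtype
  exact (h _ _ _ _ _ _ _ _ h₂ h₁).symm

lemma trans [T2Space S] (hq : IsCutPolygon Ω.loop q) (hg : 0 < g) (h : HolonomyEquivalent g q D D')
    (h' : HolonomyEquivalent g q D' D'') : HolonomyEquivalent g q D D'' := by
  intro T κ b Θ T' κ' b' Θ' h₁ h₂
  have := D.finite.to_subtype
  have := D'.finite.to_subtype
  have := D''.finite.to_subtype
  obtain ⟨κ₀, hκ₀⟩ := hq.exists_transport_line hg D'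
  obtain ⟨Θ₀, hΘ₀⟩ := exists_presents q D' (fun _ => 0) hκ₀ fun _ => 1
  exact (h _ _ _ _ _ _ _ _ h₁ hΘ₀).trans (h' _ _ _ _ _ _ _ _ hΘ₀ h₂)

end HolonomyEquivalent

lemma LinkDiagram.pt_eq_line (D : LinkDiagram S ι) (T : ℝ) (p : ι × UnitAddCircle) :
    D.pt p = D.line p.1 (time T p.2) := by
  rw [line, coe_time]; rfl

lemma LinkDiagram.vel_eq_velocity (D : LinkDiagram S ι) (T : ℝ) (p : ι × UnitAddCircle) :
    D.vel p = velocity (D.line p.1) (time T p.2) := by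
  rw [← D.vel_coe, coe_time]

lemma LinkDiagram.pt_endPt (D : LinkDiagram S ι) (e : D.crossings × Role) :
    D.pt (D.endPt e) = D.pt e.1.1.1 := by
  obtain ⟨c, _ | _⟩ := e
  · rfl
  · exact (D.pt_fst_eq_snd c.2).symm

/-- An ambient isotopy does not change the holonomy. -/
lemma holonomyEquivalent_of_isotopic [IsManifold (𝓡 2) ∞ S] [T2Space S] [Finite ι]
    (hS : IsOrientedAtlas S) (hq : IsCutPolygon Ω.loop q) (hg : 0 < g) (h : D.Isotopic D') :
    HolonomyEquivalent g q D D' := by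
  obtain ⟨H, hH, hΦ, h0, hpt, hc⟩ := h
  have hHc : Continuous fun u : ℝ × S => H u.1 u.2 := hH.continuous
  have hH1 : ContMDiff (𝓡 2) (𝓡 2) ∞ (H 1) :=
    hH.comp (contMDiff_const.prodMk contMDiff_id)
  have hline : ∀ i, D'.line i = H 1 ∘ D.line i := fun i => funext fun t => hpt (i, (t : UnitAddCircle))
  -- The plane of isotopy time and curve parameter is simply connected, so the frames of a component
  -- can be carried along the whole isotopy. The path of each crossing gets a transport `β` as well;
  -- at an end of the crossing both follow the same path, so their quotient, the state, is constant.
  choose K hK using fun i => hq.exists_transport hg (A := ℝ × ℝ)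
    (f := fun u => H u.1 (D.line i u.2))
    (hHc.comp (continuous_fst.prodMk ((D.continuous_line i).comp continuous_snd)))
  choose β hβ using fun c : D.crossings => hq.exists_transport hg (A := ℝ)
    (f := fun u => H u (D.pt c.1.1)) (hHc.comp (Continuous.prodMk_left _))
  let f : D.crossings ≃ D'.crossings := Equiv.setCongr hc.symm
  have h1 : ∀ i, IsTransport g q (D.line i) (fun t => K i (0, t)) := by
    intro i
    have := (hK i).comp (Continuous.prodMk_right (0 : ℝ))
    have e : D.line i = (fun u : ℝ × ℝ => H u.1 (D.line i u.2)) ∘ fun t => (0, t) := by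
      funext t; simp [h0]
    rw [e]; exact this
  have h2 : ∀ i, IsTransport g q (D'.line i) (fun t => K i (1, t)) := by
    intro i
    rw [hline]
    exact (hK i).comp (Continuous.prodMk_right (1 : ℝ))
  have h3 : ∀ i t, IsTransport g q (fun u => H u (D.line i t)) fun u => K i (u, t) :=
    fun i t => (hK i).comp (Continuous.prodMk_left t)
  obtain ⟨Θ, hΘ⟩ := exists_presents q D (fun _ => 0) h1 fun c => β c 0
  obtain ⟨Θ', hΘ'⟩ := exists_presents q D' (fun _ => 0) h2 fun c => β (f.symm c) 1
  have hend : ∀ e, D'.endPt (Prod.map f id e) = D.endPt e := by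
    rintro ⟨c, _ | _⟩ <;> rfl
  have htime : ∀ e, D'.endTime (fun _ => 0) (Prod.map f id e) = D.endTime (fun _ => 0) e :=
    fun e => by rw [LinkDiagram.endTime, hend]; rfl
  refine .of_presents hq hΘ hΘ' (hΘ.equivalent_of_equiv hΘ' f ?_ (fun e => by rw [hend]) ?_ ?_ ?_)
  · intro c
    have hv : ∀ p, D'.vel p = velocity (H 1 ∘ D.line p.1) (time 0 p.2) := fun p => by
      rw [D'.vel_eq_velocity 0, hline]
    have hw := wedge_velocity_comp (f := H 1) (c := D.line c.1.1.1) (t := time 0 c.1.1.2)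
      (c' := D.line c.1.2.1) (t' := time 0 c.1.2.2)
      ((hH1 _).mdifferentiableAt (by simp)) (D.mdifferentiableAt_line _ _)
      (D.mdifferentiableAt_line _ _)
      (by rw [← D.pt_eq_line, ← D.pt_eq_line]; exact D.pt_fst_eq_snd c.2)
    have hj := jac_pos_of_isotopy hS hH hΦ h0 (D.line c.1.1.1 (time 0 c.1.1.2)) (t := 1) (by simp)
    change 0 < wedge (D.vel c.1.1) (D.vel c.1.2) * wedge (D'.vel c.1.1) (D'.vel c.1.2)
    rw [hv, hv, hw, ← D.vel_eq_velocity, ← D.vel_eq_velocity]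
    have := mul_pos hj (mul_self_pos.2 (D.transverse c.1 c.2))
    change 0 < jac (H 1) _ * (wedge (D.vel c.1.1) (D.vel c.1.2) * wedge (D.vel c.1.1) (D.vel c.1.2))
      at this
    linarith
  · intro e e' _ hlt
    rwa [htime, htime]
  · intro e
    rw [hΘ'.state, hΘ.state, htime, hend]
    have e1 : D.line (D.endPt e).1 (D.endTime (fun _ => 0) e) = D.pt e.1.1.1 := by
      rw [← D.pt_endPt, D.pt_eq_line 0]; rfl
    have h4 := h3 (D.endPt e).1 (D.endTime (fun _ => 0) e)
    rw [e1] at h4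
    have := (hβ e.1).mul_inv_eq hq (hHc.comp (Continuous.prodMk_left _)) h4 1 0
    simpa using this
  · funext i
    rw [hΘ'.mono, hΘ.mono]
    have e1 : D.line i ((0 : ℝ) + 1) = D.line i 0 := by simpa using D.line_add_intCast i 0 1
    have h4 := h3 i (0 + 1)
    rw [e1] at h4
    exact (h3 i 0).mul_inv_eq hq (hHc.comp (Continuous.prodMk_left _)) h4 1 0

/-- A reparametrization does not change the holonomy. -/
lemma holonomyEquivalent_of_reparametrized [T2Space S] [Finite ι]
    (hq : IsCutPolygon Ω.loop q) (hg : 0 < g) (h : D.Reparametrized D') :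
    HolonomyEquivalent g q D D' := by
  obtain ⟨f, hf, hpos, hper, hcurve, hcross⟩ := h
  have hdiff : ∀ i, Differentiable ℝ (f i) := fun i => (hf i).differentiable (by simp)
  have hmono : ∀ i, StrictMono (f i) := fun i => strictMono_of_deriv_pos (hpos i)
  have hnat : ∀ i t (n : ℕ), f i (t + n) = f i t + n := by
    intro i t n
    induction n with
    | zero => simp
    | succ n ih => push_cast; rw [← add_assoc, hper, ih, add_assoc]
  have hint : ∀ i t (n : ℤ), f i (t + n) = f i t + n := by
    intro i t n
    obtain ⟨m, rfl | rfl⟩ := n.eq_nat_or_neg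
    · exact_mod_cast hnat i t m
    · have := hnat i (t + ((-m : ℤ) : ℝ)) m
      push_cast at this ⊢
      rw [neg_add_cancel_right] at this
      linarith
  have hsurj : ∀ i, Function.Surjective (f i) := by
    intro i y
    have hc : ContinuousOn (f i) (Icc (⌊y - f i 0⌋ : ℝ) (⌊y - f i 0⌋ + 1)) :=
      (hdiff i).continuous.continuousOn
    have h1 : f i (⌊y - f i 0⌋ : ℝ) = f i 0 + ⌊y - f i 0⌋ := by
      simpa using hint i 0 ⌊y - f i 0⌋
    obtain ⟨x, -, hx⟩ := intermediate_value_Icc (by linarith) hc (show y ∈ Icc _ _ from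
      ⟨by rw [h1]; linarith [Int.floor_le (y - f i 0)],
        by rw [hper, h1]; linarith [Int.lt_floor_add_one (y - f i 0)]⟩)
    exact ⟨x, hx⟩
  let F : ι × UnitAddCircle → ι × UnitAddCircle := fun p => (p.1, (f p.1 (time 0 p.2) : ℝ))
  have hF : ∀ i (t : ℝ), F (i, (t : UnitAddCircle)) = (i, (f i t : UnitAddCircle)) := by
    intro i t
    obtain ⟨n, hn⟩ := coe_eq_coe_iff.1 (coe_time 0 (t : UnitAddCircle))
    simp only [F]
    rw [hn, hint, coe_add_intCast]
  have hFb : Function.Bijective F := by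
    constructor
    · rintro ⟨i, p⟩ ⟨j, r⟩ h
      obtain ⟨rfl, h⟩ := Prod.mk.inj h
      obtain ⟨n, hn⟩ := coe_eq_coe_iff.1 h
      simp only at hn
      rw [← hint] at hn
      have := (hmono i).injective hn
      refine Prod.ext rfl ?_
      change p = r
      rw [← coe_time 0 p, this, coe_add_intCast, coe_time]
    · rintro ⟨i, p⟩
      obtain ⟨s, hs⟩ := hsurj i (time 0 p)
      refine ⟨(i, (s : UnitAddCircle)), ?_⟩
      rw [hF, hs, coe_time]
  let E := Equiv.ofBijective F hFb
  let G : D'.crossings ≃ D.crossings := (E.prodCongr E).subtypeEquiv (by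
    rintro ⟨⟨i, p⟩, ⟨j, r⟩⟩
    have := hcross i j (time 0 p) (time 0 r)
    rw [coe_time, coe_time] at this
    exact this)
  have hline : ∀ i, D'.line i = D.line i ∘ f i := fun i => funext fun t => hcurve i t
  obtain ⟨κ, hκ⟩ := hq.exists_transport_line hg D
  have hκ' : ∀ i, IsTransport g q (D'.line i) (κ i ∘ f i) := fun i => by
    rw [hline]; exact (hκ i).comp (hdiff i).continuous
  -- Since `f i` maps `[0, 1)` increasingly onto `[f i 0, f i 0 + 1)`, these starting times make `f
  -- i` translate the times of `D'` into those of `D`.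
  obtain ⟨Θ, hΘ⟩ := exists_presents q D (fun i => f i 0) hκ fun _ => 1
  obtain ⟨Θ', hΘ'⟩ := exists_presents q D' (fun _ => 0) hκ' fun _ => 1
  have hend : ∀ e, D.endPt (Prod.map G id e) = F (D'.endPt e) := by
    rintro ⟨c, _ | _⟩ <;> rfl
  have htime : ∀ e, D.endTime (fun i => f i 0) (Prod.map G id e) =
      f (D'.endPt e).1 (D'.endTime (fun _ => 0) e) := by
    intro e
    rw [LinkDiagram.endTime, hend]
    have := time_mem 0 (D'.endPt e).2
    refine time_eq ⟨(hmono _).monotone this.1, ?_⟩ rfl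
    have h1 := hmono (D'.endPt e).1 this.2
    rwa [hper] at h1
  refine .of_presents hq hΘ hΘ' ?_
  have := D.finite.to_subtype
  have := D'.finite.to_subtype
  refine (hΘ'.equivalent_of_equiv hΘ G ?_ (fun e => by rw [hend]) ?_ ?_ ?_).symm
  · intro c
    have hv : ∀ i (t : ℝ), D'.vel (i, (t : UnitAddCircle)) =
        deriv (f i) t • D.vel (i, (f i t : UnitAddCircle)) := by
      intro i t
      rw [D'.vel_coe, hline, velocity_comp_real (D.mdifferentiableAt_line _ _) (hdiff i t), D.vel_coe]
    have hv' : ∀ p, D'.vel p = deriv (f p.1) (time 0 p.2) • D.vel (F p) := fun p => by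
      have := hv p.1 (time 0 p.2)
      rwa [coe_time] at this
    have e1 : (G c).1 = (F c.1.1, F c.1.2) := rfl
    have e2 := D.transverse _ (G c).2
    change wedge (D.vel (F c.1.1)) (D.vel (F c.1.2)) ≠ 0 at e2
    rw [e1, hv', hv', wedge_smul_left, wedge_smul_right]
    have h1 := hpos c.1.1.1 (time 0 c.1.1.2)
    have h2 := hpos c.1.2.1 (time 0 c.1.2.2)
    have := mul_pos (mul_pos h1 h2) (mul_self_pos.2 e2)
    linarith
  · intro e e' hee hlt
    rw [htime, htime, hee]
    exact hmono _ hlt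
  · intro e
    rw [hΘ'.state, hΘ.state, htime, hend]
    rfl
  · funext i
    rw [hΘ'.mono, hΘ.mono]
    simp only [Function.comp_apply]
    rw [hper]

end HomotopyZh
end

/-! ### Zh-diagrams exist and realize words with the holonomy of the link diagram. -/

noncomputable section
namespace HomotopyZh
open Filter Topology

variable {S : Type*} [TopologicalSpace S] [ChartedSpace Plane S] {ι : Type*} {g : ℕ}
  {Ω : SymplecticBasis S g} {q : Plane → S} {D : LinkDiagram S ι}

/-! ## The homotopy Zh-construction -/

@[simp] lemma place_inl (e : D.crossings × Role) :
    place D Ω (.inl e.1, e.2) = .inl (D.endPt e) := by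
  obtain ⟨c, _ | _⟩ := e <;> rfl

/-- General position keeps the crossings off the curves of the basis, and two such curves share only
the base point, which `meets` leaves out. So the passages of a black component have a strict order
in time. -/
lemma place_injective (h : D.InGeneralPosition Ω) {e f : (D.crossings ⊕ D.meets Ω) × Role}
    {p : ι × UnitAddCircle} (he : place D Ω e = .inl p) (hf : place D Ω f = .inl p) : e = f := by
  have key : ∀ (c : D.crossings × Role) (m : D.meets Ω), D.endPt c ≠ m.1.1 := by
    intro c m hm
    obtain ⟨s, hs, hp⟩ := m.2
    exact h.not_at_crossing c.1.1 c.1.2 m.1.2 ⟨s, hs, by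
      change D.pt c.1.1.1 = _
      rw [← D.pt_endPt, hm, hp]⟩
  obtain ⟨c | m, r⟩ := e <;> obtain ⟨c' | m', r'⟩ := f
  · rw [place_inl (c, r)] at he
    rw [place_inl (c', r')] at hf
    have := D.endPt_injective ((Sum.inl_injective he).trans (Sum.inl_injective hf).symm)
    obtain ⟨rfl, rfl⟩ := Prod.mk.inj this
    rfl
  · rw [place_inl (c, r)] at he
    rcases r' with _ | _
    · simp [place] at hf
    · exact absurd ((Sum.inl_injective he).trans (Sum.inl_injective hf).symm) (key _ m')
  · rw [place_inl (c', r')] at hf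
    rcases r with _ | _
    · simp [place] at he
    · exact absurd ((Sum.inl_injective hf).trans (Sum.inl_injective he).symm) (key _ m)
  · rcases r with _ | _ <;> rcases r' with _ | _
    · simp [place] at he
    · simp [place] at he
    · simp [place] at hf
    · have e1 := (Sum.inl_injective he).trans (Sum.inl_injective hf).symm
      have : m = m' := by
        refine Subtype.ext (Prod.ext e1 ?_)
        obtain ⟨s, hs, hp⟩ := m.2
        obtain ⟨s', hs', hp'⟩ := m'.2
        by_contra hne
        exact Ω.meet _ _ hne s hs s' hs' (by rw [← hp, ← hp', e1])
      rw [this]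

variable (D Ω) in
/-- The time at which a classical crossing of the homotopy Zh-construction is passed. -/
def eventTime (e : (D.crossings ⊕ D.meets Ω) × Role) : ℝ :=
  Sum.elim (fun p => time 0 p.2) (fun _ => 0) (place D Ω e)

lemma eventTime_eq {e : (D.crossings ⊕ D.meets Ω) × Role} {p : ι × UnitAddCircle}
    (h : place D Ω e = .inl p) : eventTime Ω D e = time 0 p.2 := by
  simp [eventTime, h]

lemma eventTime_injOn (h : D.InGeneralPosition Ω) (i : ι) :
    InjOn (eventTime Ω D) {e | ∃ t, place D Ω e = .inl (i, t)} := by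
  rintro e ⟨t, he⟩ f ⟨t', hf⟩ hef
  rw [eventTime_eq he, eventTime_eq hf] at hef
  have : t = t' := time_injective _ hef
  subst this
  exact place_injective h he hf

/-- The homotopy Zh-construction of a diagram in general position exists. -/
lemma exists_isHomotopyZh (h : D.InGeneralPosition Ω) : ∃ W, IsHomotopyZh D Ω W := by
  classical
  have := D.finite.to_subtype
  have := h.finite.to_subtype
  have := Fintype.ofFinite D.crossings
  have := Fintype.ofFinite (D.meets Ω)
  have hne : ∀ m : D.meets Ω, wedge (arcOrientation m.1.2 •
      velocity (Ω.loop m.1.2) m.2.choose) (D.vel m.1.1) ≠ 0 := by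
    intro m
    obtain ⟨hs, hp⟩ := m.2.choose_spec
    rw [wedge_smul_left, wedge_swap]
    refine mul_ne_zero ?_ (neg_ne_zero.2 (h.transverse _ _ _ hs hp))
    obtain ⟨⟨_, ⟨_, _ | _⟩⟩, _⟩ := m <;> simp [arcOrientation]
  choose sc hsc using fun c : D.crossings => exists_sign (D.transverse c.1 c.2)
  choose sm hsm using fun m : D.meets Ω => exists_sign (hne m)
  choose bw hbw hbp using fun i => exists_sorted
    (Finset.univ.filter fun e => ∃ t, place D Ω e = .inl (i, t)) (eventTime Ω D)
    ((eventTime_injOn h i).mono fun e he => by simpa using he)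
  have hmem : ∀ i e, e ∈ bw i ↔ ∃ t, place D Ω e = .inl (i, t) := fun i e => by simp [hbw]
  have huniq : ∀ e i t, place D Ω e = .inl (i, t) → ∃! i, e ∈ bw i := by
    intro e i t he
    refine ⟨i, (hmem _ _).2 ⟨t, he⟩, fun j hj => ?_⟩
    obtain ⟨t', ht'⟩ := (hmem _ _).1 hj
    exact (Prod.mk.inj (Sum.inl_injective (ht'.symm.trans he))).1
  obtain ⟨W, χ, hs, hw, hc⟩ := PrismaticDiagram.exists_of_blackWords (C := D.crossings ⊕ D.meets Ω)
    (g := g) (Sum.elim sc sm) (Sum.elim (fun _ => none) fun m => some (dualColor m.1.2)) bw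
    (fun i => sorted_nodup (hbp i))
    (by
      rintro (c | m)
      · exact huniq _ c.1.2.1 c.1.2.2 rfl
      · exact huniq _ m.1.1.1 m.1.1.2 rfl)
    (by
      rintro (c | m) hn
      · exact huniq _ c.1.1.1 c.1.1.2 rfl
      · simp at hn)
    (by
      rintro (c | m) z hz i hi
      · simp at hz
      · obtain ⟨t, ht⟩ := (hmem _ _).1 hi
        simp [place] at ht)
  refine ⟨W, χ, ⟨fun c => ?_, fun m s hs' hp => ?_, fun i => ⟨bw i, ?_, hmem i, ?_⟩, ?_⟩⟩
  · rw [hs]; exact hsc c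
  · rw [hs]
    obtain ⟨hs₀, hp₀⟩ := m.2.choose_spec
    have : s = m.2.choose := Ω.simple m.1.2 ⟨hs'.1.le, hs'.2⟩ ⟨hs₀.1.le, hs₀.2⟩
      (hp.symm.trans hp₀)
    rw [this]
    exact hsm m
  · rw [hw]
  · refine (hbp i).imp_of_mem fun {e f} he hf hef => ?_
    obtain ⟨t, ht⟩ := (hmem _ _).1 he
    obtain ⟨t', ht'⟩ := (hmem _ _).1 hf
    rw [eventTime_eq ht, eventTime_eq ht'] at hef
    have h1 := time_mem 0 t
    have h2 := time_mem 0 t'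
    exact ⟨time 0 t, time 0 t', h1.1, hef, by simpa using h2.2, by rw [coe_time, ht],
      by rw [coe_time, ht']⟩
  · rintro z ⟨c | m, _ | _⟩
    · change (χ (.inl c), Role.over) ∈ _ ↔ _
      rw [hc]
      simp [place]
    · change (χ (.inl c), Role.under) ∈ _ ↔ _
      have : (χ (.inl c), Role.under) ∉ W.word (.inr z) := fun hm => by
        simpa [zhColor] using W.under_black _ _ hm
      simp [place, this]
    · change (χ (.inr m), Role.over) ∈ _ ↔ _
      rw [hc]
      simp [place]
    · change (χ (.inr m), Role.under) ∈ _ ↔ _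
      have : (χ (.inr m), Role.under) ∉ W.word (.inr z) := fun hm => by
        simpa [zhColor] using W.under_black _ _ hm
      simp [place, this]

/-- The letter that is written at an intersection with a curve of the basis is the change of the
frame. -/
lemma IsTransportAt.eventually_letter [IsManifold (𝓡 2) ∞ S] (hq : IsCutPolygon Ω.loop q)
    (hg : 0 < g) {c : ℝ → S} {κ : ℝ → SurfaceGroup g} {t : ℝ} (hκ : IsTransportAt g q c κ t)
    (hc : MDifferentiableAt 𝓘(ℝ, ℝ) (𝓡 2) c t) {z : Palette g} {s : ℝ} (hs : s ∈ Ioo (0 : ℝ) 1)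
    (hct : c t = Ω.loop z s) {ε : ℤˣ} (hε : 0 < ((ε : ℤ) : ℝ) *
      wedge (arcOrientation z • velocity (Ω.loop z) s) (velocity c t)) :
    ∃ k, (∀ᶠ t' in 𝓝[<] t, κ t' = k) ∧ ∀ᶠ t' in 𝓝[>] t, κ t' = k * val [(dualColor z, ε)] := by
  obtain ⟨h1, h2⟩ := hκ.eventually_crossing hq hg hc hs hct
  rw [wedge_smul_left, wedge_swap] at hε
  have hneg : ∀ w : Palette g, val [(w, (-1 : ℤˣ))] = (val [(w, 1)])⁻¹ := fun w => val_neg w 1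
  obtain ⟨i, _ | _⟩ := z <;> rcases Int.units_eq_one_or ε with rfl | rfl <;>
    simp only [arcOrientation, dualColor, sideLetter] at *
  · obtain ⟨h3, h4⟩ := h2 (by push_cast at hε; linarith)
    exact ⟨_, h3, h4⟩
  · obtain ⟨h3, h4⟩ := h1 (by push_cast at hε; linarith)
    refine ⟨_, h3, ?_⟩
    simpa [hneg] using h4
  · obtain ⟨h3, h4⟩ := h1 (by push_cast at hε; linarith)
    refine ⟨_, h3, ?_⟩
    simpa [hneg] using h4
  · obtain ⟨h3, h4⟩ := h2 (by push_cast at hε; linarith)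
    exact ⟨_, h3, h4⟩

/-- Reading the events of a component from time `a` to time `b`. -/
lemma reads_events [IsManifold (𝓡 2) ∞ S] [T2Space S] (hq : IsCutPolygon Ω.loop q) (hg : 0 < g)
    (h : D.InGeneralPosition Ω) {i : ι} {κ : ℝ → SurfaceGroup g}
    (hκ : IsTransport g q (D.line i) κ) {sg : D.meets Ω → ℤˣ}
    (hsg : ∀ m : D.meets Ω, ∀ s ∈ Ioo (0 : ℝ) 1, D.pt m.1.1 = Ω.loop m.1.2 s →
      0 < ((sg m : ℤ) : ℝ) *
        wedge (arcOrientation m.1.2 • velocity (Ω.loop m.1.2) s) (D.vel m.1.1))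
    {τ : (D.crossings ⊕ D.meets Ω) × Role → ℝ} {st : D.crossings × Role → SurfaceGroup g}
    (hst : ∀ e, (D.endPt e).1 = i → st e = κ (τ (.inl e.1, e.2)))
    {l : List ((D.crossings ⊕ D.meets Ω) × Role)} (hl : l.Pairwise fun e f => τ e < τ f)
    {a b : ℝ} (hab : a < b) (hτ : ∀ e ∈ l, τ e ∈ Ioo a b)
    (hp : ∀ e ∈ l, place D Ω e = .inl (i, (τ e : UnitAddCircle)))
    (he : ∀ t ∈ Icc a b, ∀ e, place D Ω e = .inl (i, (t : UnitAddCircle)) → e ∈ l ∧ τ e = t) :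
    Reads st (κ a) (l.map (symbol (Sum.map id fun m : D.meets Ω => (dualColor m.1.2, sg m))))
      (κ b) := by
  have avoid : ∀ {t : ℝ}, (∀ m : D.meets Ω, m.1.1 ≠ (i, (t : UnitAddCircle))) → ∀ z,
      ∀ s ∈ Icc (0 : ℝ) 1, D.line i t ≠ Ω.loop z s := by
    intro t ht z s hs hts
    have hb := h.avoids_base (i, (t : UnitAddCircle))
    rw [D.pt_coe, hts] at hb
    have h0 : s ≠ 0 := fun h0 => hb (h0 ▸ Ω.loop_zero z)
    have h1 : s ≠ 1 := fun h1 => hb (h1 ▸ Ω.loop_one z)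
    exact ht ⟨((i, (t : UnitAddCircle)), z), s, ⟨lt_of_le_of_ne hs.1 h0.symm,
      lt_of_le_of_ne hs.2 h1⟩, hts⟩ rfl
  induction l generalizing a with
  | nil =>
    refine hκ.eq_of_avoids hq hg (D.continuous_line i) isPreconnected_Icc (I := Icc a b)
      (fun t ht => avoid fun m hm => ?_) ⟨le_rfl, hab.le⟩ ⟨hab.le, le_rfl⟩
    have := (he t ht (.inr m, .under) (by simp [place, hm])).1
    simp at this
  | cons e l ih =>
    rw [List.pairwise_cons] at hl
    have heab := hτ e (by simp)
    -- A time between the first event and all later ones: the interval up to `m` contains one event,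
    -- the induction treats the rest.
    obtain ⟨m, hm1, hm2⟩ : ∃ m, τ e < m ∧ m < b ∧ ∀ f ∈ l, m < τ f := by
      have : ∀ᶠ m in 𝓝[>] (τ e), m < b ∧ ∀ f ∈ l, m < τ f := by
        refine ((eventually_lt_nhds heab.2).filter_mono nhdsWithin_le_nhds).and ?_
        refine (l.finite_toSet.eventually_all (l := 𝓝[>] (τ e)) (p := fun f m => m < τ f)).2 ?_
        exact fun f hf => (eventually_lt_nhds (hl.1 f hf)).filter_mono nhdsWithin_le_nhds
      obtain ⟨m, h1, h2⟩ := (this.and self_mem_nhdsWithin).exists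
      exact ⟨m, h2, h1⟩
    have hrest := ih hl.2 hm2.1 (fun f hf => ⟨hm2.2 f hf, (hτ f (by simp [hf])).2⟩)
      (fun f hf => hp f (by simp [hf])) (fun t ht f hf => by
        obtain ⟨h1, h2⟩ := he t ⟨by linarith [heab.1, ht.1], ht.2⟩ f hf
        refine ⟨?_, h2⟩
        rcases List.mem_cons.1 h1 with rfl | h1
        · linarith [ht.1]
        · exact h1)
    have hav : ∀ t ∈ Icc a m, t ≠ τ e → ∀ n : D.meets Ω, n.1.1 ≠ (i, (t : UnitAddCircle)) := by
      intro t ht hte n hn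
      obtain ⟨h1, h2⟩ := he t ⟨ht.1, ht.2.trans hm2.1.le⟩ (.inr n, .under) (by simp [place, hn])
      rcases List.mem_cons.1 h1 with h1 | h1
      · exact hte (by rw [← h1, h2])
      · have := hm2.2 _ h1
        rw [h2] at this
        linarith [ht.2]
    have hpe := hp e (by simp)
    obtain ⟨c | n, r⟩ := e
    -- At a black crossing the component avoids the curves of the basis, so the frame passes
    -- unchanged.
    · have hconst : ∀ t ∈ Icc a m, κ t = κ a := fun t ht =>
        hκ.eq_of_avoids hq hg (D.continuous_line i) isPreconnected_Icc (I := Icc a m)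
          (fun t ht => avoid (by
            by_cases hte : t = τ (.inl c, r)
            · intro n hn
              have : place D Ω (.inr n, .under) = .inl (i, (τ (.inl c, r) : UnitAddCircle)) := by
                simp [place, hn, hte]
              simpa using place_injective h hpe this
            · exact hav t ht hte)) ht ⟨le_rfl, by linarith [heab.1]⟩
      have hend : (D.endPt (c, r)).1 = i := by
        rw [place_inl (c, r)] at hpe
        rw [Sum.inl_injective hpe]
      change κ a = st (c, r) ∧ _
      rw [hst (c, r) hend]
      refine ⟨(hconst _ ⟨heab.1.le, hm1.le⟩).symm, ?_⟩
      rwa [hconst m ⟨by linarith [heab.1], le_rfl⟩] at hrest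
    · have hr : r = .under := by
        rcases r with _ | _
        · simp [place] at hpe
        · rfl
      subst hr
      change Reads st (κ a * val [(dualColor n.1.2, sg n)]) _ _
      have hn : n.1.1 = (i, (τ (.inr n, .under) : UnitAddCircle)) := Sum.inl_injective hpe
      obtain ⟨s, hs, hps⟩ := n.2
      have hsn := hsg n s hs hps
      rw [hn, D.vel_coe] at hsn
      rw [hn, D.pt_coe] at hps
      -- The frame is constant on both sides of the intersection. Hence its one-sided values there
      -- are `κ a` and `κ m`, and they differ by the syllable.
      obtain ⟨k, hk1, hk2⟩ := (hκ (τ (.inr n, .under))).eventually_letter hq hg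
        (D.mdifferentiableAt_line i _) hs hps hsn
      obtain ⟨t₁, h₁, h₁'⟩ := (hk1.and (Ioo_mem_nhdsLT heab.1)).exists
      obtain ⟨t₂, h₂, h₂'⟩ := (hk2.and (Ioo_mem_nhdsGT hm1)).exists
      have e1 : κ a = κ t₁ := hκ.eq_of_avoids hq hg (D.continuous_line i) isPreconnected_Ico
          (I := Ico a (τ (.inr n, .under)))
          (fun t ht => avoid (hav t ⟨ht.1, (ht.2.trans hm1).le⟩ ht.2.ne)) ⟨le_rfl, heab.1⟩
          ⟨h₁'.1.le, h₁'.2⟩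
      have e2 : κ m = κ t₂ := hκ.eq_of_avoids hq hg (D.continuous_line i) isPreconnected_Ioc
          (I := Ioc (τ (.inr n, .under)) m)
          (fun t ht => avoid (hav t ⟨(heab.1.trans ht.1).le, ht.2⟩ ht.1.ne')) ⟨hm1, le_rfl⟩
          ⟨h₂'.1, h₂'.2.le⟩
      rw [e2, h₂, ← h₁, ← e1] at hrest
      exact hrest

/-- A homotopy Zh-construction realizes words whose holonomy is that of the diagram. -/
lemma IsHomotopyZh.exists_realizes [IsManifold (𝓡 2) ∞ S] [T2Space S] (hq : IsCutPolygon Ω.loop q)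
    (hg : 0 < g) (h : D.InGeneralPosition Ω) {W : PrismaticDiagram (zhColor ι g)}
    (hW : IsHomotopyZh D Ω W) :
    ∃ T κ b, ∃ (Θ : Holonomy ι D.crossings g) (w : ι → List (Sym D.crossings g)),
      Presents q D T κ b Θ ∧ Θ.IsFlat w ∧ Realizes W Θ.sign w := by
  obtain ⟨χ, hχ⟩ := hW
  choose l hlw hlm hlp using hχ.word_black
  have hsort : ∀ i, (l i).Pairwise fun e f => eventTime Ω D e < eventTime Ω D f := fun i =>
    (hlp i).imp fun {e f} ⟨s, t, hs, hst, ht, he, hf⟩ => by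
      rw [eventTime_eq he, eventTime_eq hf, time_coe ⟨hs, by linarith⟩,
        time_coe ⟨by linarith, by linarith⟩]
      exact hst
  have hplace : ∀ i, ∀ e ∈ l i, place D Ω e = .inl (i, (eventTime Ω D e : UnitAddCircle)) := by
    intro i e he
    obtain ⟨t, ht⟩ := (hlm i e).1 he
    rw [eventTime_eq ht, ht, coe_time]
  have hrange : ∀ i, ∀ e ∈ l i, eventTime Ω D e ∈ Ico (0 : ℝ) 1 := by
    intro i e he
    obtain ⟨t, ht⟩ := (hlm i e).1 he
    rw [eventTime_eq ht]
    simpa using time_mem 0 t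
  have hB : ∀ i, ∃ B : ℝ, 0 < B ∧ B < 1 ∧ ∀ e ∈ l i, eventTime Ω D e < B := by
    intro i
    have : ∀ᶠ B in 𝓝[<] (1 : ℝ), 0 < B ∧ ∀ e ∈ l i, eventTime Ω D e < B := by
      refine ((eventually_gt_nhds zero_lt_one).filter_mono nhdsWithin_le_nhds).and ?_
      refine ((l i).finite_toSet.eventually_all (l := 𝓝[<] (1 : ℝ))
        (p := fun e B => eventTime Ω D e < B)).2 ?_
      exact fun e he => (eventually_gt_nhds (hrange i e he).2).filter_mono nhdsWithin_le_nhds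
    obtain ⟨B, h1, h2⟩ := (this.and self_mem_nhdsWithin).exists
    exact ⟨B, h1.1, h2, h1.2⟩
  choose B hB0 hB1 hB using hB
  obtain ⟨κ, hκ⟩ := hq.exists_transport_line hg D
  obtain ⟨Θ, hΘ⟩ := exists_presents q D (fun i => B i - 1) hκ fun _ => 1
  have hsign : ∀ c, W.sign (χ (.inl c)) = Θ.sign c := fun c =>
    sign_eq_sign (hχ.sign_crossing c) (hΘ.sign c) (mul_self_pos.2 (D.transverse c.1 c.2))
  have hend : ∀ e : D.crossings × Role, ((Sum.inl e.1, e.2) : (D.crossings ⊕ D.meets Ω) × Role) ∈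
      l (D.endPt e).1 := fun e => (hlm _ _).2 ⟨(D.endPt e).2, by simp⟩
  have htime : ∀ e : D.crossings × Role, D.endTime (fun i => B i - 1) e =
      eventTime Ω D (.inl e.1, e.2) := by
    intro e
    have h1 := hrange _ _ (hend e)
    have h2 := hB _ _ (hend e)
    refine time_eq ⟨?_, ?_⟩ ?_
    · linarith [hB1 (D.endPt e).1, h1.1]
    · linarith
    · rw [eventTime_eq (place_inl e), coe_time]
  let ty : D.crossings ⊕ D.meets Ω → D.crossings ⊕ Syllable g :=
    Sum.map id fun m => (dualColor m.1.2, W.sign (χ (.inr m)))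
  have hcons : ∀ (i : ι) (e : D.crossings × Role),
      ((Sum.inl e.1, e.2) : (D.crossings ⊕ D.meets Ω) × Role) ∈ l i ↔ (D.endPt e).1 = i := by
    intro i e
    rw [hlm, place_inl e]
    constructor
    · rintro ⟨t, ht⟩
      rw [Sum.inl_injective ht]
    · rintro rfl
      exact ⟨(D.endPt e).2, rfl⟩
  refine ⟨_, κ, _, Θ, fun i => (l i).map (symbol ty), hΘ, ⟨fun i => ?_, fun i => ?_⟩,
    ty ∘ χ.symm, ?_⟩
  · have hget : ∀ x e, (symbol ty x).getLeft? = some e → x = (.inl e.1, e.2) := by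
      rintro ⟨c | m, r⟩ e he
      · simp only [symbol, ty, Sum.map_inl, Sum.getLeft?_inl, Option.some.injEq] at he
        rw [← he]; rfl
      · simp [symbol, ty] at he
    refine sorted_ext ?_ (hΘ.sorted i) fun e => ?_
    · rw [blackEnds, List.pairwise_filterMap, List.pairwise_map]
      refine (hsort i).imp fun {x y} hxy e he f hf => ?_
      rwa [htime, htime, ← hget x e he, ← hget y f hf]
    · rw [hΘ.mem_ends, ← hcons, mem_blackEnds, List.mem_map]
      constructor
      · rintro ⟨x, hx, hxe⟩
        rwa [← hget x e (by rw [hxe]; rfl)]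
      · exact fun hx => ⟨_, hx, rfl⟩
  · refine ⟨κ i (B i - 1), ?_⟩
    rw [← hΘ.monodromy hq, sub_add_cancel]
    refine reads_events hq hg h (hκ i) hχ.sign_meet (τ := eventTime Ω D) (fun e he => ?_) (hsort i)
      (by linarith) (fun e he => ⟨by linarith [hB1 i, (hrange i e he).1], hB i e he⟩) (hplace i) ?_
    · rw [hΘ.state, htime, he]; simp
    · intro t ht e he
      have hel : e ∈ l i := (hlm _ _).2 ⟨_, he⟩
      refine ⟨hel, ?_⟩
      by_cases h0 : 0 ≤ t
      · rw [eventTime_eq he, time_coe ⟨h0, by linarith [ht.2, hB1 i]⟩]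
      -- An event at a negative time of this window would return one turn later at `t + 1 ≥ B i`,
      -- but all event times are below `B i`.
      · exfalso
        have h1 : eventTime Ω D e = t + 1 := by
          rw [eventTime_eq he]
          refine time_eq ⟨by linarith [ht.1, hB0 i], by linarith⟩ ?_
          simp
        have := hB i e hel
        linarith [ht.1]
  · have hsy : ∀ c, (ty ∘ χ.symm) (χ c) = ty c := fun c => by simp
    refine ⟨fun c => ⟨χ (.inl c), by simp [ty], fun d hd => ?_⟩, fun d c hd => ?_, fun d s hd => ?_,
      fun d c hd => ?_, fun d s hd => ?_, fun i => ?_⟩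
    · obtain ⟨c' | m, rfl⟩ := χ.surjective d
      · rw [hsy] at hd
        simp only [ty, Sum.map_inl, id_eq, Sum.inl.injEq] at hd
        rw [hd]
      · rw [hsy] at hd; simp [ty] at hd
    · obtain ⟨c' | m, rfl⟩ := χ.surjective d
      · rw [hsy] at hd
        simp only [ty, Sum.map_inl, id_eq, Sum.inl.injEq] at hd
        rw [hsign, hd]
      · rw [hsy] at hd; simp [ty] at hd
    · obtain ⟨c' | m, rfl⟩ := χ.surjective d
      · rw [hsy] at hd; simp [ty] at hd
      · rw [hsy] at hd
        simp only [ty, Sum.map_inr, Sum.inr.injEq] at hd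
        rw [← hd]
    · obtain ⟨c' | m, rfl⟩ := χ.surjective d
      · refine ⟨(D.endPt (c', .over)).1, (hlw _).mem_iff.2 ?_⟩
        exact List.mem_map.2 ⟨_, hend (c', .over), rfl⟩
      · rw [hsy] at hd; simp [ty] at hd
    · obtain ⟨c' | m, rfl⟩ := χ.surjective d
      · rw [hsy] at hd; simp [ty] at hd
      · rw [hsy] at hd
        simp only [ty, Sum.map_inr, Sum.inr.injEq] at hd
        rw [← hd]
        exact (hχ.word_color _ (.inr m, .over)).2 rfl
    · have := (hlw i).map (symbol (ty ∘ χ.symm))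
      rw [List.map_map] at this
      convert this using 2
      funext e
      simp [symbol]

end HomotopyZh
end

/-! ### Comparing frames before and after a move that is supported in a disc. -/

noncomputable section
namespace HomotopyZh
open Filter Topology

variable {S : Type*} [TopologicalSpace S] [ChartedSpace Plane S] {ι : Type*} {g : ℕ}
  {Ω : SymplecticBasis S g} {q : Plane → S} {D D' : LinkDiagram S ι}

open LinkDiagram

/-! ## Moving an arc inside a disc -/

lemma arc_sub_intCast (i : ι) (a b : ℝ) (n : ℤ) : arc i (a - n) (b - n) = arc i a b := by
  ext p
  constructor
  · rintro ⟨t, ht, rfl⟩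
    exact ⟨t + n, ⟨by linarith [ht.1], by linarith [ht.2]⟩, by rw [coe_add_intCast]⟩
  · rintro ⟨t, ht, rfl⟩
    refine ⟨t - n, ⟨by linarith [ht.1], by linarith [ht.2]⟩, ?_⟩
    rw [← coe_add_intCast (t - n) n, sub_add_cancel]

lemma mem_arc_iff {i : ι} {T a b : ℝ} (ha : T ≤ a) (hb : b < T + 1) {p : ι × UnitAddCircle} :
    p ∈ arc i a b ↔ p.1 = i ∧ time T p.2 ∈ Icc a b := by
  constructor
  · rintro ⟨t, ht, rfl⟩
    refine ⟨rfl, ?_⟩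
    rwa [time_coe ⟨ha.trans ht.1, ht.2.trans_lt hb⟩]
  · rintro ⟨rfl, h⟩
    exact ⟨_, h, by rw [coe_time]⟩

/-- The arcs do not contain the starting points of their components, after changing them by
integers. -/
lemma exists_start {U : Type*} (i : U → ι) (a b : U → ℝ) (m : U) (hlt : ∀ u, a u < b u)
    (hlt' : ∀ u, b u < a u + 1)
    (hd : ∀ u v, u ≠ v → Disjoint (arc (i u) (a u) (b u)) (arc (i v) (a v) (b v))) :
    ∃ (T : ι → ℝ) (n : U → ℤ), (∀ u, T (i u) ≤ a u - n u ∧ b u - n u < T (i u) + 1) ∧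
      T (i m) = a m - n m := by
  classical
  -- A component that contains arcs starts where one of its arcs starts. No other arc contains this
  -- point, as the arcs are disjoint, so an integer shift puts every arc inside one turn.
  obtain ⟨T, hT, hm⟩ : ∃ T : ι → ℝ, (∀ u, ∃ v, i v = i u ∧ T (i u) = a v) ∧ T (i m) = a m := by
    refine ⟨fun k => if k = i m then a m else if h : ∃ u, i u = k then a h.choose else 0,
      fun u => ?_, by simp⟩
    by_cases h : i u = i m
    · exact ⟨m, h.symm, by simp [h]⟩
    · have hu : ∃ v, i v = i u := ⟨u, rfl⟩
      exact ⟨hu.choose, hu.choose_spec, by simp [h, hu]⟩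
  have hav : ∀ u, ∀ t ∈ Ioc (a u) (b u), (t : UnitAddCircle) ≠ T (i u) := by
    intro u t ht e
    obtain ⟨v, hv, hTv⟩ := hT u
    by_cases h : u = v
    · subst h
      rw [hTv] at e
      obtain ⟨n, hn⟩ := coe_eq_coe_iff.1 e
      have h1 : (0 : ℝ) < n := by linarith [ht.1]
      have h2 : (n : ℝ) < 1 := by linarith [ht.2, hlt' u]
      have h1' : 0 < n := by exact_mod_cast h1
      have h2' : n < 1 := by exact_mod_cast h2
      omega
    · have hm : (i u, (t : UnitAddCircle)) ∈ arc (i u) (a u) (b u) := ⟨t, ⟨ht.1.le, ht.2⟩, rfl⟩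
      refine Set.disjoint_left.1 (hd u v h) hm ⟨a v, ⟨le_rfl, (hlt v).le⟩, ?_⟩
      rw [e, hTv, hv]
  refine ⟨T, fun u => ⌊a u - T (i u)⌋, fun u => ?_, by simp [hm]⟩
  have h1 := Int.floor_le (a u - T (i u))
  have h2 := Int.lt_floor_add_one (a u - T (i u))
  refine ⟨by linarith, ?_⟩
  by_contra! h3
  refine hav u (T (i u) + (⌊a u - T (i u)⌋ + 1 : ℤ)) ⟨?_, ?_⟩ (coe_add_intCast _ _)
  · push_cast; linarith
  · push_cast; linarith

/-- Inside the disc with coordinates `φ`, both diagrams consist of the arcs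
`arc (i u) (a u) (b u)`, and they differ only in the arc with index `m`.  The components start
at the times `T`. -/
structure LocalMove {U : Type*} (φ : OpenPartialHomeomorph S Plane) (D D' : LinkDiagram S ι)
    (T : ι → ℝ) (i : U → ι) (a b : U → ℝ) (m : U) : Prop where
  disc : IsDiscChart φ
  le : ∀ u, T (i u) ≤ a u
  lt : ∀ u, a u < b u
  lt' : ∀ u, b u < T (i u) + 1
  disjoint : ∀ u v, u ≠ v → Disjoint (arc (i u) (a u) (b u)) (arc (i v) (a v) (b v))
  start : T (i m) = a m
  mem : ∀ p, D.pt p ∈ φ.symm '' square ↔ ∃ u, p ∈ arc (i u) (a u) (b u)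
  mem' : ∀ p, D'.pt p ∈ φ.symm '' square ↔ ∃ u, p ∈ arc (i u) (a u) (b u)
  eq : ∀ p, p ∉ arc (i m) (a m) (b m) → D'.pt p = D.pt p

/-- The nearest point of the square. -/
def clamp (v : Plane) : Plane := !₂[max (-1) (min 1 (v 0)), max (-1) (min 1 (v 1))]

lemma continuous_clamp : Continuous clamp := by
  unfold clamp
  refine (PiLp.continuous_toLp 2 _).comp (continuous_pi fun j => ?_)
  fin_cases j
  · exact continuous_const.max (continuous_const.min (by fun_prop))
  · exact continuous_const.max (continuous_const.min (by fun_prop))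

lemma clamp_mem (v : Plane) : clamp v ∈ square := by
  simp [clamp, square]

lemma clamp_of_mem {v : Plane} (hv : v ∈ square) : clamp v = v := by
  obtain ⟨⟨h1, h2⟩, h3, h4⟩ := hv
  ext j
  fin_cases j <;> simp [clamp, *]

namespace LocalMove

variable {U : Type*} {φ : OpenPartialHomeomorph S Plane} {T : ι → ℝ} {i : U → ι} {a b : U → ℝ} {m : U}

lemma mem_arc (h : LocalMove φ D D' T i a b m) {u : U} {p : ι × UnitAddCircle} :
    p ∈ arc (i u) (a u) (b u) ↔ p.1 = i u ∧ time (T (i u)) p.2 ∈ Icc (a u) (b u) :=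
  mem_arc_iff (h.le u) (h.lt' u)

lemma isClosed_arc (j : ι) (s t : ℝ) : IsClosed {r : ℝ | (j, (r : UnitAddCircle)) ∈ arc j s t} := by
  have hK : IsClosed ((fun r : ℝ => (r : UnitAddCircle)) '' Icc s t) :=
    (isCompact_Icc.image (AddCircle.continuous_mk' 1)).isClosed
  have := hK.preimage (AddCircle.continuous_mk' (1 : ℝ))
  convert this using 1
  ext r
  constructor
  · rintro ⟨r', hr', e⟩
    exact ⟨r', hr', (Prod.mk.inj e).2.symm⟩
  · rintro ⟨r', hr', e⟩
    exact ⟨r', hr', Prod.ext rfl e.symm⟩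

lemma line_eq_of_notMem (h : LocalMove φ D D' T i a b m) {j : ι} {t : ℝ}
    (ht : (j, (t : UnitAddCircle)) ∉ arc (i m) (a m) (b m)) : D'.line j t = D.line j t :=
  h.eq _ ht

/-- The velocity outside the moved arc does not change. -/
lemma vel_eq (h : LocalMove φ D D' T i a b m) {p : ι × UnitAddCircle}
    (hp : p ∉ arc (i m) (a m) (b m)) : D'.vel p = D.vel p := by
  obtain ⟨j, p⟩ := p
  rw [D'.vel_eq_velocity 0, D.vel_eq_velocity 0]
  refine velocity_congr ?_
  by_cases hj : j = i m
  · subst hj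
    have : ∀ᶠ r : ℝ in 𝓝 (time 0 p), (i m, (r : UnitAddCircle)) ∉ arc (i m) (a m) (b m) :=
      (isClosed_arc (i m) (a m) (b m)).isOpen_compl.mem_nhds (by
        change ¬ (i m, ((time 0 p : ℝ) : UnitAddCircle)) ∈ arc (i m) (a m) (b m)
        rwa [coe_time])
    exact this.mono fun r hr => h.line_eq_of_notMem hr
  · exact .of_forall fun r => h.line_eq_of_notMem fun ⟨_, _, e⟩ => hj (Prod.mk.inj e).1

lemma line_eq_of_ne (h : LocalMove φ D D' T i a b m) {j : ι} (hj : j ≠ i m) : D'.line j = D.line j :=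
  funext fun _ => h.line_eq_of_notMem fun ⟨_, _, e⟩ => hj (Prod.mk.inj e).1

/-- Strictly between two passages of the moved arc the curves agree by hypothesis; at the two end
points they agree by continuity. -/
lemma line_eq [T2Space S] (h : LocalMove φ D D' T i a b m) {t : ℝ} (ht : t ∈ Icc (b m) (a m + 1)) :
    D'.line (i m) t = D.line (i m) t := by
  have hlt : b m < a m + 1 := h.start ▸ h.lt' m
  have hc : IsClosed {t | D'.line (i m) t = D.line (i m) t} :=
    isClosed_eq (D'.continuous_line _) (D.continuous_line _)
  have hsub : Ioo (b m) (a m + 1) ⊆ {t | D'.line (i m) t = D.line (i m) t} := by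
    intro r hr
    refine h.line_eq_of_notMem fun hm => ?_
    have := (h.mem_arc.1 hm).2
    simp only at this
    rw [time_coe ⟨by rw [h.start]; linarith [h.lt m, hr.1], by rw [h.start]; exact hr.2⟩] at this
    exact absurd this.2 (not_le.2 hr.1)
  have := closure_minimal hsub hc
  rw [closure_Ioo hlt.ne] at this
  exact this ht

lemma line_start [T2Space S] (h : LocalMove φ D D' T i a b m) :
    D'.line (i m) (a m) = D.line (i m) (a m) := by
  have hlt : b m < a m + 1 := h.start ▸ h.lt' m
  have := h.line_eq ⟨hlt.le, le_rfl⟩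
  have e1 := D.line_add_intCast (i m) (a m) 1
  have e2 := D'.line_add_intCast (i m) (a m) 1
  rw [Int.cast_one] at e1 e2
  rw [← e1, ← e2, this]

lemma coe_mem_arc {u : U} {t : ℝ} (ht : t ∈ Icc (a u) (b u)) :
    (i u, (t : UnitAddCircle)) ∈ arc (i u) (a u) (b u) := ⟨t, ht, rfl⟩

/-- Points in no arc are not at the moved arc, and the same for points in a different arc. -/
lemma notMem_of_mem (h : LocalMove φ D D' T i a b m) {u : U} (hu : u ≠ m) {p : ι × UnitAddCircle}
    (hp : p ∈ arc (i u) (a u) (b u)) : p ∉ arc (i m) (a m) (b m) :=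
  Set.disjoint_left.1 (h.disjoint u m hu) hp

end LocalMove

/-- The bundle is trivial over the disc. Composing `φ.symm` with the retraction `clamp` extends the
disc to a map of the whole plane, which is simply connected; `δ` is a transport along it. Every
transport along a curve in the disc is then a constant times `δ`. -/
lemma exists_disc_transport [T2Space S] (hq : IsCutPolygon Ω.loop q) (hg : 0 < g)
    {φ : OpenPartialHomeomorph S Plane} (hφ : IsDiscChart φ) :
    ∃ δ : Plane → SurfaceGroup g, ∀ (c : ℝ → S) (κ : ℝ → SurfaceGroup g) (a b : ℝ), Continuous c →
      IsTransport g q c κ → (∀ t ∈ Icc a b, c t ∈ φ.symm '' square) →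
        ∃ k, ∀ t ∈ Icc a b, κ t = k * δ (φ (c t)) := by
  have hf : Continuous (φ.symm ∘ clamp) :=
    φ.continuousOn_symm.comp_continuous continuous_clamp fun v => hφ.2 (clamp_mem v)
  obtain ⟨δ, hδ⟩ := hq.exists_transport hg hf
  refine ⟨δ, fun c κ a b hc hκ hm => ?_⟩
  rcases (Icc a b).eq_empty_or_nonempty with he | ⟨t₀, ht₀⟩
  · exact ⟨1, fun t ht => by simp [he] at ht⟩
  have hsrc : ∀ t ∈ Icc a b, c t ∈ φ.source ∧ φ (c t) ∈ square := by
    intro t ht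
    obtain ⟨v, hv, e⟩ := hm t ht
    rw [← e]
    exact ⟨φ.map_target (hφ.2 hv), by rwa [φ.right_inv (hφ.2 hv)]⟩
  let k : Icc a b → Plane := fun t => φ (c t)
  have hk : Continuous k := by
    have : ContinuousOn (φ ∘ c) (Icc a b) :=
      φ.continuousOn.comp hc.continuousOn fun t ht => (hsrc t ht).1
    exact continuousOn_iff_continuous_domRestrict.1 this
  have e : (φ.symm ∘ clamp) ∘ k = c ∘ ((↑) : Icc a b → ℝ) := by
    funext t
    simp only [Function.comp_apply, k]
    rw [clamp_of_mem (hsrc t t.2).2, φ.left_inv (hsrc t t.2).1]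
  have h1 := hδ.comp hk
  rw [e] at h1
  have : PreconnectedSpace (Icc a b) := Subtype.preconnectedSpace isPreconnected_Icc
  refine ⟨κ t₀ * (δ (φ (c t₀)))⁻¹, fun t ht => ?_⟩
  have := h1.mul_inv_eq hq (hc.comp continuous_subtype_val) (hκ.comp continuous_subtype_val)
    ⟨t, ht⟩ ⟨t₀, ht₀⟩
  simp only [Function.comp_apply, k] at this
  rw [← this]
  group

namespace LocalMove

variable {U : Type*} {φ : OpenPartialHomeomorph S Plane} {T : ι → ℝ} {i : U → ι} {a b : U → ℝ} {m : U}

/-- Presentations of the diagrams before and after a local move. -/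
lemma exists_presents [T2Space S] (hq : IsCutPolygon Ω.loop q) (hg : 0 < g)
    (h : LocalMove φ D D' T i a b m) :
    ∃ κ b₁ Θ κ' b₁' Θ', Presents q D T κ b₁ Θ ∧ Presents q D' T κ' b₁' Θ' ∧ Θ'.mono = Θ.mono ∧
      (∃ H : U → SurfaceGroup g,
        (∀ u e, D.endPt e ∈ arc (i u) (a u) (b u) → Θ.state e = H u) ∧
        ∀ u e, D'.endPt e ∈ arc (i u) (a u) (b u) → Θ'.state e = H u) ∧
      ∀ e e', D'.endPt e' = D.endPt e → (∀ u, D.endPt e ∉ arc (i u) (a u) (b u)) →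
        Θ'.state e' = Θ.state e := by
  classical
  obtain ⟨κ, hκ⟩ := hq.exists_transport_line hg D
  obtain ⟨κ₁, hκ₁⟩ := hq.exists_transport_line hg D'
  obtain ⟨δ, hδ⟩ := exists_disc_transport hq hg h.disc
  -- The transport along the new diagram is normalized to agree with the old one where the moved arc
  -- begins. The coefficients relative to `δ` then agree on the moved arc, so the transports agree
  -- again behind it.
  let κ' : ι → ℝ → SurfaceGroup g := fun j t => κ j (a m) * (κ₁ j (a m))⁻¹ * κ₁ j t
  have hκ' : ∀ j, IsTransport g q (D'.line j) (κ' j) := fun j t => (hκ₁ j t).const_mul _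
  have hstart : ∀ j, κ' j (a m) = κ j (a m) := fun j => by simp [κ']
  have hne : ∀ j, j ≠ i m → ∀ t, κ' j t = κ j t := by
    intro j hj t
    have h1 := hκ' j
    rw [h.line_eq_of_ne hj] at h1
    have := (hκ j).mul_inv_eq hq (D.continuous_line j) h1 t (a m)
    rwa [hstart, mul_inv_cancel, mul_inv_eq_one] at this
  choose K hK using fun u => hδ (D.line (i u)) (κ (i u)) (a u) (b u) (D.continuous_line _) (hκ _)
    fun t ht => (h.mem (i u, (t : UnitAddCircle))).2 ⟨u, coe_mem_arc ht⟩
  choose K' hK' using fun u => hδ (D'.line (i u)) (κ' (i u)) (a u) (b u) (D'.continuous_line _)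
    (hκ' _) fun t ht => (h.mem' (i u, (t : UnitAddCircle))).2 ⟨u, coe_mem_arc ht⟩
  have hKm : K' m = K m := by
    have h1 := hK' m (a m) ⟨le_rfl, (h.lt m).le⟩
    rw [hstart, hK m (a m) ⟨le_rfl, (h.lt m).le⟩, h.line_start] at h1
    exact (mul_right_cancel h1).symm
  have hlt : b m < a m + 1 := h.start ▸ h.lt' m
  have hend : ∀ t ∈ Icc (b m) (a m + 1), κ' (i m) t = κ (i m) t := by
    have hb : κ' (i m) (b m) = κ (i m) (b m) := by
      rw [hK' m _ ⟨(h.lt m).le, le_rfl⟩, hK m _ ⟨(h.lt m).le, le_rfl⟩, hKm,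
        h.line_eq ⟨le_rfl, hlt.le⟩]
    intro t ht
    have : PreconnectedSpace (Icc (b m) (a m + 1)) := Subtype.preconnectedSpace isPreconnected_Icc
    have h1 := (hκ' (i m)).comp (continuous_subtype_val (p := (· ∈ Icc (b m) (a m + 1))))
    have e : D'.line (i m) ∘ ((↑) : Icc (b m) (a m + 1) → ℝ) = D.line (i m) ∘ (↑) :=
      funext fun t => h.line_eq t.2
    rw [e] at h1
    have := ((hκ (i m)).comp continuous_subtype_val).mul_inv_eq hq
      ((D.continuous_line _).comp continuous_subtype_val) h1 ⟨t, ht⟩ ⟨b m, le_rfl, hlt.le⟩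
    simp only [Function.comp_apply] at this
    rwa [hb, mul_inv_cancel, mul_inv_eq_one] at this
  -- An arc that does not move lies on another component, or on the part of the component of the
  -- moved arc where old and new transport agree.
  have hKu : ∀ u, K' u = K u := by
    intro u
    by_cases hum : u = m
    · rw [hum, hKm]
    by_cases hi : i u = i m
    · have h2 : (i u, ((a u : ℝ) : UnitAddCircle)) ∉ arc (i m) (a m) (b m) :=
        h.notMem_of_mem hum (coe_mem_arc ⟨le_rfl, (h.lt u).le⟩)
      have ht : a u ∈ Ico (T (i u)) (T (i u) + 1) := ⟨h.le u, (h.lt u).trans (h.lt' u)⟩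
      have h3 : a u ∈ Icc (b m) (a m + 1) := by
        rw [hi, h.start] at ht
        refine ⟨?_, ht.2.le⟩
        by_contra! h4
        refine h2 (h.mem_arc.2 ⟨hi, ?_⟩)
        rw [h.start, time_coe ht]
        exact ⟨ht.1, h4.le⟩
      have h1 := hK' u (a u) ⟨le_rfl, (h.lt u).le⟩
      rw [hi, hend _ h3, h.line_eq h3, ← hi, hK u (a u) ⟨le_rfl, (h.lt u).le⟩] at h1
      exact (mul_right_cancel h1).symm
    · have h1 := hK' u (a u) ⟨le_rfl, (h.lt u).le⟩
      rw [hne _ hi, h.line_eq_of_ne hi, hK u (a u) ⟨le_rfl, (h.lt u).le⟩] at h1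
      exact (mul_right_cancel h1).symm
  -- At crossings in the disc the frame `δ` is used, so the state at an end on the arc `u` is the
  -- constant `K u`, wherever on the arc the end lies. Outside the disc the frame `1` serves both
  -- diagrams.
  obtain ⟨Θ, hΘ⟩ := HomotopyZh.exists_presents q D T hκ
    fun c => if D.pt c.1.1 ∈ φ.symm '' square then δ (φ (D.pt c.1.1)) else 1
  obtain ⟨Θ', hΘ'⟩ := HomotopyZh.exists_presents q D' T hκ'
    fun c => if D'.pt c.1.1 ∈ φ.symm '' square then δ (φ (D'.pt c.1.1)) else 1
  refine ⟨κ, _, Θ, κ', _, Θ', hΘ, hΘ', ?_, ⟨K, ?_, ?_⟩, ?_⟩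
  · funext j
    rw [hΘ'.mono, hΘ.mono]
    by_cases hj : j = i m
    · subst hj
      rw [h.start, hstart, hend _ ⟨hlt.le, le_rfl⟩]
    · rw [hne j hj, hne j hj]
  · intro u e he
    obtain ⟨h1, h2⟩ := h.mem_arc.1 he
    have hm := (h.mem _).2 ⟨u, he⟩
    rw [D.pt_endPt] at hm
    rw [hΘ.state, if_pos hm, LinkDiagram.endTime, ← D.pt_endPt, D.pt_eq_line (T (D.endPt e).1), h1,
      hK u _ h2]
    group
  · intro u e he
    obtain ⟨h1, h2⟩ := h.mem_arc.1 he
    have hm := (h.mem' _).2 ⟨u, he⟩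
    rw [D'.pt_endPt] at hm
    rw [hΘ'.state, if_pos hm, LinkDiagram.endTime, ← D'.pt_endPt, D'.pt_eq_line (T (D'.endPt e).1),
      h1, hK' u _ h2, hKu]
    group
  · intro e e' hee he
    have hm : ¬ D.pt e.1.1.1 ∈ φ.symm '' square := by
      rw [← D.pt_endPt, h.mem]; simpa using he
    have hm' : ¬ D'.pt e'.1.1.1 ∈ φ.symm '' square := by
      rw [← D'.pt_endPt, h.mem', hee]; simpa using he
    rw [hΘ'.state, hΘ.state, if_neg hm, if_neg hm', LinkDiagram.endTime, LinkDiagram.endTime, hee]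
    congr 1
    by_cases hj : (D.endPt e).1 = i m
    · have h1 := time_mem (T (i m)) (D.endPt e).2
      rw [hj]
      refine hend _ ⟨?_, ?_⟩
      · by_contra! h2
        exact he m (h.mem_arc.2 ⟨hj, by rw [← h.start]; exact h1.1, h2.le⟩)
      · rw [← h.start]; exact h1.2.le
    · exact hne _ hj _

/-- The signs of crossings outside the moved arc do not change. -/
lemma sign_eq {κ b₁ κ' b₁'} {Θ : Holonomy ι D.crossings g} {Θ' : Holonomy ι D'.crossings g}
    (h : LocalMove φ D D' T i a b m) (hΘ : Presents q D T κ b₁ Θ) (hΘ' : Presents q D' T κ' b₁' Θ')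
    {c : D.crossings} {c' : D'.crossings} (hc : c'.1 = c.1) (h1 : c.1.1 ∉ arc (i m) (a m) (b m))
    (h2 : c.1.2 ∉ arc (i m) (a m) (b m)) : Θ'.sign c' = Θ.sign c := by
  refine sign_eq_sign (hΘ'.sign c') (hΘ.sign c) ?_
  rw [hc, h.vel_eq h1, h.vel_eq h2]
  exact mul_self_pos.2 (D.transverse c.1 c.2)

/-- If the move creates crossings in the disc, where there were none, then the diagram before the
move is obtained by erasing them. -/
lemma restricts {κ b₁ κ' b₁'} {Θ : Holonomy ι D.crossings g} {Θ' : Holonomy ι D'.crossings g}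
    (h : LocalMove φ D D' T i a b m) (hΘ : Presents q D T κ b₁ Θ) (hΘ' : Presents q D' T κ' b₁' Θ')
    (hm : Θ'.mono = Θ.mono)
    (hst : ∀ e e', D'.endPt e' = D.endPt e → (∀ u, D.endPt e ∉ arc (i u) (a u) (b u)) →
        Θ'.state e' = Θ.state e)
    (hsub : D.crossings ⊆ D'.crossings)
    (hoff : ∀ c ∈ D.crossings, ∀ u, c.1 ∉ arc (i u) (a u) (b u) ∧ c.2 ∉ arc (i u) (a u) (b u)) :
    Θ'.Restricts (Set.inclusion hsub) Θ := by
  classical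
  have hend : ∀ e, D'.endPt (Prod.map (Set.inclusion hsub) id e) = D.endPt e := by
    rintro ⟨c, _ | _⟩ <;> rfl
  have hoff' : ∀ e u, D.endPt e ∉ arc (i u) (a u) (b u) := by
    rintro ⟨c, _ | _⟩ u
    · exact (hoff c.1 c.2 u).1
    · exact (hoff c.1 c.2 u).2
  refine ⟨Set.inclusion_injective hsub, fun c => ?_, fun j => ?_, fun e => ?_, ?_⟩
  · exact (h.sign_eq hΘ hΘ' (c' := Set.inclusion hsub c) rfl (hoff c.1 c.2 m).1
      (hoff c.1 c.2 m).2).symm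
  · refine sorted_ext (f := D'.endTime T) ?_ ((hΘ'.sorted j).filter _) fun e => ?_
    · rw [List.pairwise_map]
      refine (hΘ.sorted j).imp fun {e e'} hee => ?_
      simpa only [LinkDiagram.endTime, hend] using hee
    · simp only [List.mem_map, List.mem_filter, decide_eq_true_eq, hΘ.mem_ends, hΘ'.mem_ends,
        Set.mem_range]
      constructor
      · rintro ⟨e, he, rfl⟩
        exact ⟨by rw [hend, he], e.1, rfl⟩
      · obtain ⟨c, r⟩ := e
        rintro ⟨he, c', rfl⟩
        refine ⟨(c', r), ?_, rfl⟩
        have := hend (c', r)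
        rw [← this]
        exact he
  · exact (hst e _ (hend e) (hoff' e)).symm
  · exact hm.symm

/-- Crossings with one end in the disc have both ends in the disc. -/
lemma exists_mem_iff (h : LocalMove φ D D' T i a b m) {c : (ι × UnitAddCircle) × (ι × UnitAddCircle)}
    (hc : c ∈ D.crossings) :
    (∃ u, c.1 ∈ arc (i u) (a u) (b u)) ↔ ∃ u, c.2 ∈ arc (i u) (a u) (b u) := by
  rw [← h.mem, ← h.mem, D.pt_fst_eq_snd hc]

lemma exists_mem_iff' (h : LocalMove φ D D' T i a b m)
    {c : (ι × UnitAddCircle) × (ι × UnitAddCircle)} (hc : c ∈ D'.crossings) :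
    (∃ u, c.1 ∈ arc (i u) (a u) (b u)) ↔ ∃ u, c.2 ∈ arc (i u) (a u) (b u) := by
  rw [← h.mem', ← h.mem', D'.pt_fst_eq_snd hc]

end LocalMove

end HomotopyZh
end

/-! ### Neighbouring crossings on graphs in a disc; removing a single kink. -/

noncomputable section
namespace HomotopyZh
open Filter Topology

variable {S : Type*} [TopologicalSpace S] [ChartedSpace Plane S] {ι : Type*} {g : ℕ}
  {Ω : SymplecticBasis S g} {q : Plane → S} {D D' : LinkDiagram S ι}

open LinkDiagram

/-! ## Arcs that are graphs -/

/-- Two ends that are alone on an arc are neighbours. -/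
lemma Presents.adjacent {T κ b₁} {Θ : Holonomy ι D.crossings g} (h : Presents q D T κ b₁ Θ)
    {i : ι} {a b : ℝ} (ha : T i ≤ a) (hb : b < T i + 1) {e f : D.crossings × Role}
    (he : D.endPt e ∈ arc i a b) (hf : D.endPt f ∈ arc i a b)
    (honly : ∀ e', D.endPt e' ∈ arc i a b → e' = e ∨ e' = f) (hst : Θ.state e = Θ.state f) {o : ℤˣ}
    (ho : ((o : ℤ) : ℝ) * time (T i) (D.endPt e).2 < ((o : ℤ) : ℝ) * time (T i) (D.endPt f).2) :
    Θ.Adjacent o e f := by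
  have key : ∀ {e f : D.crossings × Role}, D.endPt e ∈ arc i a b → D.endPt f ∈ arc i a b →
      (∀ e', D.endPt e' ∈ arc i a b → e' = e ∨ e' = f) →
      time (T i) (D.endPt e).2 < time (T i) (D.endPt f).2 →
      ∃ j p q, Θ.ends j = p ++ e :: f :: q := by
    intro e f he hf honly hlt
    rw [mem_arc_iff ha hb] at he hf
    refine ⟨i, sorted_consecutive (h.sorted i) ((h.mem_ends i e).2 he.1) ((h.mem_ends i f).2 hf.1)
      ?_ fun c hc h1 h2 => ?_⟩
    · rwa [LinkDiagram.endTime, LinkDiagram.endTime, he.1, hf.1]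
    · have hci := (h.mem_ends i c).1 hc
      simp only [LinkDiagram.endTime, he.1, hf.1, hci] at h1 h2
      rcases honly c ((mem_arc_iff ha hb).2 ⟨hci, by linarith [he.2.1], by linarith [hf.2.2]⟩)
        with rfl | rfl
      · exact lt_irrefl _ h1
      · exact lt_irrefl _ h2
  refine ⟨hst, ?_⟩
  rcases Int.units_eq_one_or o with rfl | rfl
  · exact .inl ⟨rfl, key he hf honly (by simpa using ho)⟩
  · exact .inr ⟨rfl, key hf he (fun e' h' => (honly e' h').symm) (by simpa using ho)⟩

/-- The first coordinate of a point of a diagram. -/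
def abscissa (φ : OpenPartialHomeomorph S Plane) (D : LinkDiagram S ι) (p : ι × UnitAddCircle) : ℝ :=
  φ (D.pt p) 0

/-- In the coordinates `φ`, an arc is the graph of `F` over `[-1, 1]`, traversed in the
direction `ε`. -/
structure IsStrand (φ : OpenPartialHomeomorph S Plane) (D : LinkDiagram S ι) (i : ι) (a b : ℝ)
    (F : ℝ → ℝ) (ε : ℤˣ) : Prop where
  lt : a < b
  source : ∀ p ∈ arc i a b, D.pt p ∈ φ.source
  abscissa_mem : ∀ p ∈ arc i a b, abscissa φ D p ∈ Icc (-1 : ℝ) 1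
  ordinate : ∀ p ∈ arc i a b, φ (D.pt p) 1 = F (abscissa φ D p)
  surj : ∀ x ∈ Icc (-1 : ℝ) 1, ∃ p ∈ arc i a b, abscissa φ D p = x
  mono : StrictMonoOn (fun t : ℝ => ((ε : ℤ) : ℝ) * abscissa φ D (i, (t : UnitAddCircle))) (Icc a b)
  velocity_eq : ∀ t ∈ Icc a b, ∃ x' : ℝ, 0 < ((ε : ℤ) : ℝ) * x' ∧
    velocity (φ ∘ D.line i) t = !₂[x', deriv F (abscissa φ D (i, (t : UnitAddCircle))) * x']

lemma isGraphStrand_sub_intCast {φ : OpenPartialHomeomorph S Plane} {i : ι} {a b : ℝ} {F : ℝ → ℝ}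
    (h : IsGraphStrand φ D i a b F) (n : ℤ) : IsGraphStrand φ D i (a - n) (b - n) F := by
  obtain ⟨h1, h2, h3, h4⟩ := h
  have e : ∀ t : ℝ, ((t - n : ℝ) : UnitAddCircle) = t := fun t => by
    rw [← coe_add_intCast (t - n) n, sub_add_cancel]
  have e' : ∀ t : ℝ, ((t + n : ℝ) : UnitAddCircle) = t := fun t => coe_add_intCast t n
  refine ⟨by linarith, by linarith, fun t ht => ?_, ?_⟩
  · rw [← e']
    exact h3 _ ⟨by linarith [ht.1], by linarith [ht.2]⟩
  · have hb : BijOn (fun t : ℝ => t + n) (Icc (a - n) (b - n)) (Icc a b) := by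
      refine ⟨fun t ht => ⟨by linarith [ht.1], by linarith [ht.2]⟩, fun s _ t _ hst => ?_,
        fun t ht => ⟨t - n, ⟨by linarith [ht.1], by linarith [ht.2]⟩, sub_add_cancel _ _⟩⟩
      simpa using hst
    have := h4.comp hb
    convert this using 1
    funext t
    simp only [Function.comp_apply, e']

/-- Along a graph the abscissa determines the point, so it is continuous and injective in time,
hence monotone; this gives the direction `ε`. The vertical velocity is `F'` times the horizontal
one. The latter cannot vanish, as the curve is immersed. -/
lemma IsStrand.of_isGraphStrand [IsManifold (𝓡 2) ∞ S] {φ : OpenPartialHomeomorph S Plane}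
    (hφ : φ ∈ IsManifold.maximalAtlas (𝓡 2) ∞ S) {i : ι} {a b : ℝ} {F : ℝ → ℝ}
    (hF : Differentiable ℝ F) (h : IsGraphStrand φ D i a b F) : ∃ ε, IsStrand φ D i a b F ε := by
  obtain ⟨hab, -, hsrc, hbij⟩ := h
  set X : ℝ → ℝ := fun t => abscissa φ D (i, (t : UnitAddCircle)) with hX
  have hgraph : ∀ t ∈ Icc a b, X t ∈ Icc (-1 : ℝ) 1 ∧ φ (D.line i t) 1 = F (X t) :=
    fun t ht => hbij.mapsTo ht
  have hinj : InjOn X (Icc a b) := by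
    intro s hs t ht hst
    refine hbij.injOn hs ht ?_
    ext j
    fin_cases j
    · exact hst
    · refine (hgraph s hs).2.trans ?_
      rw [hst]
      exact (hgraph t ht).2.symm
  have hc : ContinuousOn X (Icc a b) := by
    have : ContinuousOn (φ ∘ D.line i) (Icc a b) :=
      φ.continuousOn.comp (D.continuous_line i).continuousOn hsrc
    exact (EuclideanSpace.proj (𝕜 := ℝ) (0 : Fin 2)).continuous.comp_continuousOn this
  obtain ⟨ε, hε⟩ : ∃ ε : ℤˣ, StrictMonoOn (fun t => ((ε : ℤ) : ℝ) * X t) (Icc a b) := by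
    rcases hc.strictMonoOn_of_injOn_Icc' hab.le hinj with h | h
    · exact ⟨1, by simpa using h⟩
    · refine ⟨-1, fun s hs t ht hst => ?_⟩
      have := h hs ht hst
      push_cast
      linarith
  refine ⟨ε, hab, ?_, ?_, ?_, fun x hx => ?_, hε, fun t ht => ?_⟩
  · rintro _ ⟨t, ht, rfl⟩; exact hsrc t ht
  · rintro _ ⟨t, ht, rfl⟩; exact (hgraph t ht).1
  · rintro _ ⟨t, ht, rfl⟩; exact (hgraph t ht).2
  · obtain ⟨t, ht, e⟩ := hbij.surjOn (show (!₂[x, F x] : Plane) ∈ _ from ⟨hx, rfl⟩)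
    refine ⟨_, ⟨t, ht, rfl⟩, ?_⟩
    change (fun t : ℝ => φ (D.curve i (t : UnitAddCircle))) t 0 = x
    rw [e]; rfl
  · have hmd : MDifferentiableAt 𝓘(ℝ, ℝ) (𝓡 2) (φ ∘ D.line i) t :=
      (mdifferentiableAt_of_mem_maximalAtlas hφ (hsrc t ht)).comp t (D.mdifferentiableAt_line i t)
    have hd : HasDerivAt (φ ∘ D.line i) (deriv (φ ∘ D.line i) t) t :=
      hmd.differentiableAt.hasDerivAt
    have hne : deriv (φ ∘ D.line i) t ≠ 0 := by
      intro h0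
      have h1 := velocity_comp (f := φ.symm) (c := φ ∘ D.line i) (t := t)
        (mdifferentiableAt_symm_of_mem_maximalAtlas hφ (φ.map_source (hsrc t ht))) hmd
      rw [velocity_plane, h0] at h1
      have h2 : velocity (φ.symm ∘ φ ∘ D.line i) t = velocity (D.line i) t := by
        refine velocity_congr ?_
        filter_upwards [(D.continuous_line i).continuousAt.preimage_mem_nhds
          (φ.open_source.mem_nhds (hsrc t ht))] with s hs
        exact φ.left_inv hs
      refine D.velocity_line_ne_zero i t ?_
      rw [← h2, h1]
      exact (mfderiv (𝓡 2) (𝓡 2) φ.symm ((φ ∘ D.line i) t) : Plane →L[ℝ] Plane).map_zero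
    have hx : HasDerivAt X (deriv (φ ∘ D.line i) t 0) t := hasDerivAt_coord hd 0
    have hy : HasDerivAt (fun s => φ (D.line i s) 1) (deriv (φ ∘ D.line i) t 1) t :=
      hasDerivAt_coord hd 1
    -- The curve follows the graph only for times in `[a, b]`; at the end points the derivatives are
    -- therefore compared within this interval.
    have huniq : UniqueDiffWithinAt ℝ (Icc a b) t := uniqueDiffOn_Icc hab t ht
    have hy' : HasDerivWithinAt (fun s => φ (D.line i s) 1)
        (deriv F (X t) * deriv (φ ∘ D.line i) t 0) (Icc a b) t :=
      ((hF (X t)).hasDerivAt.comp t hx).hasDerivWithinAt.congr (fun s hs => (hgraph s hs).2)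
        (hgraph t ht).2
    have e1 : deriv (φ ∘ D.line i) t 1 = deriv F (X t) * deriv (φ ∘ D.line i) t 0 :=
      huniq.eq_deriv _ hy.hasDerivWithinAt hy'
    have hnn : 0 ≤ ((ε : ℤ) : ℝ) * deriv (φ ∘ D.line i) t 0 := by
      have := hε.monotoneOn.derivWithin_nonneg (x := t)
      rwa [((hx.const_mul ((ε : ℤ) : ℝ)).hasDerivWithinAt (s := Icc a b)).derivWithin huniq] at this
    refine ⟨deriv (φ ∘ D.line i) t 0, lt_of_le_of_ne hnn fun h0 => hne ?_, ?_⟩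
    · have hz : deriv (φ ∘ D.line i) t 0 = 0 := by
        have hε0 : ((ε : ℤ) : ℝ) ≠ 0 := by exact_mod_cast ε.ne_zero
        exact (mul_eq_zero.1 h0.symm).resolve_left hε0
      ext j
      fin_cases j
      · exact hz
      · change deriv (φ ∘ D.line i) t 1 = 0
        rw [e1, hz, mul_zero]
    · rw [velocity_plane]
      ext j
      fin_cases j
      · rfl
      · exact e1

namespace IsStrand

variable {φ : OpenPartialHomeomorph S Plane} {i : ι} {a b : ℝ} {F : ℝ → ℝ} {ε : ℤˣ}

lemma time_lt (h : IsStrand φ D i a b F ε) {T : ℝ} (ha : T ≤ a) (hb : b < T + 1)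
    {p r : ι × UnitAddCircle} (hp : p ∈ arc i a b) (hr : r ∈ arc i a b)
    (hpr : abscissa φ D p < abscissa φ D r) :
    ((ε : ℤ) : ℝ) * time T p.2 < ((ε : ℤ) : ℝ) * time T r.2 := by
  obtain ⟨s, hs, rfl⟩ := hp
  obtain ⟨t, ht, rfl⟩ := hr
  simp only
  rw [time_coe ⟨ha.trans hs.1, hs.2.trans_lt hb⟩, time_coe ⟨ha.trans ht.1, ht.2.trans_lt hb⟩]
  have := h.mono.lt_iff_lt hs ht
  rcases Int.units_eq_one_or ε with rfl | rfl
  · simp only [Units.val_one, Int.cast_one, one_mul] at *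
    exact this.1 hpr
  · have h2 := h.mono.lt_iff_lt ht hs
    simp only [Units.val_neg, Units.val_one, Int.cast_neg, Int.cast_one, neg_mul, one_mul,
      neg_lt_neg_iff] at *
    exact h2.1 hpr

lemma abscissa_injOn (h : IsStrand φ D i a b F ε) : InjOn (abscissa φ D) (arc i a b) := by
  rintro _ ⟨s, hs, rfl⟩ _ ⟨t, ht, rfl⟩ hst
  have := h.mono.injOn hs ht (by simp only [hst])
  rw [this]

/-- A monotone strand that covers `[-1, 1]` starts at one of the two ends, according to its
direction. Comparing starting points thus shows that a move preserves the direction of its arcs. -/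
lemma abscissa_start (h : IsStrand φ D i a b F ε) :
    abscissa φ D (i, (a : UnitAddCircle)) = -((ε : ℤ) : ℝ) := by
  have ha : a ∈ Icc a b := ⟨le_rfl, h.lt.le⟩
  have h0 := h.abscissa_mem _ ⟨a, ha, rfl⟩
  rcases Int.units_eq_one_or ε with rfl | rfl
  · obtain ⟨_, ⟨t, ht, rfl⟩, e⟩ := h.surj (-1) ⟨le_rfl, by norm_num⟩
    have := h.mono.monotoneOn ha ht ht.1
    simp only [Units.val_one, Int.cast_one, one_mul] at *
    rw [e] at this
    exact le_antisymm this h0.1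
  · obtain ⟨_, ⟨t, ht, rfl⟩, e⟩ := h.surj 1 ⟨by norm_num, le_rfl⟩
    have := h.mono.monotoneOn ha ht ht.1
    simp only [Units.val_neg, Units.val_one, Int.cast_neg, Int.cast_one, neg_mul, one_mul,
      neg_neg] at *
    rw [e] at this
    linarith [h0.2]

/-- Two points with the same coordinates agree. -/
lemma pt_eq {j : ι} {c d : ℝ} {G : ℝ → ℝ} {ε' : ℤˣ} (h : IsStrand φ D i a b F ε)
    (h' : IsStrand φ D j c d G ε') {p r : ι × UnitAddCircle} (hp : p ∈ arc i a b)
    (hr : r ∈ arc j c d) (hx : abscissa φ D p = abscissa φ D r)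
    (hFG : F (abscissa φ D r) = G (abscissa φ D r)) : D.pt p = D.pt r := by
  refine φ.injOn (h.source p hp) (h'.source r hr) ?_
  ext k
  fin_cases k
  · exact hx
  · change φ (D.pt p) 1 = φ (D.pt r) 1
    rw [h.ordinate p hp, h'.ordinate r hr, hx, hFG]

/-- At a common point the two functions agree. -/
lemma eq_of_pt_eq {j : ι} {c d : ℝ} {G : ℝ → ℝ} {ε' : ℤˣ} (h : IsStrand φ D i a b F ε)
    (h' : IsStrand φ D j c d G ε') {p r : ι × UnitAddCircle} (hp : p ∈ arc i a b)
    (hr : r ∈ arc j c d) (hpr : D.pt p = D.pt r) : F (abscissa φ D p) = G (abscissa φ D p) := by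
  rw [← h.ordinate p hp, hpr, h'.ordinate r hr, abscissa, abscissa, hpr]

/-- The sign of a crossing of two graphs. -/
lemma sign_pos [IsManifold (𝓡 2) ∞ S] (hφ : φ ∈ IsManifold.maximalAtlas (𝓡 2) ∞ S) {j : ι} {s t : ℝ}
    {G : ℝ → ℝ} {ε' : ℤˣ} (h : IsStrand φ D i a b F ε) (h' : IsStrand φ D j s t G ε')
    {c : D.crossings} (h1 : c.1.1 ∈ arc i a b) (h2 : c.1.2 ∈ arc j s t) {η : ℤˣ}
    (hη : 0 < ((η : ℤ) : ℝ) * jac φ (D.pt c.1.1)) {σ : ℤˣ}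
    (hσ : 0 < ((σ : ℤ) : ℝ) * wedge (D.vel c.1.1) (D.vel c.1.2)) :
    0 < (((σ * (η * ε * ε') : ℤˣ) : ℤ) : ℝ) *
      (deriv G (abscissa φ D c.1.1) - deriv F (abscissa φ D c.1.1)) := by
  obtain ⟨⟨p, r⟩, hc⟩ := c
  simp only at h1 h2 hη hσ ⊢
  have hpr : D.pt p = D.pt r := D.pt_fst_eq_snd hc
  have hxx : abscissa φ D r = abscissa φ D p := by rw [abscissa, abscissa, hpr]
  obtain ⟨u, hu, rfl⟩ := h1
  obtain ⟨v, hv, rfl⟩ := h2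
  obtain ⟨x', hx', ex⟩ := h.velocity_eq u hu
  obtain ⟨y', hy', ey⟩ := h'.velocity_eq v hv
  rw [D.pt_coe] at hη
  rw [D.vel_coe, D.vel_coe] at hσ
  have hw := wedge_velocity_comp (f := φ) (c := D.line i) (c' := D.line j) (t := u) (t' := v)
    (mdifferentiableAt_of_mem_maximalAtlas hφ (h.source _ ⟨u, hu, rfl⟩))
    (D.mdifferentiableAt_line i u) (D.mdifferentiableAt_line j v) hpr
  rw [ex, ey, hxx] at hw
  set x := abscissa φ D (i, (u : UnitAddCircle))
  have e : wedge !₂[x', deriv F x * x'] !₂[y', deriv G x * y'] =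
      x' * y' * (deriv G x - deriv F x) := by simp [wedge]; ring
  rw [e] at hw
  set W := wedge (velocity (D.line i) u) (velocity (D.line j) v)
  set J := jac φ (D.line i u)
  have hsq : ∀ ν : ℤˣ, ((ν : ℤ) : ℝ) * ((ν : ℤ) : ℝ) = 1 := fun ν => by
    rcases Int.units_eq_one_or ν with rfl | rfl <;> norm_num
  have hP : 0 < (((ε : ℤ) : ℝ) * x') * (((ε' : ℤ) : ℝ) * y') := mul_pos hx' hy'
  have hQ : 0 < (((σ : ℤ) : ℝ) * W) * (((η : ℤ) : ℝ) * J) := mul_pos hσ hη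
  refine (pos_iff_pos_of_mul_pos ?_).2 hP
  have : (((σ * (η * ε * ε') : ℤˣ) : ℤ) : ℝ) * (deriv G x - deriv F x) *
      ((((ε : ℤ) : ℝ) * x') * (((ε' : ℤ) : ℝ) * y')) =
      ((σ : ℤ) : ℝ) * ((η : ℤ) : ℝ) * (((ε : ℤ) : ℝ) * ((ε : ℤ) : ℝ)) *
        (((ε' : ℤ) : ℝ) * ((ε' : ℤ) : ℝ)) * (x' * y' * (deriv G x - deriv F x)) := by
    push_cast; ring
  rw [this, hsq, hsq, hw]
  linarith

end IsStrand

lemma isPreconnected_square : IsPreconnected square := by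
  refine Convex.isPreconnected fun v hv w hw s t hs ht hst => ?_
  obtain ⟨⟨h1, h2⟩, h3, h4⟩ := hv
  obtain ⟨⟨h5, h6⟩, h7, h8⟩ := hw
  refine ⟨⟨?_, ?_⟩, ?_, ?_⟩ <;> simp only [PiLp.add_apply, PiLp.smul_apply, smul_eq_mul] <;> nlinarith

lemma LinkDiagram.IsDiscChart.exists_sign [IsManifold (𝓡 2) ∞ S] (hS : IsOrientedAtlas S)
    {φ : OpenPartialHomeomorph S Plane} (hφ : IsDiscChart φ) :
    ∃ η : ℤˣ, ∀ x ∈ φ.symm '' square, 0 < ((η : ℤ) : ℝ) * jac φ x := by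
  refine exists_sign_jac_chart hS hφ.1
    (isPreconnected_square.image _ (φ.continuousOn_symm.mono hφ.2)) ?_
  rintro _ ⟨v, hv, rfl⟩
  exact φ.map_target (hφ.2 hv)

/-! ## The first Reidemeister move -/

/-- The two ends of the new crossing are the only ends on the arc, and in the disc they are in the
same state. So they are neighbours in the canonical words, and the chord can be erased. -/
lemma holonomyEquivalent_of_reidemeister1 [IsManifold (𝓡 2) ∞ S] [T2Space S] [Finite ι]
    (hq : IsCutPolygon Ω.loop q) (hg : 0 < g) (h : D.Reidemeister1 D') :
    HolonomyEquivalent g q D D' := by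
  obtain ⟨φ, hφ, i, a, b, hab, hba, hm, hm', heq, hoff, c, hc1, hc2, hins⟩ := h
  obtain ⟨T, n, hT, hstart⟩ := exists_start (U := Unit) (fun _ => i) (fun _ => a) (fun _ => b) ()
    (fun _ => hab) (fun _ => hba) fun u v huv => (huv rfl).elim
  rw [← arc_sub_intCast i a b (n ())] at hc1 hc2
  have hL : LocalMove φ D D' T (fun _ : Unit => i) (fun _ => a - n ()) (fun _ => b - n ()) () :=
    { disc := hφ
      le := fun u => (hT u).1
      lt := fun u => by linarith
      lt' := fun u => (hT u).2
      disjoint := fun u v huv => (huv rfl).elim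
      start := hstart
      mem := fun p => by simpa [arc_sub_intCast] using hm p
      mem' := fun p => by simpa [arc_sub_intCast] using hm' p
      eq := fun p hp => heq p (by rwa [arc_sub_intCast] at hp) }
  obtain ⟨κ, b₁, Θ, κ', b₁', Θ', hΘ, hΘ', hmono, ⟨H, -, hH⟩, hst⟩ := hL.exists_presents hq hg
  have hsub : D.crossings ⊆ D'.crossings := hins ▸ subset_insert _ _
  have hoff' : ∀ c ∈ D.crossings, ∀ u : Unit, c.1 ∉ arc i (a - n ()) (b - n ()) ∧
      c.2 ∉ arc i (a - n ()) (b - n ()) := fun c hc _ => by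
    simpa only [arc_sub_intCast] using hoff c hc
  have hR := hL.restricts hΘ hΘ' hmono hst hsub hoff'
  have hcD : c ∉ D.crossings := fun hc => (hoff' c hc ()).1 hc1
  let x : D'.crossings := ⟨c, hins ▸ mem_insert _ _⟩
  have honly : ∀ e', D'.endPt e' ∈ arc i (a - n ()) (b - n ()) → e'.1 = x := by
    rintro ⟨⟨c', hc'⟩, r⟩ he
    rw [hins] at hc'
    rcases hc' with hc' | hc'
    · exact Subtype.ext hc'
    · rcases r with _ | _
      · exact ((hoff' c' hc' ()).1 he).elim
      · exact ((hoff' c' hc' ()).2 he).elim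
  have hne : time (T i) c.1.2 ≠ time (T i) c.2.2 := by
    intro h
    refine D'.ne c x.2 (Prod.ext ?_ (time_injective _ h))
    exact (hL.mem_arc (u := ()).1 hc1).1.trans (hL.mem_arc (u := ()).1 hc2).1.symm
  -- Either end of the crossing may come first; `o` records which one.
  obtain ⟨o, ho⟩ := exists_sign (sub_ne_zero.2 hne.symm)
  rw [mul_sub, sub_pos] at ho
  have hadj : Θ'.Adjacent o (x, .over) (x, .under) := by
    refine hΘ'.adjacent (e := (x, .over)) (f := (x, .under)) (hL.le ()) (hL.lt' ()) hc1 hc2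
      (fun e' he => ?_) ?_ ho
    · have := honly e' he
      obtain ⟨c', _ | _⟩ := e'
      · exact .inl (Prod.ext this rfl)
      · exact .inr (Prod.ext this rfl)
    · rw [hH () (x, .over) hc1, hH () (x, .under) hc2]
  have := D.finite.to_subtype
  have := D'.finite.to_subtype
  refine .of_presents hq hΘ hΘ' (hR.reidemeister1 (x := x) ?_ hadj).symm
  rw [range_inclusion]
  ext c'
  have hc' : c'.1 = c ∨ c'.1 ∈ D.crossings := mem_insert_iff.1 (hins.subset c'.2)
  simp only [mem_ofPred_eq, mem_compl_iff, mem_singleton_iff]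
  constructor
  · intro h1 h2
    rw [h2] at h1
    exact hcD h1
  · intro h1
    exact hc'.resolve_left fun h2 => h1 (Subtype.ext h2)

end HomotopyZh
end

/-! ### Cancelling two crossings of graphs at consecutive simple zeros. -/

noncomputable section
namespace HomotopyZh
open Filter Topology

variable {S : Type*} [TopologicalSpace S] [ChartedSpace Plane S] {ι : Type*} {g : ℕ}
  {Ω : SymplecticBasis S g} {q : Plane → S} {D D' : LinkDiagram S ι}

open LinkDiagram

/-! ## The second Reidemeister move -/

/-- At consecutive simple zeros the derivatives have opposite signs. -/
lemma deriv_mul_deriv_neg {d : ℝ → ℝ} (hd : Continuous d) {x₁ x₂ : ℝ} (h12 : x₁ < x₂)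
    (h1 : d x₁ = 0) (h2 : d x₂ = 0) (hne : ∀ x ∈ Ioo x₁ x₂, d x ≠ 0) (hd1 : deriv d x₁ ≠ 0)
    (hd2 : deriv d x₂ ≠ 0) : deriv d x₁ * deriv d x₂ < 0 := by
  -- Two positive derivatives would make `d` positive just after `x₁` and negative just before `x₂`,
  -- with a further zero in between.
  have key : ∀ d : ℝ → ℝ, Continuous d → d x₁ = 0 → d x₂ = 0 → (∀ x ∈ Ioo x₁ x₂, d x ≠ 0) →
      0 < deriv d x₁ → 0 < deriv d x₂ → False := by
    intro d hd h1 h2 hne hd1 hd2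
    have e1 := (eventually_nhdsWithin_sign_eq_of_deriv_pos hd1 h1).filter_mono
      (nhdsWithin_le_nhds : 𝓝[>] x₁ ≤ 𝓝 x₁)
    have e2 := (eventually_nhdsWithin_sign_eq_of_deriv_pos hd2 h2).filter_mono
      (nhdsWithin_le_nhds : 𝓝[<] x₂ ≤ 𝓝 x₂)
    obtain ⟨u, ⟨hu, hu1⟩, hu2⟩ := ((e1.and self_mem_nhdsWithin).and
      (Ioo_mem_nhdsGT (show x₁ < (x₁ + x₂) / 2 by linarith))).exists
    obtain ⟨v, ⟨hv, hv1⟩, hv2⟩ := ((e2.and self_mem_nhdsWithin).and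
      (Ioo_mem_nhdsLT (show (x₁ + x₂) / 2 < x₂ by linarith))).exists
    have hdu : 0 < d u := by
      rw [sign_pos (sub_pos.2 hu1), sign_eq_one_iff] at hu
      exact hu
    have hdv : d v < 0 := by
      rw [sign_neg (sub_neg.2 hv1), sign_eq_neg_one_iff] at hv
      exact hv
    have huv : u ≤ v := by linarith [hu2.2, hv2.1]
    obtain ⟨w, hw, hw0⟩ := intermediate_value_Icc' huv hd.continuousOn
      (show (0 : ℝ) ∈ Icc (d v) (d u) from ⟨hdv.le, hdu.le⟩)
    exact hne w ⟨by linarith [hw.1, hu2.1], by linarith [hw.2, hv2.2]⟩ hw0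
  rcases lt_or_gt_of_ne hd1 with h3 | h3 <;> rcases lt_or_gt_of_ne hd2 with h4 | h4
  · refine (key (fun x => -d x) hd.neg (by simp [h1]) (by simp [h2])
      (fun x hx => neg_ne_zero.2 (hne x hx)) ?_ ?_).elim
    · rw [deriv.fun_neg]; linarith
    · rw [deriv.fun_neg]; linarith
  · exact mul_neg_of_neg_of_pos h3 h4
  · exact mul_neg_of_pos_of_neg h3 h4
  · exact (key d hd h1 h2 hne h3 h4).elim

/-- The new crossings are the two zeros of `G w - G o`. At these the slopes differ in opposite
directions, so the crossings have opposite signs. On each arc they are the only ends and in the same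
state, hence neighbours. The over-arc `o` and the under-arc `w` are kept variable, since either one
may be the arc that moves. -/
lemma holonomyEquivalent_of_two_zeros [IsManifold (𝓡 2) ∞ S] [T2Space S] [Finite ι]
    (hq : IsCutPolygon Ω.loop q) (hg : 0 < g) {U : Type*} {φ : OpenPartialHomeomorph S Plane}
    {T : ι → ℝ} {i : U → ι} {a b : U → ℝ} {m : U} (h : LocalMove φ D D' T i a b m)
    (hS : IsOrientedAtlas S) {o w : U} (how : o ≠ w) {G : U → ℝ → ℝ} {ε : U → ℤˣ}
    (hG : ∀ u, Differentiable ℝ (G u))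
    (hs : ∀ u, IsStrand φ D' (i u) (a u) (b u) (G u) (ε u)) {x₁ x₂ : ℝ} (h12 : x₁ < x₂)
    (hx₁ : x₁ ∈ Icc (-1 : ℝ) 1) (hx₂ : x₂ ∈ Icc (-1 : ℝ) 1)
    (hz : ∀ x ∈ Icc (-1 : ℝ) 1, G o x = G w x ↔ x = x₁ ∨ x = x₂)
    (hd₁ : deriv (G w) x₁ - deriv (G o) x₁ ≠ 0) (hd₂ : deriv (G w) x₂ - deriv (G o) x₂ ≠ 0)
    (hsub : D.crossings ⊆ D'.crossings)
    (hoff : ∀ c ∈ D.crossings, ∀ u, c.1 ∉ arc (i u) (a u) (b u) ∧ c.2 ∉ arc (i u) (a u) (b u))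
    (hnew : ∀ c ∈ D'.crossings \ D.crossings,
      c.1 ∈ arc (i o) (a o) (b o) ∧ c.2 ∈ arc (i w) (a w) (b w)) :
    HolonomyEquivalent g q D D' := by
  obtain ⟨κ, b₁, Θ, κ', b₁', Θ', hΘ, hΘ', hmono, ⟨H, -, hH⟩, hst⟩ := h.exists_presents hq hg
  obtain ⟨η, hη⟩ := h.disc.exists_sign hS
  have hR := h.restricts hΘ hΘ' hmono hst hsub hoff
  have hdis : ∀ p, p ∈ arc (i o) (a o) (b o) → p ∉ arc (i w) (a w) (b w) := fun p hp =>
    Set.disjoint_left.1 (h.disjoint o w how) hp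
  have hex : ∀ x, x ∈ Icc (-1 : ℝ) 1 → G o x = G w x →
      ∃ c : D'.crossings, c.1 ∉ D.crossings ∧ abscissa φ D' c.1.1 = x := by
    intro x hx hGx
    obtain ⟨p, hp, hpx⟩ := (hs o).surj x hx
    obtain ⟨r, hr, hrx⟩ := (hs w).surj x hx
    have hpr : D'.pt p = D'.pt r := (hs o).pt_eq (hs w) hp hr (hpx.trans hrx.symm)
      (by rw [hrx]; exact hGx)
    rcases (D'.double p r fun e => hdis p hp (e ▸ hr)).1 hpr with hc | hc
    · exact ⟨⟨_, hc⟩, fun hc' => (hoff _ hc' o).1 hp, hpx⟩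
    · exact (hdis r (hnew _ ⟨hc, fun hc' => (hoff _ hc' w).1 hr⟩).1 hr).elim
  obtain ⟨c₁, hc₁, hcx₁⟩ := hex x₁ hx₁ ((hz x₁ hx₁).2 (.inl rfl))
  obtain ⟨c₂, hc₂, hcx₂⟩ := hex x₂ hx₂ ((hz x₂ hx₂).2 (.inr rfl))
  obtain ⟨m₁, n₁⟩ := hnew _ ⟨c₁.2, hc₁⟩
  obtain ⟨m₂, n₂⟩ := hnew _ ⟨c₂.2, hc₂⟩
  have hne : c₁ ≠ c₂ := fun e => h12.ne (by rw [← hcx₁, ← hcx₂, e])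
  have honly : ∀ c : D'.crossings, c.1 ∉ D.crossings → c = c₁ ∨ c = c₂ := by
    intro c hc
    obtain ⟨hm, hn⟩ := hnew _ ⟨c.2, hc⟩
    have hcx := (hz _ ((hs o).abscissa_mem _ hm)).1
      ((hs o).eq_of_pt_eq (hs w) hm hn (D'.pt_fst_eq_snd c.2))
    have huniq : ∀ c' : D'.crossings, c'.1.1 ∈ arc (i o) (a o) (b o) →
        abscissa φ D' c.1.1 = abscissa φ D' c'.1.1 → c = c' := by
      intro c' hm' hxx
      have := D'.endPt_injective (a₁ := (c, .over)) (a₂ := (c', .over))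
        ((hs o).abscissa_injOn hm hm' hxx)
      exact (Prod.mk.inj this).1
    exact hcx.imp (fun e => huniq c₁ m₁ (e.trans hcx₁.symm)) fun e => huniq c₂ m₂ (e.trans hcx₂.symm)
  have hnewend : ∀ e u, D'.endPt e ∈ arc (i u) (a u) (b u) → e.1 = c₁ ∨ e.1 = c₂ := by
    intro e u he
    refine honly _ fun hc => ?_
    obtain ⟨c, _ | _⟩ := e
    · exact (hoff _ hc u).1 he
    · exact (hoff _ hc u).2 he
  have hx : ∀ c : D'.crossings, abscissa φ D' c.1.2 = abscissa φ D' c.1.1 := fun c => by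
    rw [abscissa, abscissa, D'.pt_fst_eq_snd c.2]
  have hadj_over : Θ'.Adjacent (ε o) (c₁, .over) (c₂, .over) := by
    refine hΘ'.adjacent (e := (c₁, .over)) (f := (c₂, .over)) (h.le o) (h.lt' o) m₁ m₂
      (fun e' he => ?_) ?_ ?_
    · have := hnewend e' o he
      obtain ⟨c, _ | _⟩ := e'
      · exact this.imp (fun e => Prod.ext e rfl) fun e => Prod.ext e rfl
      · exfalso
        rcases this with e | e
        · exact hdis _ he (by simp only at e; rw [e]; exact n₁)
        · exact hdis _ he (by simp only at e; rw [e]; exact n₂)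
    · rw [hH o (c₁, .over) m₁, hH o (c₂, .over) m₂]
    · exact (hs o).time_lt (h.le o) (h.lt' o) m₁ m₂ (hcx₁.trans_lt (h12.trans_eq hcx₂.symm))
  have hadj_under : Θ'.Adjacent (ε w) (c₁, .under) (c₂, .under) := by
    refine hΘ'.adjacent (e := (c₁, .under)) (f := (c₂, .under)) (h.le w) (h.lt' w) n₁ n₂
      (fun e' he => ?_) ?_ ?_
    · have := hnewend e' w he
      obtain ⟨c, _ | _⟩ := e'
      · exfalso
        rcases this with e | e
        · exact hdis _ m₁ (by simp only at e; rw [← e]; exact he)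
        · exact hdis _ m₂ (by simp only at e; rw [← e]; exact he)
      · exact this.imp (fun e => Prod.ext e rfl) fun e => Prod.ext e rfl
    · rw [hH w (c₁, .under) n₁, hH w (c₂, .under) n₂]
    · exact (hs w).time_lt (h.le w) (h.lt' w) n₁ n₂ (((hx c₁).trans hcx₁).trans_lt (h12.trans_eq ((hx c₂).trans hcx₂).symm))
  have hsign : Θ'.sign c₂ = -Θ'.sign c₁ := by
    have s₁ := (hs o).sign_pos h.disc.1 (hs w) m₁ n₁ (hη _ ((h.mem' _).2 ⟨o, m₁⟩)) (hΘ'.sign c₁)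
    have s₂ := (hs o).sign_pos h.disc.1 (hs w) m₂ n₂ (hη _ ((h.mem' _).2 ⟨o, m₂⟩)) (hΘ'.sign c₂)
    rw [hcx₁] at s₁
    rw [hcx₂] at s₂
    have hder : ∀ x, deriv (fun x => G w x - G o x) x = deriv (G w) x - deriv (G o) x := fun x =>
      deriv_fun_sub (hG w x) (hG o x)
    have hneg := deriv_mul_deriv_neg (d := fun x => G w x - G o x)
      ((hG w).continuous.sub (hG o).continuous) h12
      (sub_eq_zero.2 ((hz x₁ hx₁).2 (.inl rfl)).symm)
      (sub_eq_zero.2 ((hz x₂ hx₂).2 (.inr rfl)).symm) (fun x hx h0 => ?_)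
      (by rwa [hder]) (by rwa [hder])
    · rw [hder, hder] at hneg
      have hs' : 0 < (((-(Θ'.sign c₁ * (η * ε o * ε w)) : ℤˣ) : ℤ) : ℝ) *
          -(deriv (G w) x₁ - deriv (G o) x₁) := by
        rw [Units.val_neg, Int.cast_neg, neg_mul_neg]; exact s₁
      have := sign_eq_sign s₂ hs' (by linarith)
      rw [← neg_mul] at this
      exact mul_right_cancel this
    · have hxI : x ∈ Icc (-1 : ℝ) 1 := ⟨hx₁.1.trans hx.1.le, hx.2.le.trans hx₂.2⟩
      rcases (hz x hxI).1 (sub_eq_zero.1 h0).symm with rfl | rfl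
      · exact lt_irrefl _ hx.1
      · exact lt_irrefl _ hx.2
  have := D.finite.to_subtype
  have := D'.finite.to_subtype
  refine .of_presents hq hΘ hΘ' (hR.reidemeister2 hne ?_ hsign hadj_over hadj_under).symm
  rw [range_inclusion]
  ext c
  simp only [mem_ofPred_eq, mem_compl_iff, mem_insert_iff, mem_singleton_iff]
  constructor
  · rintro hc (rfl | rfl)
    · exact hc₁ hc
    · exact hc₂ hc
  · intro hc
    by_contra hcD
    exact hc (honly c hcD)

/-- Before the move one arc lies strictly above the other and neither meets itself, so the disc
contains no crossing; afterwards the crossings in it are the two zeros of `F'`. The index `true`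
stands for the arc that moves. -/
lemma holonomyEquivalent_of_reidemeister2 [IsManifold (𝓡 2) ∞ S] [T2Space S] [Finite ι]
    (hS : IsOrientedAtlas S) (hq : IsCutPolygon Ω.loop q) (hg : 0 < g) (h : D.Reidemeister2 D') :
    HolonomyEquivalent g q D D' := by
  obtain ⟨φ, hφ, i, a, b, j, c, d, F, F', hdis, hF, hF', hpos, hcard, hsimple, hGi, hGi', hGj, hGj',
    hm, hm', heq, hsub, hnew⟩ := h
  obtain ⟨T, n, hT, hstart⟩ := exists_start (U := Bool) (fun u => bif u then j else i)
    (fun u => bif u then c else a) (fun u => bif u then d else b) true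
    (by rintro (_ | _); exacts [hGi.1, hGj.1]) (by rintro (_ | _); exacts [hGi.2.1, hGj.2.1])
    (by rintro (_ | _) (_ | _) huv <;> first | exact (huv rfl).elim | exact hdis | exact hdis.symm)
  have hTi := hT false
  have hTj := hT true
  simp only [cond_true, cond_false] at hTi hTj hstart
  rw [← arc_sub_intCast i a b (n false), ← arc_sub_intCast j c d (n true)] at *
  replace hGi := isGraphStrand_sub_intCast hGi (n false)
  replace hGi' := isGraphStrand_sub_intCast hGi' (n false)
  replace hGj := isGraphStrand_sub_intCast hGj (n true)
  replace hGj' := isGraphStrand_sub_intCast hGj' (n true)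
  generalize a - n false = a at *
  generalize b - n false = b at *
  generalize c - n true = c at *
  generalize d - n true = d at *
  have hL : LocalMove φ D D' T (fun u => bif u then j else i)
      (fun u => bif u then c else a) (fun u => bif u then d else b) true :=
    { disc := hφ
      le := by rintro (_ | _); exacts [hTi.1, hTj.1]
      lt := by rintro (_ | _); exacts [hGi.1, hGj.1]
      lt' := by rintro (_ | _); exacts [hTi.2, hTj.2]
      disjoint := by
        rintro (_ | _) (_ | _) huv <;> first | exact (huv rfl).elim | exact hdis | exact hdis.symm
      start := hstart
      mem := fun p => by simpa using hm p
      mem' := fun p => by simpa using hm' p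
      eq := fun p hp => heq p hp }
  have hd0 : Differentiable ℝ fun _ : ℝ => (0 : ℝ) := differentiable_const 0
  have hdF := hF.differentiable (by simp)
  have hdF' := hF'.differentiable (by simp)
  obtain ⟨ε₀, hs₀⟩ := IsStrand.of_isGraphStrand hφ.1 hd0 hGi
  obtain ⟨ε₁, hs₁⟩ := IsStrand.of_isGraphStrand hφ.1 hdF hGj
  obtain ⟨ε₀', hs₀'⟩ := IsStrand.of_isGraphStrand hφ.1 hd0 hGi'
  obtain ⟨ε₁', hs₁'⟩ := IsStrand.of_isGraphStrand hφ.1 hdF' hGj'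
  have hcross : ∀ p r, D.pt p = D.pt r → p ∈ arc i a b → r ∈ arc j c d → False := by
    intro p r hpr hp hr
    have h1 := hs₀.eq_of_pt_eq hs₁ hp hr hpr
    exact (hpos _ (hs₀.abscissa_mem p hp)).ne h1
  have hself : ∀ p r, D.pt p = D.pt r → p ≠ r → p ∉ arc i a b ∪ arc j c d := by
    intro p r hpr hne hp
    have hr : r ∈ arc i a b ∪ arc j c d := by rwa [← hm, ← hpr, hm]
    have hx : abscissa φ D p = abscissa φ D r := by rw [abscissa, abscissa, hpr]
    rcases hp with hp | hp <;> rcases hr with hr | hr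
    · exact hne (hs₀.abscissa_injOn hp hr hx)
    · exact hcross p r hpr hp hr
    · exact hcross r p hpr.symm hr hp
    · exact hne (hs₁.abscissa_injOn hp hr hx)
  have hoff : ∀ e ∈ D.crossings, ∀ u : Bool,
      e.1 ∉ arc (bif u then j else i) (bif u then c else a) (bif u then d else b) ∧
      e.2 ∉ arc (bif u then j else i) (bif u then c else a) (bif u then d else b) := by
    intro e he u
    have h1 := hself _ _ (D.pt_fst_eq_snd he) (D.ne e he)
    have h2 := hself _ _ (D.pt_fst_eq_snd he).symm (D.ne e he).symm
    rw [mem_union, not_or] at h1 h2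
    rcases u with _ | _
    · exact ⟨h1.1, h2.1⟩
    · exact ⟨h1.2, h2.2⟩
  obtain ⟨x₁, x₂, hne, hset⟩ := ncard_eq_two.1 hcard
  wlog h12 : x₁ < x₂ generalizing x₁ x₂
  · exact this x₂ x₁ hne.symm (by rw [hset, pair_comm]) (lt_of_le_of_ne (not_lt.1 h12) hne.symm)
  have hmem : ∀ x, (x ∈ Icc (-1 : ℝ) 1 ∧ F' x = 0) ↔ x = x₁ ∨ x = x₂ := fun x => by
    rw [← mem_ofPred_eq (p := fun x => x ∈ Icc (-1 : ℝ) 1 ∧ F' x = 0), hset]; simp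
  have hx₁ := (hmem x₁).2 (.inl rfl)
  have hx₂ := (hmem x₂).2 (.inr rfl)
  have hz : ∀ x ∈ Icc (-1 : ℝ) 1, 0 = F' x ↔ x = x₁ ∨ x = x₂ := fun x hx => by
    rw [← hmem]; exact ⟨fun h => ⟨hx, h.symm⟩, fun h => h.2.symm⟩
  have hG : ∀ u : Bool, Differentiable ℝ (bif u then F' else fun _ : ℝ => (0 : ℝ)) := by
    rintro (_ | _); exacts [hd0, hdF']
  have hs : ∀ u : Bool, IsStrand φ D' (bif u then j else i) (bif u then c else a)
      (bif u then d else b) (bif u then F' else fun _ : ℝ => (0 : ℝ)) (bif u then ε₁' else ε₀') := by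
    rintro (_ | _); exacts [hs₀', hs₁']
  rcases hnew with hnew | hnew
  · refine holonomyEquivalent_of_two_zeros hq hg hL hS (o := false) (w := true) (by simp) hG hs h12
      hx₁.1 hx₂.1 hz ?_ ?_ hsub hoff hnew
    · simpa using hsimple x₁ hx₁.1 hx₁.2
    · simpa using hsimple x₂ hx₂.1 hx₂.2
  · refine holonomyEquivalent_of_two_zeros hq hg hL hS (o := true) (w := false) (by simp) hG hs h12
      hx₁.1 hx₂.1 (fun x hx => eq_comm.trans (hz x hx)) ?_ ?_ hsub hoff hnew
    · simpa using hsimple x₁ hx₁.1 hx₁.2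
    · simpa using hsimple x₂ hx₂.1 hx₂.2

end HomotopyZh
end

/-! ### The three crossings of a triangle of graphs, and their correspondence across the third move.
-/

noncomputable section
namespace HomotopyZh
open Filter Topology

variable {S : Type*} [TopologicalSpace S] [ChartedSpace Plane S] {ι : Type*} {g : ℕ}
  {Ω : SymplecticBasis S g} {q : Plane → S} {D D' : LinkDiagram S ι}

open LinkDiagram

/-! ## The third Reidemeister move -/

section
variable {X : Type*} {a b c : X}

lemma triangleSwap_of_ne {e : X × Role} (ha : e.1 ≠ a) (hb : e.1 ≠ b) (hc : e.1 ≠ c) :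
    triangleSwap a b c e = e := by
  have key : ∀ (x : X) (r : Role), e.1 ≠ x → e ≠ (x, r) := fun x r h h' => h (by rw [h'])
  classical
  simp only [triangleSwap, Equiv.Perm.mul_apply, Equiv.swap_apply_of_ne_of_ne, ne_eq, key _ _ ha,
    key _ _ hb, key _ _ hc, not_false_eq_true]

lemma triangleSwap_apply (hab : a ≠ b) (hac : a ≠ c) (hbc : b ≠ c) :
    triangleSwap a b c (a, .over) = (b, .over) ∧ triangleSwap a b c (b, .over) = (a, .over) ∧
    triangleSwap a b c (a, .under) = (c, .over) ∧ triangleSwap a b c (c, .over) = (a, .under) ∧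
    triangleSwap a b c (b, .under) = (c, .under) ∧ triangleSwap a b c (c, .under) = (b, .under) := by
  simp [triangleSwap, Equiv.swap_apply_def, hab, hac, hbc, hab.symm, hac.symm, hbc.symm]

end

namespace LocalMove

variable {U : Type*} {φ : OpenPartialHomeomorph S Plane} {T : ι → ℝ} {i : U → ι} {a b : U → ℝ} {m : U}

/-- Points on an arc compare in the same way with the points outside the arc. -/
lemma time_lt_of_notMem (h : LocalMove φ D D' T i a b m) {u : U} {p p' r : ι × UnitAddCircle}
    (hp : p ∈ arc (i u) (a u) (b u)) (hp' : p' ∈ arc (i u) (a u) (b u)) (hri : r.1 = i u)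
    (hr : r ∉ arc (i u) (a u) (b u)) :
    (time (T (i u)) p.2 < time (T (i u)) r.2 ↔ time (T (i u)) p'.2 < time (T (i u)) r.2) ∧
    (time (T (i u)) r.2 < time (T (i u)) p.2 ↔ time (T (i u)) r.2 < time (T (i u)) p'.2) := by
  have h1 := (h.mem_arc.1 hp).2
  have h2 := (h.mem_arc.1 hp').2
  have h3 : time (T (i u)) r.2 < a u ∨ b u < time (T (i u)) r.2 := by
    by_contra! h4
    exact hr (h.mem_arc.2 ⟨hri, h4.1, h4.2⟩)
  rcases h3 with h3 | h3
  · constructor <;> constructor <;> intro <;> linarith [h1.1, h2.1]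
  · constructor <;> constructor <;> intro <;> linarith [h1.2, h2.2]

end LocalMove

/-- The three arcs of a triangle cross in `A`, `B`, `C`: `t` runs over `l` and over `m`, and `m`
runs over `l`.  The crossing opposite to the arc `u` has first coordinate `y u`. -/
structure IsTriangle (φ : OpenPartialHomeomorph S Plane) (D : LinkDiagram S ι) (i : Fin 3 → ι)
    (a b : Fin 3 → ℝ) (y : Fin 3 → ℝ) (t m l : Fin 3) (A B C : D.crossings) : Prop where
  a_over : A.1.1 ∈ arc (i t) (a t) (b t)
  a_under : A.1.2 ∈ arc (i m) (a m) (b m)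
  b_over : B.1.1 ∈ arc (i t) (a t) (b t)
  b_under : B.1.2 ∈ arc (i l) (a l) (b l)
  c_over : C.1.1 ∈ arc (i m) (a m) (b m)
  c_under : C.1.2 ∈ arc (i l) (a l) (b l)
  a_abscissa : abscissa φ D A.1.1 = y l
  b_abscissa : abscissa φ D B.1.1 = y m
  c_abscissa : abscissa φ D C.1.1 = y t
  or_off : ∀ c : D.crossings, c = A ∨ c = B ∨ c = C ∨
    ∀ u, c.1.1 ∉ arc (i u) (a u) (b u) ∧ c.1.2 ∉ arc (i u) (a u) (b u)

lemma abscissa_snd (φ : OpenPartialHomeomorph S Plane) (c : D.crossings) :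
    abscissa φ D c.1.2 = abscissa φ D c.1.1 := by
  rw [abscissa, abscissa, D.pt_fst_eq_snd c.2]

/-- The two graphs meet once, so there is one double point of the arcs; the hypothesis `hn` excludes
the wrong choice of over-strand there. -/
lemma exists_crossing {U : Type*} {φ : OpenPartialHomeomorph S Plane} {i : U → ι} {a b : U → ℝ}
    {G : U → ℝ → ℝ} {ε : U → ℤˣ} (hs : ∀ u, IsStrand φ D (i u) (a u) (b u) (G u) (ε u)) {u v : U}
    (hd : Disjoint (arc (i u) (a u) (b u)) (arc (i v) (a v) (b v))) {x₀ : ℝ}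
    (hx₀ : x₀ ∈ Icc (-1 : ℝ) 1) (hz : ∀ x ∈ Icc (-1 : ℝ) 1, G u x = G v x ↔ x = x₀)
    (hn : ∀ c ∈ D.crossings, ¬ (c.1 ∈ arc (i v) (a v) (b v) ∧ c.2 ∈ arc (i u) (a u) (b u))) :
    ∃ c : D.crossings, c.1.1 ∈ arc (i u) (a u) (b u) ∧ c.1.2 ∈ arc (i v) (a v) (b v) ∧
      abscissa φ D c.1.1 = x₀ ∧ ∀ c' : D.crossings, c'.1.1 ∈ arc (i u) (a u) (b u) →
        c'.1.2 ∈ arc (i v) (a v) (b v) → c' = c := by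
  obtain ⟨p, hp, hpx⟩ := (hs u).surj x₀ hx₀
  obtain ⟨r, hr, hrx⟩ := (hs v).surj x₀ hx₀
  have hpr : D.pt p = D.pt r := (hs u).pt_eq (hs v) hp hr (hpx.trans hrx.symm)
    (by rw [hrx]; exact (hz x₀ hx₀).2 rfl)
  rcases (D.double p r fun e => Set.disjoint_left.1 hd hp (e ▸ hr)).1 hpr with hc | hc
  · refine ⟨⟨_, hc⟩, hp, hr, hpx, fun c' h1 h2 => ?_⟩
    have hx : abscissa φ D c'.1.1 = x₀ := (hz _ ((hs u).abscissa_mem _ h1)).1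
      ((hs u).eq_of_pt_eq (hs v) h1 h2 (D.pt_fst_eq_snd c'.2))
    have := D.endPt_injective (a₁ := (c', .over)) (a₂ := (⟨_, hc⟩, .over))
      ((hs u).abscissa_injOn h1 hp (hx.trans hpx.symm))
    exact (Prod.mk.inj this).1
  · exact (hn _ hc ⟨hr, hp⟩).elim

/-- Any two of the graphs meet exactly once, and the heights say which arc is over. They also leave
only three of the nine pairs of an over-arc and an under-arc, so no further crossing has an end in
the disc. -/
lemma exists_isTriangle {φ : OpenPartialHomeomorph S Plane} {i : Fin 3 → ι} {a b : Fin 3 → ℝ}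
    {G : Fin 3 → ℝ → ℝ} {ε : Fin 3 → ℤˣ}
    (hs : ∀ u, IsStrand φ D (i u) (a u) (b u) (G u) (ε u))
    (hd : ∀ u v, u ≠ v → Disjoint (arc (i u) (a u) (b u)) (arc (i v) (a v) (b v)))
    (hmem : ∀ c ∈ D.crossings, (∃ u, c.1 ∈ arc (i u) (a u) (b u)) ↔ ∃ u, c.2 ∈ arc (i u) (a u) (b u))
    {y : Fin 3 → ℝ} (hy : ∀ u, y u ∈ Icc (-1 : ℝ) 1)
    (hz : ∀ u v w, u ≠ v → u ≠ w → v ≠ w → ∀ x ∈ Icc (-1 : ℝ) 1, G u x = G v x ↔ x = y w)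
    {height : Fin 3 → ℕ} (hh : ∀ c ∈ D.crossings, ∀ u v, c.1 ∈ arc (i u) (a u) (b u) →
      c.2 ∈ arc (i v) (a v) (b v) → height v < height u)
    {t m l : Fin 3} (htm : height m < height t) (hml : height l < height m) :
    ∃ A B C, IsTriangle φ D i a b y t m l A B C := by
  have n1 : t ≠ m := by rintro rfl; exact lt_irrefl _ htm
  have n2 : t ≠ l := by rintro rfl; exact lt_asymm htm hml
  have n3 : m ≠ l := by rintro rfl; exact lt_irrefl _ hml
  have hall : ∀ t m l u : Fin 3, t ≠ m → t ≠ l → m ≠ l → u = t ∨ u = m ∨ u = l := by decide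
  obtain ⟨A, hA1, hA2, hA3, hA4⟩ := exists_crossing hs (hd t m n1) (hy l) (hz t m l n1 n2 n3)
    fun c hc h => lt_asymm htm (hh c hc _ _ h.1 h.2)
  obtain ⟨B, hB1, hB2, hB3, hB4⟩ := exists_crossing hs (hd t l n2) (hy m) (hz t l m n2 n1 n3.symm)
    fun c hc h => lt_asymm (hml.trans htm) (hh c hc _ _ h.1 h.2)
  obtain ⟨C, hC1, hC2, hC3, hC4⟩ := exists_crossing hs (hd m l n3) (hy t)
    (hz m l t n3 n1.symm n2.symm) fun c hc h => lt_asymm hml (hh c hc _ _ h.1 h.2)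
  refine ⟨A, B, C, hA1, hA2, hB1, hB2, hC1, hC2, hA3, hB3, hC3, fun c => ?_⟩
  by_cases hc : ∃ u, c.1.1 ∈ arc (i u) (a u) (b u)
  · obtain ⟨v, hv⟩ := (hmem c.1 c.2).1 hc
    obtain ⟨u, hu⟩ := hc
    have := hh c.1 c.2 u v hu hv
    rcases hall t m l u n1 n2 n3 with rfl | rfl | rfl <;> rcases hall _ _ _ v n1 n2 n3 with
      rfl | rfl | rfl
    · omega
    · exact .inl (hA4 c hu hv)
    · exact .inr (.inl (hB4 c hu hv))
    · omega
    · omega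
    · exact .inr (.inr (.inl (hC4 c hu hv)))
    · omega
    · omega
    · omega
  · refine .inr (.inr (.inr fun u => ⟨fun h => hc ⟨u, h⟩, fun h => hc ((hmem c.1 c.2).2 ⟨u, h⟩)⟩))

namespace IsTriangle

variable {φ : OpenPartialHomeomorph S Plane} {i : Fin 3 → ι} {a b : Fin 3 → ℝ} {y y' : Fin 3 → ℝ}
  {t m l : Fin 3} {A B C : D.crossings} {A' B' C' : D'.crossings}

lemma ne (h : IsTriangle φ D i a b y t m l A B C)
    (hd : ∀ u v, u ≠ v → Disjoint (arc (i u) (a u) (b u)) (arc (i v) (a v) (b v)))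
    (n1 : t ≠ m) (n3 : m ≠ l) : A ≠ B ∧ A ≠ C ∧ B ≠ C := by
  refine ⟨fun e => ?_, fun e => ?_, fun e => ?_⟩
  · exact Set.disjoint_left.1 (hd m l n3) h.a_under (by rw [e]; exact h.b_under)
  · exact Set.disjoint_left.1 (hd t m n1) h.a_over (by rw [e]; exact h.c_over)
  · exact Set.disjoint_left.1 (hd t m n1) h.b_over (by rw [e]; exact h.c_over)

lemma exists_map (h : IsTriangle φ D i a b y t m l A B C)
    (hne : A ≠ B ∧ A ≠ C ∧ B ≠ C)
    (hoff : ∀ e, (∀ u, e.1 ∉ arc (i u) (a u) (b u)) → (∀ u, e.2 ∉ arc (i u) (a u) (b u)) →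
      e ∈ D.crossings → e ∈ D'.crossings) :
    ∃ f : D.crossings → D'.crossings, f A = A' ∧ f B = B' ∧ f C = C' ∧
      ∀ c, (∀ u, c.1.1 ∉ arc (i u) (a u) (b u) ∧ c.1.2 ∉ arc (i u) (a u) (b u)) →
        (f c).1 = c.1 := by
  obtain ⟨n1, n2, n3⟩ := hne
  have : ∀ c : D.crossings, ∃ c' : D'.crossings, (c = A → c' = A') ∧ (c = B → c' = B') ∧
      (c = C → c' = C') ∧ ((∀ u, c.1.1 ∉ arc (i u) (a u) (b u) ∧
        c.1.2 ∉ arc (i u) (a u) (b u)) → c'.1 = c.1) := by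
    intro c
    rcases h.or_off c with rfl | rfl | rfl | hc
    · exact ⟨A', fun _ => rfl, fun e => (n1 e).elim, fun e => (n2 e).elim,
        fun hc => ((hc t).1 h.a_over).elim⟩
    · exact ⟨B', fun e => (n1 e.symm).elim, fun _ => rfl, fun e => (n3 e).elim,
        fun hc => ((hc t).1 h.b_over).elim⟩
    · exact ⟨C', fun e => (n2 e.symm).elim, fun e => (n3 e.symm).elim, fun _ => rfl,
        fun hc => ((hc m).1 h.c_over).elim⟩
    · refine ⟨⟨c.1, hoff c.1 (fun u => (hc u).1) (fun u => (hc u).2) c.2⟩, ?_, ?_, ?_, fun _ => rfl⟩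
      · rintro rfl; exact ((hc t).1 h.a_over).elim
      · rintro rfl; exact ((hc t).1 h.b_over).elim
      · rintro rfl; exact ((hc m).1 h.c_over).elim
  choose f h1 h2 h3 h4 using this
  exact ⟨f, h1 A rfl, h2 B rfl, h3 C rfl, h4⟩

/-- The crossings before and after the move correspond to each other. -/
lemma exists_equiv (h : IsTriangle φ D i a b y t m l A B C)
    (h' : IsTriangle φ D' i a b y' t m l A' B' C')
    (hd : ∀ u v, u ≠ v → Disjoint (arc (i u) (a u) (b u)) (arc (i v) (a v) (b v)))
    (n1 : t ≠ m) (n3 : m ≠ l)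
    (hoff : ∀ e, (∀ u, e.1 ∉ arc (i u) (a u) (b u)) → (∀ u, e.2 ∉ arc (i u) (a u) (b u)) →
      (e ∈ D'.crossings ↔ e ∈ D.crossings)) :
    ∃ f : D.crossings ≃ D'.crossings, f A = A' ∧ f B = B' ∧ f C = C' ∧
      ∀ c, (∀ u, c.1.1 ∉ arc (i u) (a u) (b u) ∧ c.1.2 ∉ arc (i u) (a u) (b u)) →
        (f c).1 = c.1 := by
  obtain ⟨f, fA, fB, fC, hf⟩ := h.exists_map (A' := A') (B' := B') (C' := C') (h.ne hd n1 n3)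
    fun e h1 h2 => (hoff e h1 h2).2
  obtain ⟨k, kA, kB, kC, hk⟩ := h'.exists_map (A' := A) (B' := B) (C' := C) (h'.ne hd n1 n3)
    fun e h1 h2 => (hoff e h1 h2).1
  refine ⟨⟨f, k, fun c => ?_, fun c => ?_⟩, fA, fB, fC, hf⟩
  · rcases h.or_off c with rfl | rfl | rfl | hc
    · rw [fA, kA]
    · rw [fB, kB]
    · rw [fC, kC]
    · have e := hf c hc
      exact Subtype.ext ((hk (f c) (by rw [e]; exact hc)).trans e)
  · rcases h'.or_off c with rfl | rfl | rfl | hc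
    · rw [kA, fA]
    · rw [kB, fB]
    · rw [kC, fC]
    · have e := hk c hc
      exact Subtype.ext ((hf (k c) (by rw [e]; exact hc)).trans e)

/-- The ends of the crossings before and after the move. -/
lemma end_cases (h : IsTriangle φ D i a b y t m l A B C)
    (h' : IsTriangle φ D' i a b y' t m l A' B' C')
    (hd : ∀ u v, u ≠ v → Disjoint (arc (i u) (a u) (b u)) (arc (i v) (a v) (b v)))
    (n1 : t ≠ m) (n2 : t ≠ l) (n3 : m ≠ l) {f : D.crossings ≃ D'.crossings} (fA : f A = A')
    (fB : f B = B') (fC : f C = C')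
    (hf : ∀ c, (∀ u, c.1.1 ∉ arc (i u) (a u) (b u) ∧ c.1.2 ∉ arc (i u) (a u) (b u)) →
        (f c).1 = c.1) (e : D.crossings × Role) :
    (∃ u v w, u ≠ v ∧ u ≠ w ∧ v ≠ w ∧ D.endPt e ∈ arc (i u) (a u) (b u) ∧
      D'.endPt (Prod.map f id (triangleSwap A B C e)) ∈ arc (i u) (a u) (b u) ∧
      abscissa φ D (D.endPt e) = y v ∧
      abscissa φ D' (D'.endPt (Prod.map f id (triangleSwap A B C e))) = y' w) ∨
    ((∀ u, D.endPt e ∉ arc (i u) (a u) (b u)) ∧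
      D'.endPt (Prod.map f id (triangleSwap A B C e)) = D.endPt e) := by
  obtain ⟨n4, n5, n6⟩ := h.ne hd n1 n3
  obtain ⟨s1, s2, s3, s4, s5, s6⟩ := triangleSwap_apply n4 n5 n6
  obtain ⟨c, r⟩ := e
  rcases h.or_off c with rfl | rfl | rfl | hc
  · rcases r with _ | _
    · rw [s1, Prod.map_apply, fB]
      exact .inl ⟨t, l, m, n2, n1, n3.symm, h.a_over, h'.b_over, h.a_abscissa, h'.b_abscissa⟩
    · rw [s3, Prod.map_apply, fC]
      exact .inl ⟨m, l, t, n3, n1.symm, n2.symm, h.a_under, h'.c_over,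
        (abscissa_snd φ c).trans h.a_abscissa, h'.c_abscissa⟩
  · rcases r with _ | _
    · rw [s2, Prod.map_apply, fA]
      exact .inl ⟨t, m, l, n1, n2, n3, h.b_over, h'.a_over, h.b_abscissa, h'.a_abscissa⟩
    · rw [s5, Prod.map_apply, fC]
      exact .inl ⟨l, m, t, n3.symm, n2.symm, n1.symm, h.b_under, h'.c_under,
        (abscissa_snd φ c).trans h.b_abscissa, (abscissa_snd φ C').trans h'.c_abscissa⟩
  · rcases r with _ | _
    · rw [s4, Prod.map_apply, fA]
      exact .inl ⟨m, t, l, n1.symm, n3, n2, h.c_over, h'.a_under, h.c_abscissa,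
        (abscissa_snd φ A').trans h'.a_abscissa⟩
    · rw [s6, Prod.map_apply, fB]
      exact .inl ⟨l, t, m, n2.symm, n3.symm, n1, h.c_under, h'.b_under,
        (abscissa_snd φ c).trans h.c_abscissa, (abscissa_snd φ B').trans h'.b_abscissa⟩
  · have hA : c ≠ A := by rintro rfl; exact (hc t).1 h.a_over
    have hB : c ≠ B := by rintro rfl; exact (hc t).1 h.b_over
    have hC : c ≠ C := by rintro rfl; exact (hc m).1 h.c_over
    rw [triangleSwap_of_ne hA hB hC, Prod.map_apply]
    have e := hf c hc
    rcases r with _ | _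
    · exact .inr ⟨fun u => (hc u).1, congrArg Prod.fst e⟩
    · exact .inr ⟨fun u => (hc u).2, congrArg Prod.snd e⟩

end IsTriangle

end HomotopyZh
end

/-! ### Turning a triangle inside out does not change the holonomy class. -/

noncomputable section
namespace HomotopyZh
open Filter Topology

variable {S : Type*} [TopologicalSpace S] [ChartedSpace Plane S] {ι : Type*} {g : ℕ}
  {Ω : SymplecticBasis S g} {q : Plane → S} {D D' : LinkDiagram S ι}

open LinkDiagram

lemma IsStrand.unit_time_lt {φ : OpenPartialHomeomorph S Plane} {i : ι} {a b : ℝ} {F : ℝ → ℝ}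
    {ε : ℤˣ} (h : IsStrand φ D i a b F ε) {T : ℝ} (ha : T ≤ a) (hb : b < T + 1)
    {p r : ι × UnitAddCircle} (hp : p ∈ arc i a b) (hr : r ∈ arc i a b) {ρ : ℤˣ}
    (hpr : 0 < ((ρ : ℤ) : ℝ) * (abscissa φ D r - abscissa φ D p)) :
    (((ε * ρ : ℤˣ) : ℤ) : ℝ) * time T p.2 < (((ε * ρ : ℤˣ) : ℤ) : ℝ) * time T r.2 := by
  rcases Int.units_eq_one_or ρ with rfl | rfl
  · rw [mul_one]
    exact h.time_lt ha hb hp hr (by push_cast at hpr; linarith)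
  · have := h.time_lt ha hb hr hp (by push_cast at hpr; linarith)
    push_cast
    linarith

/-- Three arcs that form a triangle, before and after it is turned inside out. -/
lemma holonomyEquivalent_of_triangle [IsManifold (𝓡 2) ∞ S] [T2Space S] [Finite ι]
    (hq : IsCutPolygon Ω.loop q) (hg : 0 < g) {φ : OpenPartialHomeomorph S Plane}
    {T : ι → ℝ} {i : Fin 3 → ι} {a b : Fin 3 → ℝ} {k : Fin 3} (h : LocalMove φ D D' T i a b k)
    (hS : IsOrientedAtlas S) {G G' : Fin 3 → ℝ → ℝ} {ε : Fin 3 → ℤˣ}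
    (hs : ∀ u, IsStrand φ D (i u) (a u) (b u) (G u) (ε u))
    (hs' : ∀ u, IsStrand φ D' (i u) (a u) (b u) (G' u) (ε u)) {y y' : Fin 3 → ℝ}
    {ρ : Fin 3 → Fin 3 → ℤˣ} (hρ : ∀ u v, u ≠ v → ρ v u = -ρ u v)
    (hρy : ∀ u v, u ≠ v → 0 < ((ρ u v : ℤ) : ℝ) * (y u - y v))
    (hρy' : ∀ u v, u ≠ v → 0 < ((ρ u v : ℤ) : ℝ) * (y' v - y' u))
    (hρG : ∀ u v, u ≠ v → ∀ x ∈ Icc (-1 : ℝ) 1,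
      0 < ((ρ u v : ℤ) : ℝ) * (deriv (G u) x - deriv (G v) x))
    (hρG' : ∀ u v, u ≠ v → ∀ x ∈ Icc (-1 : ℝ) 1,
      0 < ((ρ u v : ℤ) : ℝ) * (deriv (G' u) x - deriv (G' v) x))
    {t m l : Fin 3} (n1 : t ≠ m) (n2 : t ≠ l) (n3 : m ≠ l) {A B C : D.crossings}
    {A' B' C' : D'.crossings} (hΔ : IsTriangle φ D i a b y t m l A B C)
    (hΔ' : IsTriangle φ D' i a b y' t m l A' B' C')
    (hoff : ∀ e, (∀ u, e.1 ∉ arc (i u) (a u) (b u)) → (∀ u, e.2 ∉ arc (i u) (a u) (b u)) →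
      (e ∈ D'.crossings ↔ e ∈ D.crossings)) : HolonomyEquivalent g q D D' := by
  obtain ⟨κ, b₁, Θ, κ', b₁', Θ', hΘ, hΘ', hmono, ⟨H, hH, hH'⟩, hst⟩ := h.exists_presents hq hg
  obtain ⟨η, hη⟩ := h.disc.exists_sign hS
  obtain ⟨f, fA, fB, fC, hf⟩ := hΔ.exists_equiv hΔ' h.disjoint n1 n3 hoff
  have hcase := hΔ.end_cases hΔ' h.disjoint n1 n2 n3 fA fB fC hf
  obtain ⟨n4, n5, n6⟩ := hΔ.ne h.disjoint n1 n3
  have := D.finite.to_subtype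
  have := D'.finite.to_subtype
  -- The move reverses the order of the two crossings on each arc. So the end that occupies the
  -- place of `e` after the move is not `e` itself but the other end on the same arc, and this is
  -- the trade performed by `triangleSwap`.
  set star : D.crossings × Role → D'.crossings × Role :=
    fun e => Prod.map f id (triangleSwap A B C e) with hstar
  have hbij : Function.Bijective star :=
    (f.bijective.prodMap Function.bijective_id).comp (triangleSwap A B C).bijective
  have hcomp : ∀ e, (D'.endPt (star e)).1 = (D.endPt e).1 := by
    intro e
    rcases hcase e with ⟨u, v, w, -, -, -, h1, h2, -⟩ | ⟨-, h1⟩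
    · rw [(h.mem_arc.1 h1).1, (h.mem_arc.1 h2).1]
    · rw [h1]
  -- The sign of a crossing depends only on the directions of its strands, the orientation of the
  -- chart and the order of the slopes. None of these is changed by the move.
  have sgn : ∀ {u v : Fin 3} {c : D.crossings}, u ≠ v → c.1.1 ∈ arc (i u) (a u) (b u) →
      c.1.2 ∈ arc (i v) (a v) (b v) → Θ.sign c * (η * ε u * ε v) = ρ v u := by
    intro u v c huv h1 h2
    have h3 := (hs u).sign_pos h.disc.1 (hs v) h1 h2 (hη _ ((h.mem _).2 ⟨u, h1⟩)) (hΘ.sign c)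
    have h4 := hρG v u huv.symm _ ((hs u).abscissa_mem _ h1)
    exact sign_eq_sign h3 h4 (mul_self_pos.2 (right_ne_zero_of_mul h4.ne'))
  have sgn' : ∀ {u v : Fin 3} {c : D'.crossings}, u ≠ v → c.1.1 ∈ arc (i u) (a u) (b u) →
      c.1.2 ∈ arc (i v) (a v) (b v) → Θ'.sign c * (η * ε u * ε v) = ρ v u := by
    intro u v c huv h1 h2
    have h3 := (hs' u).sign_pos h.disc.1 (hs' v) h1 h2 (hη _ ((h.mem' _).2 ⟨u, h1⟩)) (hΘ'.sign c)
    have h4 := hρG' v u huv.symm _ ((hs' u).abscissa_mem _ h1)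
    exact sign_eq_sign h3 h4 (mul_self_pos.2 (right_ne_zero_of_mul h4.ne'))
  have hsign : ∀ c, Θ'.sign (f c) = Θ.sign c := by
    intro c
    rcases hΔ.or_off c with rfl | rfl | rfl | hc
    · rw [fA]
      exact mul_right_cancel ((sgn' n1 hΔ'.a_over hΔ'.a_under).trans
        (sgn n1 hΔ.a_over hΔ.a_under).symm)
    · rw [fB]
      exact mul_right_cancel ((sgn' n2 hΔ'.b_over hΔ'.b_under).trans
        (sgn n2 hΔ.b_over hΔ.b_under).symm)
    · rw [fC]
      exact mul_right_cancel ((sgn' n3 hΔ'.c_over hΔ'.c_under).trans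
        (sgn n3 hΔ.c_over hΔ.c_under).symm)
    · exact h.sign_eq hΘ hΘ' (hf c hc) (hc k).1 (hc k).2
  have harc : ∀ e u, D.endPt e ∈ arc (i u) (a u) (b u) →
      ∃ v w, u ≠ v ∧ u ≠ w ∧ v ≠ w ∧ D'.endPt (star e) ∈ arc (i u) (a u) (b u) ∧
        abscissa φ D (D.endPt e) = y v ∧ abscissa φ D' (D'.endPt (star e)) = y' w := by
    intro e u he
    rcases hcase e with ⟨u', v, w, h1, h2, h3, h4, h5, h6, h7⟩ | ⟨h1, -⟩
    · have : u = u' := by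
        by_contra hne
        exact Set.disjoint_left.1 (h.disjoint u u' hne) he h4
      subst this
      exact ⟨v, w, h1, h2, h3, h5, h6, h7⟩
    · exact (h1 u he).elim
  have hnarc : ∀ e u, D.endPt e ∉ arc (i u) (a u) (b u) →
      D'.endPt (star e) ∉ arc (i u) (a u) (b u) := by
    intro e u he he'
    rcases hcase e with ⟨u', v, w, -, -, -, h4, h5, -⟩ | ⟨-, h1⟩
    · have : u = u' := by
        by_contra hne
        exact Set.disjoint_left.1 (h.disjoint u u' hne) he' h5
      exact he (this ▸ h4)
    · rw [h1] at he'; exact he he'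
  -- Ends on the same arc keep their order since both the crossings and the labels are interchanged.
  -- In all other cases an end moves within its arc, and no end outside this arc can come in
  -- between.
  have htime : ∀ e e', (D.endPt e).1 = (D.endPt e').1 → D.endTime T e < D.endTime T e' →
      D'.endTime T (star e) < D'.endTime T (star e') := by
    intro e e' hee hlt
    simp only [LinkDiagram.endTime, hcomp, hee] at hlt ⊢
    by_cases h1 : ∃ u, D.endPt e ∈ arc (i u) (a u) (b u)
    · obtain ⟨u, hu⟩ := h1
      have hcu := (h.mem_arc.1 hu).1
      have hcu' : (D.endPt e').1 = i u := hee.symm.trans hcu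
      obtain ⟨v, w, d1, d2, d3, hu', hx, hx'⟩ := harc e u hu
      rw [hcu'] at hlt ⊢
      by_cases h2 : D.endPt e' ∈ arc (i u) (a u) (b u)
      · obtain ⟨v₂, w₂, d4, d5, d6, hu₂', hx₂, hx₂'⟩ := harc e' u h2
        have hfin : ∀ u v w v₂ w₂ : Fin 3, u ≠ v → u ≠ w → v ≠ w → u ≠ v₂ → u ≠ w₂ → v₂ ≠ w₂ →
          v₂ = v ∨ (v₂ = w ∧ w₂ = v) := by decide
        rcases hfin u v w v₂ w₂ d1 d2 d3 d4 d5 d6 with rfl | ⟨rfl, rfl⟩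
        · rw [(hs u).abscissa_injOn hu h2 (hx.trans hx₂.symm)] at hlt
          exact (lt_irrefl _ hlt).elim
        · have h3 := (hs u).unit_time_lt (h.le u) (h.lt' u) hu h2 (ρ := ρ v₂ w₂)
            (by rw [hx, hx₂]; exact hρy _ _ d6)
          have h4 := (hs' u).unit_time_lt (h.le u) (h.lt' u) hu' hu₂' (ρ := ρ v₂ w₂)
            (by rw [hx', hx₂']; exact hρy' _ _ d6)
          rcases Int.units_eq_one_or (ε u * ρ v₂ w₂) with h5 | h5 <;> rw [h5] at h3 h4 <;>
            push_cast at h3 h4 <;> linarith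
      · rw [(h.time_lt_of_notMem hu hu' hcu' h2).1] at hlt
        by_cases h3 : ∃ v, D.endPt e' ∈ arc (i v) (a v) (b v)
        · obtain ⟨v, hv⟩ := h3
          obtain ⟨-, -, -, -, -, hv', -⟩ := harc e' v hv
          have hne : u ≠ v := by rintro rfl; exact h2 hv
          have hiv : i u = i v := hcu'.symm.trans (h.mem_arc.1 hv).1
          rw [hiv] at hlt ⊢
          exact (h.time_lt_of_notMem hv hv' ((h.mem_arc.1 hu').1.trans hiv)
            (Set.disjoint_left.1 (h.disjoint u v hne) hu')).2.1 hlt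
        · push Not at h3
          rcases hcase e' with ⟨u', -, -, -, -, -, h4, -⟩ | ⟨-, h4⟩
          · exact (h3 u' h4).elim
          · rwa [h4]
    · push Not at h1
      rcases hcase e with ⟨u', -, -, -, -, -, h4, -⟩ | ⟨-, h4⟩
      · exact (h1 u' h4).elim
      rw [h4]
      rcases hcase e' with ⟨u, -, -, -, -, -, h5, h6, -⟩ | ⟨-, h5⟩
      · have hcu := (h.mem_arc.1 h5).1
        rw [hcu] at hlt ⊢
        exact (h.time_lt_of_notMem h5 h6 (hee.trans hcu) (h1 u)).2.1 hlt
      · rwa [h5]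
  have hends : ∀ j, Θ'.ends j = (Θ.ends j).map (Prod.map f id ∘ triangleSwap A B C) := by
    intro j
    refine sorted_ext (hΘ'.sorted j) ?_ fun e' => ?_
    · rw [List.pairwise_map]
      refine (hΘ.sorted j).imp_of_mem fun {e e'} he he' hlt => ?_
      exact htime e e' (((hΘ.mem_ends j e).1 he).trans ((hΘ.mem_ends j e').1 he').symm) hlt
    · obtain ⟨e, rfl⟩ := hbij.2 e'
      rw [hΘ'.mem_ends, hcomp, ← hΘ.mem_ends]
      constructor
      · exact fun he => List.mem_map.2 ⟨e, he, rfl⟩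
      · intro he
        obtain ⟨e₂, he₂, h2⟩ := List.mem_map.1 he
        rwa [← hbij.1 h2]
  have hstate : ∀ e, Θ'.state (star e) = Θ.state e := by
    intro e
    rcases hcase e with ⟨u, -, -, -, -, -, h1, h2, -⟩ | ⟨h1, h2⟩
    · rw [hH u e h1, hH' u (star e) h2]
    · exact hst e (star e) h2 h1
  have hdis : ∀ {p : ι × UnitAddCircle} {u v : Fin 3}, u ≠ v → p ∈ arc (i u) (a u) (b u) →
      p ∉ arc (i v) (a v) (b v) := fun {p u v} huv hu => Set.disjoint_left.1 (h.disjoint u v huv) hu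
  have adj : ∀ {u v w : Fin 3} {e e' : D.crossings × Role}, v ≠ w →
      D.endPt e ∈ arc (i u) (a u) (b u) → D.endPt e' ∈ arc (i u) (a u) (b u) →
      (∀ e₂, D.endPt e₂ ∈ arc (i u) (a u) (b u) → e₂ = e ∨ e₂ = e') →
      abscissa φ D (D.endPt e) = y v → abscissa φ D (D.endPt e') = y w →
      Θ.Adjacent (ε u * ρ w v) e e' := by
    intro u v w e e' hvw he he' honly hx hx'
    refine hΘ.adjacent (h.le u) (h.lt' u) he he' honly (by rw [hH u e he, hH u e' he']) ?_
    exact (hs u).unit_time_lt (h.le u) (h.lt' u) he he' (by rw [hx, hx']; exact hρy w v hvw.symm)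
  -- The slope order `ρ` fixes both the sign of the crossing of `u` and `v` and the order of the two
  -- crossings on the third arc `w`. In the product it drops out, leaving a quantity symmetric in
  -- the three arcs; this is the sign condition of the third move.
  have key : ∀ u v w : Fin 3, u ≠ v → ∀ σ : ℤˣ, σ * (η * ε u * ε v) = ρ v u →
      σ * (ε w * ρ u v) = -(η * ε u * ε v * ε w) := by
    intro u v w huv σ hσ
    have h2 : σ = ρ v u * (η * ε u * ε v) := by
      rw [← hσ, mul_assoc, Int.units_mul_self, mul_one]
    rw [h2, hρ u v huv, neg_mul, neg_mul, neg_inj]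
    rcases Int.units_eq_one_or (ρ u v) with h3 | h3 <;> rw [h3] <;> simp [mul_assoc]
  refine .of_presents hq hΘ hΘ' (Holonomy.equivalent_reidemeister3 f n4 n5 n6 hsign hends hstate
    hmono (ot := ε t * ρ m l) (om := ε m * ρ t l) (ob := ε l * ρ t m) ?_ ?_ ?_ ?_ ?_)
  · refine adj (u := t) n3.symm hΔ.a_over hΔ.b_over (fun e he => ?_) hΔ.a_abscissa hΔ.b_abscissa
    obtain ⟨c, r⟩ := e
    rcases hΔ.or_off c with rfl | rfl | rfl | hc <;> rcases r with _ | _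
    · exact .inl rfl
    · exact (hdis n1 he hΔ.a_under).elim
    · exact .inr rfl
    · exact (hdis n2 he hΔ.b_under).elim
    · exact (hdis n1 he hΔ.c_over).elim
    · exact (hdis n2 he hΔ.c_under).elim
    · exact ((hc t).1 he).elim
    · exact ((hc t).2 he).elim
  · refine adj (u := m) n2.symm hΔ.a_under hΔ.c_over (fun e he => ?_)
      ((abscissa_snd φ A).trans hΔ.a_abscissa) hΔ.c_abscissa
    obtain ⟨c, r⟩ := e
    rcases hΔ.or_off c with rfl | rfl | rfl | hc <;> rcases r with _ | _
    · exact (hdis n1 hΔ.a_over he).elim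
    · exact .inl rfl
    · exact (hdis n1 hΔ.b_over he).elim
    · exact (hdis n3 he hΔ.b_under).elim
    · exact .inr rfl
    · exact (hdis n3 he hΔ.c_under).elim
    · exact ((hc m).1 he).elim
    · exact ((hc m).2 he).elim
  · refine adj (u := l) n1.symm hΔ.b_under hΔ.c_under (fun e he => ?_)
      ((abscissa_snd φ B).trans hΔ.b_abscissa) ((abscissa_snd φ C).trans hΔ.c_abscissa)
    obtain ⟨c, r⟩ := e
    rcases hΔ.or_off c with rfl | rfl | rfl | hc <;> rcases r with _ | _
    · exact (hdis n2 hΔ.a_over he).elim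
    · exact (hdis n3 hΔ.a_under he).elim
    · exact (hdis n2 hΔ.b_over he).elim
    · exact .inl rfl
    · exact (hdis n3 hΔ.c_over he).elim
    · exact .inr rfl
    · exact ((hc l).1 he).elim
    · exact ((hc l).2 he).elim
  · rw [key t m l n1 _ (sgn n1 hΔ.a_over hΔ.a_under), key t l m n2 _ (sgn n2 hΔ.b_over hΔ.b_under)]
    congr 1; simp only [mul_comm, mul_left_comm]
  · rw [key t l m n2 _ (sgn n2 hΔ.b_over hΔ.b_under), key m l t n3 _ (sgn n3 hΔ.c_over hΔ.c_under)]
    congr 1; simp only [mul_comm, mul_left_comm]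

lemma IsStrand.abscissa_end {φ : OpenPartialHomeomorph S Plane} {i : ι} {a b : ℝ} {F : ℝ → ℝ}
    {ε : ℤˣ} (h : IsStrand φ D i a b F ε) : abscissa φ D (i, (b : UnitAddCircle)) = ((ε : ℤ) : ℝ) := by
  have hb : b ∈ Icc a b := ⟨h.lt.le, le_rfl⟩
  have h0 := h.abscissa_mem _ ⟨b, hb, rfl⟩
  rcases Int.units_eq_one_or ε with rfl | rfl
  · obtain ⟨_, ⟨t, ht, rfl⟩, e⟩ := h.surj 1 ⟨by norm_num, le_rfl⟩
    have := h.mono.monotoneOn ht hb ht.2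
    simp only [Units.val_one, Int.cast_one, one_mul] at *
    rw [e] at this
    exact le_antisymm h0.2 this
  · obtain ⟨_, ⟨t, ht, rfl⟩, e⟩ := h.surj (-1) ⟨le_rfl, by norm_num⟩
    have := h.mono.monotoneOn ht hb ht.2
    simp only [Units.val_neg, Units.val_one, Int.cast_neg, Int.cast_one, neg_mul, one_mul] at *
    rw [e] at this
    linarith [h0.1]

lemma exists_zero_of_deriv_neg {d : ℝ → ℝ} (hd : Differentiable ℝ d)
    (hneg : ∀ x ∈ Icc (-1 : ℝ) 1, deriv d x < 0) {p r : ℝ} (hp : -1 ≤ p) (hpr : p ≤ r) (hr : r ≤ 1)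
    (h1 : 0 < d p) (h2 : d r < 0) :
    ∃ x₀ ∈ Ioo p r, ∀ x ∈ Icc (-1 : ℝ) 1, d x = 0 ↔ x = x₀ := by
  obtain ⟨x₀, hx₀, h0⟩ := intermediate_value_Icc' hpr hd.continuous.continuousOn
    (show (0 : ℝ) ∈ Icc (d r) (d p) from ⟨h2.le, h1.le⟩)
  refine ⟨x₀, ⟨lt_of_le_of_ne hx₀.1 ?_, lt_of_le_of_ne hx₀.2 ?_⟩, fun x hx => ⟨fun h => ?_, ?_⟩⟩
  · rintro rfl; exact h1.ne' h0
  · rintro rfl; exact h2.ne h0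
  · exact (strictAntiOn_of_deriv_neg (convex_Icc (-1 : ℝ) 1) hd.continuous.continuousOn fun x hx =>
      hneg x (interior_subset hx)).injOn hx ⟨hp.trans hx₀.1, hx₀.2.trans hr⟩ (h.trans h0.symm)
  · rintro rfl; exact h0

end HomotopyZh
end

/-! ### The third Reidemeister move in coordinates, and the invariance of the holonomy. -/

noncomputable section
namespace HomotopyZh
open Filter Topology

variable {S : Type*} [TopologicalSpace S] [ChartedSpace Plane S] {ι : Type*} {g : ℕ}
  {Ω : SymplecticBasis S g} {q : Plane → S} {D D' : LinkDiagram S ι}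

open LinkDiagram

/-- The order of the slopes of the three arcs of a third Reidemeister move, and also of the
crossings opposite to them before the move. -/
def slopeOrder : Fin 3 → Fin 3 → ℤˣ := ![![1, 1, 1], ![-1, 1, -1], ![-1, 1, 1]]

/-- The third graph is less steep than the two lines, so it meets each of them once. Passing below
the origin it meets the line of slope `1/2` to the left and the other line to the right; passing
above it, the other way round. Hence the abscissas of the crossings, indexed by the opposite arcs,
are ordered like the slopes before the move and in the reverse order after it. -/
lemma holonomyEquivalent_of_reidemeister3 [IsManifold (𝓡 2) ∞ S] [T2Space S] [Finite ι]
    (hS : IsOrientedAtlas S) (hq : IsCutPolygon Ω.loop q) (hg : 0 < g) (h : D.Reidemeister3 D') :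
    HolonomyEquivalent g q D D' := by
  obtain ⟨φ, hφ, i, a, b, F, F', height, hdis, hinj, hF, hF', hder, hF0, hF0', g0, g0', g1, g1', g2,
    g2', hm, hm', heq, hoff, hh⟩ := h
  have hdF : Differentiable ℝ F := hF.differentiable (by simp)
  have hdF' : Differentiable ℝ F' := hF'.differentiable (by simp)
  have hd0 : Differentiable ℝ fun x : ℝ => x / 2 := by fun_prop
  have hd1 : Differentiable ℝ fun x : ℝ => -x / 2 := by fun_prop
  have e0 : ∀ x, deriv (fun x : ℝ => x / 2) x = 1 / 2 := fun x => by simp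
  have e1 : ∀ x, deriv (fun x : ℝ => -x / 2) x = -(1 / 2) := fun x => by
    simp [neg_div]
  have hgs : ∀ u, IsGraphStrand φ D (i u) (a u) (b u) (![fun x => x / 2, fun x => -x / 2, F] u) := by
    intro u; fin_cases u; exacts [g0, g1, g2]
  have hgs' : ∀ u, IsGraphStrand φ D' (i u) (a u) (b u)
      (![fun x => x / 2, fun x => -x / 2, F'] u) := by
    intro u; fin_cases u; exacts [g0', g1', g2']
  obtain ⟨T, n, hT, hstart⟩ := exists_start i a b 2 (fun u => (hgs u).1) (fun u => (hgs u).2.1) hdis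
  have harc : ∀ u, arc (i u) (a u - n u) (b u - n u) = arc (i u) (a u) (b u) := fun u =>
    arc_sub_intCast _ _ _ _
  simp only [← harc] at hdis hm hm' heq hoff hh
  choose ε hs using fun u => IsStrand.of_isGraphStrand hφ.1
    (show Differentiable ℝ (![fun x => x / 2, fun x => -x / 2, F] u) by
      fin_cases u; exacts [hd0, hd1, hdF]) (isGraphStrand_sub_intCast (hgs u) (n u))
  choose ε' hs' using fun u => IsStrand.of_isGraphStrand hφ.1
    (show Differentiable ℝ (![fun x => x / 2, fun x => -x / 2, F'] u) by
      fin_cases u; exacts [hd0, hd1, hdF']) (isGraphStrand_sub_intCast (hgs' u) (n u))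
  have hL : LocalMove φ D D' T i (fun u => a u - n u) (fun u => b u - n u) 2 :=
    { disc := hφ
      le := fun u => (hT u).1
      lt := fun u => (hs u).lt
      lt' := fun u => (hT u).2
      disjoint := hdis
      start := hstart
      mem := hm
      mem' := hm'
      eq := heq }
  -- Each arc starts at the same point of the disc before and after the move, and the abscissa of
  -- that point determines the direction.
  have hε : ε' = ε := by
    funext u
    have h1 := (hs u).abscissa_start
    have h2 := (hs' u).abscissa_start
    have h3 : abscissa φ D' (i u, ((a u - n u : ℝ) : UnitAddCircle)) =
        abscissa φ D (i u, ((a u - n u : ℝ) : UnitAddCircle)) := by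
      by_cases hu : u = 2
      · subst hu
        exact congrArg (fun p => φ p 0) hL.line_start
      · rw [abscissa, abscissa, hL.eq _ (hL.notMem_of_mem hu ⟨_, ⟨le_rfl, (hL.lt u).le⟩, rfl⟩)]
    rw [h1, h2, neg_inj] at h3
    exact Units.ext (by exact_mod_cast h3)
  subst hε
  -- The moved arc keeps its two end points. According to its direction, its start is over `-1` or
  -- over `1`.
  have hend : F 1 = F' 1 ∧ F (-1) = F' (-1) := by
    have ha : (i 2, ((a 2 - n 2 : ℝ) : UnitAddCircle)) ∈ arc (i 2) (a 2 - n 2) (b 2 - n 2) :=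
      ⟨_, ⟨le_rfl, (hL.lt 2).le⟩, rfl⟩
    have hb : (i 2, ((b 2 - n 2 : ℝ) : UnitAddCircle)) ∈ arc (i 2) (a 2 - n 2) (b 2 - n 2) :=
      ⟨_, ⟨(hL.lt 2).le, le_rfl⟩, rfl⟩
    have h1 := (hs 2).ordinate _ ha
    have h1' := (hs' 2).ordinate _ ha
    have h2 := (hs 2).ordinate _ hb
    have h2' := (hs' 2).ordinate _ hb
    have pa : D'.pt (i 2, ((a 2 - n 2 : ℝ) : UnitAddCircle)) =
        D.pt (i 2, ((a 2 - n 2 : ℝ) : UnitAddCircle)) := hL.line_start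
    have pb : D'.pt (i 2, ((b 2 - n 2 : ℝ) : UnitAddCircle)) =
        D.pt (i 2, ((b 2 - n 2 : ℝ) : UnitAddCircle)) :=
      hL.line_eq ⟨le_rfl, by have := hL.lt' 2; rw [hL.start] at this; exact this.le⟩
    rw [(hs' 2).abscissa_start, pa, h1, (hs 2).abscissa_start] at h1'
    rw [(hs' 2).abscissa_end, pb, h2, (hs 2).abscissa_end] at h2'
    change F _ = F' _ at h1' h2'
    rcases Int.units_eq_one_or (ε' 2) with h3 | h3 <;> rw [h3] at h1' h2' <;>
      norm_num at h1' h2'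
    · exact ⟨h2', h1'⟩
    · exact ⟨h1', h2'⟩
  -- The value of each graph at `1` and at `-1` is estimated through the other graph: from `F' 0 >
  -- 0` and the slope bound, `F (-1) = F' (-1) > -1/2`, and similarly for the other ends. This puts
  -- the ends on the sides of the lines that force the intersections to lie in the disc.
  have hmv : ∀ f : ℝ → ℝ, Differentiable ℝ f → (∀ x ∈ Icc (-1 : ℝ) 1, |deriv f x| < 1 / 2) →
      ∀ x ∈ Icc (-1 : ℝ) 1, |f x - f 0| ≤ 1 / 2 := by
    intro f hf hd x hx
    have := (convex_Icc (-1 : ℝ) 1).norm_image_sub_le_of_norm_deriv_le (f := f) (C := 1 / 2)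
      (fun x _ => hf x) (fun x hx => (hd x hx).le) (show (0 : ℝ) ∈ Icc (-1 : ℝ) 1 by norm_num) hx
    rw [Real.norm_eq_abs, Real.norm_eq_abs, sub_zero] at this
    linarith [abs_le.2 hx]
  have b1 := hmv F hdF (fun x hx => (hder x hx).1)
  have b2 := hmv F' hdF' (fun x hx => (hder x hx).2)
  have i1 : (1 : ℝ) ∈ Icc (-1 : ℝ) 1 := by norm_num
  have i2 : (-1 : ℝ) ∈ Icc (-1 : ℝ) 1 := by norm_num
  have b3 := abs_le.1 (b1 1 i1)
  have b4 := abs_le.1 (b1 (-1) i2)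
  have b5 := abs_le.1 (b2 1 i1)
  have b6 := abs_le.1 (b2 (-1) i2)
  have dneg : ∀ f : ℝ → ℝ, Differentiable ℝ f → (∀ x ∈ Icc (-1 : ℝ) 1, |deriv f x| < 1 / 2) →
      (Differentiable ℝ fun x => f x - x / 2) ∧ (Differentiable ℝ fun x => -x / 2 - f x) ∧
      (∀ x ∈ Icc (-1 : ℝ) 1, deriv (fun x => f x - x / 2) x < 0) ∧
      ∀ x ∈ Icc (-1 : ℝ) 1, deriv (fun x => -x / 2 - f x) x < 0 := by
    intro f hf hd
    refine ⟨hf.sub hd0, hd1.sub hf, fun x hx => ?_, fun x hx => ?_⟩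
    · rw [deriv_fun_sub (hf x) (hd0 x), e0]; linarith [(abs_lt.1 (hd x hx)).2]
    · rw [deriv_fun_sub (hd1 x) (hf x), e1]; linarith [(abs_lt.1 (hd x hx)).1]
  obtain ⟨c1, c2, c3, c4⟩ := dneg F hdF fun x hx => (hder x hx).1
  obtain ⟨c1', c2', c3', c4'⟩ := dneg F' hdF' fun x hx => (hder x hx).2
  obtain ⟨x1, hx1, z1⟩ := exists_zero_of_deriv_neg c1 c3 (p := -1) (r := 0) le_rfl (by norm_num)
    (by norm_num) (by linarith [b6.1, hend.2]) (by linarith)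
  obtain ⟨x0, hx0, z0⟩ := exists_zero_of_deriv_neg c2 c4 (p := 0) (r := 1) (by norm_num)
    (by norm_num) le_rfl (by linarith) (by linarith [b5.1, hend.1])
  obtain ⟨x1', hx1', z1'⟩ := exists_zero_of_deriv_neg c1' c3' (p := 0) (r := 1) (by norm_num)
    (by norm_num) le_rfl (by linarith) (by linarith [b3.2, hend.1])
  obtain ⟨x0', hx0', z0'⟩ := exists_zero_of_deriv_neg c2' c4' (p := -1) (r := 0) le_rfl
    (by norm_num) (by norm_num) (by linarith [b4.2, hend.2]) (by linarith)
  have zeros : ∀ (f : ℝ → ℝ) (x₀ x₁ : ℝ), (∀ x ∈ Icc (-1 : ℝ) 1, f x - x / 2 = 0 ↔ x = x₁) →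
      (∀ x ∈ Icc (-1 : ℝ) 1, -x / 2 - f x = 0 ↔ x = x₀) →
      ∀ u v w : Fin 3, u ≠ v → u ≠ w → v ≠ w → ∀ x ∈ Icc (-1 : ℝ) 1,
        (![fun x => x / 2, fun x => -x / 2, f] : Fin 3 → ℝ → ℝ) u x =
          (![fun x => x / 2, fun x => -x / 2, f] : Fin 3 → ℝ → ℝ) v x ↔
            x = (![x₀, x₁, 0] : Fin 3 → ℝ) w := by
    intro f x₀ x₁ h1 h0 u v w huv huw hvw x hx
    have k1 := h1 x hx
    have k0 := h0 x hx
    have k2 : x / 2 = -x / 2 ↔ x = 0 := by constructor <;> intro <;> linarith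
    rw [sub_eq_zero] at k1 k0
    fin_cases u <;> fin_cases v <;> fin_cases w <;>
      first
      | exact absurd rfl huv
      | exact absurd rfl huw
      | exact absurd rfl hvw
      | exact k0
      | exact k1
      | exact k2
      | exact eq_comm.trans k0
      | exact eq_comm.trans k1
      | exact eq_comm.trans k2
  have hderiv : ∀ f : ℝ → ℝ, (∀ x ∈ Icc (-1 : ℝ) 1, |deriv f x| < 1 / 2) → ∀ u v : Fin 3, u ≠ v →
      ∀ x ∈ Icc (-1 : ℝ) 1, 0 < ((slopeOrder u v : ℤ) : ℝ) *
        (deriv ((![fun x => x / 2, fun x => -x / 2, f] : Fin 3 → ℝ → ℝ) u) x -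
          deriv ((![fun x => x / 2, fun x => -x / 2, f] : Fin 3 → ℝ → ℝ) v) x) := by
    intro f hd u v huv x hx
    have k := abs_lt.1 (hd x hx)
    fin_cases u <;> fin_cases v <;>
      first
      | exact absurd rfl huv
      | (change 0 < (((1 : ℤˣ) : ℤ) : ℝ) *
          (deriv (fun x : ℝ => x / 2) x - deriv (fun x : ℝ => -x / 2) x)
         rw [e0, e1]; norm_num)
      | (change 0 < (((1 : ℤˣ) : ℤ) : ℝ) * (deriv (fun x : ℝ => x / 2) x - deriv f x)
         rw [e0]; push_cast; linarith)
      | (change 0 < (((-1 : ℤˣ) : ℤ) : ℝ) *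
          (deriv (fun x : ℝ => -x / 2) x - deriv (fun x : ℝ => x / 2) x)
         rw [e0, e1]; norm_num)
      | (change 0 < (((-1 : ℤˣ) : ℤ) : ℝ) * (deriv (fun x : ℝ => -x / 2) x - deriv f x)
         rw [e1]; push_cast; linarith)
      | (change 0 < (((-1 : ℤˣ) : ℤ) : ℝ) * (deriv f x - deriv (fun x : ℝ => x / 2) x)
         rw [e0]; push_cast; linarith)
      | (change 0 < (((1 : ℤˣ) : ℤ) : ℝ) * (deriv f x - deriv (fun x : ℝ => -x / 2) x)
         rw [e1]; push_cast; linarith)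
  have horder : ∀ x₀ x₁ : ℝ, x₁ < 0 → 0 < x₀ → ∀ u v : Fin 3, u ≠ v → 0 <
      ((slopeOrder u v : ℤ) : ℝ) * ((![x₀, x₁, 0] : Fin 3 → ℝ) u - (![x₀, x₁, 0] : Fin 3 → ℝ) v) := by
    intro x₀ x₁ h1 h0 u v huv
    fin_cases u <;> fin_cases v <;> first | exact absurd rfl huv | skip
    all_goals simp [slopeOrder]
    all_goals linarith
  have horder' : ∀ x₀ x₁ : ℝ, x₀ < 0 → 0 < x₁ → ∀ u v : Fin 3, u ≠ v → 0 <
      ((slopeOrder u v : ℤ) : ℝ) * ((![x₀, x₁, 0] : Fin 3 → ℝ) v - (![x₀, x₁, 0] : Fin 3 → ℝ) u) := by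
    intro x₀ x₁ h0 h1 u v huv
    fin_cases u <;> fin_cases v <;> first | exact absurd rfl huv | skip
    all_goals simp [slopeOrder]
    all_goals linarith
  -- Any of the three arcs may be the top, the middle or the bottom one; the argument for triangles
  -- is symmetric in them.
  obtain ⟨t, m, l, htm, hml⟩ : ∃ t m l, height m < height t ∧ height l < height m := by
    have h01 : height 0 ≠ height 1 := hinj.ne (by decide)
    have h02 : height 0 ≠ height 2 := hinj.ne (by decide)
    have h12 : height 1 ≠ height 2 := hinj.ne (by decide)
    rcases lt_or_gt_of_ne h01 with h1 | h1 <;> rcases lt_or_gt_of_ne h02 with h2 | h2 <;>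
      rcases lt_or_gt_of_ne h12 with h3 | h3
    · exact ⟨2, 1, 0, h3, h1⟩
    · exact ⟨1, 2, 0, h3, h2⟩
    · omega
    · exact ⟨1, 0, 2, h1, h2⟩
    · exact ⟨2, 0, 1, h2, h1⟩
    · omega
    · exact ⟨0, 2, 1, h2, h3⟩
    · exact ⟨0, 1, 2, h1, h3⟩
  obtain ⟨A, B, C, hΔ⟩ := exists_isTriangle (y := ![x0, x1, 0]) hs hdis
    (fun c hc => hL.exists_mem_iff hc)
    (by intro u; fin_cases u
        exacts [⟨(neg_one_lt_zero.trans hx0.1).le, hx0.2.le⟩,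
          ⟨hx1.1.le, (hx1.2.trans one_pos).le⟩, ⟨neg_one_lt_zero.le, zero_le_one⟩])
    (zeros F x0 x1 z1 z0) (fun c hc => hh c (.inl hc)) htm hml
  obtain ⟨A', B', C', hΔ'⟩ := exists_isTriangle (y := ![x0', x1', 0]) hs' hdis
    (fun c hc => hL.exists_mem_iff' hc)
    (by intro u; fin_cases u
        exacts [⟨hx0'.1.le, (hx0'.2.trans one_pos).le⟩,
          ⟨(neg_one_lt_zero.trans hx1'.1).le, hx1'.2.le⟩, ⟨neg_one_lt_zero.le, zero_le_one⟩])
    (zeros F' x0' x1' z1' z0') (fun c hc => hh c (.inr hc)) htm hml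
  exact holonomyEquivalent_of_triangle hq hg hL hS hs hs' (ρ := slopeOrder) (by decide)
    (horder x0 x1 hx1.2 hx0.1) (horder' x0' x1' hx0'.2 hx1'.1)
    (hderiv F fun x hx => (hder x hx).1) (hderiv F' fun x hx => (hder x hx).2)
    (by rintro rfl; exact lt_irrefl _ htm) (by rintro rfl; exact lt_asymm htm hml)
    (by rintro rfl; exact lt_irrefl _ hml) hΔ hΔ' hoff

/-- Reidemeister equivalent diagrams have equivalent holonomies. -/
lemma holonomyEquivalent_of_reidemeisterEquivalent [IsManifold (𝓡 2) ∞ S] [T2Space S] [Finite ι]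
    (hS : IsOrientedAtlas S) (hq : IsCutPolygon Ω.loop q) (hg : 0 < g)
    (h : ReidemeisterEquivalent D D') : HolonomyEquivalent g q D D' := by
  induction h with
  | rel D D' h =>
    rcases h with h | h | h | h | h
    · exact holonomyEquivalent_of_isotopic hS hq hg h
    · exact holonomyEquivalent_of_reparametrized hq hg h
    · exact holonomyEquivalent_of_reidemeister1 hq hg h
    · exact holonomyEquivalent_of_reidemeister2 hS hq hg h
    · exact holonomyEquivalent_of_reidemeister3 hS hq hg h
  | refl D => exact .refl hq D
  | symm D D' _ ih => exact ih.symm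
  | trans D D' D'' _ _ ih ih' => exact ih.trans hq hg ih'

end HomotopyZh
end

open HomotopyZh in
theorem theorem3p5 {S : Type*} [TopologicalSpace S] [ChartedSpace Plane S]
    [IsManifold (𝓡 2) ∞ S] [T2Space S] [CompactSpace S] [ConnectedSpace S]
    (hS : IsOrientedAtlas S) {g : ℕ} (hg : 0 < g) (Ω : SymplecticBasis S g)
    {ι : Type*} [Finite ι] (D₁ D₂ : LinkDiagram S ι)
    (h₁ : D₁.InGeneralPosition Ω) (h₂ : D₂.InGeneralPosition Ω)
    (h : LinkDiagram.ReidemeisterEquivalent D₁ D₂) :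
    (∃ W₁, IsHomotopyZh D₁ Ω W₁) ∧ (∃ W₂, IsHomotopyZh D₂ Ω W₂) ∧
      ∀ W₁ W₂ : PrismaticDiagram (zhColor ι g),
        IsHomotopyZh D₁ Ω W₁ → IsHomotopyZh D₂ Ω W₂ → PrismaticDiagram.Equivalent W₁ W₂ := by
  refine ⟨exists_isHomotopyZh h₁, exists_isHomotopyZh h₂, fun W₁ W₂ hW₁ hW₂ => ?_⟩
  obtain ⟨q, hq⟩ := Ω.cut
  obtain ⟨T₁, κ₁, b₁, Θ₁, w₁, hΘ₁, hf₁, hr₁⟩ := hW₁.exists_realizes hq hg h₁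
  obtain ⟨T₂, κ₂, b₂, Θ₂, w₂, hΘ₂, hf₂, hr₂⟩ := hW₂.exists_realizes hq hg h₂
  -- The holonomies are equivalent for whatever starting times and frames the two Zh-diagrams
  -- provide, so their words lead to each other. The choices made in the construction thus play no
  -- role.
  exact (holonomyEquivalent_of_reidemeisterEquivalent hS hq hg h _ _ _ _ _ _ _ _ hΘ₁ hΘ₂
    _ _ hf₁ hf₂).equivalent hr₁ hr₂
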